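/- Let $d\ge 1$, $1\le p,q\le\infty$, $\frac1q+\frac1{q'}=1$, $s,\gamma\ge 0$, and write $\langle x\rangle=(1+|x|^2)^{1/2}$. Fix a window $g\in C_0^\infty(\mathbb R^d)$, $g\neq 0$ (any one). For $\sigma\in\mathbb R$ and a tempered distribution $f$ on $\mathbb R^d$ put $$\|f\|_{W(\mathcal FL^q_\sigma,L^p_\gamma)}=\Big\|\,\langle x\rangle^{\gamma}\,\big\|\langle y\rangle^{\sigma}\,\mathcal F\big(f\,g(\cdot-x)\big)(y)\big\|_{L^q(dy)}\Big\|_{L^p(dx)},\qquad \mathcal Fh(y)=\int e^{-2\pi i y\cdot z}h(z)\,dz .$$ The Wiener amalgam space $W(\mathcal FL^q_\sigma,L^p_\gamma)$ consists of the tempered distributions with finite norm if $p,q<\infty$, and is the closure of the Schwartz class for this norm if $p=\infty$ or $q=\infty$. For $F:\mathbb C\to\mathbb C$ consider the nonlinear wave equation $\partial_t^2u-\Delta u=F(u)$, $u(0)=u_0$, $\partial_tu(0)=u_1$ on $\mathbb R^d$ in its integral form $$u(t)=K'(t)u_0+K(t)u_1+\int_0^tK(t-\tau)F(u(\tau))\,d\tau,\tag{1}$$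 where $K'(t)$ and $K(t)$ are the Fourier multipliers with symbols $\cos(2\pi t|\xi|)$ and $\sin(2\pi t|\xi|)/(2\pi|\xi|)$, and the identity is understood in the sense of tempered distributions. (a) Let $F(u)=\lambda|u|^{2k}u$ with $\lambda\in\mathbb C$, $k\in\{0,1,2,\dots\}$, let $q'>2kd$, and assume $\frac1{q'}\le s+\frac1{2k+1}$. (The last condition guarantees that $F(u)$ makes sense for every $u\in W(\mathcal FL^q_s,L^p_\gamma)$; it follows from $q'>2kd$ if $d\ge2$ or $k=0$, and it holds whenever $q'\ge 2k+1$.) Then for every $R>0$ there exists $T>0$ such that for every $(u_0,u_1)$ in the ball $B_R$ of center $0$ and radius $R$ in $W(\mathcal FL^q_s,L^p_\gamma)\times W(\mathcal FL^q_{s-1},L^p_\gamma)$ there exists a unique solution $u\in C([0,T];W(\mathcal FL^q_s,L^p_\gamma))$ of (1). Furthermore the map $(u_0,u_1)\mapsto u$ from $B_R$ to $C([0,T];W(\mathcal FL^q_s,L^p_\gamma))$ is Lipschitz continuous. (b) If $q=1$, the same conclusion holds for every entire real-analytic $F$ with $F(0)=0$, that is, $F(z)=\sum_{j,k\ge0}c_{j,k}z^j\bar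 z^k$ with convergence for all $z\in\mathbb C$. -/

import Mathlib

open scoped SchwartzMap ENNReal Topology ComplexConjugate

noncomputable section

namespace NLW

/-- The Japanese bracket `⟨x⟩ = (1 + |x|²)^{1/2}`. -/
def bracket {d : ℕ} (x : EuclideanSpace ℝ (Fin d)) : ℝ := Real.sqrt (1 + ‖x‖ ^ 2)

/-- The function `z ↦ exp (-2πi y·z) g (z - x)`, as a Schwartz function. -/
def shiftedWindow {d : ℕ} (g : 𝓢(EuclideanSpace ℝ (Fin d), ℂ))
    (x y : EuclideanSpace ℝ (Fin d)) : 𝓢(EuclideanSpace ℝ (Fin d), ℂ) :=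
  SchwartzMap.smulLeftCLM ℂ
    (fun z : EuclideanSpace ℝ (Fin d) =>
      Complex.exp (-(2 * Real.pi * inner ℝ y z : ℝ) * Complex.I))
    (SchwartzMap.compSubConstCLM ℂ x g)

/-- The value `ℱ(f · T_x g)(y) = ⟨f, exp (-2πi y·) g(· - x)⟩` for a tempered distribution `f`;
for `g` of compact support, `f · T_x g` is a compactly supported distribution and this is
its (smooth) Fourier transform. -/
def localFourier {d : ℕ} (g : 𝓢(EuclideanSpace ℝ (Fin d), ℂ))
    (f : 𝓢'(EuclideanSpace ℝ (Fin d), ℂ)) (x y : EuclideanSpace ℝ (Fin d)) : ℂ :=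
  f (shiftedWindow g x y)

/-- The norm of the Wiener amalgam space `W(ℱL^q_s, L^p_γ)` with respect to the window `g`:
`‖ ⟨x⟩^γ ‖ ⟨y⟩^s ℱ(f T_x g)(y) ‖_{L^q(dy)} ‖_{L^p(dx)}`, with values in `[0, ∞]`. -/
def wNorm {d : ℕ} (g : 𝓢(EuclideanSpace ℝ (Fin d), ℂ)) (q : ℝ≥0∞) (s : ℝ) (p : ℝ≥0∞) (γ : ℝ)
    (f : 𝓢'(EuclideanSpace ℝ (Fin d), ℂ)) : ℝ≥0∞ :=
  MeasureTheory.eLpNorm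
    (fun x : EuclideanSpace ℝ (Fin d) =>
      ENNReal.ofReal (bracket x ^ γ) *
        MeasureTheory.eLpNorm
          (fun y : EuclideanSpace ℝ (Fin d) => ((bracket y ^ s : ℝ) : ℂ) * localFourier g f x y)
          q MeasureTheory.volume)
    p MeasureTheory.volume

/-- The tempered distribution `f` belongs to `W(ℱL^q_s, L^p_γ)`: its norm is finite and, if `p = ∞`
or `q = ∞`, moreover `f` lies in the closure of the Schwartz class. -/
def MemW {d : ℕ} (g : 𝓢(EuclideanSpace ℝ (Fin d), ℂ)) (q : ℝ≥0∞) (s : ℝ) (p : ℝ≥0∞) (γ : ℝ)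
    (f : 𝓢'(EuclideanSpace ℝ (Fin d), ℂ)) : Prop :=
  wNorm g q s p γ f < ∞ ∧
    (p = ∞ ∨ q = ∞ →
      ∀ ε : ℝ≥0∞, 0 < ε → ∃ φ : 𝓢(EuclideanSpace ℝ (Fin d), ℂ),
        wNorm g q s p γ (f - (φ : 𝓢'(EuclideanSpace ℝ (Fin d), ℂ))) < ε)

/-- `K'(t) = cos (t √(-Δ))`, the Fourier multiplier with symbol `cos (2πt|ξ|)`. -/
def waveCos {d : ℕ} (t : ℝ) :
    𝓢'(EuclideanSpace ℝ (Fin d), ℂ) →L[ℂ] 𝓢'(EuclideanSpace ℝ (Fin d), ℂ) :=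
  TemperedDistribution.fourierMultiplierCLM ℂ
    (fun ξ : EuclideanSpace ℝ (Fin d) => ((Real.cos (2 * Real.pi * t * ‖ξ‖) : ℝ) : ℂ))

/-- `K(t) = sin (t √(-Δ)) / √(-Δ)`, the Fourier multiplier with symbol
`sin (2πt|ξ|) / (2π|ξ|) = t sinc (2πt|ξ|)` (whose value at `ξ = 0` is `t`). -/
def waveSin {d : ℕ} (t : ℝ) :
    𝓢'(EuclideanSpace ℝ (Fin d), ℂ) →L[ℂ] 𝓢'(EuclideanSpace ℝ (Fin d), ℂ) :=
  TemperedDistribution.fourierMultiplierCLM ℂ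
    (fun ξ : EuclideanSpace ℝ (Fin d) => ((t * Real.sinc (2 * Real.pi * t * ‖ξ‖) : ℝ) : ℂ))

/-- The tempered distribution `u` is (given by integration against) the function `f`. -/
def IsGivenBy {d : ℕ} (u : 𝓢'(EuclideanSpace ℝ (Fin d), ℂ))
    (f : EuclideanSpace ℝ (Fin d) → ℂ) : Prop :=
  ∀ φ : 𝓢(EuclideanSpace ℝ (Fin d), ℂ),
    MeasureTheory.Integrable (fun x => φ x * f x) MeasureTheory.volume ∧
      u φ = ∫ x, φ x * f x

/-- `v = F(u)` for tempered distributions `u`, `v`: either `u` is a function `f` and `v` is the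
function `F ∘ f`, or `F` is a linear map `z ↦ a z` (which acts on every distribution) and
`v = a u`. The two clauses agree when both apply, and `v` is determined by `F` and `u`. -/
def IsNonlinearImage {d : ℕ} (F : ℂ → ℂ) (u v : 𝓢'(EuclideanSpace ℝ (Fin d), ℂ)) : Prop :=
  (∃ f : EuclideanSpace ℝ (Fin d) → ℂ, IsGivenBy u f ∧ IsGivenBy v (fun x => F (f x))) ∨
    (∃ a : ℂ, (∀ z : ℂ, F z = a * z) ∧ v = a • u)

/-- `u ∈ C([0,T]; W(ℱL^q_s, L^p_γ))` (only the values of `u` on `[0,T]` matter). -/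
def IsContinuousCurve {d : ℕ} (g : 𝓢(EuclideanSpace ℝ (Fin d), ℂ)) (q : ℝ≥0∞) (s : ℝ)
    (p : ℝ≥0∞) (γ T : ℝ) (u : ℝ → 𝓢'(EuclideanSpace ℝ (Fin d), ℂ)) : Prop :=
  ∀ t ∈ Set.Icc (0 : ℝ) T, MemW g q s p γ (u t) ∧
    Filter.Tendsto (fun τ => wNorm g q s p γ (u τ - u t)) (𝓝[Set.Icc 0 T] t) (𝓝 0)

/-- `u(t) = K'(t) u₀ + K(t) u₁ + ∫₀ᵗ K(t-τ) F(u(τ)) dτ` for all `t ∈ [0,T]`, an identity of tempered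
distributions; `w τ` is the distribution `F(u(τ))`. -/
def SolvesIntegralEquation {d : ℕ} (F : ℂ → ℂ) (T : ℝ)
    (u₀ u₁ : 𝓢'(EuclideanSpace ℝ (Fin d), ℂ))
    (u : ℝ → 𝓢'(EuclideanSpace ℝ (Fin d), ℂ)) : Prop :=
  ∃ w : ℝ → 𝓢'(EuclideanSpace ℝ (Fin d), ℂ),
    (∀ τ ∈ Set.Icc (0 : ℝ) T, IsNonlinearImage F (u τ) (w τ)) ∧
    ∀ t ∈ Set.Icc (0 : ℝ) T, ∀ φ : 𝓢(EuclideanSpace ℝ (Fin d), ℂ),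
      IntervalIntegrable (fun τ => waveSin (t - τ) (w τ) φ) MeasureTheory.volume 0 t ∧
      u t φ = waveCos t u₀ φ + waveSin t u₁ φ + ∫ τ in (0 : ℝ)..t, waveSin (t - τ) (w τ) φ

/-- `u ∈ C([0,T]; W(ℱL^q_s, L^p_γ))` solves the integral form of the nonlinear wave equation with
nonlinearity `F` and initial data `(u₀, u₁)`. -/
def IsSolution {d : ℕ} (g : 𝓢(EuclideanSpace ℝ (Fin d), ℂ)) (q : ℝ≥0∞) (s : ℝ) (p : ℝ≥0∞)
    (γ : ℝ) (F : ℂ → ℂ) (T : ℝ) (u₀ u₁ : 𝓢'(EuclideanSpace ℝ (Fin d), ℂ))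
    (u : ℝ → 𝓢'(EuclideanSpace ℝ (Fin d), ℂ)) : Prop :=
  IsContinuousCurve g q s p γ T u ∧ SolvesIntegralEquation F T u₀ u₁ u

/-- The data `(u₀, u₁)` lie in the closed ball of radius `R` about `0` in
`W(ℱL^q_s, L^p_γ) × W(ℱL^q_{s-1}, L^p_γ)`. -/
def InDataBall {d : ℕ} (g : 𝓢(EuclideanSpace ℝ (Fin d), ℂ)) (q : ℝ≥0∞) (s : ℝ) (p : ℝ≥0∞)
    (γ R : ℝ) (u₀ u₁ : 𝓢'(EuclideanSpace ℝ (Fin d), ℂ)) : Prop :=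
  MemW g q s p γ u₀ ∧ MemW g q (s - 1) p γ u₁ ∧
    wNorm g q s p γ u₀ ≤ ENNReal.ofReal R ∧ wNorm g q (s - 1) p γ u₁ ≤ ENNReal.ofReal R

/-- Local well-posedness in `W(ℱL^q_s, L^p_γ)`: for every `R > 0` there is `T > 0` such that for all
data in the ball of radius `R` there is exactly one solution in `C([0,T]; W(ℱL^q_s, L^p_γ))`,
and the map from the data to the solution is Lipschitz continuous on this ball. -/
def LocallyWellPosed {d : ℕ} (g : 𝓢(EuclideanSpace ℝ (Fin d), ℂ)) (q : ℝ≥0∞) (s : ℝ) (p : ℝ≥0∞)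
    (γ : ℝ) (F : ℂ → ℂ) : Prop :=
  ∀ R : ℝ, 0 < R → ∃ T : ℝ, 0 < T ∧
    (∀ u₀ u₁, InDataBall g q s p γ R u₀ u₁ →
      ∃ u, IsSolution g q s p γ F T u₀ u₁ u ∧
        ∀ v, IsSolution g q s p γ F T u₀ u₁ v → Set.EqOn v u (Set.Icc 0 T)) ∧
    ∃ L : ℝ, 0 ≤ L ∧ ∀ u₀ u₁ v₀ v₁ u v,
      InDataBall g q s p γ R u₀ u₁ → InDataBall g q s p γ R v₀ v₁ →
      IsSolution g q s p γ F T u₀ u₁ u → IsSolution g q s p γ F T v₀ v₁ v →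
      ∀ t ∈ Set.Icc (0 : ℝ) T,
        wNorm g q s p γ (u t - v t) ≤
          ENNReal.ofReal L * (wNorm g q s p γ (u₀ - v₀) + wNorm g q (s - 1) p γ (u₁ - v₁))

/-- `F` is an entire real-analytic function on `ℂ`: `F z = ∑_{j,k} c_{j,k} z^j z̄^k`, with
(unconditional, hence absolute) convergence for every `z ∈ ℂ`. -/
def IsEntireRealAnalytic (F : ℂ → ℂ) : Prop :=
  ∃ c : ℕ × ℕ → ℂ, ∀ z : ℂ, HasSum (fun n : ℕ × ℕ => c n * z ^ n.1 * conj z ^ n.2) (F z)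

end NLW

end

open scoped SchwartzMap ENNReal Topology ComplexConjugate

noncomputable section

namespace NLW

open MeasureTheory Filter FourierTransform

/-! ### Schwartz seminorms, translations and modulations of windows -/

section


/-! Write X = W(ℱL^q_s, L^p_γ) and Y = W(ℱL^q_{s-1}, L^p_γ). The theorem is a contraction argument
in C([0,T]; X), carried out abstractly in `duhamel_wellPosed`. It rests on three facts: X is
complete; K'(t) : X → X and K(t) : Y → X are uniformly bounded for |t| ≤ 1 and strongly continuous
in t; and u ↦ F(u) maps X to Y and is Lipschitz on bounded sets (`ActsOn`). The derivative lost by F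
is the one gained by K(t).

The linear facts come from one estimate. By the reproducing formula `reproducing`, the coefficient
of a tempered distribution against any time-frequency shifted window is dominated by an average of
its coefficients against g with a rapidly decaying kernel, times a Schwartz seminorm of the new
window (`enorm_apply_shiftedWindow_le`). Minkowski's and Peetre's inequalities bound such averages
in weighted mixed norms (`mixNorm_kav_le`). This gives independence of the window, continuity of the
pairing with Schwartz functions, completeness, density of the Schwartz class for finite exponents,
and multiplier bounds: near frequency y a multiplier m acts on the window through m(ξ + y), and if
the derivatives of m are O(⟨ξ⟩^{-r}), the resulting windows have seminorms O(⟨y⟩^{-r})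
(`wNorm_mult_le`). The two propagator symbols are entire functions of |ξ|², and the differential
equation of cos √r yields the bounds with r = 0 and r = 1.

The nonlinear estimate is local in x. Measured with the window |g|^{2k} g, the localisation of
|u|^{2k} u is the same power of g(· - x) u, so it suffices to bound |h|^{2k} h in ℱL^q_{s-1} by h in
ℱL^q_s (`FiberEstimate`, `fiberEstimate`). Put Q = q'. If Q ≥ 2k+1, Young's inequality lowers the
reciprocal exponent by 1/Q in each of 2k multiplications, and Hölder's inequality against ⟨y⟩^{-1}
restores it, which is possible because 2kd < Q. If Q ≤ 2k+1, then d = 1. For s ≥ 1/Q the weight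
leaves room for a smaller loss per product, and the same scheme works. For s < 1/Q one uses ℱL^q_s ⊂
L^{2k+1}, bounds the Fourier transform of |h|^{2k} h by its L¹ norm, and integrates ⟨y⟩^{s-1} in
L^q. The embedding is the Paley-type inequality `eLpNorm_le_fl`, and it needs exactly 1/Q ≤ s +
1/(2k+1).

These estimates are proved for Schwartz functions and extended by density. That the extension is the
pointwise nonlinearity is checked through a continuous map of X into L^{2k+1} of a finite weighted
measure. For q = 1 the space embeds into the bounded continuous functions and is an algebra, so an
entire power series converges in it. The case k = 0 is linear and needs no representation by
functions. -/

/-- Euclidean space of dimension `d`. -/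
abbrev Euc (d : ℕ) := EuclideanSpace ℝ (Fin d)

variable {d : ℕ}

/-- The increasing family of seminorms `max_{k, n ≤ m} sup ‖z‖^k ‖D^n φ(z)‖` on the Schwartz
space. -/
def ssn (m : ℕ) : Seminorm ℂ 𝓢(Euc d, ℂ) :=
  (Finset.Iic (m, m)).sup (schwartzSeminormFamily ℂ (Euc d) ℂ)

lemma ssn_bound {m k n : ℕ} (hk : k ≤ m) (hn : n ≤ m) (φ : 𝓢(Euc d, ℂ)) (x : Euc d) :
    (1 + ‖x‖) ^ k * ‖iteratedFDeriv ℝ n φ x‖ ≤ 2 ^ m * ssn m φ :=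
  SchwartzMap.one_add_le_sup_seminorm_apply (𝕜 := ℂ) (m := (m, m)) hk hn φ x

lemma ssn_bound_zero {m k : ℕ} (hk : k ≤ m) (φ : 𝓢(Euc d, ℂ)) (x : Euc d) :
    (1 + ‖x‖) ^ k * ‖φ x‖ ≤ 2 ^ m * ssn m φ := by
  simpa using ssn_bound hk (Nat.zero_le m) φ x

lemma ssn_le {m : ℕ} {φ : 𝓢(Euc d, ℂ)} {M : ℝ} (hM : 0 ≤ M)
    (h : ∀ n ≤ m, ∀ x, (1 + ‖x‖) ^ m * ‖iteratedFDeriv ℝ n φ x‖ ≤ M) : ssn m φ ≤ M := by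
  refine Seminorm.finset_sup_apply_le hM fun i hi => ?_
  rw [Finset.mem_Iic] at hi
  refine SchwartzMap.seminorm_le_bound ℂ i.1 i.2 φ hM fun x => ?_
  refine le_trans ?_ (h i.2 hi.2 x)
  gcongr
  calc ‖x‖ ^ i.1 ≤ (1 + ‖x‖) ^ i.1 := by gcongr; linarith
    _ ≤ (1 + ‖x‖) ^ m := pow_le_pow_right₀ (by linarith [norm_nonneg x]) hi.1

lemma ssn_mono {m m' : ℕ} (h : m ≤ m') (φ : 𝓢(Euc d, ℂ)) : ssn m φ ≤ ssn m' φ := by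
  have : (Finset.Iic (m, m)) ⊆ Finset.Iic (m', m') := Finset.Iic_subset_Iic.2 ⟨h, h⟩
  exact (Finset.sup_mono this : ssn (d := d) m ≤ ssn m') φ

lemma continuous_ssn (m : ℕ) : Continuous (ssn (d := d) m) :=
  Seminorm.continuous_finsetSup fun i _ => (schwartz_withSeminorms ℂ (Euc d) ℂ).continuous_seminorm i

lemma le_ssn_of_continuous {p : Seminorm ℂ 𝓢(Euc d, ℂ)} (hp : Continuous p) :
    ∃ (m : ℕ) (C : ℝ), 0 ≤ C ∧ ∀ φ, p φ ≤ C * ssn m φ := by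
  obtain ⟨s, C, -, h⟩ := Seminorm.bound_of_continuous (schwartz_withSeminorms ℂ (Euc d) ℂ) p hp
  refine ⟨s.sup (fun i => max i.1 i.2), C, C.2, fun φ => (h φ).trans ?_⟩
  refine mul_le_mul_of_nonneg_left ?_ C.2
  refine (Finset.sup_mono (f := schwartzSeminormFamily ℂ (Euc d) ℂ) (fun i hi => ?_) : s.sup _ ≤ ssn _) φ
  rw [Finset.mem_Iic]
  have := Finset.le_sup (f := fun i : ℕ × ℕ => max i.1 i.2) hi
  exact ⟨(le_max_left _ _).trans this, (le_max_right _ _).trans this⟩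

lemma ssn_clm (L : 𝓢(Euc d, ℂ) →L[ℂ] 𝓢(Euc d, ℂ)) (m : ℕ) :
    ∃ (m' : ℕ) (C : ℝ), 0 ≤ C ∧ ∀ φ, ssn m (L φ) ≤ C * ssn m' φ :=
  le_ssn_of_continuous (p := (ssn m).comp L.toLinearMap) ((continuous_ssn m).comp L.continuous)

lemma dist_bound (f : 𝓢'(Euc d, ℂ)) :
    ∃ (m : ℕ) (C : ℝ), 0 ≤ C ∧ ∀ φ, ‖f φ‖ ≤ C * ssn m φ :=
  le_ssn_of_continuous (p := (normSeminorm ℂ ℂ).comp f.toLinearMap)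
    (continuous_norm.comp f.continuous)

lemma tendsto_of_ssn {ι : Type*} {l : Filter ι} {u : ι → 𝓢(Euc d, ℂ)} {φ : 𝓢(Euc d, ℂ)}
    (h : ∀ m, Tendsto (fun i => ssn m (u i - φ)) l (𝓝 0)) : Tendsto u l (𝓝 φ) := by
  rw [(schwartz_withSeminorms ℂ (Euc d) ℂ).tendsto_nhds]
  intro i ε hε
  have := (h (max i.1 i.2)).eventually (gt_mem_nhds hε)
  refine this.mono fun j hj => lt_of_le_of_lt ?_ hj
  have : schwartzSeminormFamily ℂ (Euc d) ℂ i ≤ ssn (max i.1 i.2) :=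
    Finset.le_sup (Finset.mem_Iic.2 ⟨le_max_left _ _, le_max_right _ _⟩)
  exact this _

lemma ssn_sub_tendsto {ι : Type*} {l : Filter ι} {u : ι → 𝓢(Euc d, ℂ)} {φ : 𝓢(Euc d, ℂ)}
    (h : Tendsto u l (𝓝 φ)) (m : ℕ) : Tendsto (fun i => ssn m (u i - φ)) l (𝓝 0) := by
  have h1 : Tendsto (fun i => u i - φ) l (𝓝 0) := by simpa using h.sub_const φ
  simpa [Function.comp_def] using ((continuous_ssn m).tendsto 0).comp h1

/-- Translation `φ(· - w)` of a Schwartz function. -/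
abbrev tr (w : Euc d) : 𝓢(Euc d, ℂ) →L[ℂ] 𝓢(Euc d, ℂ) := SchwartzMap.compSubConstCLM ℂ w

lemma iteratedFDeriv_tr (n : ℕ) (w : Euc d) (φ : 𝓢(Euc d, ℂ)) (x : Euc d) :
    iteratedFDeriv ℝ n (tr w φ) x = iteratedFDeriv ℝ n φ (x - w) := by
  have : (tr w φ : Euc d → ℂ) = fun z => φ (z - w) := by
    ext z; simp
  rw [this, iteratedFDeriv_comp_sub]

lemma one_add_norm_le_mul (x w : Euc d) : 1 + ‖x‖ ≤ (1 + ‖w‖) * (1 + ‖x - w‖) := by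
  have : ‖x‖ ≤ ‖x - w‖ + ‖w‖ := by simpa using norm_add_le (x - w) w
  nlinarith [norm_nonneg w, norm_nonneg (x - w)]

lemma ssn_tr (m : ℕ) (w : Euc d) (φ : 𝓢(Euc d, ℂ)) :
    ssn m (tr w φ) ≤ (1 + ‖w‖) ^ m * (2 ^ m * ssn m φ) := by
  refine ssn_le (mul_nonneg (by positivity) (mul_nonneg (by positivity) (apply_nonneg _ _)))
    fun n hn x => ?_
  rw [iteratedFDeriv_tr]
  calc (1 + ‖x‖) ^ m * ‖iteratedFDeriv ℝ n φ (x - w)‖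
      ≤ ((1 + ‖w‖) * (1 + ‖x - w‖)) ^ m * ‖iteratedFDeriv ℝ n φ (x - w)‖ := by
        gcongr; exact one_add_norm_le_mul x w
    _ = (1 + ‖w‖) ^ m * ((1 + ‖x - w‖) ^ m * ‖iteratedFDeriv ℝ n φ (x - w)‖) := by
      rw [mul_pow]; ring
    _ ≤ _ := mul_le_mul_of_nonneg_left (ssn_bound le_rfl hn φ _) (by positivity)

/-- This is the mean value inequality on the segment from x to x - w, where the weights at all
points are comparable to the weight at x up to (1 + ‖w‖)^m. One order of differentiation is spent
for the factor ‖w‖. -/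
lemma ssn_tr_sub (m : ℕ) (w : Euc d) (φ : 𝓢(Euc d, ℂ)) :
    ssn m (tr w φ - φ) ≤ ‖w‖ * ((1 + ‖w‖) ^ m * (2 ^ (m + 1) * ssn (m + 1) φ)) := by
  refine ssn_le (mul_nonneg (by positivity) (mul_nonneg (by positivity)
    (mul_nonneg (by positivity) (apply_nonneg _ _)))) fun n hn x => ?_
  have e : iteratedFDeriv ℝ n (tr w φ - φ) x
      = iteratedFDeriv ℝ n φ (x - w) - iteratedFDeriv ℝ n φ x := by
    rw [← iteratedFDeriv_tr]
    exact iteratedFDeriv_sub_apply (((tr w φ).smooth ⊤).contDiffAt.of_le (mod_cast le_top))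
      ((φ.smooth ⊤).contDiffAt.of_le (mod_cast le_top))
  rw [e]
  have hd : Differentiable ℝ (iteratedFDeriv ℝ n φ) :=
    (φ.smooth ⊤).differentiable_iteratedFDeriv (mod_cast (WithTop.coe_lt_top _))
  have key : ‖iteratedFDeriv ℝ n φ (x - w) - iteratedFDeriv ℝ n φ x‖
      ≤ ((1 + ‖w‖) ^ m * (2 ^ (m + 1) * ssn (m + 1) φ) / (1 + ‖x‖) ^ m) * ‖(x - w) - x‖ := by
    refine (convex_segment (𝕜 := ℝ) x (x - w)).norm_image_sub_le_of_norm_fderiv_le (𝕜 := ℝ)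
      (fun z _ => hd z) (fun z hz => ?_) (left_mem_segment _ _ _) (right_mem_segment _ _ _)
    rw [norm_fderiv_iteratedFDeriv, le_div_iff₀ (by positivity), mul_comm]
    have hz' : ‖x - z‖ ≤ ‖w‖ := by
      obtain ⟨a, b, ha, hb, hab, rfl⟩ := hz
      have : x - (a • x + b • (x - w)) = b • w := by
        have : x = (a + b) • x := by rw [hab, one_smul]
        nth_rw 1 [this]; module
      rw [this, norm_smul, Real.norm_of_nonneg hb]
      exact mul_le_of_le_one_left (norm_nonneg _) (by linarith)
    calc (1 + ‖x‖) ^ m * ‖iteratedFDeriv ℝ (n + 1) φ z‖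
        ≤ ((1 + ‖w‖) * (1 + ‖z‖)) ^ m * ‖iteratedFDeriv ℝ (n + 1) φ z‖ := by
          gcongr
          have h1 := one_add_norm_le_mul x (x - z)
          rw [sub_sub_cancel] at h1
          refine h1.trans ?_
          gcongr
      _ = (1 + ‖w‖) ^ m * ((1 + ‖z‖) ^ m * ‖iteratedFDeriv ℝ (n + 1) φ z‖) := by
        rw [mul_pow]; ring
      _ ≤ _ := mul_le_mul_of_nonneg_left (ssn_bound (by lia) (by lia) φ _) (by positivity)
  have : ‖(x - w) - x‖ = ‖w‖ := by simp
  rw [this] at key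
  calc (1 + ‖x‖) ^ m * ‖iteratedFDeriv ℝ n φ (x - w) - iteratedFDeriv ℝ n φ x‖
      ≤ (1 + ‖x‖) ^ m * (((1 + ‖w‖) ^ m * (2 ^ (m + 1) * ssn (m + 1) φ) / (1 + ‖x‖) ^ m) * ‖w‖) := by
        gcongr
    _ = _ := by field_simp

lemma continuous_tr : Continuous fun a : Euc d × 𝓢(Euc d, ℂ) => tr a.1 a.2 := by
  rw [continuous_iff_continuousAt]
  rintro ⟨w₀, φ₀⟩
  refine tendsto_of_ssn fun m => ?_
  have hb : ∀ a : Euc d × 𝓢(Euc d, ℂ), ssn m (tr a.1 a.2 - tr w₀ φ₀) ≤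
      (1 + ‖a.1‖) ^ m * (2 ^ m * ssn m (a.2 - φ₀)) +
      ‖a.1 - w₀‖ * ((1 + ‖a.1 - w₀‖) ^ m * (2 ^ (m + 1) * ssn (m + 1) (tr w₀ φ₀))) := by
    rintro ⟨w, φ⟩
    have : tr w φ - tr w₀ φ₀ = tr w (φ - φ₀) + (tr (w - w₀) (tr w₀ φ₀) - tr w₀ φ₀) := by
      ext z; simp
    rw [this]
    exact (map_add_le_add _ _ _).trans (add_le_add (ssn_tr _ _ _) (ssn_tr_sub _ _ _))
  refine squeeze_zero (fun a => apply_nonneg _ _) hb ?_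
  have hc : Continuous fun a : Euc d × 𝓢(Euc d, ℂ) =>
      (1 + ‖a.1‖) ^ m * (2 ^ m * ssn m (a.2 - φ₀)) +
      ‖a.1 - w₀‖ * ((1 + ‖a.1 - w₀‖) ^ m * (2 ^ (m + 1) * ssn (m + 1) (tr w₀ φ₀))) := by
    have h1 : Continuous fun a : Euc d × 𝓢(Euc d, ℂ) => ssn m (a.2 - φ₀) :=
      (continuous_ssn m).comp (continuous_snd.sub continuous_const)
    fun_prop
  simpa using hc.tendsto (w₀, φ₀)

/-- The character `z ↦ exp (-2πi y·z)`. -/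
def chr (y z : Euc d) : ℂ := Complex.exp (-(2 * Real.pi * inner ℝ y z : ℝ) * Complex.I)

lemma chr_eq (y z : Euc d) : chr y z = (Real.fourierChar (-(inner ℝ z y)) : ℂ) := by
  rw [chr, Real.fourierChar_apply, real_inner_comm]
  congr 1; push_cast; ring

lemma norm_chr (y z : Euc d) : ‖chr y z‖ = 1 := by rw [chr_eq]; exact Circle.norm_coe _

lemma chr_add_left (y y' z : Euc d) : chr (y + y') z = chr y z * chr y' z := by
  simp only [chr, ← Complex.exp_add]; congr 1; rw [inner_add_left]; push_cast; ring

lemma chr_add_right (y z z' : Euc d) : chr y (z + z') = chr y z * chr y z' := by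
  simp only [chr, ← Complex.exp_add]; congr 1; rw [inner_add_right]; push_cast; ring

lemma chr_hasTemperateGrowth (y : Euc d) : (chr y).HasTemperateGrowth := by
  have h1 : (fun t : ℝ => Complex.exp (-(t : ℂ) * Complex.I)).HasTemperateGrowth := by
    have hd : ∀ n : ℕ, iteratedDeriv n (fun t : ℝ => Complex.exp (-(t : ℂ) * Complex.I)) =
        fun t : ℝ => (-Complex.I) ^ n * Complex.exp (-(t : ℂ) * Complex.I) := by
      intro n
      induction n with
      | zero => simp
      | succ n ih =>
        rw [iteratedDeriv_succ, ih]
        ext t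
        have h : HasDerivAt (fun t : ℝ => (-Complex.I) ^ n * Complex.exp (-(t : ℂ) * Complex.I))
            ((-Complex.I) ^ n * (Complex.exp (-(t : ℂ) * Complex.I) * (-1 * Complex.I))) t := by
          have : HasDerivAt (fun t : ℝ => -(t : ℂ) * Complex.I) (-1 * Complex.I) t :=
            (Complex.ofRealCLM.hasDerivAt.neg).mul_const _
          exact (this.cexp).const_mul _
        rw [h.deriv]; ring
    refine ⟨?_, fun n => ⟨0, 1, fun t => ?_⟩⟩
    · have : ContDiff ℝ ⊤ (fun t : ℝ => (t : ℂ)) := Complex.ofRealCLM.contDiff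
      exact (this.neg.mul contDiff_const).cexp.of_le le_top
    · rw [norm_iteratedFDeriv_eq_norm_iteratedDeriv, hd]
      have := Complex.norm_exp_ofReal_mul_I (-t)
      push_cast at this
      rw [norm_mul, this]; simp
  have h2 : (fun z : Euc d => 2 * Real.pi * inner ℝ y z).HasTemperateGrowth :=
    (Function.HasTemperateGrowth.const (2 * Real.pi)).mul (Function.hasTemperateGrowth_inner_right y)
  exact h1.comp h2

lemma shiftedWindow_apply (g : 𝓢(Euc d, ℂ)) (x y z : Euc d) :
    shiftedWindow g x y z = chr y z * g (z - x) := by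
  have := SchwartzMap.smulLeftCLM_apply_apply (𝕜 := ℂ) (chr_hasTemperateGrowth y) (tr x g) z
  rw [smul_eq_mul, SchwartzMap.compSubConstCLM_apply] at this
  exact this

lemma fourier_apply_eq (φ : 𝓢(Euc d, ℂ)) (y : Euc d) : 𝓕 φ y = ∫ z, chr y z * φ z := by
  rw [SchwartzMap.fourier_coe, Real.fourier_eq]
  refine integral_congr_ae (Eventually.of_forall fun z => ?_)
  simp only [chr_eq, Circle.smul_def, smul_eq_mul]

lemma fourierInv_apply_eq (φ : 𝓢(Euc d, ℂ)) (y : Euc d) : 𝓕⁻ φ y = ∫ z, chr (-y) z * φ z := by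
  rw [SchwartzMap.fourierInv_apply_eq]
  exact fourier_apply_eq φ (-y)

lemma fourier_shiftedWindow (g : 𝓢(Euc d, ℂ)) (x y : Euc d) :
    𝓕 (shiftedWindow g x y) = tr (-y) (𝓕 (tr x g)) := by
  ext ξ
  rw [fourier_apply_eq, SchwartzMap.compSubConstCLM_apply, fourier_apply_eq]
  refine integral_congr_ae (Eventually.of_forall fun z => ?_)
  simp only [shiftedWindow_apply, sub_neg_eq_add, chr_add_left, SchwartzMap.compSubConstCLM_apply]
  ring

/-- Modulation is translation conjugated by the Fourier transform, so joint continuity and seminorm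
bounds for shifted windows follow from those for translations alone. -/
lemma shiftedWindow_eq (g : 𝓢(Euc d, ℂ)) (x y : Euc d) :
    shiftedWindow g x y = 𝓕⁻ (tr (-y) (𝓕 (tr x g))) := by
  rw [← fourier_shiftedWindow]; simp

lemma continuous_shiftedWindow (g : 𝓢(Euc d, ℂ)) :
    Continuous fun a : Euc d × Euc d => shiftedWindow g a.1 a.2 := by
  simp only [shiftedWindow_eq]
  have h1 : Continuous fun a : Euc d × Euc d => tr a.1 g :=
    continuous_tr.comp (continuous_fst.prodMk continuous_const)
  have h2 : Continuous fun a : Euc d × Euc d => 𝓕 (tr a.1 g) :=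
    (FourierTransform.fourierCLM ℂ 𝓢(Euc d, ℂ)).continuous.comp h1
  have h3 : Continuous fun a : Euc d × Euc d => tr (-a.2) (𝓕 (tr a.1 g)) :=
    continuous_tr.comp (continuous_snd.neg.prodMk h2)
  exact (FourierTransform.fourierInvCLM ℂ 𝓢(Euc d, ℂ)).continuous.comp h3

lemma ssn_shiftedWindow_le (m : ℕ) : ∃ (m' : ℕ) (C : ℝ), 0 ≤ C ∧ ∀ (g : 𝓢(Euc d, ℂ)) (x y : Euc d),
    ssn m (shiftedWindow g x y) ≤ C * (1 + ‖x‖) ^ m' * (1 + ‖y‖) ^ m' * ssn m' g := by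
  obtain ⟨m₁, C₁, hC₁, h₁⟩ := ssn_clm (FourierTransform.fourierInvCLM ℂ 𝓢(Euc d, ℂ)) m
  obtain ⟨m₂, C₂, hC₂, h₂⟩ := ssn_clm (FourierTransform.fourierCLM ℂ 𝓢(Euc d, ℂ)) m₁
  refine ⟨max m₁ m₂, C₁ * (2 ^ m₁ * (C₂ * 2 ^ m₂)), by positivity, fun g x y => ?_⟩
  rw [shiftedWindow_eq]
  calc ssn m (𝓕⁻ (tr (-y) (𝓕 (tr x g)))) ≤ C₁ * ssn m₁ (tr (-y) (𝓕 (tr x g))) := h₁ _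
    _ ≤ C₁ * ((1 + ‖y‖) ^ m₁ * (2 ^ m₁ * (C₂ * ((1 + ‖x‖) ^ m₂ * (2 ^ m₂ * ssn m₂ g))))) := by
      have a := ssn_tr m₁ (-y) (𝓕 (tr x g))
      rw [norm_neg] at a
      have b : ssn m₁ (𝓕 (tr x g)) ≤ C₂ * ssn m₂ (tr x g) := h₂ _
      have c := ssn_tr m₂ x g
      grw [a, b, c]
    _ = C₁ * (2 ^ m₁ * (C₂ * 2 ^ m₂)) * (1 + ‖x‖) ^ m₂ * (1 + ‖y‖) ^ m₁ * ssn m₂ g := by ring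
    _ ≤ _ := by
      have hx : 1 ≤ 1 + ‖x‖ := by linarith [norm_nonneg x]
      have hy : 1 ≤ 1 + ‖y‖ := by linarith [norm_nonneg y]
      have := apply_nonneg (ssn (d := d) m₂) g
      gcongr
      · exact le_max_right _ _
      · exact le_max_left _ _
      · exact ssn_mono (le_max_right _ _) g

lemma norm_iteratedFDeriv_mul_le_of_le {a b : Euc d → ℂ} {n : ℕ} {x : Euc d} {A B : ℝ}
    (ha : ContDiff ℝ n a) (hb : ContDiff ℝ n b) (hA : ∀ i ≤ n, ‖iteratedFDeriv ℝ i a x‖ ≤ A)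
    (hB : ∀ i ≤ n, ‖iteratedFDeriv ℝ i b x‖ ≤ B) :
    ‖iteratedFDeriv ℝ n (fun z => a z * b z) x‖ ≤ 2 ^ n * (A * B) := by
  have hA0 : 0 ≤ A := (norm_nonneg _).trans (hA 0 (Nat.zero_le n))
  refine (norm_iteratedFDeriv_mul_le ha hb x le_rfl).trans ?_
  have : (2 : ℝ) ^ n = ∑ i ∈ Finset.range (n + 1), (n.choose i : ℝ) := by
    exact_mod_cast (Nat.sum_range_choose n).symm
  rw [this, Finset.sum_mul]
  refine Finset.sum_le_sum fun i hi => ?_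
  rw [mul_assoc]
  have hi' : i ≤ n := Nat.lt_succ_iff.mp (Finset.mem_range.mp hi)
  have := hA i hi'
  have := hB (n - i) (Nat.sub_le _ _)
  gcongr

/-- The product of two Schwartz functions. -/
def smul' (φ ψ : 𝓢(Euc d, ℂ)) : 𝓢(Euc d, ℂ) := SchwartzMap.smulLeftCLM ℂ φ ψ

lemma smul'_apply (φ ψ : 𝓢(Euc d, ℂ)) (z : Euc d) : smul' φ ψ z = φ z * ψ z :=
  SchwartzMap.smulLeftCLM_apply_apply φ.hasTemperateGrowth ψ z

/-- The factors concentrate near w and near 0. Since 1 + ‖w‖ ≤ (1 + ‖x - w‖)(1 + ‖x‖), N powers of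
decay taken from each of them pay for the weight in w. -/
lemma ssn_smul_tr_le (m N : ℕ) : ∃ C : ℝ, 0 ≤ C ∧ ∀ (h ψ : 𝓢(Euc d, ℂ)) (w : Euc d),
    (1 + ‖w‖) ^ N * ssn m (smul' (tr w h) ψ) ≤ C * ssn (m + N) h * ssn (m + N) ψ := by
  refine ⟨2 ^ m * (2 ^ (m + N) * 2 ^ (m + N)), by positivity, fun h ψ w => ?_⟩
  rw [mul_comm, ← le_div_iff₀ (by positivity)]
  have h0 := apply_nonneg (ssn (d := d) (m + N)) h
  have h1 := apply_nonneg (ssn (d := d) (m + N)) ψ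
  refine ssn_le (by positivity) fun n hn x => ?_
  rw [le_div_iff₀ (by positivity)]
  have e : (smul' (tr w h) ψ : Euc d → ℂ) = fun z => tr w h z * ψ z := by
    ext z; exact smul'_apply _ _ _
  have hA : ∀ i ≤ n, ‖iteratedFDeriv ℝ i (tr w h) x‖
      ≤ 2 ^ (m + N) * ssn (m + N) h / (1 + ‖x - w‖) ^ N := fun i hi => by
    rw [iteratedFDeriv_tr, le_div_iff₀ (by positivity), mul_comm]
    exact ssn_bound (by lia) (by lia) h _
  have hB : ∀ i ≤ n, ‖iteratedFDeriv ℝ i ψ x‖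
      ≤ 2 ^ (m + N) * ssn (m + N) ψ / (1 + ‖x‖) ^ (m + N) := fun i hi => by
    rw [le_div_iff₀ (by positivity), mul_comm]
    exact ssn_bound (by lia) (by lia) ψ _
  have key := norm_iteratedFDeriv_mul_le_of_le (((tr w h).smooth ⊤).of_le (mod_cast le_top))
    ((ψ.smooth ⊤).of_le (mod_cast le_top)) hA hB
  rw [e]
  have hw : 1 + ‖w‖ ≤ (1 + ‖x - w‖) * (1 + ‖x‖) := by
    have h2 := one_add_norm_le_mul w x
    rw [norm_sub_rev w x, mul_comm] at h2
    exact h2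
  calc (1 + ‖x‖) ^ m * ‖iteratedFDeriv ℝ n (fun z => tr w h z * ψ z) x‖ * (1 + ‖w‖) ^ N
      ≤ (1 + ‖x‖) ^ m * (2 ^ n * (2 ^ (m + N) * ssn (m + N) h / (1 + ‖x - w‖) ^ N *
        (2 ^ (m + N) * ssn (m + N) ψ / (1 + ‖x‖) ^ (m + N)))) *
        ((1 + ‖x - w‖) * (1 + ‖x‖)) ^ N := by gcongr
    _ = 2 ^ n * (2 ^ (m + N) * 2 ^ (m + N)) * ssn (m + N) h * ssn (m + N) ψ := by
      rw [pow_add (1 + ‖x‖), mul_pow]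
      field_simp
    _ ≤ _ := by
      have : (2 : ℝ) ^ n ≤ 2 ^ m := pow_le_pow_right₀ (by norm_num) hn
      gcongr

lemma localFourier_coe (h ψ : 𝓢(Euc d, ℂ)) (x y : Euc d) :
    localFourier h (ψ : 𝓢'(Euc d, ℂ)) x y = ∫ z, chr y z * h (z - x) * ψ z := by
  refine (SchwartzMap.toTemperedDistributionCLM_apply_apply volume ψ (shiftedWindow h x y)).trans ?_
  refine integral_congr_ae (Eventually.of_forall fun z => ?_)
  simp [shiftedWindow_apply]

lemma localFourier_coe_eq_fourier (h ψ : 𝓢(Euc d, ℂ)) (x y : Euc d) :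
    localFourier h (ψ : 𝓢'(Euc d, ℂ)) x y = 𝓕 (smul' (tr x h) ψ) y := by
  rw [localFourier_coe, fourier_apply_eq]
  refine integral_congr_ae (Eventually.of_forall fun z => ?_)
  simp only [smul'_apply, SchwartzMap.compSubConstCLM_apply]
  ring

/-- Decay in x comes from the separation of window and function, decay in y from continuity of the
Fourier transform on the Schwartz space. -/
lemma norm_localFourier_coe_le (N : ℕ) : ∃ (m : ℕ) (C : ℝ), 0 ≤ C ∧
    ∀ (h ψ : 𝓢(Euc d, ℂ)) (x y : Euc d),
    (1 + ‖x‖) ^ N * (1 + ‖y‖) ^ N * ‖localFourier h (ψ : 𝓢'(Euc d, ℂ)) x y‖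
      ≤ C * ssn m h * ssn m ψ := by
  obtain ⟨m₁, C₁, hC₁, h₁⟩ := ssn_clm (FourierTransform.fourierCLM ℂ 𝓢(Euc d, ℂ)) N
  obtain ⟨C₂, hC₂, h₂⟩ := ssn_smul_tr_le (d := d) m₁ N
  refine ⟨m₁ + N, 2 ^ N * C₁ * C₂, by positivity, fun h ψ x y => ?_⟩
  rw [localFourier_coe_eq_fourier]
  calc (1 + ‖x‖) ^ N * (1 + ‖y‖) ^ N * ‖𝓕 (smul' (tr x h) ψ) y‖
      = (1 + ‖x‖) ^ N * ((1 + ‖y‖) ^ N * ‖𝓕 (smul' (tr x h) ψ) y‖) := by ring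
    _ ≤ (1 + ‖x‖) ^ N * (2 ^ N * (C₁ * ssn m₁ (smul' (tr x h) ψ))) := by
      refine mul_le_mul_of_nonneg_left ((ssn_bound_zero le_rfl _ _).trans ?_) (by positivity)
      exact mul_le_mul_of_nonneg_left (h₁ _) (by positivity)
    _ = 2 ^ N * C₁ * ((1 + ‖x‖) ^ N * ssn m₁ (smul' (tr x h) ψ)) := by ring
    _ ≤ 2 ^ N * C₁ * (C₂ * ssn (m₁ + N) h * ssn (m₁ + N) ψ) := 
      mul_le_mul_of_nonneg_left (h₂ h ψ x) (by positivity)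
    _ = _ := by ring

end

/-! ### Integrals of Schwartz-valued families under a tempered distribution -/

section

open MeasureTheory Filter FourierTransform BoundedContinuousFunction

variable {d : ℕ}

/-- The space of bounded continuous jets of order `m`. -/
def JetSpace (d m : ℕ) := (i : Fin (m + 1)) → (Euc d →ᵇ (Euc d [×(i : ℕ)]→L[ℝ] ℂ))

instance (m : ℕ) : NormedAddCommGroup (JetSpace d m) :=
  inferInstanceAs (NormedAddCommGroup ((i : Fin (m + 1)) → (Euc d →ᵇ (Euc d [×(i : ℕ)]→L[ℝ] ℂ))))

instance (m : ℕ) : NormedSpace ℂ (JetSpace d m) :=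
  inferInstanceAs (NormedSpace ℂ ((i : Fin (m + 1)) → (Euc d →ᵇ (Euc d [×(i : ℕ)]→L[ℝ] ℂ))))

instance (m : ℕ) : NormedSpace ℝ (JetSpace d m) :=
  inferInstanceAs (NormedSpace ℝ ((i : Fin (m + 1)) → (Euc d →ᵇ (Euc d [×(i : ℕ)]→L[ℝ] ℂ))))

instance (m : ℕ) : CompleteSpace (JetSpace d m) :=
  inferInstanceAs (CompleteSpace ((i : Fin (m + 1)) → (Euc d →ᵇ (Euc d [×(i : ℕ)]→L[ℝ] ℂ))))

/-- The component of order `i` of a jet. -/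
def jetProj (m : ℕ) (i : Fin (m + 1)) :
    JetSpace d m →L[ℝ] (Euc d →ᵇ (Euc d [×(i : ℕ)]→L[ℝ] ℂ)) :=
  ContinuousLinearMap.proj (R := ℝ) (φ := fun i : Fin (m + 1) =>
    (Euc d →ᵇ (Euc d [×(i : ℕ)]→L[ℝ] ℂ))) i

/-- The component of order `i` of a jet, evaluated at a point. -/
def jetEval (m : ℕ) (i : Fin (m + 1)) (z : Euc d) : JetSpace d m →L[ℝ] (Euc d [×(i : ℕ)]→L[ℝ] ℂ) :=
  (BoundedContinuousFunction.evalCLM ℝ z).comp (jetProj m i)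

lemma norm_weighted_iteratedFDeriv_le (m : ℕ) (i : Fin (m + 1)) (φ : 𝓢(Euc d, ℂ)) (z : Euc d) :
    ‖((1 + ‖z‖) ^ m : ℝ) • iteratedFDeriv ℝ i φ z‖ ≤ 2 ^ m * ssn m φ := by
  rw [norm_smul, Real.norm_of_nonneg (by positivity)]
  exact ssn_bound le_rfl (by lia) φ z

/-- The weighted jet of a Schwartz function. -/
def jetFun (m : ℕ) (φ : 𝓢(Euc d, ℂ)) : JetSpace d m := fun i =>
  BoundedContinuousFunction.ofNormedAddCommGroup
    (fun z => ((1 + ‖z‖) ^ m : ℝ) • iteratedFDeriv ℝ i φ z)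
    (by
      have := (φ.smooth ⊤).continuous_iteratedFDeriv (m := i) (mod_cast le_top)
      fun_prop)
    (2 ^ m * ssn m φ) (norm_weighted_iteratedFDeriv_le m i φ)

lemma jetFun_apply (m : ℕ) (φ : 𝓢(Euc d, ℂ)) (i : Fin (m + 1)) (z : Euc d) :
    jetFun m φ i z = ((1 + ‖z‖) ^ m : ℝ) • iteratedFDeriv ℝ i φ z := rfl

lemma norm_jetFun_le (m : ℕ) (φ : 𝓢(Euc d, ℂ)) : ‖jetFun m φ‖ ≤ 2 ^ m * ssn m φ := by
  have h : 0 ≤ 2 ^ m * ssn m φ := mul_nonneg (by positivity) (apply_nonneg _ _)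
  refine (pi_norm_le_iff_of_nonneg (ι := Fin (m + 1)) (G := fun i : Fin (m + 1) =>
    (Euc d →ᵇ (Euc d [×(i : ℕ)]→L[ℝ] ℂ))) h).2 fun i => ?_
  rw [BoundedContinuousFunction.norm_le h]
  exact norm_weighted_iteratedFDeriv_le m i φ

lemma ssn_le_norm_jetFun (m : ℕ) (φ : 𝓢(Euc d, ℂ)) : ssn m φ ≤ ‖jetFun m φ‖ := by
  refine ssn_le (norm_nonneg _) fun n hn x => ?_
  have h1 := (jetFun m φ ⟨n, by lia⟩).norm_coe_le_norm x
  rw [jetFun_apply, norm_smul, Real.norm_of_nonneg (by positivity)] at h1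
  exact h1.trans (norm_le_pi_norm (ι := Fin (m + 1)) (G := fun i : Fin (m + 1) =>
    (Euc d →ᵇ (Euc d [×(i : ℕ)]→L[ℝ] ℂ))) (jetFun m φ) _)

/-- The weighted jet as a continuous linear map. -/
def jet (m : ℕ) : 𝓢(Euc d, ℂ) →L[ℂ] JetSpace d m where
  toFun := jetFun m
  map_add' φ ψ := by
    refine funext fun i => BoundedContinuousFunction.ext fun z => ?_
    refine Eq.trans ?_ (smul_add ((1 + ‖z‖) ^ m : ℝ) (iteratedFDeriv ℝ i φ z)
      (iteratedFDeriv ℝ i ψ z))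
    rw [jetFun_apply]
    congr 1
    exact iteratedFDeriv_add_apply ((φ.smooth ⊤).contDiffAt.of_le (mod_cast le_top))
      ((ψ.smooth ⊤).contDiffAt.of_le (mod_cast le_top))
  map_smul' c φ := by
    refine funext fun i => BoundedContinuousFunction.ext fun z => ?_
    refine Eq.trans ?_ (smul_comm ((1 + ‖z‖) ^ m : ℝ) c (iteratedFDeriv ℝ i φ z))
    rw [jetFun_apply]
    congr 1
    exact iteratedFDeriv_const_smul_apply ((φ.smooth ⊤).contDiffAt.of_le (mod_cast le_top))
  cont := by
    rw [continuous_iff_continuousAt]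
    intro φ
    rw [ContinuousAt, tendsto_iff_norm_sub_tendsto_zero]
    refine squeeze_zero (fun _ => norm_nonneg _) (g := fun ψ => 2 ^ m * ssn m (ψ - φ))
      (fun ψ => ?_) ?_
    · refine le_trans (le_of_eq ?_) (norm_jetFun_le m (ψ - φ))
      congr 1
      refine funext fun i => BoundedContinuousFunction.ext fun z => ?_
      refine Eq.trans (smul_sub ((1 + ‖z‖) ^ m : ℝ) (iteratedFDeriv ℝ i ψ z)
        (iteratedFDeriv ℝ i φ z)).symm ?_
      rw [jetFun_apply]
      congr 1
      exact (iteratedFDeriv_sub_apply ((ψ.smooth ⊤).contDiffAt.of_le (mod_cast le_top))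
        ((φ.smooth ⊤).contDiffAt.of_le (mod_cast le_top))).symm
    · simpa using (ssn_sub_tendsto (l := 𝓝 φ) tendsto_id m).const_mul (2 ^ m)

lemma jetProj_jet_apply (m : ℕ) (φ : 𝓢(Euc d, ℂ)) (i : Fin (m + 1)) (z : Euc d) :
    jetProj m i (jet m φ) z = ((1 + ‖z‖) ^ m : ℝ) • iteratedFDeriv ℝ i φ z := rfl

/-- The component of order zero determines the function. Injectivity lets a distribution be
transported to the range of `jet m`. -/
lemma jet_injective (m : ℕ) : Function.Injective (jet (d := d) m) := by
  intro φ ψ h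
  ext z
  have h1 : jetProj m 0 (jet m φ) z = jetProj m 0 (jet m ψ) z := by rw [h]
  rw [jetProj_jet_apply, jetProj_jet_apply] at h1
  have h2 : iteratedFDeriv ℝ 0 φ z = iteratedFDeriv ℝ 0 ψ z :=
    smul_right_injective _ (by positivity : ((1 + ‖z‖) ^ m : ℝ) ≠ 0) h1
  simpa using congrArg (fun T => T 0) h2

/-- Every tempered distribution factors through some jet space. -/
lemma exists_jet_extension (f : 𝓢'(Euc d, ℂ)) :
    ∃ (m : ℕ) (F : JetSpace d m →L[ℂ] ℂ), ∀ φ, f φ = F (jet m φ) := by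
  obtain ⟨m, C, hC, h⟩ := dist_bound f
  refine ⟨m, ?_⟩
  let e := LinearEquiv.ofInjective (jet (d := d) m).toLinearMap (jet_injective m)
  let l : LinearMap.range (jet (d := d) m).toLinearMap →ₗ[ℂ] ℂ := f.toLinearMap ∘ₗ e.symm.toLinearMap
  have hl : ∀ b, ‖l b‖ ≤ C * ‖b‖ := by
    intro b
    obtain ⟨φ, rfl⟩ := e.surjective b
    have : l (e φ) = f φ := congrArg f (e.symm_apply_apply φ)
    rw [this]
    exact (h φ).trans (mul_le_mul_of_nonneg_left (ssn_le_norm_jetFun m φ) hC)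
  -- Hahn–Banach: on the range of the jet map the distribution is bounded for the norm of the jet
  -- space, since that norm dominates `ssn m`.
  obtain ⟨F, hF, -⟩ := exists_extension_norm_eq _ (l.mkContinuous C hl)
  refine ⟨F, fun φ => ?_⟩
  have h1 := hF (e φ)
  have h2 : l.mkContinuous C hl (e φ) = f φ := congrArg f (e.symm_apply_apply φ)
  rw [h2] at h1
  exact h1.symm

/-- Currying as a continuous linear equivalence. -/
def curryLeft (d n : ℕ) :
    (Euc d [×(n + 1)]→L[ℝ] ℂ) ≃L[ℝ] (Euc d →L[ℝ] (Euc d [×n]→L[ℝ] ℂ)) :=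
  (continuousMultilinearCurryLeftEquiv ℝ (fun _ : Fin (n + 1) => Euc d) ℂ).toContinuousLinearEquiv

lemma continuous_iteratedFDeriv_eval (n : ℕ) (z : Euc d) :
    Continuous fun φ : 𝓢(Euc d, ℂ) => iteratedFDeriv ℝ n φ z := by
  have h1 : Continuous fun φ : 𝓢(Euc d, ℂ) => jetProj n (Fin.last n) (jet n φ) z :=
    (BoundedContinuousFunction.evalCLM ℝ z).continuous.comp
      ((jetProj n (Fin.last n)).continuous.comp (jet n).continuous)
  have h2 : (fun φ : 𝓢(Euc d, ℂ) => iteratedFDeriv ℝ n φ z) =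
      fun φ => (((1 + ‖z‖) ^ n)⁻¹ : ℝ) • jetProj n (Fin.last n) (jet n φ) z := by
    ext1 φ
    rw [jetProj_jet_apply, smul_smul, inv_mul_cancel₀ (by positivity), one_smul]
    rfl
  rw [h2]
  exact Continuous.smul (M := ℝ) continuous_const h1

section Pettis

variable {X : Type*} [TopologicalSpace X] [SecondCountableTopology X] [MeasurableSpace X]
  [OpensMeasurableSpace X] {μ : Measure X} {Φ : X → 𝓢(Euc d, ℂ)} {Ψ : 𝓢(Euc d, ℂ)}

lemma integrable_iteratedFDeriv_eval (hΦ : Continuous Φ)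
    (hint : ∀ m, Integrable (fun ν => ssn m (Φ ν)) μ) (n : ℕ) (z : Euc d) :
    Integrable (fun ν => iteratedFDeriv ℝ n (Φ ν) z) μ := by
  refine ((hint n).const_mul (2 ^ n)).mono'
    ((continuous_iteratedFDeriv_eval n z).comp hΦ).aestronglyMeasurable
    (Eventually.of_forall fun ν => ?_)
  simpa using ssn_bound (Nat.zero_le n) le_rfl (Φ ν) z

/-- Differentiation under the integral sign, one order at a time. The derivative of order n + 1 is
dominated, uniformly in the point, by the integrable function `2 ^ (n + 1) * ssn (n + 1) (Φ ν)`. -/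
lemma iteratedFDeriv_eq_integral (hΦ : Continuous Φ)
    (hint : ∀ m, Integrable (fun ν => ssn m (Φ ν)) μ) (hΨ : ∀ z, Ψ z = ∫ ν, Φ ν z ∂μ) (n : ℕ)
    (z : Euc d) : iteratedFDeriv ℝ n Ψ z = ∫ ν, iteratedFDeriv ℝ n (Φ ν) z ∂μ := by
  induction n generalizing z with
  | zero =>
    simp only [iteratedFDeriv_zero_eq_comp, Function.comp_apply]
    rw [hΨ]
    exact ((continuousMultilinearCurryFin0 ℝ (Euc d) ℂ).symm.toContinuousLinearEquiv.integral_comp_comm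
      (fun ν => Φ ν z)).symm
  | succ n ih =>
    have hs : ∀ φ : 𝓢(Euc d, ℂ), ∀ x, fderiv ℝ (iteratedFDeriv ℝ n φ) x =
        curryLeft d n (iteratedFDeriv ℝ (n + 1) φ x) := fun φ x => by
      rw [iteratedFDeriv_succ_eq_comp_left]
      exact ((curryLeft d n).apply_symm_apply _).symm
    have key : HasFDerivAt (fun x => ∫ ν, iteratedFDeriv ℝ n (Φ ν) x ∂μ)
        (∫ ν, fderiv ℝ (iteratedFDeriv ℝ n (Φ ν)) z ∂μ) z := by
      refine hasFDerivAt_integral_of_dominated_of_fderiv_le (𝕜 := ℝ) (H := Euc d)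
        (E := Euc d [×n]→L[ℝ] ℂ) (F := fun x ν => iteratedFDeriv ℝ n (Φ ν) x)
        (F' := fun x ν => fderiv ℝ (iteratedFDeriv ℝ n (Φ ν)) x) (s := Set.univ) univ_mem
        (Eventually.of_forall fun x => (integrable_iteratedFDeriv_eval hΦ hint n x).1)
        (integrable_iteratedFDeriv_eval hΦ hint n z) ?_
        (bound := fun ν => 2 ^ (n + 1) * ssn (n + 1) (Φ ν)) ?_ ((hint (n + 1)).const_mul _) ?_
      · simp only [hs]
        exact (curryLeft d n).continuous.comp_aestronglyMeasurable
          (integrable_iteratedFDeriv_eval hΦ hint (n + 1) z).1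
      · refine Eventually.of_forall fun ν x _ => ?_
        rw [norm_fderiv_iteratedFDeriv]
        simpa using ssn_bound (Nat.zero_le (n + 1)) le_rfl (Φ ν) x
      · refine Eventually.of_forall fun ν x _ => ?_
        exact (((Φ ν).smooth ⊤).differentiable_iteratedFDeriv
          (mod_cast (WithTop.coe_lt_top _)) x).hasFDerivAt
    have e : iteratedFDeriv ℝ n Ψ = fun x => ∫ ν, iteratedFDeriv ℝ n (Φ ν) x ∂μ := funext ih
    rw [iteratedFDeriv_succ_eq_comp_left, Function.comp_apply, e, key.fderiv]
    simp only [hs]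
    refine (ContinuousLinearEquiv.integral_comp_comm (𝕜 := ℝ)
      (E := Euc d →L[ℝ] (Euc d [×n]→L[ℝ] ℂ)) (F := Euc d [×(n + 1)]→L[ℝ] ℂ)
      (μ := μ) (curryLeft d n).symm
      (fun ν => curryLeft d n (iteratedFDeriv ℝ (n + 1) (Φ ν) z))).symm.trans ?_
    simp only [ContinuousLinearEquiv.symm_apply_apply]

/-- A tempered distribution commutes with integrals of continuous families of Schwartz functions
all of whose seminorms are integrable. -/
theorem apply_eq_integral (hΦ : Continuous Φ)
    (hint : ∀ m, Integrable (fun ν => ssn m (Φ ν)) μ) (hΨ : ∀ z, Ψ z = ∫ ν, Φ ν z ∂μ)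
    (f : 𝓢'(Euc d, ℂ)) : f Ψ = ∫ ν, f (Φ ν) ∂μ := by
  -- The integral is taken in the Banach space of jets, where Bochner integration commutes with the
  -- bounded functional F. The integral of the jets is identified with the jet of Ψ by evaluating
  -- each component at each point.
  obtain ⟨m, F, hF⟩ := exists_jet_extension f
  have hI : Integrable (fun ν => jet m (Φ ν)) μ := by
    refine ((hint m).const_mul (2 ^ m)).mono'
      ((jet m).continuous.comp hΦ).aestronglyMeasurable
      (Eventually.of_forall fun ν => norm_jetFun_le m (Φ ν))
  have hJ : ∫ ν, jet m (Φ ν) ∂μ = jet m Ψ := by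
    refine funext fun i => BoundedContinuousFunction.ext fun z => ?_
    change jetEval m i z (∫ ν, jet m (Φ ν) ∂μ) = jetProj m i (jet m Ψ) z
    rw [← ContinuousLinearMap.integral_comp_comm (𝕜 := ℝ) (E := JetSpace d m)
      (Fₗ := Euc d [×(i : ℕ)]→L[ℝ] ℂ) (jetEval m i z) hI, jetProj_jet_apply]
    change ∫ ν, ((1 + ‖z‖) ^ m : ℝ) • iteratedFDeriv ℝ i (Φ ν) z ∂μ = _
    rw [integral_smul, iteratedFDeriv_eq_integral hΦ hint hΨ]
  simp only [hF]
  rw [F.integral_comp_comm hI, hJ]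

end Pettis

end

/-! ### The reproducing formula for tempered distributions -/

section


variable {d : ℕ}

/-- The complex conjugate of a Schwartz function. -/
def cj (φ : 𝓢(Euc d, ℂ)) : 𝓢(Euc d, ℂ) :=
  SchwartzMap.postcompCLM (𝕜 := ℝ) (Complex.conjCLE : ℂ →L[ℝ] ℂ) φ

lemma cj_apply (φ : 𝓢(Euc d, ℂ)) (z : Euc d) : cj φ z = conj (φ z) := rfl

/-- The weight `(1 + ‖x‖)^{-N}`. -/
def krn (N : ℕ) (x : Euc d) : ℝ := ((1 + ‖x‖) ^ N)⁻¹

lemma krn_pos (N : ℕ) (x : Euc d) : 0 < krn N x := by unfold krn; positivity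

lemma krn_neg (N : ℕ) (x : Euc d) : krn N (-x) = krn N x := by simp [krn]

lemma continuous_krn (N : ℕ) : Continuous (krn (d := d) N) := by
  unfold krn
  exact Continuous.inv₀ (by fun_prop) fun x => by positivity

lemma integrable_krn {N : ℕ} (hN : d < N) : Integrable (krn (d := d) N) := by
  have h := integrable_one_add_norm (E := Euc d) (μ := volume) (r := N)
    (by rw [finrank_euclideanSpace_fin]; exact_mod_cast hN)
  refine h.congr (Eventually.of_forall fun x => ?_)
  simp only [krn]
  rw [Real.rpow_neg (by positivity), Real.rpow_natCast]

lemma integrable_krn_prod {N : ℕ} (hN : d < N) :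
    Integrable (fun a : Euc d × Euc d => krn N a.1 * krn N a.2) :=
  (integrable_krn hN).mul_prod (integrable_krn hN)

lemma continuous_localFourier (g : 𝓢(Euc d, ℂ)) (f : 𝓢'(Euc d, ℂ)) :
    Continuous fun a : Euc d × Euc d => localFourier g f a.1 a.2 :=
  f.continuous.comp (continuous_shiftedWindow g)

lemma continuous_localFourier_neg (g : 𝓢(Euc d, ℂ)) (f : 𝓢'(Euc d, ℂ)) :
    Continuous fun a : Euc d × Euc d => localFourier g f a.1 (-a.2) := by
  have hn : Continuous fun a : Euc d × Euc d => (a.1, -a.2) := by fun_prop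
  have h := (continuous_localFourier g f).comp hn
  exact h

lemma norm_localFourier_coe_le_krn (h : 𝓢(Euc d, ℂ)) (N : ℕ) : ∃ (m : ℕ) (C : ℝ), 0 ≤ C ∧
    ∀ (ψ : 𝓢(Euc d, ℂ)) (x y : Euc d),
    ‖localFourier h (ψ : 𝓢'(Euc d, ℂ)) x y‖ ≤ C * ssn m ψ * (krn N x * krn N y) := by
  obtain ⟨m, C, hC, hb⟩ := norm_localFourier_coe_le (d := d) N
  refine ⟨m, C * ssn m h, mul_nonneg hC (apply_nonneg _ _), fun ψ x y => ?_⟩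
  have := hb h ψ x y
  rw [krn, krn, ← mul_inv, ← div_eq_mul_inv, le_div_iff₀ (by positivity)]
  linarith

lemma localFourier_smul (g : 𝓢(Euc d, ℂ)) (c : ℂ) (f : 𝓢'(Euc d, ℂ)) (x y : Euc d) :
    localFourier g (c • f) x y = c * localFourier g f x y := rfl

lemma localFourier_add (g : 𝓢(Euc d, ℂ)) (f f' : 𝓢'(Euc d, ℂ)) (x y : Euc d) :
    localFourier g (f + f') x y = localFourier g f x y + localFourier g f' x y := rfl

lemma chr_comm (y z : Euc d) : chr y z = chr z y := by simp only [chr, real_inner_comm]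

/-- The squared `L²` norm of a window. -/
def nsq (g : 𝓢(Euc d, ℂ)) : ℝ := ∫ z, ‖g z‖ ^ 2

lemma nsq_pos {g : 𝓢(Euc d, ℂ)} (hg : g ≠ 0) : 0 < nsq g := by
  have hint : Integrable (fun z => ‖g z‖ ^ 2) := by
    have := (memLp_two_iff_integrable_sq_norm g.continuous.aestronglyMeasurable).1 (g.memLp 2 volume)
    exact this
  have hc : Continuous fun z => ‖g z‖ ^ 2 := by have := g.continuous; fun_prop
  obtain ⟨z, hz⟩ : ∃ z, g z ≠ 0 := by
    by_contra! h
    exact hg (SchwartzMap.ext h)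
  exact integral_pos_of_integrable_nonneg_nonzero hc hint (fun z => by positivity)
    (x := z) (by positivity)

/-- For fixed w the integral over frequencies is Fourier inversion for conj(g(· - w)) Ψ. The
remaining factor g(z - w) completes the square modulus. -/
lemma integral_window (g Ψ : 𝓢(Euc d, ℂ)) (w z : Euc d) :
    ∫ η, localFourier (cj g) (Ψ : 𝓢'(Euc d, ℂ)) w (-η) * shiftedWindow g w η z
      = ((‖g (z - w)‖ ^ 2 : ℝ) : ℂ) * Ψ z := by
  have h1 : ∫ η, localFourier (cj g) (Ψ : 𝓢'(Euc d, ℂ)) w (-η) * shiftedWindow g w η z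
      = (∫ η, chr (-z) η * 𝓕 (smul' (tr w (cj g)) Ψ) η) * g (z - w) := by
    rw [← integral_mul_const]
    refine (integral_neg_eq_self (fun η => localFourier (cj g) (Ψ : 𝓢'(Euc d, ℂ)) w (-η) *
      shiftedWindow g w η z) volume).symm.trans ?_
    refine integral_congr_ae (Eventually.of_forall fun η => ?_)
    have e : chr (-η) z = chr (-z) η := by rw [chr_comm]; simp [chr]
    simp only [neg_neg, localFourier_coe_eq_fourier, shiftedWindow_apply]
    rw [e]; ring
  have h2 : ∫ η, chr (-z) η * 𝓕 (smul' (tr w (cj g)) Ψ) η = conj (g (z - w)) * Ψ z := by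
    rw [← fourierInv_apply_eq, FourierTransform.fourierInv_fourier_eq, smul'_apply,
      SchwartzMap.compSubConstCLM_apply, cj_apply]
  rw [h1, h2]
  have : (((‖g (z - w)‖ ^ 2 : ℝ)) : ℂ) = conj (g (z - w)) * g (z - w) := by
    rw [← Complex.normSq_eq_norm_sq, Complex.normSq_eq_conj_mul_self]
  rw [this]; ring

/-- The reproducing family of a Schwartz function. -/
def reproFamily (g Ψ : 𝓢(Euc d, ℂ)) (a : Euc d × Euc d) : 𝓢(Euc d, ℂ) :=
  localFourier (cj g) (Ψ : 𝓢'(Euc d, ℂ)) a.1 (-a.2) • shiftedWindow g a.1 a.2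

lemma continuous_reproFamily (g Ψ : 𝓢(Euc d, ℂ)) : Continuous (reproFamily g Ψ) := by
  have h1 : Continuous fun a : Euc d × Euc d =>
      localFourier (cj g) (Ψ : 𝓢'(Euc d, ℂ)) a.1 (-a.2) := continuous_localFourier_neg _ _
  exact h1.smul (continuous_shiftedWindow g)

/-- Seminorms of shifted windows grow polynomially, of some order m', in both variables. Taking the
coefficients of Ψ with decay of order m' + N leaves decay of order N. -/
lemma ssn_reproFamily_le (g Ψ : 𝓢(Euc d, ℂ)) (m N : ℕ) : ∃ C : ℝ, 0 ≤ C ∧ ∀ a,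
    ssn m (reproFamily g Ψ a) ≤ C * (krn N a.1 * krn N a.2) := by
  obtain ⟨m', C', hC', h'⟩ := ssn_shiftedWindow_le (d := d) m
  obtain ⟨M, C, hC, h⟩ := norm_localFourier_coe_le_krn (cj g) (m' + N)
  refine ⟨C * ssn M Ψ * (C' * ssn m' g), mul_nonneg (mul_nonneg hC (apply_nonneg _ _))
    (mul_nonneg hC' (apply_nonneg _ _)), fun a => ?_⟩
  rw [reproFamily, map_smul_eq_mul]
  have h0 := apply_nonneg (ssn (d := d) m') g
  have h1 := apply_nonneg (ssn (d := d) M) Ψ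
  calc ‖localFourier (cj g) (Ψ : 𝓢'(Euc d, ℂ)) a.1 (-a.2)‖ * ssn m (shiftedWindow g a.1 a.2)
      ≤ (C * ssn M Ψ * (krn (m' + N) a.1 * krn (m' + N) (-a.2))) *
        (C' * (1 + ‖a.1‖) ^ m' * (1 + ‖a.2‖) ^ m' * ssn m' g) := by
        have := krn_pos (m' + N) a.1
        have := krn_pos (m' + N) (-a.2)
        exact mul_le_mul (h _ _ _) (h' _ _ _) (apply_nonneg _ _) (by positivity)
    _ = _ := by
      rw [krn_neg]
      unfold krn
      rw [pow_add, pow_add]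
      field_simp

lemma integrable_ssn_reproFamily (g Ψ : 𝓢(Euc d, ℂ)) (m : ℕ) :
    Integrable (fun a => ssn m (reproFamily g Ψ a)) := by
  obtain ⟨C, hC, h⟩ := ssn_reproFamily_le g Ψ m (d + 1)
  refine ((integrable_krn_prod (Nat.lt_succ_self d)).const_mul C).mono'
    ((continuous_ssn m).comp (continuous_reproFamily g Ψ)).aestronglyMeasurable
    (Eventually.of_forall fun a => ?_)
  rw [Real.norm_of_nonneg (apply_nonneg _ _)]
  exact h a

lemma integral_reproFamily (g Ψ : 𝓢(Euc d, ℂ)) (z : Euc d) :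
    ((nsq g : ℂ) • Ψ) z = ∫ a, reproFamily g Ψ a z := by
  have hi : Integrable (fun a => reproFamily g Ψ a z) := by
    have := integrable_iteratedFDeriv_eval (continuous_reproFamily g Ψ)
      (integrable_ssn_reproFamily g Ψ) 0 z
    refine this.norm.mono' ?_ (Eventually.of_forall fun a => ?_)
    · have : Continuous fun a => TemperedDistribution.delta z (reproFamily g Ψ a) :=
        (TemperedDistribution.delta z).continuous.comp (continuous_reproFamily g Ψ)
      exact this.aestronglyMeasurable
    · simp
  rw [Measure.volume_eq_prod] at hi ⊢
  rw [integral_prod _ hi]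
  have : ∀ w, ∫ η, reproFamily g Ψ (w, η) z = ((‖g (z - w)‖ ^ 2 : ℝ) : ℂ) * Ψ z := fun w => by
    rw [← integral_window]
    rfl
  simp only [this]
  rw [integral_mul_const]
  refine congrArg (fun c => c * Ψ z) ?_
  rw [nsq, ← integral_complex_ofReal]
  -- Integrating |g(z - w)|² over w gives the constant `nsq g`, whatever z is.
  exact (integral_sub_left_eq_self (fun w => ((‖g w‖ ^ 2 : ℝ) : ℂ)) volume z).symm

/-- The reproducing formula for tempered distributions. -/
theorem reproducing (g Ψ : 𝓢(Euc d, ℂ)) (f : 𝓢'(Euc d, ℂ)) :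
    (nsq g : ℂ) * f Ψ = ∫ a : Euc d × Euc d,
      localFourier (cj g) (Ψ : 𝓢'(Euc d, ℂ)) a.1 (-a.2) * localFourier g f a.1 a.2 := by
  have := apply_eq_integral (continuous_reproFamily g Ψ) (integrable_ssn_reproFamily g Ψ)
    (integral_reproFamily g Ψ) f
  rw [map_smul, smul_eq_mul] at this
  rw [this]
  refine integral_congr_ae (Eventually.of_forall fun a => ?_)
  simp only [reproFamily, map_smul, smul_eq_mul]
  rfl

/-- The average of `H` in both variables against a rapidly decaying kernel. -/
def kav (N : ℕ) (H : Euc d → Euc d → ℝ≥0∞) (x y : Euc d) : ℝ≥0∞ :=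
  ∫⁻ a : Euc d × Euc d, ENNReal.ofReal (krn N a.1 * krn N a.2) * H (x + a.1) (y + a.2)

/-- A time-frequency shift of the function translates its short-time Fourier transform and
multiplies it by a unimodular factor, as the substitution z ↦ z + x shows. -/
lemma norm_localFourier_shiftedWindow (h G : 𝓢(Euc d, ℂ)) (x y w η : Euc d) :
    ‖localFourier h (shiftedWindow G x y : 𝓢'(Euc d, ℂ)) w η‖ =
      ‖localFourier h (G : 𝓢'(Euc d, ℂ)) (w - x) (η + y)‖ := by
  rw [localFourier_coe, localFourier_coe, ← integral_add_right_eq_self _ x]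
  have : ∀ z, chr η (z + x) * h (z + x - w) * shiftedWindow G x y (z + x) =
      chr (η + y) x * (chr (η + y) z * h (z - (w - x)) * G z) := fun z => by
    rw [shiftedWindow_apply, chr_add_right, chr_add_right, chr_add_left, chr_add_left,
      add_sub_cancel_right, show z + x - w = z - (w - x) by abel]
    ring
  simp only [this]
  rw [integral_const_mul, norm_mul, norm_chr, one_mul]

/-- Partial integrals of the reproducing formula are dominated by averages of the coefficients
with respect to a fixed window. -/
theorem enorm_setIntegral_le {g : 𝓢(Euc d, ℂ)} (hg : g ≠ 0) (N : ℕ) :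
    ∃ (m : ℕ) (C : ℝ), 0 ≤ C ∧ ∀ (f : 𝓢'(Euc d, ℂ)) (G : 𝓢(Euc d, ℂ)) (S : Set (Euc d × Euc d)),
    MeasurableSet S → ∀ x y : Euc d, ‖(nsq g : ℂ)⁻¹ * ∫ a in S,
      localFourier (cj g) (shiftedWindow G x y : 𝓢'(Euc d, ℂ)) a.1 (-a.2) *
        localFourier g f a.1 a.2‖ₑ ≤ ENNReal.ofReal (C * ssn m G) *
          kav N (fun x y => S.indicator (fun a => ‖localFourier g f a.1 a.2‖ₑ) (x, y)) x y := by
  obtain ⟨m, C, hC, h⟩ := norm_localFourier_coe_le_krn (cj g) N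
  have hn := nsq_pos hg
  refine ⟨m, C / nsq g, by positivity, fun f G S hS x y => ?_⟩
  have h0 := apply_nonneg (ssn (d := d) m) G
  rw [enorm_mul]
  calc ‖(nsq g : ℂ)⁻¹‖ₑ * ‖∫ a in S,
      localFourier (cj g) (shiftedWindow G x y : 𝓢'(Euc d, ℂ)) a.1 (-a.2) *
        localFourier g f a.1 a.2‖ₑ
      ≤ ENNReal.ofReal (nsq g)⁻¹ * ∫⁻ a in S,
        ENNReal.ofReal (C * ssn m G) * (ENNReal.ofReal (krn N (-(x, y) + a).1 * krn N (-(x, y) + a).2) *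
        ‖localFourier g f a.1 a.2‖ₑ) := by
        gcongr
        · rw [← ofReal_norm, norm_inv, Complex.norm_real, Real.norm_of_nonneg hn.le]
        · refine (enorm_integral_le_lintegral_enorm _).trans (lintegral_mono fun a => ?_)
          rw [enorm_mul, ← mul_assoc]
          gcongr
          rw [← ENNReal.ofReal_mul (by positivity), ← ofReal_norm,
            norm_localFourier_shiftedWindow]
          refine ENNReal.ofReal_le_ofReal ((h _ _ _).trans (le_of_eq ?_))
          rw [← krn_neg N (-a.2 + y)]
          simp [sub_eq_add_neg, add_comm]
    _ = ENNReal.ofReal (nsq g)⁻¹ * ∫⁻ a,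
        ENNReal.ofReal (C * ssn m G) * (ENNReal.ofReal (krn N (-(x, y) + a).1 * krn N (-(x, y) + a).2) *
        S.indicator (fun a => ‖localFourier g f a.1 a.2‖ₑ) a) := by
        rw [← lintegral_indicator hS]
        congr 2
        ext a
        by_cases ha : a ∈ S <;> simp [ha]
    _ = _ := by
        rw [lintegral_const_mul', ← mul_assoc, ← ENNReal.ofReal_mul (by positivity)]
        · congr 1
          · congr 1; ring
          · have : (volume : Measure (Euc d × Euc d)).IsAddLeftInvariant := by
              rw [Measure.volume_eq_prod]; infer_instance
            -- Recentring at (x, y) turns the kernel in a - (x, y) into the averaging kernel of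
            -- `kav`.
            rw [kav, ← lintegral_add_left_eq_self _ (x, y)]
            simp only [neg_add_cancel_left]
            rfl
        · exact ENNReal.ofReal_ne_top

/-- Every coefficient of a distribution is dominated by averages of its coefficients with respect
to a fixed window. -/
theorem enorm_apply_shiftedWindow_le {g : 𝓢(Euc d, ℂ)} (hg : g ≠ 0) (N : ℕ) :
    ∃ (m : ℕ) (C : ℝ), 0 ≤ C ∧ ∀ (f : 𝓢'(Euc d, ℂ)) (G : 𝓢(Euc d, ℂ)) (x y : Euc d),
    ‖f (shiftedWindow G x y)‖ₑ ≤
      ENNReal.ofReal (C * ssn m G) * kav N (fun x y => ‖localFourier g f x y‖ₑ) x y := by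
  obtain ⟨m, C, hC, h⟩ := enorm_setIntegral_le hg N
  refine ⟨m, C, hC, fun f G x y => ?_⟩
  have h1 := h f G Set.univ MeasurableSet.univ x y
  rw [setIntegral_univ, ← reproducing, inv_mul_cancel_left₀
    (by exact_mod_cast (nsq_pos hg).ne')] at h1
  simpa only [Set.indicator_univ] using h1

end

/-! ### Hölder and Minkowski inequalities for functions with values in [0, ∞] -/

section


section ENNRealLp

variable {α β : Type*} [MeasurableSpace α] [MeasurableSpace β] {μ : Measure α} {ν : Measure β}
  {p : ℝ≥0∞}

lemma eLpNorm_ennreal (hp0 : p ≠ 0) (hpt : p ≠ ∞) (f : α → ℝ≥0∞) :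
    eLpNorm f p μ = (∫⁻ x, f x ^ p.toReal ∂μ) ^ (1 / p.toReal) := by
  rw [eLpNorm_eq_lintegral_rpow_enorm_toReal hp0 hpt]
  simp only [enorm_eq_self]

lemma eLpNorm_ennreal_top (f : α → ℝ≥0∞) : eLpNorm f ∞ μ = essSup f μ := by
  rw [eLpNorm_exponent_top, eLpNormEssSup]
  simp only [enorm_eq_self]

lemma eLpNorm_mono_ennreal {f g : α → ℝ≥0∞} (h : ∀ x, f x ≤ g x) : eLpNorm f p μ ≤ eLpNorm g p μ :=
  eLpNorm_mono_enorm (by simpa only [enorm_eq_self] using h)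

lemma eLpNorm_const_mul_ennreal (hp : 1 ≤ p) (c : ℝ≥0∞) {f : α → ℝ≥0∞} (hf : AEMeasurable f μ) :
    eLpNorm (fun x => c * f x) p μ = c * eLpNorm f p μ := by
  have hp0 : p ≠ 0 := (zero_lt_one.trans_le hp).ne'
  by_cases hpt : p = ∞
  · subst hpt
    simp only [eLpNorm_ennreal_top]
    exact ENNReal.essSup_const_mul
  · have hp' : 0 < p.toReal := ENNReal.toReal_pos hp0 hpt
    rw [eLpNorm_ennreal hp0 hpt, eLpNorm_ennreal hp0 hpt]
    simp only [ENNReal.mul_rpow_of_nonneg _ _ hp'.le]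
    rw [lintegral_const_mul'' _ (hf.pow_const _), ENNReal.mul_rpow_of_nonneg _ _ (by positivity),
      ← ENNReal.rpow_mul, mul_one_div_cancel hp'.ne', ENNReal.rpow_one]

lemma eLpNorm_mul_le_top_left (hp : 1 ≤ p) {f g : α → ℝ≥0∞} (hg : AEMeasurable g μ) :
    eLpNorm (fun x => f x * g x) p μ ≤ eLpNorm f ∞ μ * eLpNorm g p μ := by
  rw [← eLpNorm_const_mul_ennreal hp _ hg, eLpNorm_ennreal_top]
  refine eLpNorm_mono_enorm_ae ?_
  filter_upwards [ENNReal.ae_le_essSup f] with x hx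
  simp only [enorm_eq_self]
  gcongr

/-- Hölder's inequality for functions with values in `[0, ∞]`. -/
lemma eLpNorm_mul_le_ennreal {r q : ℝ≥0∞} (hr : 1 ≤ r) [hpqr : ENNReal.HolderTriple p q r]
    {f g : α → ℝ≥0∞} (hf : AEMeasurable f μ) (hg : AEMeasurable g μ) :
    eLpNorm (fun x => f x * g x) r μ ≤ eLpNorm f p μ * eLpNorm g q μ := by
  have hinv := ENNReal.HolderTriple.inv_add_inv_eq_inv p q r
  by_cases hpt : p = ∞
  · subst hpt
    have : q = r := by simpa using hinv
    subst this
    exact eLpNorm_mul_le_top_left hr hg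
  by_cases hqt : q = ∞
  · subst hqt
    have : p = r := by simpa using hinv
    subst this
    simp only [mul_comm (f _)]
    rw [mul_comm]
    exact eLpNorm_mul_le_top_left hr hf
  have hr0 : r ≠ 0 := (zero_lt_one.trans_le hr).ne'
  have hp0 : p ≠ 0 := by
    rintro rfl
    rw [ENNReal.inv_zero, top_add] at hinv
    exact hr0 (ENNReal.inv_eq_top.1 hinv.symm)
  have hq0 : q ≠ 0 := by
    rintro rfl
    rw [ENNReal.inv_zero, add_top] at hinv
    exact hr0 (ENNReal.inv_eq_top.1 hinv.symm)
  have hrt : r ≠ ∞ := by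
    rintro rfl
    rw [ENNReal.inv_top, add_eq_zero] at hinv
    exact hpt (ENNReal.inv_eq_zero.1 hinv.1)
  rw [eLpNorm_ennreal hp0 hpt, eLpNorm_ennreal hq0 hqt, eLpNorm_ennreal hr0 hrt]
  have hp' := ENNReal.toReal_pos hp0 hpt
  have hq' := ENNReal.toReal_pos hq0 hqt
  have hr' := ENNReal.toReal_pos hr0 hrt
  have hinv' : p.toReal⁻¹ + q.toReal⁻¹ = r.toReal⁻¹ := by
    rw [← ENNReal.toReal_inv, ← ENNReal.toReal_inv, ← ENNReal.toReal_inv, ← hinv,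
      ENNReal.toReal_add (ENNReal.inv_ne_top.2 hp0) (ENNReal.inv_ne_top.2 hq0)]
  have hlt : r.toReal < p.toReal := by
    have : p.toReal⁻¹ < r.toReal⁻¹ := by rw [← hinv']; linarith [inv_pos.2 hq']
    exact (inv_lt_inv₀ hp' hr').1 this
  exact ENNReal.lintegral_Lp_mul_le_Lq_mul_Lr hr' hlt
    (by rw [one_div, one_div, one_div, ← hinv']) μ hf hg

lemma lintegral_mul_le_ennreal {q : ℝ≥0∞} [hpq : ENNReal.HolderConjugate p q]
    {f g : α → ℝ≥0∞} (hf : AEMeasurable f μ) (hg : AEMeasurable g μ) :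
    ∫⁻ x, f x * g x ∂μ ≤ eLpNorm f p μ * eLpNorm g q μ := by
  have := eLpNorm_mul_le_ennreal (μ := μ) (p := p) (q := q) (r := 1) le_rfl hf hg
  rwa [eLpNorm_one_eq_lintegral_enorm] at this

/-- Minkowski's integral inequality for functions with values in `[0, ∞]`. -/
theorem eLpNorm_lintegral_le [SigmaFinite μ] [SFinite ν] (hp : 1 ≤ p) {F : β → α → ℝ≥0∞}
    (hF : Measurable (Function.uncurry F)) (hF' : Measurable fun b => eLpNorm (F b) p μ) :
    eLpNorm (fun x => ∫⁻ b, F b x ∂ν) p μ ≤ ∫⁻ b, eLpNorm (F b) p μ ∂ν := by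
  have hp0 : p ≠ 0 := (zero_lt_one.trans_le hp).ne'
  by_cases hpt : p = ∞
  · subst hpt
    rw [eLpNorm_ennreal_top]
    refine essSup_le_of_ae_le _ ?_
    have h1 : ∀ᵐ b ∂ν, ∀ᵐ x ∂μ, F b x ≤ eLpNorm (F b) ∞ μ := by
      refine Eventually.of_forall fun b => ?_
      rw [eLpNorm_ennreal_top]
      exact ENNReal.ae_le_essSup _
    -- For p = ∞ the bound by the essential supremum holds for almost every x at each fixed b.
    -- Fubini for null sets exchanges the quantifiers.
    have h2 := (Measure.ae_ae_comm (p := fun b x => F b x ≤ eLpNorm (F b) ∞ μ)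
      (measurableSet_le hF (hF'.comp measurable_fst))).1 h1
    filter_upwards [h2] with x hx using lintegral_mono_ae hx
  set r := p.toReal with hr
  have hr0 : 0 < r := ENNReal.toReal_pos hp0 hpt
  have hr1 : 1 ≤ r := by
    rw [hr, ← ENNReal.toReal_one]; exact ENNReal.toReal_mono hpt hp
  set M := ∫⁻ b, eLpNorm (F b) p μ ∂ν with hM
  set I : α → ℝ≥0∞ := fun x => ∫⁻ b, F b x ∂ν with hI
  have hFs : Measurable (Function.uncurry fun x b => F b x) := hF.comp measurable_swap
  have hIm : Measurable I := hFs.lintegral_prod_right'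
  rw [eLpNorm_ennreal hp0 hpt, one_div, ENNReal.rpow_inv_le_iff hr0]
  by_cases hMt : M = ∞
  · rw [hMt, ENNReal.top_rpow_of_pos hr0]; exact le_top
  -- The truncation is bounded and lives on a set of finite measure, so ∫ J^r is finite and powers
  -- of it can be cancelled below. The full integral is recovered by monotone convergence.
  let J : ℕ → α → ℝ≥0∞ := fun n => (spanningSets μ n).indicator fun x => min (I x) n
  have hJm : ∀ n, Measurable (J n) := fun n =>
    (hIm.min measurable_const).indicator (measurableSet_spanningSets μ n)
  have hJI : ∀ n x, J n x ≤ I x := fun n x =>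
    (Set.indicator_le_self' (fun _ _ => zero_le) x).trans (min_le_left _ _)
  have hJmono : Monotone J := by
    intro n m hnm x
    refine (Set.indicator_le_indicator_of_subset (monotone_spanningSets μ hnm)
      (fun _ => zero_le) x).trans ?_
    refine Set.indicator_le_indicator ?_
    exact min_le_min le_rfl (by exact_mod_cast hnm)
  have hJsup : ∀ x, ⨆ n, J n x = I x := by
    intro x
    refine le_antisymm (iSup_le fun n => hJI n x) ?_
    refine le_of_forall_lt fun c hc => ?_
    obtain ⟨n, hn⟩ : ∃ n, x ∈ spanningSets μ n := ⟨_, mem_spanningSetsIndex μ x⟩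
    obtain ⟨m, hm⟩ := ENNReal.exists_nat_gt hc.ne_top
    have hx : x ∈ spanningSets μ (max n m) := monotone_spanningSets μ (le_max_left n m) hn
    have hcm : c < ((max n m : ℕ) : ℝ≥0∞) :=
      hm.trans_le (by exact_mod_cast le_max_right n m)
    refine lt_of_lt_of_le ?_ (le_iSup (fun k => J k x) (max n m))
    simp only [J, Set.indicator_of_mem hx]
    exact lt_min hc hcm
  have key : ∀ n, ∫⁻ x, J n x ^ r ∂μ ≤ M ^ r := by
    intro n
    set K := ∫⁻ x, J n x ^ r ∂μ with hK
    have hKt : K ≠ ∞ := by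
      have : ∀ x, J n x ^ r ≤ (spanningSets μ n).indicator (fun _ => (n : ℝ≥0∞) ^ r) x := by
        intro x
        by_cases hx : x ∈ spanningSets μ n
        · simp only [J, Set.indicator_of_mem hx]
          exact ENNReal.rpow_le_rpow (min_le_right _ _) hr0.le
        · simp [J, Set.indicator_of_notMem hx, hr0]
      refine ((lintegral_mono this).trans_lt ?_).ne
      rw [lintegral_indicator (measurableSet_spanningSets μ n), setLIntegral_const]
      exact ENNReal.mul_lt_top (ENNReal.rpow_lt_top_of_nonneg hr0.le (ENNReal.natCast_ne_top n))
        (measure_spanningSets_lt_top μ n)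
    -- The duality argument: J^r ≤ I · J^{r-1}, the order of integration is exchanged, and Hölder is
    -- applied in x for each fixed b. The case r = 1 is Tonelli, since the conjugate exponent is
    -- then infinite.
    have h1 : K ≤ M * K ^ (1 - 1 / r) := by
      rcases hr1.eq_or_lt with hr1 | hr1
      · rw [← hr1]
        simp only [ne_eq, one_ne_zero, not_false_eq_true, div_self, sub_self, ENNReal.rpow_zero,
          mul_one]
        rw [hK, ← hr1, hM]
        simp only [ENNReal.rpow_one, eLpNorm_ennreal hp0 hpt, ← hr, ← hr1, div_one]
        rw [lintegral_lintegral_swap hF.aemeasurable]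
        exact lintegral_mono fun x => hJI n x
      have hconj : r.HolderConjugate (r / (r - 1)) := Real.HolderConjugate.conjExponent hr1
      calc K = ∫⁻ x, J n x * J n x ^ (r - 1) ∂μ := by
            refine lintegral_congr fun x => ?_
            rcases eq_or_ne (J n x) 0 with h | h
            · rw [h, ENNReal.zero_rpow_of_pos hr0, zero_mul]
            · have ht : J n x ≠ ∞ := by
                by_cases hx : x ∈ spanningSets μ n
                · simp only [J, Set.indicator_of_mem hx]
                  exact ((min_le_right _ _).trans_lt (ENNReal.natCast_lt_top n)).ne
                · simp [J, Set.indicator_of_notMem hx]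
              nth_rw 2 [← ENNReal.rpow_one (J n x)]
              rw [← ENNReal.rpow_add _ _ h ht]
              congr 1; ring
        _ ≤ ∫⁻ x, I x * J n x ^ (r - 1) ∂μ := by
            gcongr with x; exact hJI n x
        _ = ∫⁻ x, ∫⁻ b, F b x * J n x ^ (r - 1) ∂ν ∂μ := by
            refine lintegral_congr fun x => ?_
            rw [lintegral_mul_const _ (hFs.of_uncurry_left)]
        _ = ∫⁻ b, ∫⁻ x, F b x * J n x ^ (r - 1) ∂μ ∂ν := by
            refine lintegral_lintegral_swap ?_
            exact (hFs.mul (((hJm n).pow_const _).comp measurable_fst)).aemeasurable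
        _ ≤ ∫⁻ b, eLpNorm (F b) p μ * K ^ (1 - 1 / r) ∂ν := by
            refine lintegral_mono fun b => ?_
            refine (ENNReal.lintegral_mul_le_Lp_mul_Lq μ hconj hF.of_uncurry_left.aemeasurable
              ((hJm n).pow_const _).aemeasurable).trans (le_of_eq ?_)
            rw [eLpNorm_ennreal hp0 hpt]
            congr 1
            have hrr : r - 1 ≠ 0 := by linarith
            simp only [← ENNReal.rpow_mul, hK]
            have e1 : (r - 1) * (r / (r - 1)) = r := by field_simp
            have e2 : 1 / (r / (r - 1)) = 1 - 1 / r := by field_simp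
            rw [e1, e2]
        _ = _ := by rw [lintegral_mul_const _ hF']
    rcases eq_or_ne K 0 with h0 | h0
    · rw [h0]; exact zero_le
    have h2 : K ^ (1 / r) ≤ M := by
      have hne : K ^ (1 - 1 / r) ≠ 0 := by simp [ENNReal.rpow_eq_zero_iff, h0, hKt]
      have hnt : K ^ (1 - 1 / r) ≠ ∞ := ENNReal.rpow_ne_top_of_nonneg
        (by rw [sub_nonneg, div_le_one hr0]; exact hr1) hKt
      have h3 : K ^ (1 / r) * K ^ (1 - 1 / r) ≤ M * K ^ (1 - 1 / r) := by
        rw [← ENNReal.rpow_add _ _ h0 hKt]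
        simpa using h1
      exact (ENNReal.mul_le_mul_iff_left hne hnt).1 h3
    rw [one_div, ENNReal.rpow_inv_le_iff hr0] at h2
    exact h2
  have hlim : ∫⁻ x, I x ^ r ∂μ = ⨆ n, ∫⁻ x, J n x ^ r ∂μ := by
    rw [← lintegral_iSup (fun n => (hJm n).pow_const _)
      (fun n m hnm x => ENNReal.rpow_le_rpow (hJmono hnm x) hr0.le)]
    refine lintegral_congr fun x => ?_
    rw [← hJsup x]
    exact ((ENNReal.orderIsoRpow r hr0).map_iSup _)
  rw [hlim]
  exact iSup_le key

end ENNRealLp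

end

/-! ### Weights, mixed norms and averaging operators -/

section


variable {d : ℕ}

lemma one_le_bracket (x : Euc d) : 1 ≤ bracket x := by
  rw [bracket, Real.one_le_sqrt]; nlinarith [norm_nonneg x]

lemma bracket_pos (x : Euc d) : 0 < bracket x := zero_lt_one.trans_le (one_le_bracket x)

lemma bracket_le (x : Euc d) : bracket x ≤ 1 + ‖x‖ := by
  rw [bracket, Real.sqrt_le_left (by positivity)]; nlinarith [norm_nonneg x]

lemma one_add_norm_le (x : Euc d) : 1 + ‖x‖ ≤ 2 * bracket x := by
  have h1 := one_le_bracket x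
  have h2 : ‖x‖ ≤ bracket x := by
    rw [bracket]; exact Real.le_sqrt_of_sq_le (by linarith)
  linarith

lemma continuous_bracket : Continuous (bracket (d := d)) := by
  unfold bracket; fun_prop

lemma continuous_bracket_rpow (σ : ℝ) : Continuous fun x : Euc d => bracket x ^ σ :=
  continuous_bracket.rpow_const fun x => Or.inl (bracket_pos x).ne'

/-- The weight `⟨x⟩^σ` with values in `[0, ∞]`. -/
def wt (σ : ℝ) (x : Euc d) : ℝ≥0∞ := ENNReal.ofReal (bracket x ^ σ)

lemma measurable_wt (σ : ℝ) : Measurable (wt (d := d) σ) :=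
  (continuous_bracket_rpow σ).measurable.ennreal_ofReal

lemma wt_ne_zero (σ : ℝ) (x : Euc d) : wt σ x ≠ 0 := by
  have := Real.rpow_pos_of_pos (bracket_pos x) σ
  simpa [wt] using this

lemma wt_ne_top (σ : ℝ) (x : Euc d) : wt σ x ≠ ∞ := ENNReal.ofReal_ne_top

lemma wt_add (σ τ : ℝ) (x : Euc d) : wt (σ + τ) x = wt σ x * wt τ x := by
  rw [wt, wt, wt, Real.rpow_add (bracket_pos x), ENNReal.ofReal_mul]
  exact (Real.rpow_pos_of_pos (bracket_pos x) σ).le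

lemma wt_zero (x : Euc d) : wt 0 x = 1 := by simp [wt]

lemma wt_neg_mul (σ : ℝ) (x : Euc d) : wt (-σ) x * wt σ x = 1 := by
  rw [← wt_add, neg_add_cancel, wt_zero]

lemma wt_mono {σ τ : ℝ} (h : σ ≤ τ) (x : Euc d) : wt σ x ≤ wt τ x :=
  ENNReal.ofReal_le_ofReal (Real.rpow_le_rpow_of_exponent_le (one_le_bracket x) h)

lemma wt_neg_arg (σ : ℝ) (x : Euc d) : wt σ (-x) = wt σ x := by simp [wt, bracket]

lemma wt_le_ofReal (σ : ℝ) (x : Euc d) : wt σ x ≤ ENNReal.ofReal ((2 * (1 + ‖x‖)) ^ |σ|) := by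
  refine ENNReal.ofReal_le_ofReal ?_
  calc bracket x ^ σ ≤ bracket x ^ |σ| :=
        Real.rpow_le_rpow_of_exponent_le (one_le_bracket x) (le_abs_self σ)
    _ ≤ _ := Real.rpow_le_rpow (bracket_pos x).le
        ((bracket_le x).trans (by linarith [norm_nonneg x])) (abs_nonneg σ)

/-- Peetre's inequality. -/
lemma bracket_le_mul (y η : Euc d) : bracket y ≤ 2 * (1 + ‖η‖) * bracket (y + η) := by
  have h1 := bracket_le y
  have h2 := one_add_norm_le (y + η)
  have h3 : 1 + ‖y‖ ≤ (1 + ‖η‖) * (1 + ‖y + η‖) := by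
    have := one_add_norm_le_mul y (-η)
    rwa [norm_neg, sub_neg_eq_add] at this
  calc bracket y ≤ (1 + ‖η‖) * (1 + ‖y + η‖) := h1.trans h3
    _ ≤ (1 + ‖η‖) * (2 * bracket (y + η)) := by gcongr
    _ = _ := by ring

/-- Peetre's inequality for real powers. For negative σ the inequality for the bracket is applied
with y and y + η interchanged. -/
lemma wt_le_mul (σ : ℝ) (y η : Euc d) :
    wt σ y ≤ ENNReal.ofReal ((2 * (1 + ‖η‖)) ^ |σ|) * wt σ (y + η) := by
  have hb := bracket_pos y
  have hb' := bracket_pos (y + η)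
  rw [wt, wt, ← ENNReal.ofReal_mul (by positivity)]
  refine ENNReal.ofReal_le_ofReal ?_
  rcases le_total 0 σ with h | h
  · rw [abs_of_nonneg h, ← Real.mul_rpow (by positivity) hb'.le]
    exact Real.rpow_le_rpow hb.le (bracket_le_mul y η) h
  · have h1 := bracket_le_mul (y + η) (-η)
    rw [norm_neg, add_neg_cancel_right] at h1
    have h2 : bracket (y + η) ^ (-σ) ≤ (2 * (1 + ‖η‖) * bracket y) ^ (-σ) :=
      Real.rpow_le_rpow hb'.le h1 (by linarith)
    rw [Real.mul_rpow (by positivity) hb.le, Real.rpow_neg hb'.le, Real.rpow_neg hb.le] at h2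
    rw [abs_of_nonpos h]
    have h3 := Real.rpow_pos_of_pos hb σ
    have h4 := Real.rpow_pos_of_pos hb' σ
    rw [inv_le_iff_one_le_mul₀ h4] at h2
    calc bracket y ^ σ = 1 * bracket y ^ σ := (one_mul _).symm
      _ ≤ ((2 * (1 + ‖η‖)) ^ (-σ) * (bracket y ^ σ)⁻¹ * bracket (y + η) ^ σ) * bracket y ^ σ := by
        gcongr
      _ = _ := by field_simp

/-- The weighted norm `‖⟨y⟩^σ h(y)‖_{L^q}`. -/
def innerNorm (q : ℝ≥0∞) (σ : ℝ) (h : Euc d → ℝ≥0∞) : ℝ≥0∞ :=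
  eLpNorm (fun y => wt σ y * h y) q volume

/-- The mixed weighted norm `‖⟨x⟩^γ ‖⟨y⟩^σ H(x, y)‖_{L^q(dy)}‖_{L^p(dx)}`. -/
def mixNorm (q : ℝ≥0∞) (σ : ℝ) (p : ℝ≥0∞) (γ : ℝ) (H : Euc d → Euc d → ℝ≥0∞) : ℝ≥0∞ :=
  innerNorm p γ fun x => innerNorm q σ (H x)

lemma innerNorm_mono {q : ℝ≥0∞} {σ : ℝ} {h h' : Euc d → ℝ≥0∞} (hh : ∀ y, h y ≤ h' y) :
    innerNorm q σ h ≤ innerNorm q σ h' :=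
  eLpNorm_mono_ennreal fun y => by gcongr; exact hh y

lemma mixNorm_mono {q p : ℝ≥0∞} {σ γ : ℝ} {H H' : Euc d → Euc d → ℝ≥0∞}
    (hH : ∀ x y, H x y ≤ H' x y) : mixNorm q σ p γ H ≤ mixNorm q σ p γ H' :=
  innerNorm_mono fun x => innerNorm_mono (hH x)

lemma innerNorm_const_mul {q : ℝ≥0∞} (hq : 1 ≤ q) {σ : ℝ} (c : ℝ≥0∞) {h : Euc d → ℝ≥0∞}
    (hh : Measurable h) : innerNorm q σ (fun y => c * h y) = c * innerNorm q σ h := by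
  have h1 : AEMeasurable (fun y => wt σ y * h y) (volume : Measure (Euc d)) :=
    ((measurable_wt σ).mul hh).aemeasurable
  rw [innerNorm, innerNorm, ← eLpNorm_const_mul_ennreal hq c h1]
  congr 1
  ext y; ring

lemma mixNorm_const_mul {q p : ℝ≥0∞} (hq : 1 ≤ q) (hp : 1 ≤ p) {σ γ : ℝ} (c : ℝ≥0∞)
    {H : Euc d → Euc d → ℝ≥0∞} (hH : Measurable (Function.uncurry H))
    (hA : Measurable fun x => innerNorm q σ (H x)) :
    mixNorm q σ p γ (fun x y => c * H x y) = c * mixNorm q σ p γ H := by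
  rw [mixNorm, mixNorm, ← innerNorm_const_mul hp c hA]
  congr 1
  ext x
  exact innerNorm_const_mul hq c hH.of_uncurry_left

lemma innerNorm_shift {q : ℝ≥0∞} {σ : ℝ} {h : Euc d → ℝ≥0∞} (hh : Measurable h) (η : Euc d) :
    eLpNorm (fun y => wt σ (y + η) * h (y + η)) q volume = innerNorm q σ h := by
  have h1 : Measurable (fun y => wt σ y * h y) := (measurable_wt σ).mul hh
  have h2 := eLpNorm_comp_measurePreserving (p := q) h1.aestronglyMeasurable
    (measurePreserving_add_right volume η)
  exact h2

/-- The total mass of the averaging kernel against the Peetre weight. -/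
def krnMass (d N : ℕ) (σ : ℝ) : ℝ≥0∞ :=
  ∫⁻ η : Euc d, ENNReal.ofReal (krn N η * (2 * (1 + ‖η‖)) ^ |σ|)

lemma krnMass_lt_top {N : ℕ} {σ : ℝ} (hN : d + |σ| < N) : krnMass d N σ < ∞ := by
  have h := (integrable_one_add_norm (E := Euc d) (μ := volume) (r := N - |σ|)
    (by rw [finrank_euclideanSpace_fin]; linarith)).const_mul (2 ^ |σ|)
  refine lt_of_le_of_lt (lintegral_mono fun η => ?_) h.lintegral_lt_top
  refine ENNReal.ofReal_le_ofReal (le_of_eq ?_)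
  have h0 : 0 < 1 + ‖η‖ := by positivity
  rw [krn, Real.mul_rpow (by norm_num) h0.le, neg_sub, Real.rpow_sub h0, Real.rpow_natCast]
  field_simp

lemma measurable_krn (N : ℕ) : Measurable (krn (d := d) N) := (continuous_krn N).measurable

lemma measurable_peetre (σ : ℝ) : Measurable fun η : Euc d => (2 * (1 + ‖η‖)) ^ |σ| := by
  fun_prop

/-- Minkowski's inequality moves the norm inside the average. A shift by η in frequency costs the
Peetre factor, which the kernel absorbs into `krnMass`, and only the average in position remains. -/
lemma innerNorm_kav_le {q : ℝ≥0∞} (hq : 1 ≤ q) (σ : ℝ) (N : ℕ) {H : Euc d → Euc d → ℝ≥0∞}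
    (hH : Measurable (Function.uncurry H)) (hA : Measurable fun x => innerNorm q σ (H x))
    (x : Euc d) : innerNorm q σ (kav N H x) ≤
      krnMass d N σ * ∫⁻ w, ENNReal.ofReal (krn N w) * innerNorm q σ (H (x + w)) := by
  let c : Euc d × Euc d → ℝ≥0∞ := fun a =>
    ENNReal.ofReal (krn N a.1) * ENNReal.ofReal (krn N a.2 * (2 * (1 + ‖a.2‖)) ^ |σ|)
  have hc : Measurable c :=
    ((measurable_krn N).comp measurable_fst).ennreal_ofReal.mul
      (((measurable_krn N).comp measurable_snd).mul
        ((measurable_peetre σ).comp measurable_snd)).ennreal_ofReal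
  let F : Euc d × Euc d → Euc d → ℝ≥0∞ := fun a y =>
    c a * (wt σ (y + a.2) * H (x + a.1) (y + a.2))
  have hHx : ∀ a, Measurable (H a) := fun a => hH.of_uncurry_left
  have hF : Measurable (Function.uncurry F) := by
    have h1 : Measurable fun b : (Euc d × Euc d) × Euc d => (x + b.1.1, b.2 + b.1.2) := by fun_prop
    have h2 : Measurable fun b : (Euc d × Euc d) × Euc d => b.2 + b.1.2 := by fun_prop
    exact (hc.comp measurable_fst).mul (((measurable_wt σ).comp h2).mul (hH.comp h1))
  have hFn : ∀ a, eLpNorm (F a) q volume = c a * innerNorm q σ (H (x + a.1)) := fun a => by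
    rw [← innerNorm_shift (hHx _) a.2]
    refine eLpNorm_const_mul_ennreal hq _ ?_
    have h2 : Measurable fun y : Euc d => y + a.2 := by fun_prop
    exact (((measurable_wt σ).comp h2).mul ((hHx _).comp h2)).aemeasurable
  have hFm : Measurable fun a => eLpNorm (F a) q volume := by
    simp only [hFn]
    have h1 : Measurable fun a : Euc d × Euc d => x + a.1 := by fun_prop
    exact hc.mul (hA.comp h1)
  calc innerNorm q σ (kav N H x)
      ≤ eLpNorm (fun y => ∫⁻ a, F a y) q volume := by
        refine eLpNorm_mono_ennreal fun y => ?_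
        rw [kav, ← lintegral_const_mul' _ _ (wt_ne_top σ y)]
        refine lintegral_mono fun a => ?_
        have h1 := wt_le_mul σ y a.2
        calc wt σ y * (ENNReal.ofReal (krn N a.1 * krn N a.2) * H (x + a.1) (y + a.2))
            ≤ (ENNReal.ofReal ((2 * (1 + ‖a.2‖)) ^ |σ|) * wt σ (y + a.2)) *
              (ENNReal.ofReal (krn N a.1 * krn N a.2) * H (x + a.1) (y + a.2)) := by gcongr
          _ = F a y := by
            simp only [F, c]
            rw [ENNReal.ofReal_mul (krn_pos N a.1).le, ENNReal.ofReal_mul (krn_pos N a.2).le]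
            ring
    _ ≤ ∫⁻ a, eLpNorm (F a) q volume := eLpNorm_lintegral_le hq hF hFm
    _ = ∫⁻ a : Euc d × Euc d, (ENNReal.ofReal (krn N a.1) * innerNorm q σ (H (x + a.1))) *
          ENNReal.ofReal (krn N a.2 * (2 * (1 + ‖a.2‖)) ^ |σ|) := by
        refine lintegral_congr fun a => ?_
        rw [hFn]; simp only [c]; ring
    _ = _ := by
        rw [Measure.volume_eq_prod, lintegral_prod_mul
          (f := fun w => ENNReal.ofReal (krn N w) * innerNorm q σ (H (x + w)))
          (g := fun η => ENNReal.ofReal (krn N η * (2 * (1 + ‖η‖)) ^ |σ|)), mul_comm]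
        · rfl
        · have h1 : Measurable fun w : Euc d => x + w := by fun_prop
          exact ((measurable_krn N).ennreal_ofReal.mul (hA.comp h1)).aemeasurable
        · exact ((measurable_krn N).mul (measurable_peetre σ)).ennreal_ofReal.aemeasurable

lemma innerNorm_lintegral_krn_le {p : ℝ≥0∞} (hp : 1 ≤ p) (γ : ℝ) (N : ℕ) {A : Euc d → ℝ≥0∞}
    (hA : Measurable A) : innerNorm p γ (fun x => ∫⁻ w, ENNReal.ofReal (krn N w) * A (x + w)) ≤
      krnMass d N γ * innerNorm p γ A := by
  let c : Euc d → ℝ≥0∞ := fun w => ENNReal.ofReal (krn N w * (2 * (1 + ‖w‖)) ^ |γ|)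
  have hc : Measurable c := ((measurable_krn N).mul (measurable_peetre γ)).ennreal_ofReal
  let F : Euc d → Euc d → ℝ≥0∞ := fun w x => c w * (wt γ (x + w) * A (x + w))
  have hF : Measurable (Function.uncurry F) := by
    have h2 : Measurable fun b : Euc d × Euc d => b.2 + b.1 := by fun_prop
    exact (hc.comp measurable_fst).mul (((measurable_wt γ).comp h2).mul (hA.comp h2))
  have hFn : ∀ w, eLpNorm (F w) p volume = c w * innerNorm p γ A := fun w => by
    rw [← innerNorm_shift hA w]
    refine eLpNorm_const_mul_ennreal hp _ ?_
    have h2 : Measurable fun y : Euc d => y + w := by fun_prop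
    exact (((measurable_wt γ).comp h2).mul (hA.comp h2)).aemeasurable
  calc innerNorm p γ (fun x => ∫⁻ w, ENNReal.ofReal (krn N w) * A (x + w))
      ≤ eLpNorm (fun x => ∫⁻ w, F w x) p volume := by
        refine eLpNorm_mono_ennreal fun x => ?_
        rw [← lintegral_const_mul' _ _ (wt_ne_top γ x)]
        refine lintegral_mono fun w => ?_
        have h1 := wt_le_mul γ x w
        calc wt γ x * (ENNReal.ofReal (krn N w) * A (x + w))
            ≤ (ENNReal.ofReal ((2 * (1 + ‖w‖)) ^ |γ|) * wt γ (x + w)) *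
              (ENNReal.ofReal (krn N w) * A (x + w)) := by gcongr
          _ = F w x := by
            simp only [F, c]
            rw [ENNReal.ofReal_mul (krn_pos N w).le]
            ring
    _ ≤ ∫⁻ w, eLpNorm (F w) p volume := eLpNorm_lintegral_le hp hF (by
        simp only [hFn]; exact hc.mul_const _)
    _ = _ := by
        simp only [hFn]
        rw [lintegral_mul_const _ hc]
        rfl

lemma measurable_lintegral_krn (N : ℕ) {A : Euc d → ℝ≥0∞} (hA : Measurable A) :
    Measurable fun x => ∫⁻ w, ENNReal.ofReal (krn N w) * A (x + w) := by
  have h2 : Measurable fun b : Euc d × Euc d => b.1 + b.2 := by fun_prop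
  have h4 : Measurable fun b : Euc d × Euc d => ENNReal.ofReal (krn N b.2) :=
    ((measurable_krn N).comp measurable_snd).ennreal_ofReal
  have h5 : Measurable fun b : Euc d × Euc d => ENNReal.ofReal (krn N b.2) * A (b.1 + b.2) :=
    h4.mul (hA.comp h2)
  exact h5.lintegral_prod_right'

/-- The frequency average is removed first and the position average next, each at the cost of one
kernel mass. The masses are finite once N exceeds d + |σ| and d + |γ|. -/
lemma mixNorm_kav_le {q p : ℝ≥0∞} (hq : 1 ≤ q) (hp : 1 ≤ p) (σ γ : ℝ) (N : ℕ)
    {H : Euc d → Euc d → ℝ≥0∞} (hH : Measurable (Function.uncurry H))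
    (hA : Measurable fun x => innerNorm q σ (H x)) :
    mixNorm q σ p γ (kav N H) ≤ krnMass d N σ * krnMass d N γ * mixNorm q σ p γ H := by
  have hm := measurable_lintegral_krn N hA
  calc mixNorm q σ p γ (kav N H)
      ≤ innerNorm p γ fun x => krnMass d N σ *
          ∫⁻ w, ENNReal.ofReal (krn N w) * innerNorm q σ (H (x + w)) :=
        innerNorm_mono (innerNorm_kav_le hq σ N hH hA)
    _ = krnMass d N σ * innerNorm p γ fun x =>
          ∫⁻ w, ENNReal.ofReal (krn N w) * innerNorm q σ (H (x + w)) :=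
        innerNorm_const_mul hp _ hm
    _ ≤ krnMass d N σ * (krnMass d N γ * innerNorm p γ fun x => innerNorm q σ (H x)) := by
        have h := innerNorm_lintegral_krn_le hp γ N hA
        exact mul_le_mul_right h _
    _ = krnMass d N σ * krnMass d N γ * innerNorm p γ fun x => innerNorm q σ (H x) :=
        (mul_assoc _ _ _).symm

/-- The dual norm of the averaging kernel. -/
def krnDual (d N : ℕ) (σ : ℝ) (q : ℝ≥0∞) : ℝ≥0∞ :=
  eLpNorm (fun w : Euc d => ENNReal.ofReal (krn N w) * wt (-σ) w) q volume

lemma lintegral_krn_mul_le {q q' : ℝ≥0∞} [ENNReal.HolderConjugate q' q] (σ : ℝ) (N : ℕ)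
    {h : Euc d → ℝ≥0∞} (hh : Measurable h) :
    ∫⁻ w, ENNReal.ofReal (krn N w) * h w ≤ krnDual d N σ q' * innerNorm q σ h := by
  refine le_trans (le_of_eq ?_) (lintegral_mul_le_ennreal (p := q') (q := q)
    ((measurable_krn N).ennreal_ofReal.mul (measurable_wt (-σ))).aemeasurable
    ((measurable_wt σ).mul hh).aemeasurable)
  refine lintegral_congr fun w => ?_
  rw [mul_assoc, ← mul_assoc (wt (-σ) w), wt_neg_mul, one_mul]

lemma krnDual_lt_top (σ : ℝ) (q : ℝ≥0∞) : ∃ N₀ : ℕ, ∀ N, N₀ ≤ N → krnDual d N σ q < ∞ := by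
  obtain ⟨k, hk⟩ := Measure.HasTemperateGrowth.exists_eLpNorm_lt_top q
    (μ := (volume : Measure (Euc d))) inferInstance
  refine ⟨k + ⌈|σ|⌉₊, fun N hN => ?_⟩
  have hb : ∀ w : Euc d, ‖ENNReal.ofReal (krn N w) * wt (-σ) w‖ₑ ≤
      ‖((2 ^ |σ| : ℝ) • (fun w : Euc d => (1 + ‖w‖) ^ (-k : ℝ))) w‖ₑ := fun w => by
    have h0 : 1 ≤ 1 + ‖w‖ := by linarith [norm_nonneg w]
    rw [enorm_eq_self, Pi.smul_apply, smul_eq_mul, Real.enorm_eq_ofReal (by positivity)]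
    calc ENNReal.ofReal (krn N w) * wt (-σ) w
        ≤ ENNReal.ofReal (krn N w) * ENNReal.ofReal ((2 * (1 + ‖w‖)) ^ |-σ|) := by
          gcongr; exact wt_le_ofReal _ _
      _ = ENNReal.ofReal (krn N w * (2 * (1 + ‖w‖)) ^ |σ|) := by
          rw [abs_neg, ENNReal.ofReal_mul (krn_pos N w).le]
      _ ≤ _ := by
          refine ENNReal.ofReal_le_ofReal ?_
          rw [Real.mul_rpow (by norm_num) (by positivity), mul_left_comm]
          gcongr
          rw [krn, ← Real.rpow_natCast, ← Real.rpow_neg (by positivity),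
            ← Real.rpow_add (by positivity)]
          refine Real.rpow_le_rpow_of_exponent_le h0 ?_
          have h1 : |σ| ≤ ⌈|σ|⌉₊ := Nat.le_ceil _
          have h2 : ((k + ⌈|σ|⌉₊ : ℕ) : ℝ) ≤ N := by exact_mod_cast hN
          push_cast at h2
          linarith
  refine (eLpNorm_mono_enorm hb).trans_lt (eLpNorm_const_smul_le.trans_lt ?_)
  exact ENNReal.mul_lt_top enorm_lt_top hk

/-- Hölder in frequency and then in position, with each weight and its inverse inserted. A single
average is thereby controlled by the mixed norm, which later makes evaluation on Schwartz functions
continuous. -/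
lemma kav_le {q q' p p' : ℝ≥0∞} [ENNReal.HolderConjugate q' q] [ENNReal.HolderConjugate p' p]
    (σ γ : ℝ) (N : ℕ) {H : Euc d → Euc d → ℝ≥0∞} (hH : Measurable (Function.uncurry H))
    (hA : Measurable fun x => innerNorm q σ (H x)) :
    kav N H 0 0 ≤ krnDual d N σ q' * krnDual d N γ p' * mixNorm q σ p γ H := by
  have hHx : ∀ a, Measurable (H a) := fun a => hH.of_uncurry_left
  calc kav N H 0 0 = ∫⁻ w, ENNReal.ofReal (krn N w) * ∫⁻ η, ENNReal.ofReal (krn N η) * H w η := by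
        rw [kav, Measure.volume_eq_prod, lintegral_prod]
        · refine lintegral_congr fun w => ?_
          rw [← lintegral_const_mul' _ _ ENNReal.ofReal_ne_top]
          refine lintegral_congr fun η => ?_
          rw [ENNReal.ofReal_mul (krn_pos N w).le, mul_assoc]
          simp
        · simp only [zero_add]
          exact (((measurable_krn N).comp measurable_fst).mul
            ((measurable_krn N).comp measurable_snd)).ennreal_ofReal.aemeasurable.mul hH.aemeasurable
    _ ≤ ∫⁻ w, ENNReal.ofReal (krn N w) * (krnDual d N σ q' * innerNorm q σ (H w)) := by
        gcongr with w
        exact lintegral_krn_mul_le σ N (hHx w)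
    _ ≤ krnDual d N γ p' * innerNorm p γ (fun w => krnDual d N σ q' * innerNorm q σ (H w)) :=
        lintegral_krn_mul_le γ N (hA.const_mul _)
    _ = _ := by
        rw [innerNorm_const_mul (ENNReal.HolderTriple.le (p := p) (q := p') (r := 1)) _ hA]
        rw [mixNorm]; ring

end

/-! ### The amalgam norm: window independence, pairing, local bounds -/

section


variable {d : ℕ} {p q : ℝ≥0∞} {σ γ : ℝ}

lemma exists_holderConjugate (hq : 1 ≤ q) : ∃ q' : ℝ≥0∞, ENNReal.HolderConjugate q' q := by
  refine ⟨(1 - q⁻¹)⁻¹, ENNReal.holderConjugate_iff.2 ?_⟩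
  rw [inv_inv]
  exact tsub_add_cancel_of_le (ENNReal.inv_le_one.2 hq)

lemma eLpNorm_liminf_le {α : Type*} [MeasurableSpace α] {μ : Measure α} (hp : 1 ≤ p)
    {h : ℕ → α → ℝ≥0∞} (hh : ∀ n, Measurable (h n)) :
    eLpNorm (fun x => liminf (fun n => h n x) atTop) p μ ≤
      liminf (fun n => eLpNorm (h n) p μ) atTop := by
  have hp0 : p ≠ 0 := (zero_lt_one.trans_le hp).ne'
  by_cases hpt : p = ∞
  · subst hpt
    simp only [eLpNorm_ennreal_top]
    refine essSup_le_of_ae_le _ ?_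
    filter_upwards [ae_all_iff.2 fun n => ENNReal.ae_le_essSup (μ := μ) (h n)] with x hx
    exact liminf_le_liminf (Eventually.of_forall hx)
  · have hp' : 0 < p.toReal := ENNReal.toReal_pos hp0 hpt
    have hmono : ∀ {r : ℝ}, 0 < r → ∀ u : ℕ → ℝ≥0∞,
        (liminf u atTop) ^ r = liminf (fun n => u n ^ r) atTop := fun {r} hr u => by
      have := (ENNReal.orderIsoRpow r hr).liminf_apply (u := u) (f := atTop)
      simpa using this
    simp only [eLpNorm_ennreal hp0 hpt]
    rw [← hmono (by positivity)]
    refine ENNReal.rpow_le_rpow ?_ (by positivity)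
    simp only [hmono hp']
    exact lintegral_liminf_le fun n => (hh n).pow_const _

lemma measurable_innerNorm {H : Euc d → Euc d → ℝ≥0∞} (hH : Measurable (Function.uncurry H)) :
    Measurable fun x => innerNorm q σ (H x) := by
  have hw : Measurable fun a : Euc d × Euc d => wt σ a.2 * Function.uncurry H a :=
    ((measurable_wt σ).comp measurable_snd).mul hH
  by_cases hq0 : q = 0
  · simp [innerNorm, hq0]
  by_cases hqt : q = ∞
  · subst hqt
    refine measurable_of_Iic fun c => ?_
    -- An essential supremum is at most c exactly when the slice of the exceptional set is null, and
    -- measures of slices are measurable in x.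
    have h1 : ((fun x => innerNorm ∞ σ (H x)) ⁻¹' Set.Iic c) =
        (fun x => volume (Prod.mk x ⁻¹' {a : Euc d × Euc d | ¬ wt σ a.2 * Function.uncurry H a ≤ c}))
          ⁻¹' {0} := by
      ext x
      simp only [innerNorm, eLpNorm_ennreal_top, Set.mem_preimage, Set.mem_Iic,
        Set.mem_singleton_iff]
      constructor
      · intro h
        exact ae_iff.1 ((ENNReal.ae_le_essSup fun y => wt σ y * H x y).mono fun y hy => hy.trans h)
      · intro h
        exact essSup_le_of_ae_le c (ae_iff.2 h)
    rw [h1]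
    exact measurable_measure_prodMk_left (measurableSet_le hw measurable_const).compl
      (measurableSet_singleton 0)
  · simp only [innerNorm, eLpNorm_ennreal hq0 hqt]
    have h1 : Measurable fun a : Euc d × Euc d => (wt σ a.2 * Function.uncurry H a) ^ q.toReal :=
      hw.pow_const _
    exact h1.lintegral_prod_right'.pow_const _

lemma innerNorm_add_le (hq : 1 ≤ q) {h h' : Euc d → ℝ≥0∞} (hh : Measurable h)
    (hh' : Measurable h') :
    innerNorm q σ (fun y => h y + h' y) ≤ innerNorm q σ h + innerNorm q σ h' := by
  have h1 : Measurable fun y => wt σ y * h y := (measurable_wt σ).mul hh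
  have h2 : Measurable fun y => wt σ y * h' y := (measurable_wt σ).mul hh'
  have h3 := eLpNorm_add_le (μ := volume) h1.aestronglyMeasurable h2.aestronglyMeasurable hq
  refine le_trans (le_of_eq ?_) h3
  rw [innerNorm]
  congr 1
  ext y
  simp [mul_add]

lemma innerNorm_liminf_le (hq : 1 ≤ q) {h : ℕ → Euc d → ℝ≥0∞} (hh : ∀ n, Measurable (h n)) :
    innerNorm q σ (fun y => liminf (fun n => h n y) atTop) ≤
      liminf (fun n => innerNorm q σ (h n)) atTop := by
  have h1 : ∀ n, Measurable fun y => wt σ y * h n y := fun n => (measurable_wt σ).mul (hh n)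
  refine le_trans (eLpNorm_mono_ennreal fun y => ?_) (eLpNorm_liminf_le hq h1)
  rw [ENNReal.liminf_const_mul_of_ne_top (wt_ne_top σ y)]

lemma mixNorm_add_le (hq : 1 ≤ q) (hp : 1 ≤ p) {H H' : Euc d → Euc d → ℝ≥0∞}
    (hH : Measurable (Function.uncurry H)) (hH' : Measurable (Function.uncurry H')) :
    mixNorm q σ p γ (fun x y => H x y + H' x y) ≤ mixNorm q σ p γ H + mixNorm q σ p γ H' :=
  (innerNorm_mono fun _ => innerNorm_add_le hq hH.of_uncurry_left hH'.of_uncurry_left).trans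
    (innerNorm_add_le hp (measurable_innerNorm hH) (measurable_innerNorm hH'))

lemma mixNorm_liminf_le (hq : 1 ≤ q) (hp : 1 ≤ p) {H : ℕ → Euc d → Euc d → ℝ≥0∞}
    (hH : ∀ n, Measurable (Function.uncurry (H n))) :
    mixNorm q σ p γ (fun x y => liminf (fun n => H n x y) atTop) ≤
      liminf (fun n => mixNorm q σ p γ (H n)) atTop :=
  (innerNorm_mono fun _ => innerNorm_liminf_le hq fun n => (hH n).of_uncurry_left).trans
    (innerNorm_liminf_le hp fun n => measurable_innerNorm (hH n))

lemma measurable_kav (N : ℕ) {H : Euc d → Euc d → ℝ≥0∞} (hH : Measurable (Function.uncurry H)) :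
    Measurable (Function.uncurry (kav N H)) := by
  have h1 : Measurable fun b : (Euc d × Euc d) × (Euc d × Euc d) =>
      (b.1.1 + b.2.1, b.1.2 + b.2.2) := by fun_prop
  have h2 : Measurable fun b : (Euc d × Euc d) × (Euc d × Euc d) =>
      ENNReal.ofReal (krn N b.2.1 * krn N b.2.2) :=
    (((measurable_krn N).comp (measurable_fst.comp measurable_snd)).mul
      ((measurable_krn N).comp (measurable_snd.comp measurable_snd))).ennreal_ofReal
  have h3 : Measurable fun b : (Euc d × Euc d) × (Euc d × Euc d) =>
      ENNReal.ofReal (krn N b.2.1 * krn N b.2.2) * H (b.1.1 + b.2.1) (b.1.2 + b.2.2) :=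
    h2.mul (hH.comp h1)
  exact h3.lintegral_prod_right'

/-- A factor ⟨y⟩^{-r} in a pointwise bound by averages converts into r extra powers of the frequency
weight. This is the mechanism by which multipliers gain derivatives. -/
lemma mixNorm_le_of_kav (hq : 1 ≤ q) (hp : 1 ≤ p) (r : ℝ) (N : ℕ) (K : ℝ≥0∞)
    {H H' : Euc d → Euc d → ℝ≥0∞} (hH : Measurable (Function.uncurry H))
    (h : ∀ x y, H' x y ≤ K * (wt (-r) y * kav N H x y)) :
    mixNorm q (σ + r) p γ H' ≤
      K * (krnMass d N σ * krnMass d N γ * mixNorm q σ p γ H) := by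
  have hA := measurable_innerNorm (q := q) (σ := σ) hH
  have hk := measurable_kav N hH
  calc mixNorm q (σ + r) p γ H'
      ≤ mixNorm q σ p γ (fun x y => K * kav N H x y) := by
        refine innerNorm_mono fun x => eLpNorm_mono_ennreal fun y => ?_
        calc wt (σ + r) y * H' x y ≤ wt (σ + r) y * (K * (wt (-r) y * kav N H x y)) := by
              gcongr; exact h x y
          _ = wt σ y * (K * kav N H x y) * (wt (-r) y * wt r y) := by rw [wt_add]; ring
          _ = _ := by rw [wt_neg_mul, mul_one]
    _ = K * mixNorm q σ p γ (kav N H) := mixNorm_const_mul hq hp K hk (measurable_innerNorm hk)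
    _ ≤ _ := by
        have := mixNorm_kav_le hq hp σ γ N hH hA
        exact mul_le_mul_right this _

/-- The modulus of the local Fourier transform. -/
def amp (g : 𝓢(Euc d, ℂ)) (f : 𝓢'(Euc d, ℂ)) (x y : Euc d) : ℝ≥0∞ := ‖localFourier g f x y‖ₑ

lemma measurable_amp (g : 𝓢(Euc d, ℂ)) (f : 𝓢'(Euc d, ℂ)) :
    Measurable (Function.uncurry (amp g f)) :=
  (continuous_localFourier g f).measurable.enorm

lemma wNorm_eq (g : 𝓢(Euc d, ℂ)) (q : ℝ≥0∞) (s : ℝ) (p : ℝ≥0∞) (γ : ℝ) (f : 𝓢'(Euc d, ℂ)) :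
    wNorm g q s p γ f = mixNorm q s p γ (amp g f) := by
  rw [wNorm, mixNorm, innerNorm]
  congr 1
  ext x
  rw [wt, innerNorm]
  congr 1
  refine eLpNorm_congr_enorm_ae (Eventually.of_forall fun y => ?_)
  rw [enorm_eq_self, enorm_mul, wt, amp, ← ofReal_norm,
    Complex.norm_of_nonneg (Real.rpow_pos_of_pos (bracket_pos y) s).le]

variable {g : 𝓢(Euc d, ℂ)}

lemma wNorm_add_le (hq : 1 ≤ q) (hp : 1 ≤ p) (f f' : 𝓢'(Euc d, ℂ)) :
    wNorm g q σ p γ (f + f') ≤ wNorm g q σ p γ f + wNorm g q σ p γ f' := by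
  simp only [wNorm_eq]
  refine le_trans (mixNorm_mono fun x y => ?_)
    (mixNorm_add_le hq hp (measurable_amp g f) (measurable_amp g f'))
  simp only [amp, localFourier_add]
  exact enorm_add_le _ _

lemma wNorm_smul (hq : 1 ≤ q) (hp : 1 ≤ p) (c : ℂ) (f : 𝓢'(Euc d, ℂ)) :
    wNorm g q σ p γ (c • f) = ‖c‖ₑ * wNorm g q σ p γ f := by
  simp only [wNorm_eq]
  rw [← mixNorm_const_mul hq hp _ (measurable_amp g f) (measurable_innerNorm (measurable_amp g f))]
  congr 1
  ext x y
  simp [amp, localFourier_smul, enorm_mul]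

lemma wNorm_zero : wNorm g q σ p γ (0 : 𝓢'(Euc d, ℂ)) = 0 := by
  have : amp g (0 : 𝓢'(Euc d, ℂ)) = fun _ _ => 0 := by
    ext x y
    have : localFourier g (0 : 𝓢'(Euc d, ℂ)) x y = 0 := rfl
    simp [amp, this]
  simp [wNorm_eq, this, mixNorm, innerNorm]

/-- Pointwise convergence on Schwartz functions gives pointwise convergence of the short-time
Fourier transforms, and Fatou's lemma applies to both norms. Completeness will follow from this. -/
lemma wNorm_le_liminf (hq : 1 ≤ q) (hp : 1 ≤ p) {f : ℕ → 𝓢'(Euc d, ℂ)} {f₀ : 𝓢'(Euc d, ℂ)}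
    (h : ∀ φ, Tendsto (fun n => f n φ) atTop (𝓝 (f₀ φ))) :
    wNorm g q σ p γ f₀ ≤ liminf (fun n => wNorm g q σ p γ (f n)) atTop := by
  simp only [wNorm_eq]
  refine le_trans (mixNorm_mono fun x y => ?_)
    (mixNorm_liminf_le hq hp fun n => measurable_amp g (f n))
  have h1 : Tendsto (fun n => amp g (f n) x y) atTop (𝓝 (amp g f₀ x y)) :=
    (h (shiftedWindow g x y)).enorm
  exact h1.liminf_eq.ge

/-- Boundedness of an operator which acts on windows by a family of symbols. -/
theorem wNorm_le_of_shiftedWindow (hg : g ≠ 0) (hq : 1 ≤ q) (hp : 1 ≤ p) (σ r γ : ℝ) :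
    ∃ (m : ℕ) (C : ℝ), 0 ≤ C ∧ ∀ (h : 𝓢(Euc d, ℂ)) (f f' : 𝓢'(Euc d, ℂ))
      (G : Euc d → 𝓢(Euc d, ℂ)) (K : ℝ), 0 ≤ K →
      (∀ x y, ‖f' (shiftedWindow h x y)‖ ≤ ‖f (shiftedWindow (G y) x y)‖) →
      (∀ y, ssn m (G y) ≤ K * bracket y ^ (-r)) →
      wNorm h q (σ + r) p γ f' ≤ ENNReal.ofReal (C * K) * wNorm g q σ p γ f := by
  obtain ⟨N, hN⟩ : ∃ N : ℕ, d + |σ| + |γ| < N := exists_nat_gt _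
  have hN1 : krnMass d N σ < ∞ := krnMass_lt_top (by linarith [abs_nonneg γ])
  have hN2 : krnMass d N γ < ∞ := krnMass_lt_top (by linarith [abs_nonneg σ])
  obtain ⟨m, C, hC, hm⟩ := enorm_apply_shiftedWindow_le hg N
  refine ⟨m, C * (krnMass d N σ * krnMass d N γ).toReal, by positivity,
    fun h f f' G K hK h1 h2 => ?_⟩
  simp only [wNorm_eq]
  refine (mixNorm_le_of_kav hq hp r N (ENNReal.ofReal (C * K)) (measurable_amp g f)
    (fun x y => ?_)).trans (le_of_eq ?_)
  · calc amp h f' x y ≤ ‖f (shiftedWindow (G y) x y)‖ₑ := by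
          rw [amp, localFourier, ← ofReal_norm, ← ofReal_norm]
          exact ENNReal.ofReal_le_ofReal (h1 x y)
      _ ≤ ENNReal.ofReal (C * ssn m (G y)) * kav N (amp g f) x y := hm f (G y) x y
      _ ≤ ENNReal.ofReal (C * (K * bracket y ^ (-r))) * kav N (amp g f) x y := by
          gcongr; exact h2 y
      _ = _ := by
          rw [← mul_assoc C, ENNReal.ofReal_mul (mul_nonneg hC hK), mul_assoc]; rfl
  · rw [mul_right_comm C, ENNReal.ofReal_mul (mul_nonneg hC hK), ENNReal.ofReal_toReal
      (ENNReal.mul_ne_top hN1.ne hN2.ne)]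
    ring

/-- The general bound for the identity operator, whose family of windows is constantly h. It allows
the nonlinearity to be measured with a window adapted to it. -/
lemma wNorm_window_le (hg : g ≠ 0) (hq : 1 ≤ q) (hp : 1 ≤ p) (σ γ : ℝ) (h : 𝓢(Euc d, ℂ)) :
    ∃ C : ℝ, 0 ≤ C ∧ ∀ f, wNorm h q σ p γ f ≤ ENNReal.ofReal C * wNorm g q σ p γ f := by
  obtain ⟨m, C, hC, H⟩ := wNorm_le_of_shiftedWindow hg hq hp σ 0 γ
  refine ⟨C * ssn m h, mul_nonneg hC (apply_nonneg _ _), fun f => ?_⟩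
  have := H h f f (fun _ => h) (ssn m h) (apply_nonneg _ _) (fun _ _ => le_rfl) (fun y => by simp)
  rwa [add_zero] at this

/-- Evaluation on Schwartz functions is bounded by the amalgam norm. -/
theorem enorm_apply_le (hg : g ≠ 0) (hq : 1 ≤ q) (hp : 1 ≤ p) (σ γ : ℝ) :
    ∃ (m : ℕ) (C : ℝ), 0 ≤ C ∧ ∀ (f : 𝓢'(Euc d, ℂ)) (φ : 𝓢(Euc d, ℂ)),
      ‖f φ‖ₑ ≤ ENNReal.ofReal (C * ssn m φ) * wNorm g q σ p γ f := by
  obtain ⟨q', hq'⟩ := exists_holderConjugate hq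
  obtain ⟨p', hp'⟩ := exists_holderConjugate hp
  obtain ⟨N₁, h₁⟩ := krnDual_lt_top (d := d) σ q'
  obtain ⟨N₂, h₂⟩ := krnDual_lt_top (d := d) γ p'
  set N := max N₁ N₂
  have hK1 := h₁ N (le_max_left _ _)
  have hK2 := h₂ N (le_max_right _ _)
  obtain ⟨m, C, hC, hm⟩ := enorm_apply_shiftedWindow_le hg N
  refine ⟨m, C * (krnDual d N σ q' * krnDual d N γ p').toReal, by positivity, fun f φ => ?_⟩
  -- A pairing with φ is the coefficient at the origin for the window φ, so the estimate for
  -- coefficients applies to it.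
  have h0 : shiftedWindow φ 0 0 = φ := by
    ext z; simp [shiftedWindow_apply, chr]
  have h3 := hm f φ 0 0
  rw [h0] at h3
  have h4 := kav_le (q := q) (q' := q') (p := p) (p' := p') σ γ N (measurable_amp g f)
    (measurable_innerNorm (measurable_amp g f))
  calc ‖f φ‖ₑ ≤ ENNReal.ofReal (C * ssn m φ) * kav N (amp g f) 0 0 := h3
    _ ≤ ENNReal.ofReal (C * ssn m φ) *
        (krnDual d N σ q' * krnDual d N γ p' * mixNorm q σ p γ (amp g f)) := mul_le_mul_right h4 _
    _ = _ := by
      rw [wNorm_eq, mul_right_comm C, ENNReal.ofReal_mul (mul_nonneg hC (apply_nonneg _ _)),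
        ENNReal.ofReal_toReal (ENNReal.mul_ne_top hK1.ne hK2.ne)]
      ring

lemma eq_zero_of_wNorm_eq_zero (hg : g ≠ 0) (hq : 1 ≤ q) (hp : 1 ≤ p) {f : 𝓢'(Euc d, ℂ)}
    (h : wNorm g q σ p γ f = 0) : f = 0 := by
  obtain ⟨m, C, -, H⟩ := enorm_apply_le (q := q) (p := p) hg hq hp σ γ
  ext φ
  have := H f φ
  rw [h, mul_zero] at this
  simpa using this

lemma innerNorm_krn_lt_top (σ : ℝ) (q : ℝ≥0∞) : ∃ N₀ : ℕ, ∀ N, N₀ ≤ N →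
    innerNorm q σ (fun x : Euc d => ENNReal.ofReal (krn N x)) < ∞ := by
  obtain ⟨N₀, h⟩ := krnDual_lt_top (d := d) (-σ) q
  refine ⟨N₀, fun N hN => ?_⟩
  have := h N hN
  rw [krnDual, neg_neg] at this
  simpa only [innerNorm, mul_comm] using this

/-- Schwartz functions have finite amalgam norms. -/
theorem wNorm_coe_le (g : 𝓢(Euc d, ℂ)) (hq : 1 ≤ q) (hp : 1 ≤ p) (σ γ : ℝ) :
    ∃ (m : ℕ) (C : ℝ), 0 ≤ C ∧ ∀ ψ : 𝓢(Euc d, ℂ),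
      wNorm g q σ p γ (ψ : 𝓢'(Euc d, ℂ)) ≤ ENNReal.ofReal (C * ssn m ψ) := by
  obtain ⟨N₁, h₁⟩ := innerNorm_krn_lt_top (d := d) σ q
  obtain ⟨N₂, h₂⟩ := innerNorm_krn_lt_top (d := d) γ p
  set N := max N₁ N₂
  have hK1 := h₁ N (le_max_left _ _)
  have hK2 := h₂ N (le_max_right _ _)
  obtain ⟨m, C, hC, hm⟩ := norm_localFourier_coe_le_krn g N
  set k : Euc d → ℝ≥0∞ := fun x => ENNReal.ofReal (krn N x)
  have hk : Measurable k := (measurable_krn N).ennreal_ofReal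
  refine ⟨m, C * (innerNorm q σ k * innerNorm p γ k).toReal, by positivity, fun ψ => ?_⟩
  have h1 : ∀ x y, amp g (ψ : 𝓢'(Euc d, ℂ)) x y ≤ ENNReal.ofReal (C * ssn m ψ) * (k x * k y) := by
    intro x y
    rw [amp, ← ofReal_norm, ← ENNReal.ofReal_mul (krn_pos N x).le,
      ← ENNReal.ofReal_mul (mul_nonneg hC (apply_nonneg _ _))]
    exact ENNReal.ofReal_le_ofReal (hm ψ x y)
  have hkk : Measurable (Function.uncurry fun x y => k x * k y) :=
    (hk.comp measurable_fst).mul (hk.comp measurable_snd)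
  have h2 : ∀ x, innerNorm q σ (fun y => k x * k y) = innerNorm q σ k * k x := fun x => by
    rw [innerNorm_const_mul hq _ hk, mul_comm]
  calc wNorm g q σ p γ (ψ : 𝓢'(Euc d, ℂ))
      ≤ mixNorm q σ p γ (fun x y => ENNReal.ofReal (C * ssn m ψ) * (k x * k y)) := by
        rw [wNorm_eq]; exact mixNorm_mono h1
    _ = ENNReal.ofReal (C * ssn m ψ) * mixNorm q σ p γ (fun x y => k x * k y) :=
        mixNorm_const_mul hq hp _ hkk (measurable_innerNorm hkk)
    _ = ENNReal.ofReal (C * ssn m ψ) * (innerNorm q σ k * innerNorm p γ k) := by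
        rw [mixNorm]
        simp only [h2]
        rw [innerNorm_const_mul hp _ hk]
    _ = _ := by
        rw [mul_right_comm C, ENNReal.ofReal_mul (mul_nonneg hC (apply_nonneg _ _)),
          ENNReal.ofReal_toReal (ENNReal.mul_ne_top hK1.ne hK2.ne)]

/-- The local norms are bounded by the amalgam norm, uniformly in the position. -/
theorem innerNorm_amp_le (hg : g ≠ 0) (hq : 1 ≤ q) (hp : 1 ≤ p) (σ : ℝ) (hγ : 0 ≤ γ) :
    ∃ C : ℝ, 0 ≤ C ∧ ∀ (f : 𝓢'(Euc d, ℂ)) (x : Euc d),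
      innerNorm q σ (amp g f x) ≤ ENNReal.ofReal C * wNorm g q σ p γ f := by
  obtain ⟨p', hp'⟩ := exists_holderConjugate hp
  obtain ⟨N₁, h₁⟩ := krnDual_lt_top (d := d) 0 p'
  obtain ⟨N₂, h₂⟩ : ∃ N : ℕ, d + |σ| < N := exists_nat_gt _
  set N := max N₁ N₂
  have hK1 := h₁ N (le_max_left _ _)
  have hK2 : krnMass d N σ < ∞ := krnMass_lt_top
    (h₂.trans_le (by exact_mod_cast le_max_right _ _))
  obtain ⟨m, C, hC, hm⟩ := enorm_apply_shiftedWindow_le hg N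
  refine ⟨C * ssn m g * (krnMass d N σ * krnDual d N 0 p').toReal,
    mul_nonneg (mul_nonneg hC (apply_nonneg _ _)) ENNReal.toReal_nonneg, fun f x => ?_⟩
  have hA := measurable_innerNorm (q := q) (σ := σ) (measurable_amp g f)
  have hk : Measurable (kav N (amp g f) x) := (measurable_kav N (measurable_amp g f)).of_uncurry_left
  have hx : Measurable fun w : Euc d => x + w := by fun_prop
  calc innerNorm q σ (amp g f x)
      ≤ innerNorm q σ (fun y => ENNReal.ofReal (C * ssn m g) * kav N (amp g f) x y) :=
        innerNorm_mono fun y => hm f g x y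
    _ = ENNReal.ofReal (C * ssn m g) * innerNorm q σ (kav N (amp g f) x) :=
        innerNorm_const_mul hq _ hk
    _ ≤ ENNReal.ofReal (C * ssn m g) * (krnMass d N σ *
          ∫⁻ w, ENNReal.ofReal (krn N w) * innerNorm q σ (amp g f (x + w))) :=
        mul_le_mul_right (innerNorm_kav_le hq σ N (measurable_amp g f) hA x) _
    _ ≤ ENNReal.ofReal (C * ssn m g) * (krnMass d N σ *
          (krnDual d N 0 p' * innerNorm p 0 (fun w => innerNorm q σ (amp g f (x + w))))) := by
        -- Hölder with exponent 0 for the position weight: the unweighted norm is translation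
        -- invariant, so the bound is uniform in x. Since γ ≥ 0, it is dominated by the weighted
        -- norm.
        have h5 := lintegral_krn_mul_le (q := p) (q' := p') 0 N (hA.comp hx)
        exact mul_le_mul_right (mul_le_mul_right h5 _) _
    _ ≤ ENNReal.ofReal (C * ssn m g) * (krnMass d N σ *
          (krnDual d N 0 p' * wNorm g q σ p γ f)) := by
        have h6 : innerNorm p 0 (fun w => innerNorm q σ (amp g f (x + w))) ≤
            wNorm g q σ p γ f := by
          have h7 := innerNorm_shift (q := p) (σ := 0) hA x
          simp only [wt_zero, one_mul] at h7
          have h8 : innerNorm p 0 (fun w => innerNorm q σ (amp g f (x + w))) =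
              innerNorm p 0 (fun w => innerNorm q σ (amp g f w)) := by
            rw [← h7, innerNorm]
            simp only [wt_zero, one_mul, add_comm x]
          rw [h8, wNorm_eq, mixNorm]
          exact eLpNorm_mono_ennreal fun y => mul_le_mul_left (wt_mono hγ y) _
        exact mul_le_mul_right (mul_le_mul_right (mul_le_mul_right h6 _) _) _
    _ = _ := by
        rw [ENNReal.ofReal_mul (mul_nonneg hC (apply_nonneg _ _)),
          ENNReal.ofReal_toReal (ENNReal.mul_ne_top hK2.ne hK1.ne)]
        ring

end

/-! ### The amalgam space as a Banach space -/

section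


variable {d : ℕ}

lemma exists_distribution_of_bound (T : 𝓢(Euc d, ℂ) →ₗ[ℂ] ℂ)
    (h : ∃ (m : ℕ) (C : ℝ), 0 ≤ C ∧ ∀ φ, ‖T φ‖ ≤ C * ssn m φ) :
    ∃ f : 𝓢'(Euc d, ℂ), ∀ φ, f φ = T φ := by
  obtain ⟨m, C, hC, hT⟩ := h
  have h1 : Continuous ((normSeminorm ℂ ℂ).comp T) := by
    refine Seminorm.continuous_of_le (q := C.toNNReal • ssn m) ?_ fun φ => ?_
    · exact (continuous_ssn m).const_smul C.toNNReal
    · have : (C.toNNReal • ssn m) φ = C * ssn m φ := by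
        rw [smul_apply, NNReal.smul_def, Real.coe_toNNReal C hC, smul_eq_mul]
      rw [this]; exact hT φ
  have h2 : Continuous T := by
    refine continuous_of_continuousAt_zero T ?_
    rw [ContinuousAt, map_zero, tendsto_zero_iff_norm_tendsto_zero]
    have h2 : Tendsto (fun φ => ‖T φ‖) (𝓝 0) (𝓝 ‖T 0‖) := h1.tendsto 0
    rwa [map_zero, norm_zero] at h2
  exact ⟨(⟨T, h2⟩ : 𝓢(Euc d, ℂ) →L[ℂ] ℂ), fun φ => rfl⟩

/-- Membership in the closure of the Schwartz class for the amalgam norm. -/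
def MemClosure (g : 𝓢(Euc d, ℂ)) (q : ℝ≥0∞) (σ : ℝ) (p : ℝ≥0∞) (γ : ℝ)
    (f : 𝓢'(Euc d, ℂ)) : Prop :=
  wNorm g q σ p γ f < ∞ ∧ ∀ ε : ℝ≥0∞, 0 < ε → ∃ φ : 𝓢(Euc d, ℂ),
    wNorm g q σ p γ (f - (φ : 𝓢'(Euc d, ℂ))) < ε

section

variable (g : 𝓢(Euc d, ℂ)) (q : ℝ≥0∞) (σ : ℝ) (p : ℝ≥0∞) (γ : ℝ)

/-- The amalgam space as a subspace of the tempered distributions. -/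
def amalgam [hq : Fact (1 ≤ q)] [hp : Fact (1 ≤ p)] : Submodule ℂ 𝓢'(Euc d, ℂ) where
  carrier := {f | MemClosure g q σ p γ f}
  zero_mem' := by
    refine ⟨by rw [wNorm_zero]; exact ENNReal.zero_lt_top, fun ε hε => ⟨0, ?_⟩⟩
    rw [map_zero, sub_zero, wNorm_zero]
    exact hε
  add_mem' := by
    rintro f f' ⟨h1, h2⟩ ⟨h1', h2'⟩
    refine ⟨(wNorm_add_le hq.out hp.out f f').trans_lt (ENNReal.add_lt_top.2 ⟨h1, h1'⟩),
      fun ε hε => ?_⟩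
    obtain ⟨φ, hφ⟩ := h2 (ε / 2) (ENNReal.half_pos hε.ne')
    obtain ⟨φ', hφ'⟩ := h2' (ε / 2) (ENNReal.half_pos hε.ne')
    refine ⟨φ + φ', ?_⟩
    rw [map_add, add_sub_add_comm]
    calc _ ≤ _ := wNorm_add_le hq.out hp.out _ _
      _ < ε / 2 + ε / 2 := ENNReal.add_lt_add hφ hφ'
      _ = ε := ENNReal.add_halves ε
  smul_mem' := by
    rintro c f ⟨h1, h2⟩
    refine ⟨by rw [wNorm_smul hq.out hp.out]; exact ENNReal.mul_lt_top enorm_lt_top h1,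
      fun ε hε => ?_⟩
    obtain ⟨φ, hφ⟩ := h2 (ε / (‖c‖ₑ + 1)) (ENNReal.div_pos hε.ne'
      (ENNReal.add_ne_top.2 ⟨enorm_ne_top, ENNReal.one_ne_top⟩))
    refine ⟨c • φ, ?_⟩
    rw [map_smul, ← smul_sub, wNorm_smul hq.out hp.out]
    by_cases hεt : ε = ∞
    · subst hεt
      refine ENNReal.mul_lt_top enorm_lt_top (lt_of_lt_of_le hφ le_top)
    have h0 : ‖c‖ₑ + 1 ≠ 0 := by simp
    have ht : ‖c‖ₑ + 1 ≠ ∞ := ENNReal.add_ne_top.2 ⟨enorm_ne_top, ENNReal.one_ne_top⟩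
    calc ‖c‖ₑ * wNorm g q σ p γ (f - (φ : 𝓢'(Euc d, ℂ)))
        ≤ (‖c‖ₑ + 1) * wNorm g q σ p γ (f - (φ : 𝓢'(Euc d, ℂ))) := by gcongr; exact le_self_add
      _ < (‖c‖ₑ + 1) * (ε / (‖c‖ₑ + 1)) := (ENNReal.mul_lt_mul_iff_right h0 ht).2 hφ
      _ = ε := ENNReal.mul_div_cancel h0 ht

/-- The amalgam space, normed by the amalgam norm. -/
def WSpace [Fact (1 ≤ q)] [Fact (1 ≤ p)] : Type := amalgam g q σ p γ

variable [hq : Fact (1 ≤ q)] [hp : Fact (1 ≤ p)]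

instance : AddCommGroup (WSpace g q σ p γ) := inferInstanceAs (AddCommGroup (amalgam g q σ p γ))

instance : Module ℂ (WSpace g q σ p γ) := inferInstanceAs (Module ℂ (amalgam g q σ p γ))

end

variable {g : 𝓢(Euc d, ℂ)} {q : ℝ≥0∞} {σ : ℝ} {p : ℝ≥0∞} {γ : ℝ}
  [hq : Fact (1 ≤ q)] [hp : Fact (1 ≤ p)]

/-- The distribution underlying an element of the amalgam space. -/
def toDist : WSpace g q σ p γ →ₗ[ℂ] 𝓢'(Euc d, ℂ) := (amalgam g q σ p γ).subtype

lemma toDist_injective : Function.Injective (toDist (g := g) (q := q) (σ := σ) (p := p) (γ := γ)) :=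
  Subtype.val_injective

lemma memClosure_toDist (f : WSpace g q σ p γ) : MemClosure g q σ p γ (toDist f) := f.2

/-- The element of the amalgam space given by a distribution. -/
def ofDist (f : 𝓢'(Euc d, ℂ)) (hf : MemClosure g q σ p γ f) : WSpace g q σ p γ := ⟨f, hf⟩

instance : Norm (WSpace g q σ p γ) := ⟨fun f => (wNorm g q σ p γ (toDist f)).toReal⟩

lemma norm_def (f : WSpace g q σ p γ) : ‖f‖ = (wNorm g q σ p γ (toDist f)).toReal := rfl

lemma ofReal_norm_wspace (f : WSpace g q σ p γ) :
    ENNReal.ofReal ‖f‖ = wNorm g q σ p γ (toDist f) :=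
  ENNReal.ofReal_toReal (memClosure_toDist f).1.ne

lemma memClosure_coe (φ : 𝓢(Euc d, ℂ)) : MemClosure g q σ p γ (φ : 𝓢'(Euc d, ℂ)) := by
  obtain ⟨m, C, -, h⟩ := wNorm_coe_le g hq.out hp.out σ γ
  refine ⟨(h φ).trans_lt ENNReal.ofReal_lt_top, fun ε hε => ⟨φ, ?_⟩⟩
  rw [sub_self, wNorm_zero]
  exact hε

variable [hg : Fact (g ≠ 0)]

lemma wspace_core : NormedSpace.Core ℂ (WSpace g q σ p γ) where
  norm_nonneg f := ENNReal.toReal_nonneg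
  norm_smul c f := by
    rw [norm_def, norm_def, map_smul, wNorm_smul hq.out hp.out, ENNReal.toReal_mul, toReal_enorm]
  norm_triangle f f' := by
    rw [norm_def, norm_def, norm_def, map_add,
      ← ENNReal.toReal_add (memClosure_toDist f).1.ne (memClosure_toDist f').1.ne]
    exact ENNReal.toReal_mono
      (ENNReal.add_ne_top.2 ⟨(memClosure_toDist f).1.ne, (memClosure_toDist f').1.ne⟩)
      (wNorm_add_le hq.out hp.out _ _)
  norm_eq_zero_iff f := by
    constructor
    · intro h
      rw [norm_def, ENNReal.toReal_eq_zero_iff] at h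
      refine toDist_injective ?_
      rw [map_zero]
      exact eq_zero_of_wNorm_eq_zero hg.out hq.out hp.out
        (h.resolve_right (memClosure_toDist f).1.ne)
    · rintro rfl
      rw [norm_def, map_zero, wNorm_zero, ENNReal.toReal_zero]

instance : NormedAddCommGroup (WSpace g q σ p γ) := NormedAddCommGroup.ofCore wspace_core

instance : NormedSpace ℂ (WSpace g q σ p γ) := NormedSpace.ofCore wspace_core

lemma enorm_wspace (f : WSpace g q σ p γ) : ‖f‖ₑ = wNorm g q σ p γ (toDist f) := by
  rw [← ofReal_norm, ofReal_norm_wspace]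

lemma exists_norm_apply_le : ∃ (m : ℕ) (C : ℝ), 0 ≤ C ∧ ∀ (f : WSpace g q σ p γ)
    (φ : 𝓢(Euc d, ℂ)), ‖toDist f φ‖ ≤ C * ssn m φ * ‖f‖ := by
  obtain ⟨m, C, hC, h⟩ := enorm_apply_le hg.out hq.out hp.out σ γ
  refine ⟨m, C, hC, fun f φ => ?_⟩
  have h1 := h (toDist f) φ
  have h2 : 0 ≤ C * ssn m φ := mul_nonneg hC (apply_nonneg _ _)
  rwa [← ofReal_norm_wspace, ← ENNReal.ofReal_mul h2, ← ofReal_norm,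
    ENNReal.ofReal_le_ofReal_iff (mul_nonneg h2 (norm_nonneg _))] at h1

/-- Evaluation at a Schwartz function, as a functional on the amalgam space. -/
def evalAt (φ : 𝓢(Euc d, ℂ)) : WSpace g q σ p γ →L[ℂ] ℂ :=
  LinearMap.mkContinuousOfExistsBound
    { toFun := fun f => toDist f φ
      map_add' := fun f f' => by rw [map_add]; rfl
      map_smul' := fun c f => by rw [map_smul]; rfl } (by
    obtain ⟨m, C, -, h⟩ := exists_norm_apply_le (g := g) (q := q) (σ := σ) (p := p) (γ := γ)
    exact ⟨C * ssn m φ, fun f => h f φ⟩)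

@[simp] lemma evalAt_apply (φ : 𝓢(Euc d, ℂ)) (f : WSpace g q σ p γ) : evalAt φ f = toDist f φ := rfl

/-- A Cauchy sequence converges on every Schwartz function, and its bounded norms make the limit a
tempered distribution. Lower semicontinuity of the norm upgrades this to convergence in norm. A norm
limit of elements in the closure of the Schwartz class lies in that closure. -/
instance : CompleteSpace (WSpace g q σ p γ) := by
  refine Metric.complete_of_cauchySeq_tendsto fun u hu => ?_
  obtain ⟨m, C, hC, hb⟩ := exists_norm_apply_le (g := g) (q := q) (σ := σ) (p := p) (γ := γ)
  have hc : ∀ φ, ∃ z : ℂ, Tendsto (fun n => toDist (u n) φ) atTop (𝓝 z) := fun φ =>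
    cauchySeq_tendsto_of_complete (hu.map (evalAt φ).uniformContinuous)
  choose T hT using hc
  obtain ⟨B, hB⟩ := hu.norm_bddAbove
  have hB' : ∀ n, ‖u n‖ ≤ B := fun n => hB (Set.mem_range_self n)
  have hB0 : 0 ≤ B := (norm_nonneg _).trans (hB' 0)
  let T' : 𝓢(Euc d, ℂ) →ₗ[ℂ] ℂ :=
    { toFun := T
      map_add' := fun φ ψ => tendsto_nhds_unique (hT (φ + ψ))
        (((hT φ).add (hT ψ)).congr fun n => (map_add (toDist (u n)) φ ψ).symm)
      map_smul' := fun c φ => tendsto_nhds_unique (hT (c • φ))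
        (((hT φ).const_smul c).congr fun n => (map_smul (toDist (u n)) c φ).symm) }
  obtain ⟨f, hf⟩ := exists_distribution_of_bound T' ⟨m, C * B, by positivity, fun φ => by
    refine le_of_tendsto (hT φ).norm (Eventually.of_forall fun n => ?_)
    refine (hb (u n) φ).trans ?_
    rw [mul_right_comm]
    exact mul_le_mul_of_nonneg_right (mul_le_mul_of_nonneg_left (hB' n) hC) (apply_nonneg _ _)⟩
  have hlim : ∀ n ε, 0 ≤ ε → (∀ k ≥ n, ‖u k - u n‖ ≤ ε) →
      wNorm g q σ p γ (f - toDist (u n)) ≤ ENNReal.ofReal ε := fun n ε hε hk => by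
    have h1 := wNorm_le_liminf (g := g) (σ := σ) (γ := γ) hq.out hp.out
      (f := fun k => toDist (u k - u n)) (f₀ := f - toDist (u n)) (fun φ => by
        have h2 := (hT φ).sub_const (toDist (u n) φ)
        have h3 : (f - toDist (u n)) φ = T φ - toDist (u n) φ := by
          rw [← show f φ = T φ from hf φ]; rfl
        rw [h3]
        refine h2.congr fun k => ?_
        rw [map_sub]; rfl)
    refine h1.trans ?_
    refine (liminf_le_liminf (v := fun _ => ENNReal.ofReal ε) ?_).trans (by simp)
    filter_upwards [eventually_ge_atTop n] with k hkn
    rw [← ofReal_norm_wspace]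
    exact ENNReal.ofReal_le_ofReal (hk k hkn)
  have hcau : ∀ ε > 0, ∃ n, ∀ k ≥ n, wNorm g q σ p γ (f - toDist (u k)) ≤ ENNReal.ofReal ε := by
    intro ε hε
    obtain ⟨n, hn⟩ := Metric.cauchySeq_iff.1 hu ε hε
    refine ⟨n, fun k hk => hlim k ε hε.le fun j hj => ?_⟩
    rw [← dist_eq_norm]
    exact (hn j (hk.trans hj) k hk).le
  have hmem : MemClosure g q σ p γ f := by
    have hsplit : ∀ n, f = (f - toDist (u n)) + toDist (u n) := fun n => by abel
    constructor
    · obtain ⟨n, hn⟩ := hcau 1 one_pos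
      rw [hsplit n]
      exact (wNorm_add_le hq.out hp.out _ _).trans_lt (ENNReal.add_lt_top.2
        ⟨(hn n le_rfl).trans_lt ENNReal.ofReal_lt_top, (memClosure_toDist (u n)).1⟩)
    · intro ε hε
      obtain ⟨δ, hδ0, hδ⟩ : ∃ δ : ℝ, 0 < δ ∧ ENNReal.ofReal δ < ε / 2 := by
        obtain ⟨c, hc0, hc⟩ := ENNReal.lt_iff_exists_nnreal_btwn.1 (ENNReal.half_pos hε.ne')
        exact ⟨c, by exact_mod_cast hc0, by simpa using hc⟩
      obtain ⟨n, hn⟩ := hcau δ hδ0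
      obtain ⟨φ, hφ⟩ := (memClosure_toDist (u n)).2 (ε / 2) (ENNReal.half_pos hε.ne')
      refine ⟨φ, ?_⟩
      have : f - (φ : 𝓢'(Euc d, ℂ)) =
          (f - toDist (u n)) + (toDist (u n) - (φ : 𝓢'(Euc d, ℂ))) := by abel
      rw [this]
      calc _ ≤ _ := wNorm_add_le hq.out hp.out _ _
        _ < ε / 2 + ε / 2 := ENNReal.add_lt_add ((hn n le_rfl).trans_lt hδ) hφ
        _ = ε := ENNReal.add_halves ε
  refine ⟨ofDist f hmem, ?_⟩
  rw [Metric.tendsto_atTop]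
  intro ε hε
  obtain ⟨n, hn⟩ := hcau (ε / 2) (half_pos hε)
  refine ⟨n, fun k hk => ?_⟩
  rw [dist_comm, dist_eq_norm]
  have h1 := hn k hk
  have h2 : wNorm g q σ p γ (f - toDist (u k)) = ENNReal.ofReal ‖ofDist f hmem - u k‖ := by
    rw [ofReal_norm_wspace, map_sub]; rfl
  rw [h2, ENNReal.ofReal_le_ofReal_iff (half_pos hε).le] at h1
  linarith

/-- The inclusion of the Schwartz functions into the amalgam space. -/
def ofSchwartz : 𝓢(Euc d, ℂ) →ₗ[ℂ] WSpace g q σ p γ where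
  toFun φ := ofDist (φ : 𝓢'(Euc d, ℂ)) (memClosure_coe φ)
  map_add' φ ψ := toDist_injective
    ((map_add (SchwartzMap.toTemperedDistributionCLM (Euc d) ℂ volume) φ ψ).trans rfl)
  map_smul' c φ := toDist_injective
    ((map_smul (SchwartzMap.toTemperedDistributionCLM (Euc d) ℂ volume) c φ).trans rfl)

@[simp] lemma toDist_ofSchwartz (φ : 𝓢(Euc d, ℂ)) :
    toDist (ofSchwartz φ : WSpace g q σ p γ) = (φ : 𝓢'(Euc d, ℂ)) := rfl

lemma exists_norm_ofSchwartz_le : ∃ (m : ℕ) (C : ℝ), 0 ≤ C ∧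
    ∀ φ : 𝓢(Euc d, ℂ), ‖(ofSchwartz φ : WSpace g q σ p γ)‖ ≤ C * ssn m φ := by
  obtain ⟨m, C, hC, h⟩ := wNorm_coe_le g hq.out hp.out σ γ
  refine ⟨m, C, hC, fun φ => ?_⟩
  have h1 : wNorm g q σ p γ (toDist (ofSchwartz φ : WSpace g q σ p γ)) ≤
      ENNReal.ofReal (C * ssn m φ) := h φ
  rw [norm_def]
  exact ENNReal.toReal_le_of_le_ofReal (mul_nonneg hC (apply_nonneg _ _)) h1

lemma continuous_ofSchwartz :
    Continuous (ofSchwartz : 𝓢(Euc d, ℂ) →ₗ[ℂ] WSpace g q σ p γ) := by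
  obtain ⟨m, C, hC, h⟩ := exists_norm_ofSchwartz_le (g := g) (q := q) (σ := σ) (p := p) (γ := γ)
  refine continuous_iff_continuousAt.2 fun φ => ?_
  refine tendsto_iff_norm_sub_tendsto_zero.2 ?_
  have h1 := (ssn_sub_tendsto (tendsto_id (x := 𝓝 φ)) m).const_mul C
  rw [mul_zero] at h1
  refine squeeze_zero (fun _ => norm_nonneg _) (fun ψ => ?_) h1
  rw [← map_sub]
  exact h _

lemma exists_schwartz_near (f : WSpace g q σ p γ) {ε : ℝ} (hε : 0 < ε) :
    ∃ φ : 𝓢(Euc d, ℂ), ‖f - ofSchwartz φ‖ < ε := by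
  obtain ⟨φ, hφ⟩ := (memClosure_toDist f).2 (ENNReal.ofReal ε) (by simpa using hε)
  refine ⟨φ, ?_⟩
  rw [← toDist_ofSchwartz (g := g) (q := q) (σ := σ) (p := p) (γ := γ), ← map_sub,
    ← ofReal_norm_wspace] at hφ
  exact (ENNReal.ofReal_lt_ofReal_iff hε).1 hφ

lemma denseRange_ofSchwartz :
    DenseRange (ofSchwartz : 𝓢(Euc d, ℂ) →ₗ[ℂ] WSpace g q σ p γ) := by
  intro f
  rw [Metric.mem_closure_range_iff]
  intro ε hε
  obtain ⟨φ, hφ⟩ := exists_schwartz_near f hε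
  exact ⟨φ, by rwa [dist_eq_norm]⟩

end

/-! ### Density of the Schwartz class for finite exponents -/

section


variable {d : ℕ}

lemma eLpNorm_tendsto_zero_of_dominated {α : Type*} [MeasurableSpace α] {μ : Measure α} {p : ℝ≥0∞}
    (hp0 : p ≠ 0) (hpt : p ≠ ∞) {h : ℕ → α → ℝ≥0∞} {H : α → ℝ≥0∞} (hh : ∀ n, Measurable (h n))
    (hle : ∀ n x, h n x ≤ H x) (hH : eLpNorm H p μ < ∞)
    (hlim : ∀ᵐ x ∂μ, Tendsto (fun n => h n x) atTop (𝓝 0)) :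
    Tendsto (fun n => eLpNorm (h n) p μ) atTop (𝓝 0) := by
  have hp' : 0 < p.toReal := ENNReal.toReal_pos hp0 hpt
  have hfin : ∫⁻ x, H x ^ p.toReal ∂μ ≠ ∞ := by
    rw [eLpNorm_ennreal hp0 hpt] at hH
    exact (ENNReal.rpow_lt_top_iff_of_pos (by positivity)).1 hH |>.ne
  have h1 : Tendsto (fun n => ∫⁻ x, h n x ^ p.toReal ∂μ) atTop (𝓝 (∫⁻ _, 0 ∂μ)) := by
    refine tendsto_lintegral_of_dominated_convergence (fun x => H x ^ p.toReal)
      (fun n => (hh n).pow_const _) (fun n => Eventually.of_forall fun x => ?_) hfin ?_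
    · exact ENNReal.rpow_le_rpow (hle n x) hp'.le
    · filter_upwards [hlim] with x hx
      have := (ENNReal.continuous_rpow_const (y := p.toReal)).tendsto 0 |>.comp hx
      simpa [ENNReal.zero_rpow_of_pos hp', Function.comp_def] using this
  rw [lintegral_zero] at h1
  have h2 := (ENNReal.continuous_rpow_const (y := 1 / p.toReal)).tendsto 0 |>.comp h1
  rw [ENNReal.zero_rpow_of_pos (by positivity)] at h2
  refine h2.congr fun n => ?_
  rw [eLpNorm_ennreal hp0 hpt]; rfl

lemma ae_lt_top_of_eLpNorm {α : Type*} [MeasurableSpace α] {μ : Measure α} {p : ℝ≥0∞}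
    (hp0 : p ≠ 0) (hpt : p ≠ ∞) {H : α → ℝ≥0∞} (hm : Measurable H) (hH : eLpNorm H p μ < ∞) :
    ∀ᵐ x ∂μ, H x < ∞ := by
  have hp' : 0 < p.toReal := ENNReal.toReal_pos hp0 hpt
  rw [eLpNorm_ennreal hp0 hpt] at hH
  have h1 := (ENNReal.rpow_lt_top_iff_of_pos (by positivity)).1 hH
  filter_upwards [ae_lt_top (hm.pow_const _) h1.ne] with x hx
  exact (ENNReal.rpow_lt_top_iff_of_pos hp').1 hx

/-- Dominated convergence twice, in frequency and then in position. Finiteness of the mixed norm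
makes the inner norm of the majorant finite for almost every x, which is all that the inner step
requires. -/
lemma mixNorm_tendsto_zero {q p : ℝ≥0∞} (hq : 1 ≤ q) (hqt : q ≠ ∞) (hp : 1 ≤ p) (hpt : p ≠ ∞)
    {σ γ : ℝ} {H : Euc d → Euc d → ℝ≥0∞} (hH : Measurable (Function.uncurry H))
    (hfin : mixNorm q σ p γ H < ∞) {h : ℕ → Euc d → Euc d → ℝ≥0∞}
    (hh : ∀ n, Measurable (Function.uncurry (h n))) (hle : ∀ n x y, h n x y ≤ H x y)
    (hlim : ∀ x y, Tendsto (fun n => h n x y) atTop (𝓝 0)) :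
    Tendsto (fun n => mixNorm q σ p γ (h n)) atTop (𝓝 0) := by
  have hq0 : q ≠ 0 := (zero_lt_one.trans_le hq).ne'
  have hp0 : p ≠ 0 := (zero_lt_one.trans_le hp).ne'
  have hmul : ∀ (τ : ℝ) {u : ℕ → ℝ≥0∞} (x : Euc d), Tendsto u atTop (𝓝 0) →
      Tendsto (fun n => wt τ x * u n) atTop (𝓝 0) := fun τ _ x hu => by
    have := ENNReal.Tendsto.const_mul hu (Or.inr (wt_ne_top τ x))
    rwa [mul_zero] at this
  have hA := measurable_innerNorm (q := q) (σ := σ) hH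
  have hm : Measurable fun x => wt γ x * innerNorm q σ (H x) := (measurable_wt γ).mul hA
  refine eLpNorm_tendsto_zero_of_dominated (H := fun x => wt γ x * innerNorm q σ (H x)) hp0 hpt
    (fun n => (measurable_wt γ).mul (measurable_innerNorm (hh n)))
    (fun n x => mul_le_mul_right (innerNorm_mono (hle n x)) _) hfin ?_
  filter_upwards [ae_lt_top_of_eLpNorm hp0 hpt hm hfin] with x hx
  refine hmul γ x ?_
  have hx' : innerNorm q σ (H x) < ∞ := by
    by_contra hcon
    rw [not_lt_top_iff] at hcon
    rw [hcon, ENNReal.mul_top (wt_ne_zero γ x)] at hx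
    exact absurd hx (lt_irrefl _)
  exact eLpNorm_tendsto_zero_of_dominated (H := fun y => wt σ y * H x y) hq0 hqt
    (fun n => (measurable_wt σ).mul (hh n).of_uncurry_left)
    (fun n y => mul_le_mul_right (hle n x y) _) hx' (Eventually.of_forall fun y => hmul σ y (hlim x y))

lemma integrable_reproducing (g Ψ : 𝓢(Euc d, ℂ)) (f : 𝓢'(Euc d, ℂ)) :
    Integrable fun a : Euc d × Euc d =>
      localFourier (cj g) (Ψ : 𝓢'(Euc d, ℂ)) a.1 (-a.2) * localFourier g f a.1 a.2 := by
  obtain ⟨m, C, hC, h⟩ := dist_bound f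
  refine ((integrable_ssn_reproFamily g Ψ m).const_mul C).mono'
    (((continuous_localFourier_neg _ _).mul (continuous_localFourier g f)).aestronglyMeasurable)
    (Eventually.of_forall fun a => ?_)
  refine le_trans (le_of_eq ?_) (h (reproFamily g Ψ a))
  congr 1
  exact (map_smul f _ _).symm

variable {g : 𝓢(Euc d, ℂ)} {q : ℝ≥0∞} {σ : ℝ} {p : ℝ≥0∞} {γ : ℝ}
  [hq : Fact (1 ≤ q)] [hp : Fact (1 ≤ p)] [hg : Fact (g ≠ 0)]

/-- For finite exponents, the Schwartz functions are dense in the space of all distributions with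
finite amalgam norm. -/
theorem memClosure_of_wNorm_lt_top (hqt : q ≠ ∞) (hpt : p ≠ ∞) {f : 𝓢'(Euc d, ℂ)}
    (hf : wNorm g q σ p γ f < ∞) : MemClosure g q σ p γ f := by
  have hn : (nsq g : ℂ) ≠ 0 := by exact_mod_cast (nsq_pos hg.out).ne'
  let B : ℕ → Set (Euc d × Euc d) := fun n => Metric.closedBall 0 n
  have hB : ∀ n, MeasurableSet (B n) := fun n => Metric.isClosed_closedBall.measurableSet
  -- The approximants are the reproducing formula cut off to balls, as Bochner integrals of a
  -- continuous family in the amalgam space. They belong to the closure of the Schwartz class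
  -- automatically, by completeness.
  let Φ : Euc d × Euc d → WSpace g q σ p γ := fun a =>
    localFourier g f a.1 a.2 • ofSchwartz (shiftedWindow (cj g) a.1 (-a.2))
  have hcΦ : Continuous Φ := by
    have hneg : Continuous fun a : Euc d × Euc d => (a.1, -a.2) := by fun_prop
    have h1 := (continuous_shiftedWindow (cj g)).comp hneg
    exact (continuous_localFourier g f).smul (continuous_ofSchwartz.comp h1)
  have hiΦ : ∀ n, IntegrableOn Φ (B n) := fun n =>
    hcΦ.continuousOn.integrableOn_compact (isCompact_closedBall _ _)
  have hev : ∀ (a : Euc d × Euc d) (G : 𝓢(Euc d, ℂ)), toDist (Φ a) G =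
      localFourier (cj g) (G : 𝓢'(Euc d, ℂ)) a.1 (-a.2) * localFourier g f a.1 a.2 := fun a G => by
    have h1 : toDist (Φ a) G = localFourier g f a.1 a.2 *
        (shiftedWindow (cj g) a.1 (-a.2) : 𝓢'(Euc d, ℂ)) G := by
      simp only [Φ, map_smul]; rfl
    rw [h1, mul_comm]
    congr 1
    rw [localFourier_coe]
    refine (SchwartzMap.toTemperedDistributionCLM_apply_apply volume _ G).trans ?_
    refine integral_congr_ae (Eventually.of_forall fun z => ?_)
    simp only [shiftedWindow_apply, smul_eq_mul]
    ring
  let u : ℕ → WSpace g q σ p γ := fun n => (nsq g : ℂ)⁻¹ • ∫ a in B n, Φ a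
  -- The error is the tail of the reproducing formula. The estimate for partial integrals bounds it
  -- by averages of the coefficients of f outside the ball, whose mixed norm tends to zero.
  have hu : ∀ n G, (f - toDist (u n)) G = (nsq g : ℂ)⁻¹ * ∫ a in (B n)ᶜ,
      localFourier (cj g) (G : 𝓢'(Euc d, ℂ)) a.1 (-a.2) * localFourier g f a.1 a.2 := fun n G => by
    have h1 : toDist (u n) G = (nsq g : ℂ)⁻¹ * ∫ a in B n,
        localFourier (cj g) (G : 𝓢'(Euc d, ℂ)) a.1 (-a.2) * localFourier g f a.1 a.2 := by
      have h2 := (evalAt (g := g) (q := q) (σ := σ) (p := p) (γ := γ) G).integral_comp_comm (hiΦ n)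
      simp only [evalAt_apply, hev] at h2
      rw [h2]
      simp only [u, map_smul]; rfl
    have h3 := integral_add_compl (hB n) (integrable_reproducing g G f)
    rw [← reproducing] at h3
    have h4 : (f - toDist (u n)) G = f G - toDist (u n) G := rfl
    rw [h4, h1]
    field_simp
    rw [mul_comm, ← h3]; ring
  obtain ⟨N, hN⟩ : ∃ N : ℕ, d + |σ| + |γ| < N := exists_nat_gt _
  have hN1 : krnMass d N σ < ∞ := krnMass_lt_top (by linarith [abs_nonneg γ])
  have hN2 : krnMass d N γ < ∞ := krnMass_lt_top (by linarith [abs_nonneg σ])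
  obtain ⟨m, C, hC, hm⟩ := enorm_setIntegral_le hg.out N
  let H : ℕ → Euc d → Euc d → ℝ≥0∞ := fun n x y =>
    (B n)ᶜ.indicator (fun a => ‖localFourier g f a.1 a.2‖ₑ) (x, y)
  have hH : ∀ n, Measurable (Function.uncurry (H n)) := fun n =>
    (measurable_amp g f).indicator (hB n).compl
  have hlim : Tendsto (fun n => mixNorm q σ p γ (H n)) atTop (𝓝 0) := by
    rw [wNorm_eq] at hf
    refine mixNorm_tendsto_zero hq.out hqt hp.out hpt (measurable_amp g f) hf hH
      (fun n x y => Set.indicator_le_self' (fun _ _ => zero_le) _) fun x y => ?_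
    refine tendsto_const_nhds.congr' ?_
    filter_upwards [eventually_ge_atTop ⌈‖(x, y)‖⌉₊] with n hn
    have : (x, y) ∉ (B n)ᶜ := by
      rw [Set.notMem_compl_iff]
      simpa only [B, mem_closedBall_zero_iff] using (Nat.le_ceil _).trans (Nat.cast_le.2 hn)
    exact (Set.indicator_of_notMem this _).symm
  have hbd : ∀ n, wNorm g q σ p γ (f - toDist (u n)) ≤ ENNReal.ofReal (C * ssn m g) *
      (krnMass d N σ * krnMass d N γ * mixNorm q σ p γ (H n)) := fun n => by
    have h1 := mixNorm_le_of_kav (H' := amp g (f - toDist (u n))) (H := H n) (σ := σ) (γ := γ)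
      hq.out hp.out 0 N
      (ENNReal.ofReal (C * ssn m g)) (hH n) fun x y => by
        rw [neg_zero, wt_zero, one_mul, amp, localFourier, hu]
        exact hm f g _ (hB n).compl x y
    rwa [add_zero, ← wNorm_eq] at h1
  have hlim' : Tendsto (fun n => wNorm g q σ p γ (f - toDist (u n))) atTop (𝓝 0) := by
    refine tendsto_of_tendsto_of_tendsto_of_le_of_le tendsto_const_nhds ?_ (fun _ => zero_le) hbd
    have h1 := ENNReal.Tendsto.const_mul hlim
      (Or.inr (ENNReal.mul_ne_top hN1.ne hN2.ne))
    have h2 := ENNReal.Tendsto.const_mul h1 (Or.inr (ENNReal.ofReal_ne_top (r := C * ssn m g)))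
    simpa using h2
  refine ⟨hf, fun ε hε => ?_⟩
  obtain ⟨n, hn⟩ := (hlim'.eventually (gt_mem_nhds (ENNReal.half_pos hε.ne'))).exists
  obtain ⟨φ, hφ⟩ := (memClosure_toDist (u n)).2 (ε / 2) (ENNReal.half_pos hε.ne')
  refine ⟨φ, ?_⟩
  have : f - (φ : 𝓢'(Euc d, ℂ)) =
      (f - toDist (u n)) + (toDist (u n) - (φ : 𝓢'(Euc d, ℂ))) := by abel
  rw [this]
  calc _ ≤ _ := wNorm_add_le hq.out hp.out _ _
    _ < ε / 2 + ε / 2 := ENNReal.add_lt_add hn hφ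
    _ = ε := ENNReal.add_halves ε

theorem memW_iff_memClosure (f : 𝓢'(Euc d, ℂ)) : MemW g q σ p γ f ↔ MemClosure g q σ p γ f := by
  constructor
  · rintro ⟨h1, h2⟩
    by_cases h : p = ∞ ∨ q = ∞
    · exact ⟨h1, h2 h⟩
    · rw [not_or] at h
      exact memClosure_of_wNorm_lt_top h.2 h.1 h1
  · rintro ⟨h1, h2⟩
    exact ⟨h1, fun _ => h2⟩

end

/-! ### The symbols of the propagators and their derivatives -/

section


variable {d : ℕ}

/-- The coefficients of the power series of `r ↦ cos √r`. -/
def cosCoeff (n : ℕ) : ℝ := (-1) ^ n / (2 * n).factorial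

/-- The entire function `r ↦ cos √r`. -/
def cosSqrt (r : ℝ) : ℝ := FormalMultilinearSeries.ofScalarsSum cosCoeff r

/-- The ratio test gives infinite radius of convergence. Composed with |ξ|², this shows that the
symbols are smooth at ξ = 0 although |ξ| is not. -/
lemma contDiff_cosSqrt (n : ℕ∞) : ContDiff ℝ n cosSqrt := by
  have hr : (FormalMultilinearSeries.ofScalars ℝ cosCoeff).radius = ⊤ := by
    refine FormalMultilinearSeries.ofScalars_radius_eq_top_of_tendsto ℝ _
      (Eventually.of_forall fun n => ?_) ?_
    · rw [cosCoeff]; positivity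
    · have h1 : ∀ n : ℕ, ‖cosCoeff n.succ‖ / ‖cosCoeff n‖ = 1 / ((2 * n + 1) * (2 * n + 2) : ℝ) := by
        intro n
        have h2 : (2 * n.succ).factorial = (2 * n + 2) * ((2 * n + 1) * (2 * n).factorial) := by
          rw [show 2 * n.succ = (2 * n + 1) + 1 by lia, Nat.factorial_succ, Nat.factorial_succ]
        have h3 : ((2 * n).factorial : ℝ) ≠ 0 := by positivity
        rw [cosCoeff, cosCoeff, norm_div, norm_div, norm_pow, norm_pow, norm_neg, norm_one, one_pow,
          one_pow, h2, Real.norm_natCast, Real.norm_natCast]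
        push_cast
        field_simp
      simp only [h1]
      refine squeeze_zero (fun n => by positivity) (fun n => ?_)
        (tendsto_one_div_add_atTop_nhds_zero_nat (𝕜 := ℝ))
      refine one_div_le_one_div_of_le (by positivity) ?_
      have : (0 : ℝ) ≤ n := n.cast_nonneg
      nlinarith
  have h1 := (FormalMultilinearSeries.ofScalars ℝ cosCoeff).hasFPowerSeriesOnBall
    (by rw [hr]; exact ENNReal.zero_lt_top)
  rw [hr] at h1
  have h2 : AnalyticOnNhd ℝ cosSqrt Set.univ := by
    have := h1.analyticOnNhd
    rwa [Metric.eball_top] at this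
  have h3 : ContDiffOn ℝ n cosSqrt Set.univ := h2.contDiffOn uniqueDiffOn_univ
  exact contDiffOn_univ.1 h3

lemma cosSqrt_sq (x : ℝ) : cosSqrt (x ^ 2) = Real.cos x := by
  rw [cosSqrt, FormalMultilinearSeries.ofScalars_sum_eq, ← (Real.hasSum_cos x).tsum_eq]
  refine tsum_congr fun n => ?_
  rw [cosCoeff, smul_eq_mul, ← pow_mul]
  ring

lemma differentiable_iteratedDeriv_cosSqrt (k : ℕ) : Differentiable ℝ (iteratedDeriv k cosSqrt) :=
  (contDiff_cosSqrt ⊤).differentiable_iteratedDeriv k (mod_cast WithTop.coe_lt_top _)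

lemma hasDerivAt_iteratedDeriv_cosSqrt (k : ℕ) (r : ℝ) :
    HasDerivAt (iteratedDeriv k cosSqrt) (iteratedDeriv (k + 1) cosSqrt r) r := by
  rw [iteratedDeriv_succ]
  exact (differentiable_iteratedDeriv_cosSqrt k r).hasDerivAt

lemma hasDerivAt_iteratedDeriv_cosSqrt_sq (k : ℕ) (x : ℝ) :
    HasDerivAt (fun x => iteratedDeriv k cosSqrt (x ^ 2))
      (iteratedDeriv (k + 1) cosSqrt (x ^ 2) * (2 * x)) x := by
  have h1 : HasDerivAt (fun x : ℝ => x ^ 2) (2 * x) x := by simpa using hasDerivAt_pow 2 x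
  exact (hasDerivAt_iteratedDeriv_cosSqrt k (x ^ 2)).comp x h1

lemma two_mul_deriv_cosSqrt_sq (x : ℝ) :
    iteratedDeriv 1 cosSqrt (x ^ 2) * (2 * x) = -Real.sin x := by
  have h1 := hasDerivAt_iteratedDeriv_cosSqrt_sq 0 x
  simp only [iteratedDeriv_zero, cosSqrt_sq] at h1
  exact h1.unique (Real.hasDerivAt_cos x)

/-- The differential equation of `r ↦ cos √r` and its derivatives. -/
lemma cosSqrt_ode (k : ℕ) : ∀ r : ℝ, 0 < r → 4 * r * iteratedDeriv (k + 2) cosSqrt r +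
    (4 * k + 2) * iteratedDeriv (k + 1) cosSqrt r + iteratedDeriv k cosSqrt r = 0 := by
  induction k with
  | zero =>
    intro r hr
    have hx : (Real.sqrt r) ^ 2 = r := Real.sq_sqrt hr.le
    set x := Real.sqrt r
    have h1 : HasDerivAt (fun x => iteratedDeriv 1 cosSqrt (x ^ 2) * (2 * x))
        (iteratedDeriv 2 cosSqrt (x ^ 2) * (2 * x) * (2 * x) +
          iteratedDeriv 1 cosSqrt (x ^ 2) * 2) x := by
      have h2 : HasDerivAt (fun x : ℝ => 2 * x) 2 x := by simpa using (hasDerivAt_id x).const_mul 2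
      exact (hasDerivAt_iteratedDeriv_cosSqrt_sq 1 x).mul h2
    simp only [two_mul_deriv_cosSqrt_sq] at h1
    have h3 := h1.unique (Real.hasDerivAt_sin x).neg
    rw [← cosSqrt_sq, hx] at h3
    simp only [iteratedDeriv_zero]
    push_cast
    linear_combination h3 - 4 * iteratedDeriv 2 cosSqrt r * hx
  | succ k ih =>
    intro r hr
    have h1 : HasDerivAt (fun r => 4 * r * iteratedDeriv (k + 2) cosSqrt r +
        (4 * k + 2) * iteratedDeriv (k + 1) cosSqrt r + iteratedDeriv k cosSqrt r)
        (4 * iteratedDeriv (k + 2) cosSqrt r + 4 * r * iteratedDeriv (k + 3) cosSqrt r +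
        (4 * k + 2) * iteratedDeriv (k + 2) cosSqrt r + iteratedDeriv (k + 1) cosSqrt r) r := by
      have h4 : HasDerivAt (fun r : ℝ => 4 * r) 4 r := by simpa using (hasDerivAt_id r).const_mul 4
      exact ((h4.mul (hasDerivAt_iteratedDeriv_cosSqrt (k + 2) r)).add
        ((hasDerivAt_iteratedDeriv_cosSqrt (k + 1) r).const_mul _)).add
        (hasDerivAt_iteratedDeriv_cosSqrt k r)
    have h2 : (fun r => 4 * r * iteratedDeriv (k + 2) cosSqrt r +
        (4 * k + 2) * iteratedDeriv (k + 1) cosSqrt r + iteratedDeriv k cosSqrt r) =ᶠ[𝓝 r]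
        fun _ => 0 := by
      filter_upwards [lt_mem_nhds hr] with x hx using ih x hx
    have h3 := (h1.congr_of_eventuallyEq h2.symm).unique (hasDerivAt_const r (0 : ℝ))
    push_cast
    linear_combination h3

/-- Each derivative gains r^{-1/2}. Orders 0 and 1 are the bounds for cosine and sine; afterwards
the differential equation, divided by 4r, expresses the derivative of order k + 2 through the two
preceding ones. -/
lemma exists_bound_cosSqrt_of_one_le (k : ℕ) : ∃ c : ℝ, 0 ≤ c ∧ ∀ r : ℝ, 1 ≤ r →
    |iteratedDeriv k cosSqrt r| * Real.sqrt r ^ k ≤ c := by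
  induction k using Nat.strong_induction_on with
  | _ k ih =>
    match k with
    | 0 =>
      refine ⟨1, zero_le_one, fun r hr => ?_⟩
      rw [iteratedDeriv_zero, pow_zero, mul_one, ← Real.sq_sqrt (zero_le_one.trans hr), cosSqrt_sq]
      exact Real.abs_cos_le_one _
    | 1 =>
      refine ⟨1, zero_le_one, fun r hr => ?_⟩
      have h1 := two_mul_deriv_cosSqrt_sq (Real.sqrt r)
      rw [Real.sq_sqrt (zero_le_one.trans hr)] at h1
      have h2 := congrArg abs h1
      rw [abs_neg, abs_mul, abs_of_nonneg (show 0 ≤ 2 * Real.sqrt r by positivity)] at h2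
      have h3 := Real.abs_sin_le_one (Real.sqrt r)
      have h4 : 0 ≤ |iteratedDeriv 1 cosSqrt r| * Real.sqrt r := by positivity
      rw [pow_one]
      linarith
    | k + 2 =>
      obtain ⟨c₀, h₀, H₀⟩ := ih k (by lia)
      obtain ⟨c₁, h₁, H₁⟩ := ih (k + 1) (by lia)
      refine ⟨(4 * k + 2) * c₁ + c₀, by positivity, fun r hr => ?_⟩
      have hr0 : 0 < r := zero_lt_one.trans_le hr
      have hs : 1 ≤ Real.sqrt r := by rwa [Real.one_le_sqrt]
      have hode := cosSqrt_ode k r hr0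
      have h1 := H₀ r hr
      have h2 := H₁ r hr
      have h3 : 4 * r * |iteratedDeriv (k + 2) cosSqrt r| ≤
          (4 * k + 2) * |iteratedDeriv (k + 1) cosSqrt r| + |iteratedDeriv k cosSqrt r| := by
        have : 4 * r * iteratedDeriv (k + 2) cosSqrt r =
            -((4 * k + 2) * iteratedDeriv (k + 1) cosSqrt r + iteratedDeriv k cosSqrt r) := by
          linear_combination hode
        rw [← abs_of_pos (show 0 < 4 * r by positivity), ← abs_mul, this, abs_neg]
        refine (abs_add_le _ _).trans ?_
        rw [abs_mul, abs_of_nonneg (show (0 : ℝ) ≤ 4 * k + 2 by positivity)]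
      have hsq := Real.sq_sqrt hr0.le
      set w := Real.sqrt r
      calc |iteratedDeriv (k + 2) cosSqrt r| * w ^ (k + 2)
          = (r * |iteratedDeriv (k + 2) cosSqrt r|) * w ^ k := by rw [← hsq]; ring
        _ ≤ (4 * r * |iteratedDeriv (k + 2) cosSqrt r|) * w ^ k := by
          have : 0 ≤ r * |iteratedDeriv (k + 2) cosSqrt r| := by positivity
          refine mul_le_mul_of_nonneg_right (by linarith) (by positivity)
        _ ≤ ((4 * k + 2) * |iteratedDeriv (k + 1) cosSqrt r| + |iteratedDeriv k cosSqrt r|) *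
            w ^ k := mul_le_mul_of_nonneg_right h3 (by positivity)
        _ = (4 * k + 2) * (|iteratedDeriv (k + 1) cosSqrt r| * w ^ k) +
            |iteratedDeriv k cosSqrt r| * w ^ k := by ring
        _ ≤ (4 * k + 2) * (|iteratedDeriv (k + 1) cosSqrt r| * w ^ (k + 1)) +
            |iteratedDeriv k cosSqrt r| * w ^ k := by
          gcongr
          lia
        _ ≤ _ := by gcongr

lemma exists_bound_cosSqrt (k : ℕ) : ∃ c : ℝ, 0 ≤ c ∧ ∀ r : ℝ, 0 ≤ r →
    |iteratedDeriv k cosSqrt r| * Real.sqrt (1 + r) ^ k ≤ c := by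
  obtain ⟨c, hc, h⟩ := exists_bound_cosSqrt_of_one_le k
  have hcont : Continuous fun r => |iteratedDeriv k cosSqrt r| * Real.sqrt (1 + r) ^ k := by
    have := (differentiable_iteratedDeriv_cosSqrt k).continuous
    fun_prop
  obtain ⟨b, hb⟩ := (isCompact_Icc (a := (0 : ℝ)) (b := 1)).bddAbove_image hcont.continuousOn
  refine ⟨max b (Real.sqrt 2 ^ k * c), le_max_of_le_right (by positivity), fun r hr => ?_⟩
  rcases le_total r 1 with h1 | h1
  · exact (hb (Set.mem_image_of_mem _ ⟨hr, h1⟩)).trans (le_max_left _ _)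
  · refine le_trans ?_ (le_max_right _ _)
    calc |iteratedDeriv k cosSqrt r| * Real.sqrt (1 + r) ^ k
        ≤ |iteratedDeriv k cosSqrt r| * (Real.sqrt 2 * Real.sqrt r) ^ k := by
          gcongr
          rw [← Real.sqrt_mul (by norm_num)]
          exact Real.sqrt_le_sqrt (by linarith)
      _ = Real.sqrt 2 ^ k * (|iteratedDeriv k cosSqrt r| * Real.sqrt r ^ k) := by
          rw [mul_pow]; ring
      _ ≤ _ := by gcongr; exact h r h1

/-- The entire function `r ↦ sinc √r`. -/
def sincSqrt (r : ℝ) : ℝ := -2 * iteratedDeriv 1 cosSqrt r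

/-- Away from 0 this is the derivative of cosSqrt(x²) = cos x. Both sides are continuous, so the
identity extends to x = 0. -/
lemma sincSqrt_sq (x : ℝ) : sincSqrt (x ^ 2) = Real.sinc x := by
  have h0 : ∀ x : ℝ, x ≠ 0 → sincSqrt (x ^ 2) = Real.sinc x := fun x hx => by
    have h1 := two_mul_deriv_cosSqrt_sq x
    rw [Real.sinc_of_ne_zero hx, sincSqrt, eq_div_iff hx]
    linear_combination -h1
  have hc : Continuous fun x : ℝ => sincSqrt (x ^ 2) := by
    have := (differentiable_iteratedDeriv_cosSqrt 1).continuous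
    unfold sincSqrt
    fun_prop
  have := Continuous.ext_on (s := {(0 : ℝ)}ᶜ) (dense_compl_singleton 0) hc Real.continuous_sinc
    fun x hx => h0 x hx
  exact congrFun this x

lemma contDiff_sincSqrt (n : ℕ∞) : ContDiff ℝ n sincSqrt := by
  have h1 : ContDiff ℝ n (iteratedDeriv 1 cosSqrt) := by
    have h2 := contDiff_cosSqrt ⊤
    rw [iteratedDeriv_one]
    exact (contDiff_infty_iff_deriv.1 h2).2.of_le (mod_cast le_top)
  have h3 : ContDiff ℝ n (fun _ : ℝ => (-2 : ℝ)) := contDiff_const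
  exact h3.mul h1

lemma iteratedDeriv_sincSqrt (k : ℕ) (r : ℝ) :
    iteratedDeriv k sincSqrt r = -2 * iteratedDeriv (k + 1) cosSqrt r := by
  have h1 : sincSqrt = fun r => -2 * deriv cosSqrt r := by
    ext r; rw [sincSqrt, iteratedDeriv_one]
  rw [h1, iteratedDeriv_const_mul_field, ← iteratedDeriv_succ']

/-- The function is quadratic: its derivative is linear, the second derivative is constant and all
higher ones vanish. -/
lemma norm_iteratedFDeriv_norm_sq_le (x : Euc d) (j : ℕ) :
    ‖iteratedFDeriv ℝ (j + 1) (fun ξ : Euc d => ‖ξ‖ ^ 2) x‖ ≤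
      if j = 0 then 2 * ‖x‖ else if j = 1 then 2 else 0 := by
  let L : Euc d →L[ℝ] Euc d →L[ℝ] ℝ := 2 • innerSL ℝ
  have hL : ∀ y, ‖L y‖ ≤ 2 * ‖y‖ := fun y => by
    have h1 : L y = 2 • innerSL ℝ y := rfl
    rw [h1, two_nsmul, two_mul]
    refine (norm_add_le _ _).trans ?_
    rw [innerSL_apply_norm]
  have h1 : fderiv ℝ (fun ξ : Euc d => ‖ξ‖ ^ 2) = L := fderiv_norm_sq
  rw [← norm_iteratedFDeriv_fderiv, h1]
  rcases j with _ | j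
  · rw [norm_iteratedFDeriv_zero]
    simpa using hL x
  have h2 : fderiv ℝ L = fun _ => L := by
    ext1 y
    exact L.hasFDerivAt.fderiv
  rw [← norm_iteratedFDeriv_fderiv, h2]
  rcases j with _ | j
  · rw [norm_iteratedFDeriv_zero]
    simpa using ContinuousLinearMap.opNorm_le_bound _ (by norm_num) hL
  · rw [iteratedFDeriv_succ_const]
    simp

/-- Derivatives of `ξ ↦ F (τ² |ξ|²)` for functions `F` whose derivatives decay like those of
`cos √r`. -/
lemma exists_bound_comp_norm_sq {F : ℝ → ℝ} (hF : ContDiff ℝ ((⊤ : ℕ∞) : WithTop ℕ∞) F) (b : ℕ) (n : ℕ)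
    (hb : ∀ k, ∃ c : ℝ, 0 ≤ c ∧ ∀ r : ℝ, 0 ≤ r →
      |iteratedDeriv k F r| * Real.sqrt (1 + r) ^ (k + b) ≤ c) :
    ∃ c : ℝ, 0 ≤ c ∧ ∀ (τ : ℝ) (x : Euc d),
      ‖iteratedFDeriv ℝ n (fun ξ : Euc d => F (τ ^ 2 * ‖ξ‖ ^ 2)) x‖ * bracket (τ • x) ^ b ≤
        c * |τ| ^ n := by
  choose c hc hcb using hb
  set A := ∑ k ∈ Finset.range (n + 1), 2 ^ k * c k with hA
  have hA0 : 0 ≤ A := Finset.sum_nonneg fun k _ => by have := hc k; positivity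
  refine ⟨n.factorial * A * 2 ^ n, by positivity, fun τ x => ?_⟩
  -- The scale Λ, frozen at the point x, balances the composition F(Λ · (τ²/Λ)|ξ|²). The inner
  -- function then has derivatives of order i at most (2|τ|)^i at x, and the decay of F^{(i)}
  -- compensates the factor Λ^i of the outer one, so that the Faà di Bruno bound can be used.
  set Λ : ℝ := 1 + |τ| * ‖x‖ with hΛ
  have hΛ1 : 1 ≤ Λ := by have : 0 ≤ |τ| * ‖x‖ := by positivity
                         linarith
  have hΛ0 : 0 < Λ := by linarith
  set w := bracket (τ • x) with hw
  have hwe : w = Real.sqrt (1 + τ ^ 2 * ‖x‖ ^ 2) := by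
    rw [hw, bracket, norm_smul, mul_pow, Real.norm_eq_abs, sq_abs]
  have hw0 : 0 < w := bracket_pos _
  have hΛw : Λ ≤ 2 * w := by
    have := one_add_norm_le (τ • x)
    rwa [norm_smul, Real.norm_eq_abs] at this
  have hcomp : (fun ξ : Euc d => F (τ ^ 2 * ‖ξ‖ ^ 2)) =
      (fun u => F (Λ * u)) ∘ fun ξ : Euc d => (τ ^ 2 / Λ) • ‖ξ‖ ^ 2 := by
    ext ξ
    simp only [Function.comp_apply, smul_eq_mul]
    congr 1
    field_simp
  have hsq : ContDiff ℝ ((⊤ : ℕ∞) : WithTop ℕ∞) (fun ξ : Euc d => ‖ξ‖ ^ 2) := contDiff_norm_sq ℝ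
  have hf : ContDiff ℝ ((⊤ : ℕ∞) : WithTop ℕ∞) (fun ξ : Euc d => (τ ^ 2 / Λ) • ‖ξ‖ ^ 2) :=
    hsq.const_smul _
  have hgc : ContDiff ℝ ((⊤ : ℕ∞) : WithTop ℕ∞) (fun u => F (Λ * u)) := hF.comp (contDiff_const.mul contDiff_id)
  have key := norm_iteratedFDeriv_comp_le (n := n) hgc hf (mod_cast le_top) x
    (C := A / w ^ b) (D := 2 * |τ|) (fun i hi => ?_) (fun i hi1 hi => ?_)
  · rw [hcomp]
    calc _ ≤ n.factorial * (A / w ^ b) * (2 * |τ|) ^ n * w ^ b := by gcongr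
      _ = _ := by rw [mul_pow]; field_simp
  · rw [norm_iteratedFDeriv_eq_norm_iteratedDeriv,
      iteratedDeriv_comp_const_mul (hF.of_le (mod_cast le_top)), Real.norm_eq_abs]
    rw [le_div_iff₀ (by positivity)]
    have h1 := hcb i (τ ^ 2 * ‖x‖ ^ 2) (by positivity)
    rw [← hwe] at h1
    have h2 : Λ * ((τ ^ 2 / Λ) • ‖x‖ ^ 2) = τ ^ 2 * ‖x‖ ^ 2 := by
      rw [smul_eq_mul]; field_simp
    simp only [h2]
    rw [abs_mul, abs_of_nonneg (show 0 ≤ Λ ^ i by positivity)]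
    calc Λ ^ i * |iteratedDeriv i F (τ ^ 2 * ‖x‖ ^ 2)| * w ^ b
        ≤ (2 * w) ^ i * |iteratedDeriv i F (τ ^ 2 * ‖x‖ ^ 2)| * w ^ b := by gcongr
      _ = 2 ^ i * (|iteratedDeriv i F (τ ^ 2 * ‖x‖ ^ 2)| * w ^ (i + b)) := by
          rw [mul_pow, pow_add]; ring
      _ ≤ 2 ^ i * c i := by gcongr
      _ ≤ A := Finset.single_le_sum (f := fun k => 2 ^ k * c k)
          (fun k _ => by have := hc k; positivity) (Finset.mem_range.2 (by lia))
  · obtain ⟨j, rfl⟩ : ∃ j, i = j + 1 := ⟨i - 1, by lia⟩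
    have h3 := norm_iteratedFDeriv_norm_sq_le x j
    have h4 : iteratedFDeriv ℝ (j + 1) (fun ξ : Euc d => (τ ^ 2 / Λ) • ‖ξ‖ ^ 2) x =
        (τ ^ 2 / Λ) • iteratedFDeriv ℝ (j + 1) (fun ξ : Euc d => ‖ξ‖ ^ 2) x :=
      iteratedFDeriv_const_smul_apply' (hsq.of_le (mod_cast le_top)).contDiffAt
    rw [h4, norm_smul, Real.norm_of_nonneg (by positivity)]
    have ht : τ ^ 2 = |τ| ^ 2 := (sq_abs τ).symm
    match j with
    | 0 =>
      rw [if_pos rfl] at h3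
      calc τ ^ 2 / Λ * _ ≤ τ ^ 2 / Λ * (2 * ‖x‖) := by gcongr
        _ = (2 * |τ|) * (|τ| * ‖x‖ / Λ) := by rw [ht]; ring
        _ ≤ (2 * |τ|) * 1 := by
          gcongr
          rw [div_le_one hΛ0]; linarith
        _ = _ := by ring
    | 1 =>
      rw [if_neg (by norm_num), if_pos rfl] at h3
      calc τ ^ 2 / Λ * _ ≤ τ ^ 2 / 1 * 2 := by gcongr
        _ ≤ _ := by rw [ht]; nlinarith [sq_nonneg |τ|]
    | j + 2 =>
      rw [if_neg (by lia), if_neg (by lia)] at h3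
      rw [le_antisymm h3 (norm_nonneg _), mul_zero]
      positivity

/-- The symbol of `cos (t √(-Δ))`. -/
def cosSymbol (t : ℝ) (ξ : Euc d) : ℂ := ((Real.cos (2 * Real.pi * t * ‖ξ‖) : ℝ) : ℂ)

/-- The symbol of `sin (t √(-Δ)) / √(-Δ)`. -/
def sinSymbol (t : ℝ) (ξ : Euc d) : ℂ := ((t * Real.sinc (2 * Real.pi * t * ‖ξ‖) : ℝ) : ℂ)

lemma cosSymbol_eq (t : ℝ) : (cosSymbol t : Euc d → ℂ) =
    Complex.ofRealCLM ∘ fun ξ => cosSqrt ((2 * Real.pi * t) ^ 2 * ‖ξ‖ ^ 2) := by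
  ext ξ
  simp only [cosSymbol, Function.comp_apply, Complex.ofRealCLM_apply]
  rw [← mul_pow, cosSqrt_sq]

lemma sinSymbol_eq (t : ℝ) : (sinSymbol t : Euc d → ℂ) =
    Complex.ofRealCLM ∘ fun ξ => t • sincSqrt ((2 * Real.pi * t) ^ 2 * ‖ξ‖ ^ 2) := by
  ext ξ
  simp only [sinSymbol, Function.comp_apply, Complex.ofRealCLM_apply, smul_eq_mul]
  rw [← mul_pow, sincSqrt_sq]

lemma contDiff_comp_norm_sq {F : ℝ → ℝ} (hF : ContDiff ℝ ((⊤ : ℕ∞) : WithTop ℕ∞) F) (τ : ℝ) :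
    ContDiff ℝ ((⊤ : ℕ∞) : WithTop ℕ∞) fun ξ : Euc d => F (τ ^ 2 * ‖ξ‖ ^ 2) := by
  have hsq : ContDiff ℝ ((⊤ : ℕ∞) : WithTop ℕ∞) (fun ξ : Euc d => ‖ξ‖ ^ 2) := contDiff_norm_sq ℝ
  exact hF.comp (contDiff_const.mul hsq)

lemma contDiff_cosSymbol (t : ℝ) : ContDiff ℝ ((⊤ : ℕ∞) : WithTop ℕ∞) (cosSymbol t : Euc d → ℂ) := by
  rw [cosSymbol_eq]
  have h := contDiff_comp_norm_sq (d := d) (contDiff_cosSqrt ⊤) (2 * Real.pi * t)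
  exact Complex.ofRealCLM.contDiff.comp h

lemma contDiff_sinSymbol (t : ℝ) : ContDiff ℝ ((⊤ : ℕ∞) : WithTop ℕ∞) (sinSymbol t : Euc d → ℂ) := by
  rw [sinSymbol_eq]
  have h := contDiff_comp_norm_sq (d := d) (contDiff_sincSqrt ⊤) (2 * Real.pi * t)
  exact Complex.ofRealCLM.contDiff.comp (h.const_smul t)

lemma exists_bound_cosSymbol (n : ℕ) : ∃ c : ℝ, 0 ≤ c ∧ ∀ (t : ℝ) (x : Euc d),
    ‖iteratedFDeriv ℝ n (cosSymbol t) x‖ ≤ c * |t| ^ n := by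
  obtain ⟨c, hc, h⟩ := exists_bound_comp_norm_sq (d := d) (contDiff_cosSqrt ⊤) 0 n
    exists_bound_cosSqrt
  refine ⟨c * (2 * Real.pi) ^ n, by positivity, fun t x => ?_⟩
  have h1 := h (2 * Real.pi * t) x
  have h2 : c * |2 * Real.pi * t| ^ n = c * (2 * Real.pi) ^ n * |t| ^ n := by
    rw [abs_mul, abs_of_pos Real.two_pi_pos, mul_pow, ← mul_assoc]
  rw [pow_zero, mul_one, h2] at h1
  rw [cosSymbol_eq]
  refine (Complex.ofRealCLM.norm_iteratedFDeriv_comp_left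
    (contDiff_comp_norm_sq (contDiff_cosSqrt ⊤) _).contDiffAt (mod_cast le_top)).trans ?_
  rwa [Complex.ofRealCLM_norm, one_mul]

lemma exists_bound_sinSymbol (n : ℕ) : ∃ c : ℝ, 0 ≤ c ∧ ∀ (t : ℝ) (x : Euc d),
    ‖iteratedFDeriv ℝ n (sinSymbol t) x‖ * bracket ((2 * Real.pi * t) • x) ≤ c * |t| ^ (n + 1) := by
  obtain ⟨c, hc, h⟩ := exists_bound_comp_norm_sq (d := d) (contDiff_sincSqrt ⊤) 1 n fun k => by
    obtain ⟨c, hc, h⟩ := exists_bound_cosSqrt (k + 1)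
    refine ⟨2 * c, by positivity, fun r hr => ?_⟩
    rw [iteratedDeriv_sincSqrt, abs_mul, abs_neg, abs_two, mul_assoc]
    exact mul_le_mul_of_nonneg_left (h r hr) zero_le_two
  refine ⟨c * (2 * Real.pi) ^ n, by positivity, fun t x => ?_⟩
  have h1 := h (2 * Real.pi * t) x
  have h5 : c * |2 * Real.pi * t| ^ n = c * (2 * Real.pi) ^ n * |t| ^ n := by
    rw [abs_mul, abs_of_pos Real.two_pi_pos, mul_pow, ← mul_assoc]
  rw [pow_one, h5] at h1
  have hcd := contDiff_comp_norm_sq (d := d) (contDiff_sincSqrt ⊤) (2 * Real.pi * t)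
  have h2 : ‖iteratedFDeriv ℝ n (sinSymbol t) x‖ ≤
      |t| * ‖iteratedFDeriv ℝ n (fun ξ : Euc d => sincSqrt ((2 * Real.pi * t) ^ 2 * ‖ξ‖ ^ 2)) x‖ := by
    rw [sinSymbol_eq]
    refine (Complex.ofRealCLM.norm_iteratedFDeriv_comp_left
      (hcd.const_smul t).contDiffAt (mod_cast le_top)).trans ?_
    rw [Complex.ofRealCLM_norm, one_mul]
    have h3 := iteratedFDeriv_const_smul_apply' (a := t) (i := n) (x := x)
      (hcd.of_le (mod_cast le_top)).contDiffAt
    exact (le_of_eq (congrArg norm h3)).trans (by rw [norm_smul, Real.norm_eq_abs])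
  have h4 := bracket_pos ((2 * Real.pi * t) • x)
  calc _ ≤ (|t| * ‖iteratedFDeriv ℝ n (fun ξ : Euc d => sincSqrt ((2 * Real.pi * t) ^ 2 * ‖ξ‖ ^ 2)) x‖)
        * bracket ((2 * Real.pi * t) • x) := by gcongr
    _ = |t| * (‖iteratedFDeriv ℝ n (fun ξ : Euc d => sincSqrt ((2 * Real.pi * t) ^ 2 * ‖ξ‖ ^ 2)) x‖
        * bracket ((2 * Real.pi * t) • x)) := by ring
    _ ≤ |t| * (c * (2 * Real.pi) ^ n * |t| ^ n) := by gcongr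
    _ = _ := by ring

lemma hasTemperateGrowth_cosSymbol (t : ℝ) : (cosSymbol t : Euc d → ℂ).HasTemperateGrowth := by
  refine ⟨contDiff_cosSymbol t, fun n => ?_⟩
  obtain ⟨c, -, h⟩ := exists_bound_cosSymbol (d := d) n
  exact ⟨0, c * |t| ^ n, fun x => by simpa using h t x⟩

lemma hasTemperateGrowth_sinSymbol (t : ℝ) : (sinSymbol t : Euc d → ℂ).HasTemperateGrowth := by
  refine ⟨contDiff_sinSymbol t, fun n => ?_⟩
  obtain ⟨c, -, h⟩ := exists_bound_sinSymbol (d := d) n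
  refine ⟨0, c * |t| ^ (n + 1), fun x => ?_⟩
  rw [pow_zero, mul_one]
  refine le_trans ?_ (h t x)
  exact le_mul_of_one_le_right (norm_nonneg _) (one_le_bracket _)

lemma exists_bound_cosSymbol_of_le_one (n : ℕ) : ∃ c : ℝ, 0 ≤ c ∧ ∀ t : ℝ, |t| ≤ 1 → ∀ x : Euc d,
    ‖iteratedFDeriv ℝ n (cosSymbol t) x‖ ≤ c := by
  obtain ⟨c, hc, h⟩ := exists_bound_cosSymbol (d := d) n
  exact ⟨c, hc, fun t ht x => (h t x).trans
    (mul_le_of_le_one_right hc (pow_le_one₀ (abs_nonneg t) ht))⟩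

/-- One decay estimate yields both bounds. The factor |t| serves for continuity in time, and the
factor ⟨x⟩^{-1}, uniform in t, is the gain of one derivative. -/
lemma exists_bound_sinSymbol_of_le_one (n : ℕ) : ∃ c : ℝ, 0 ≤ c ∧ ∀ t : ℝ, |t| ≤ 1 → ∀ x : Euc d,
    ‖iteratedFDeriv ℝ n (sinSymbol t) x‖ ≤ c * |t| ∧
    ‖iteratedFDeriv ℝ n (sinSymbol t) x‖ ≤ c * bracket x ^ (-1 : ℝ) := by
  obtain ⟨c, hc, h⟩ := exists_bound_sinSymbol (d := d) n
  refine ⟨c, hc, fun t ht x => ?_⟩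
  have h1 := h t x
  have hb := bracket_pos x
  have hb' := one_le_bracket ((2 * Real.pi * t) • x)
  have h2 : ‖iteratedFDeriv ℝ n (sinSymbol t) x‖ * bracket ((2 * Real.pi * t) • x) ≤ c * |t| := by
    refine h1.trans (mul_le_mul_of_nonneg_left ?_ hc)
    rw [pow_succ]
    exact mul_le_of_le_one_left (abs_nonneg t) (pow_le_one₀ (abs_nonneg t) ht)
  refine ⟨(le_mul_of_one_le_right (norm_nonneg _) hb').trans h2, ?_⟩
  rw [Real.rpow_neg_one, ← div_eq_mul_inv, le_div_iff₀ hb]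
  -- This exchanges the small factor |t| for decay in x, and it is where |t| ≤ 1 enters.
  have h3 : |t| * bracket x ≤ bracket ((2 * Real.pi * t) • x) := by
    rw [bracket, bracket, ← Real.sqrt_sq (abs_nonneg t), ← Real.sqrt_mul (sq_nonneg _)]
    refine Real.sqrt_le_sqrt ?_
    rw [norm_smul, Real.norm_eq_abs, abs_mul, abs_of_pos Real.two_pi_pos]
    have h5 : |t| ^ 2 ≤ 1 := pow_le_one₀ (abs_nonneg t) ht
    have h6 : 1 ≤ (2 * Real.pi) ^ 2 := by nlinarith [Real.pi_gt_three]
    have h7 : 0 ≤ |t| ^ 2 * ‖x‖ ^ 2 := by positivity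
    calc |t| ^ 2 * (1 + ‖x‖ ^ 2) = |t| ^ 2 + 1 * (|t| ^ 2 * ‖x‖ ^ 2) := by ring
      _ ≤ 1 + (2 * Real.pi) ^ 2 * (|t| ^ 2 * ‖x‖ ^ 2) := by gcongr
      _ = _ := by ring
  rcases eq_or_ne t 0 with rfl | ht0
  · have : ‖iteratedFDeriv ℝ n (sinSymbol 0) x‖ ≤ 0 := by
      refine (le_mul_of_one_le_right (norm_nonneg _) hb').trans (h2.trans ?_)
      simp
    rw [le_antisymm this (norm_nonneg _), zero_mul]
    exact hc
  · have ht' : 0 < |t| := abs_pos.2 ht0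
    refine le_of_mul_le_mul_right ?_ ht'
    calc _ = ‖iteratedFDeriv ℝ n (sinSymbol t) x‖ * (|t| * bracket x) := by ring
      _ ≤ ‖iteratedFDeriv ℝ n (sinSymbol t) x‖ * bracket ((2 * Real.pi * t) • x) := by gcongr
      _ ≤ _ := h2

/-- Sum-to-product, written with sinc so that every factor is a smooth symbol. The factor at (s -
t)/2 is O(|s - t|), and the growth |ξ|² is harmless on Schwartz functions. -/
lemma cosSymbol_sub (s t : ℝ) (ξ : Euc d) : cosSymbol s ξ - cosSymbol t ξ =
    -8 * (Real.pi : ℂ) ^ 2 * ((‖ξ‖ ^ 2 : ℝ) : ℂ) *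
      (sinSymbol ((s + t) / 2) ξ * sinSymbol ((s - t) / 2) ξ) := by
  have hs : ∀ r : ℝ, 2 * Real.pi * ‖ξ‖ * (r * Real.sinc (2 * Real.pi * r * ‖ξ‖)) =
      Real.sin (2 * Real.pi * r * ‖ξ‖) := fun r => by
    rcases eq_or_ne (2 * Real.pi * r * ‖ξ‖) 0 with h | h
    · rw [h, Real.sin_zero, Real.sinc_zero]; linarith
    · rw [Real.sinc_of_ne_zero h]
      calc _ = (2 * Real.pi * r * ‖ξ‖) *
            (Real.sin (2 * Real.pi * r * ‖ξ‖) / (2 * Real.pi * r * ‖ξ‖)) := by ring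
        _ = _ := mul_div_cancel₀ _ h
  have h1 := hs ((s + t) / 2)
  have h2 := hs ((s - t) / 2)
  have h3 := Real.cos_sub_cos (2 * Real.pi * s * ‖ξ‖) (2 * Real.pi * t * ‖ξ‖)
  rw [show (2 * Real.pi * s * ‖ξ‖ + 2 * Real.pi * t * ‖ξ‖) / 2 =
    2 * Real.pi * ((s + t) / 2) * ‖ξ‖ by ring, show (2 * Real.pi * s * ‖ξ‖ - 2 * Real.pi * t * ‖ξ‖) / 2
    = 2 * Real.pi * ((s - t) / 2) * ‖ξ‖ by ring, ← h1, ← h2] at h3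
  simp only [cosSymbol, sinSymbol]
  rw [← Complex.ofReal_sub, h3]
  push_cast
  ring

lemma sinSymbol_sub (s t : ℝ) (ξ : Euc d) : sinSymbol s ξ - sinSymbol t ξ =
    2 * (cosSymbol ((s + t) / 2) ξ * sinSymbol ((s - t) / 2) ξ) := by
  simp only [cosSymbol, sinSymbol]
  rcases eq_or_ne ξ 0 with rfl | hξ
  · simp
    ring
  have hn : ‖ξ‖ ≠ 0 := norm_ne_zero_iff.2 hξ
  have hs : ∀ r : ℝ, (r * Real.sinc (2 * Real.pi * r * ‖ξ‖)) =
      Real.sin (2 * Real.pi * r * ‖ξ‖) / (2 * Real.pi * ‖ξ‖) := fun r => by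
    rcases eq_or_ne (2 * Real.pi * r * ‖ξ‖) 0 with h | h
    · have hr : r = 0 := by
        rcases mul_eq_zero.1 h with h | h
        · exact (mul_eq_zero.1 h).resolve_left Real.two_pi_pos.ne'
        · exact absurd h hn
      simp [hr]
    · have hr : r ≠ 0 := by rintro rfl; simp at h
      rw [Real.sinc_of_ne_zero h]
      field_simp
  rw [hs, hs, hs]
  have h3 := Real.sin_sub_sin (2 * Real.pi * s * ‖ξ‖) (2 * Real.pi * t * ‖ξ‖)
  rw [show (2 * Real.pi * s * ‖ξ‖ + 2 * Real.pi * t * ‖ξ‖) / 2 =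
    2 * Real.pi * ((s + t) / 2) * ‖ξ‖ by ring, show (2 * Real.pi * s * ‖ξ‖ - 2 * Real.pi * t * ‖ξ‖) / 2
    = 2 * Real.pi * ((s - t) / 2) * ‖ξ‖ by ring] at h3
  rw [← Complex.ofReal_sub, ← sub_div, h3]
  push_cast
  ring

end

/-! ### Fourier multipliers and propagators on the amalgam spaces -/

section


variable {d : ℕ}

lemma fourierInv_shiftedWindow (h : 𝓢(Euc d, ℂ)) (x y : Euc d) :
    𝓕⁻ (shiftedWindow h x y) = tr y (𝓕⁻ (tr x h)) := by
  ext ξ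
  rw [fourierInv_apply_eq, SchwartzMap.compSubConstCLM_apply, fourierInv_apply_eq]
  refine integral_congr_ae (Eventually.of_forall fun z => ?_)
  simp only [shiftedWindow_apply, SchwartzMap.compSubConstCLM_apply]
  rw [show -(ξ - y) = -ξ + y by abel, chr_add_left, mul_assoc]

lemma fourierInv_tr (h : 𝓢(Euc d, ℂ)) (x ξ : Euc d) : 𝓕⁻ (tr x h) ξ = chr (-ξ) x * 𝓕⁻ h ξ := by
  rw [fourierInv_apply_eq, fourierInv_apply_eq, ← integral_add_right_eq_self _ x,
    ← integral_const_mul]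
  refine integral_congr_ae (Eventually.of_forall fun z => ?_)
  simp only [SchwartzMap.compSubConstCLM_apply, add_sub_cancel_right, chr_add_right]
  ring

lemma hasTemperateGrowth_shift {m : Euc d → ℂ} (hm : m.HasTemperateGrowth) (y : Euc d) :
    (fun ξ => m (ξ + y)).HasTemperateGrowth := by
  have h : (fun ξ : Euc d => ξ + y).HasTemperateGrowth := by fun_prop
  exact hm.comp h

/-- The window transformed by a Fourier multiplier and demodulated. -/
def multiplierWindow (m : Euc d → ℂ) (h : 𝓢(Euc d, ℂ)) (y : Euc d) : 𝓢(Euc d, ℂ) :=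
  𝓕 (SchwartzMap.smulLeftCLM ℂ (fun ξ => m (ξ + y)) (𝓕⁻ h))

/-- A multiplier commutes with translations, and moving it past a modulation by y shifts its symbol
by y. It therefore sends the shifted window to the same shift of a window depending only on y. -/
lemma fourierMultiplier_shiftedWindow {m : Euc d → ℂ} (hm : m.HasTemperateGrowth)
    (h : 𝓢(Euc d, ℂ)) (x y : Euc d) :
    𝓕 (SchwartzMap.smulLeftCLM ℂ m (𝓕⁻ (shiftedWindow h x y))) =
      shiftedWindow (multiplierWindow m h y) x y := by
  have h1 : SchwartzMap.smulLeftCLM ℂ m (𝓕⁻ (shiftedWindow h x y)) =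
      𝓕⁻ (shiftedWindow (multiplierWindow m h y) x y) := by
    ext ξ
    rw [SchwartzMap.smulLeftCLM_apply_apply hm, fourierInv_shiftedWindow, fourierInv_shiftedWindow,
      SchwartzMap.compSubConstCLM_apply, SchwartzMap.compSubConstCLM_apply, fourierInv_tr,
      fourierInv_tr, multiplierWindow, FourierTransform.fourierInv_fourier_eq,
      SchwartzMap.smulLeftCLM_apply_apply (hasTemperateGrowth_shift hm y), sub_add_cancel,
      smul_eq_mul, smul_eq_mul]
    ring
  rw [h1, FourierTransform.fourier_fourierInv_eq]

lemma bracket_rpow_le (r : ℝ) (y ξ : Euc d) :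
    bracket (ξ + y) ^ r ≤ (2 * (1 + ‖ξ‖)) ^ |r| * bracket y ^ r := by
  have h := wt_le_mul r (ξ + y) (-ξ)
  rw [norm_neg, show ξ + y + -ξ = y by abel, wt, wt, ← ENNReal.ofReal_mul (by positivity),
    ENNReal.ofReal_le_ofReal_iff
      (mul_nonneg (by positivity) (Real.rpow_pos_of_pos (bracket_pos y) r).le)] at h
  exact h

/-- Peetre's inequality replaces ⟨ξ + y⟩^{-r} by ⟨y⟩^{-r} times (2(1 + ‖ξ‖))^{|r|}. This polynomial
factor is absorbed by the decay of 𝓕⁻ h, at the price of L more seminorm orders. -/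
lemma exists_ssn_multiplierWindow_le (r : ℝ) (M : ℕ) : ∃ (N M' : ℕ) (C : ℝ), 0 ≤ C ∧
    ∀ (m : Euc d → ℂ), m.HasTemperateGrowth → ∀ A : ℝ, 0 ≤ A →
    (∀ n ≤ N, ∀ ξ, ‖iteratedFDeriv ℝ n m ξ‖ ≤ A * bracket ξ ^ (-r)) →
    ∀ (h : 𝓢(Euc d, ℂ)) (y : Euc d),
      ssn M (multiplierWindow m h y) ≤ C * A * ssn M' (𝓕⁻ h) * bracket y ^ (-r) := by
  obtain ⟨N, C, hC, hN⟩ := ssn_clm (FourierTransform.fourierCLM ℂ 𝓢(Euc d, ℂ)) M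
  obtain ⟨L, hL⟩ := exists_nat_ge |r|
  refine ⟨N, N + L, C * (2 ^ N * (2 ^ L * 2 ^ (N + L))), by positivity,
    fun m hm A hA hb h y => ?_⟩
  set ψ := 𝓕⁻ h with hψ
  have hw := Real.rpow_pos_of_pos (bracket_pos y) (-r)
  have hψ0 : 0 ≤ ssn (N + L) ψ := apply_nonneg _ _
  refine (hN _).trans ?_
  have key : ssn N (SchwartzMap.smulLeftCLM ℂ (fun ξ => m (ξ + y)) ψ) ≤
      (2 ^ N * (2 ^ L * 2 ^ (N + L))) * A * ssn (N + L) ψ * bracket y ^ (-r) := by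
    refine ssn_le (by positivity) fun n hn ξ => ?_
    have hcoe : (SchwartzMap.smulLeftCLM ℂ (fun ξ => m (ξ + y)) ψ : Euc d → ℂ) =
        fun ξ => m (ξ + y) * ψ ξ := by
      ext ξ
      rw [SchwartzMap.smulLeftCLM_apply_apply (hasTemperateGrowth_shift hm y), smul_eq_mul]
    rw [hcoe]
    have hP : 0 < 1 + ‖ξ‖ := by positivity
    have h1 : ∀ i ≤ n, ‖iteratedFDeriv ℝ i (fun ξ => m (ξ + y)) ξ‖ ≤
        A * ((2 * (1 + ‖ξ‖)) ^ L * bracket y ^ (-r)) := fun i hi => by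
      rw [iteratedFDeriv_comp_add_right]
      refine (hb i (hi.trans hn) _).trans (mul_le_mul_of_nonneg_left ?_ hA)
      refine (bracket_rpow_le (-r) y ξ).trans ?_
      gcongr
      rw [abs_neg, ← Real.rpow_natCast]
      exact Real.rpow_le_rpow_of_exponent_le (by linarith [norm_nonneg ξ]) hL
    have h2 : ∀ i ≤ n, ‖iteratedFDeriv ℝ i ψ ξ‖ ≤
        2 ^ (N + L) * ssn (N + L) ψ / (1 + ‖ξ‖) ^ (N + L) := fun i hi => by
      rw [le_div_iff₀ (by positivity), mul_comm]
      exact ssn_bound le_rfl (by lia) ψ ξ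
    have h3 := norm_iteratedFDeriv_mul_le_of_le
      ((hasTemperateGrowth_shift hm y).1.of_le (mod_cast le_top)) ((ψ.smooth ⊤).of_le (mod_cast le_top))
      h1 h2
    calc (1 + ‖ξ‖) ^ N * _ ≤ (1 + ‖ξ‖) ^ N * (2 ^ n * (A * ((2 * (1 + ‖ξ‖)) ^ L * bracket y ^ (-r)) *
          (2 ^ (N + L) * ssn (N + L) ψ / (1 + ‖ξ‖) ^ (N + L)))) := by gcongr
      _ = (2 ^ n * (2 ^ L * 2 ^ (N + L))) * A * ssn (N + L) ψ * bracket y ^ (-r) := by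
        rw [mul_pow, pow_add (1 + ‖ξ‖)]
        field_simp
      _ ≤ _ := by
        gcongr
        exact one_le_two
  calc C * _ ≤ C * _ := mul_le_mul_of_nonneg_left key hC
    _ = _ := by ring

/-- The Fourier multiplier with symbol `m`. -/
abbrev mult (m : Euc d → ℂ) : 𝓢'(Euc d, ℂ) →L[ℂ] 𝓢'(Euc d, ℂ) :=
  TemperedDistribution.fourierMultiplierCLM ℂ m

/-- Fourier multipliers whose derivatives are of order `-r` gain `r` derivatives. -/
theorem wNorm_mult_le {g : 𝓢(Euc d, ℂ)} (hg : g ≠ 0) {q p : ℝ≥0∞} (hq : 1 ≤ q) (hp : 1 ≤ p)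
    {σ σ' r : ℝ} (hσ : σ' = σ + r) (γ : ℝ) : ∃ (N : ℕ) (C : ℝ), 0 ≤ C ∧
    ∀ (m : Euc d → ℂ), m.HasTemperateGrowth → ∀ A : ℝ, 0 ≤ A →
    (∀ n ≤ N, ∀ ξ, ‖iteratedFDeriv ℝ n m ξ‖ ≤ A * bracket ξ ^ (-r)) →
    ∀ f, wNorm g q σ' p γ (mult m f) ≤ ENNReal.ofReal (C * A) * wNorm g q σ p γ f := by
  subst hσ
  obtain ⟨M, C, hC, H⟩ := wNorm_le_of_shiftedWindow hg hq hp σ r γ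
  obtain ⟨N, M', C', hC', H'⟩ := exists_ssn_multiplierWindow_le (d := d) r M
  have h0 : 0 ≤ ssn M' (𝓕⁻ g) := apply_nonneg _ _
  refine ⟨N, C * (C' * ssn M' (𝓕⁻ g)), by positivity, fun m hm A hA hb f => ?_⟩
  have h1 := H g f (mult m f) (multiplierWindow m g) (C' * A * ssn M' (𝓕⁻ g)) (by positivity)
    (fun x y => by
      rw [TemperedDistribution.fourierMultiplierCLM_apply_apply,
        fourierMultiplier_shiftedWindow hm]) (fun y => H' m hm A hA hb g y)
  refine h1.trans (le_of_eq ?_)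
  congr 2
  ring

lemma mult_coe {m : Euc d → ℂ} (hm : m.HasTemperateGrowth) (φ : 𝓢(Euc d, ℂ)) :
    mult m (φ : 𝓢'(Euc d, ℂ)) = (SchwartzMap.fourierMultiplierCLM ℂ m φ : 𝓢(Euc d, ℂ)) :=
  TemperedDistribution.fourierMultiplierCLM_toTemperedDistributionCLM_eq hm φ

lemma mult_sub_mult {a b c : Euc d → ℂ} (ha : a.HasTemperateGrowth) (hb : b.HasTemperateGrowth)
    (hc : c.HasTemperateGrowth) (h : ∀ ξ, a ξ - b ξ = c ξ) (f : 𝓢'(Euc d, ℂ)) :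
    mult a f - mult b f = mult c f := by
  ext u
  have h1 : (mult a f - mult b f) u = mult a f u - mult b f u := rfl
  rw [h1]
  simp only [TemperedDistribution.fourierMultiplierCLM_apply_apply]
  rw [← map_sub]
  congr 1
  refine (map_sub (FourierTransform.fourierCLM ℂ 𝓢(Euc d, ℂ)) _ _).symm.trans ?_
  refine congrArg (FourierTransform.fourierCLM ℂ 𝓢(Euc d, ℂ)) ?_
  ext ξ
  rw [sub_apply, SchwartzMap.smulLeftCLM_apply_apply ha,
    SchwartzMap.smulLeftCLM_apply_apply hb, SchwartzMap.smulLeftCLM_apply_apply hc, ← sub_smul, h]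

section

variable {g : 𝓢(Euc d, ℂ)} {q : ℝ≥0∞} {σ σ' : ℝ} {p : ℝ≥0∞} {γ : ℝ}
  [hq : Fact (1 ≤ q)] [hp : Fact (1 ≤ p)] [hg : Fact (g ≠ 0)]

/-- Operators on distributions which preserve the Schwartz class and are bounded for the amalgam
norms act on the amalgam spaces. -/
theorem exists_lift (T : 𝓢'(Euc d, ℂ) →L[ℂ] 𝓢'(Euc d, ℂ)) {C : ℝ} (hC : 0 ≤ C)
    (hb : ∀ f, wNorm g q σ' p γ (T f) ≤ ENNReal.ofReal C * wNorm g q σ p γ f)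
    (hS : ∀ φ : 𝓢(Euc d, ℂ), ∃ ψ : 𝓢(Euc d, ℂ), T (φ : 𝓢'(Euc d, ℂ)) = (ψ : 𝓢'(Euc d, ℂ))) :
    ∃ L : WSpace g q σ p γ →L[ℂ] WSpace g q σ' p γ, ‖L‖ ≤ C ∧
      ∀ f, toDist (L f) = T (toDist f) := by
  have hmem : ∀ f : WSpace g q σ p γ, MemClosure g q σ' p γ (T (toDist f)) := fun f => by
    refine ⟨(hb _).trans_lt (ENNReal.mul_lt_top ENNReal.ofReal_lt_top (memClosure_toDist f).1),
      fun ε hε => ?_⟩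
    have h1 : Tendsto (fun δ : ℝ≥0∞ => ENNReal.ofReal C * δ) (𝓝 0) (𝓝 0) := by
      have := ENNReal.Tendsto.const_mul (a := ENNReal.ofReal C) (tendsto_id (x := 𝓝 (0 : ℝ≥0∞)))
        (Or.inr ENNReal.ofReal_ne_top)
      simpa using this
    obtain ⟨δ, hδ0, hδ⟩ : ∃ δ : ℝ≥0∞, 0 < δ ∧ ENNReal.ofReal C * δ < ε := by
      have h2 := h1.eventually (gt_mem_nhds hε)
      obtain ⟨δ, hδ, h3⟩ := ENNReal.nhds_zero_basis.eventually_iff.1 h2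
      obtain ⟨η, hη0, hη⟩ := exists_between hδ
      exact ⟨η, hη0, h3 hη⟩
    obtain ⟨φ, hφ⟩ := (memClosure_toDist f).2 δ hδ0
    obtain ⟨ψ, hψ⟩ := hS φ
    refine ⟨ψ, ?_⟩
    rw [← hψ, ← map_sub]
    exact (hb _).trans_lt ((mul_le_mul_right hφ.le _).trans_lt hδ)
  let L : WSpace g q σ p γ →ₗ[ℂ] WSpace g q σ' p γ :=
    { toFun := fun f => ofDist (T (toDist f)) (hmem f)
      map_add' := fun f f' => toDist_injective (by
        change T (toDist (f + f')) = T (toDist f) + T (toDist f')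
        rw [map_add, map_add])
      map_smul' := fun c f => toDist_injective (by
        change T (toDist (c • f)) = c • T (toDist f)
        rw [map_smul, map_smul]) }
  have hL : ∀ f, ‖L f‖ ≤ C * ‖f‖ := fun f => by
    have h1 := hb (toDist f)
    rw [← ofReal_norm_wspace, ← ENNReal.ofReal_mul hC] at h1
    rw [norm_def]
    exact ENNReal.toReal_le_of_le_ofReal (by positivity) h1
  exact ⟨L.mkContinuous C hL, L.mkContinuous_norm_le hC hL, fun f => rfl⟩

theorem exists_lift_mult {r : ℝ} (hσ : σ' = σ + r) : ∃ (N : ℕ) (C : ℝ), 0 ≤ C ∧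
    ∀ (m : Euc d → ℂ), m.HasTemperateGrowth → ∀ A : ℝ, 0 ≤ A →
    (∀ n ≤ N, ∀ ξ, ‖iteratedFDeriv ℝ n m ξ‖ ≤ A * bracket ξ ^ (-r)) →
    ∃ L : WSpace g q σ p γ →L[ℂ] WSpace g q σ' p γ, ‖L‖ ≤ C * A ∧
      ∀ f, toDist (L f) = mult m (toDist f) := by
  obtain ⟨N, C, hC, h⟩ := wNorm_mult_le hg.out hq.out hp.out hσ γ
  exact ⟨N, C, hC, fun m hm A hA hb => exists_lift (mult m) (by positivity) (h m hm A hA hb)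
    fun φ => ⟨_, mult_coe hm φ⟩⟩

lemma continuousOn_of_dense {E F : Type*} [NormedAddCommGroup E] [NormedSpace ℂ E]
    [NormedAddCommGroup F] [NormedSpace ℂ F] {S : Set ℝ} {A : ℝ → E →L[ℂ] F} {M : ℝ}
    (hM : ∀ t ∈ S, ‖A t‖ ≤ M) {D : Set E} (hD : Dense D)
    (h : ∀ f ∈ D, ContinuousOn (fun t => A t f) S) (f : E) : ContinuousOn (fun t => A t f) S := by
  intro t₀ ht₀
  have hM0 : 0 ≤ M := (norm_nonneg _).trans (hM t₀ ht₀)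
  rw [ContinuousWithinAt, Metric.tendsto_nhds]
  intro ε hε
  obtain ⟨f', hf', hff'⟩ := hD.exists_dist_lt f (show 0 < ε / (3 * (M + 1)) by positivity)
  have h1 := Metric.tendsto_nhds.1 (h f' hf' t₀ ht₀) (ε / 3) (by positivity)
  have hb : ∀ t ∈ S, dist (A t f) (A t f') ≤ ε / 3 := fun t ht => by
    rw [dist_eq_norm, ← map_sub]
    calc ‖A t (f - f')‖ ≤ M * ‖f - f'‖ := (A t).le_of_opNorm_le (hM t ht) _
      _ ≤ (M + 1) * (ε / (3 * (M + 1))) := by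
        rw [dist_eq_norm] at hff'
        exact mul_le_mul (by linarith) hff'.le (norm_nonneg _) (by linarith)
      _ = ε / 3 := by field_simp
  filter_upwards [h1, self_mem_nhdsWithin] with t ht htS
  calc dist (A t f) (A t₀ f) ≤ dist (A t f) (A t f') + dist (A t f') (A t₀ f') +
        dist (A t₀ f') (A t₀ f) := dist_triangle4 _ _ _ _
    _ < ε / 3 + ε / 3 + ε / 3 := by
      have h3 := hb t htS
      have h4 := hb t₀ ht₀
      rw [dist_comm] at h4
      linarith
    _ = ε := by ring

lemma exists_max_bound {P : ℕ → ℝ → Prop} (hP : ∀ n c c', c ≤ c' → P n c → P n c')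
    (h : ∀ n, ∃ c : ℝ, 0 ≤ c ∧ P n c) (N : ℕ) : ∃ c : ℝ, 0 ≤ c ∧ ∀ n ≤ N, P n c := by
  choose c hc h using h
  refine ⟨∑ n ∈ Finset.range (N + 1), c n, Finset.sum_nonneg fun n _ => hc n, fun n hn => ?_⟩
  exact hP n _ _ (Finset.single_le_sum (f := c) (fun n _ => hc n) (Finset.mem_range.2 (by lia))) (h n)

lemma exists_bound_cosSymbol_upto (N : ℕ) : ∃ c : ℝ, 0 ≤ c ∧ ∀ n ≤ N, ∀ t : ℝ, |t| ≤ 1 →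
    ∀ x : Euc d, ‖iteratedFDeriv ℝ n (cosSymbol t) x‖ ≤ c :=
  exists_max_bound (P := fun n c => ∀ t : ℝ, |t| ≤ 1 →
    ∀ x : Euc d, ‖iteratedFDeriv ℝ n (cosSymbol t) x‖ ≤ c)
    (fun _ _ _ hcc h t ht x => (h t ht x).trans hcc) exists_bound_cosSymbol_of_le_one N

lemma exists_bound_sinSymbol_upto (N : ℕ) : ∃ c : ℝ, 0 ≤ c ∧ ∀ n ≤ N, ∀ t : ℝ, |t| ≤ 1 →
    ∀ x : Euc d, ‖iteratedFDeriv ℝ n (sinSymbol t) x‖ ≤ c * |t| ∧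
    ‖iteratedFDeriv ℝ n (sinSymbol t) x‖ ≤ c * bracket x ^ (-1 : ℝ) :=
  exists_max_bound (P := fun n c => ∀ t : ℝ, |t| ≤ 1 →
    ∀ x : Euc d, ‖iteratedFDeriv ℝ n (sinSymbol t) x‖ ≤ c * |t| ∧
    ‖iteratedFDeriv ℝ n (sinSymbol t) x‖ ≤ c * bracket x ^ (-1 : ℝ))
    (fun _ _ _ hcc h t ht x => ⟨(h t ht x).1.trans (by gcongr),
      (h t ht x).2.trans (mul_le_mul_of_nonneg_right hcc
        (Real.rpow_pos_of_pos (bracket_pos x) _).le)⟩) exists_bound_sinSymbol_of_le_one N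

lemma exists_norm_mult_sinSymbol_le (g : 𝓢(Euc d, ℂ)) [hg : Fact (g ≠ 0)] (q : ℝ≥0∞) (σ : ℝ)
    (p : ℝ≥0∞) (γ : ℝ) [hq : Fact (1 ≤ q)] [hp : Fact (1 ≤ p)] :
    ∃ C : ℝ, 0 ≤ C ∧ ∀ t : ℝ, |t| ≤ 1 → ∀ f,
      wNorm g q σ p γ (mult (sinSymbol t) f) ≤ ENNReal.ofReal (C * |t|) * wNorm g q σ p γ f := by
  obtain ⟨N, C, hC, h⟩ := wNorm_mult_le (σ := σ) (σ' := σ) (r := 0) hg.out hq.out hp.out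
    (add_zero σ).symm γ
  obtain ⟨c, hc, hb⟩ := exists_bound_sinSymbol_upto (d := d) N
  refine ⟨C * c, by positivity, fun t ht f => ?_⟩
  have := h (sinSymbol t) (hasTemperateGrowth_sinSymbol t) (c * |t|) (by positivity)
    (fun n hn ξ => by simpa using (hb n hn t ht ξ).1) f
  rwa [← mul_assoc] at this

/-- The propagator `cos (t √(-Δ))` on the amalgam spaces. -/
theorem exists_waveCos (g : 𝓢(Euc d, ℂ)) [hg : Fact (g ≠ 0)] (q : ℝ≥0∞) (σ : ℝ)
    (p : ℝ≥0∞) (γ : ℝ) [hq : Fact (1 ≤ q)] [hp : Fact (1 ≤ p)] :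
    ∃ (A : ℝ → WSpace g q σ p γ →L[ℂ] WSpace g q σ p γ) (M : ℝ), 0 ≤ M ∧
      (∀ t, |t| ≤ 1 → ‖A t‖ ≤ M ∧ ∀ f, toDist (A t f) = waveCos t (toDist f)) ∧
      ∀ f, ContinuousOn (fun t => A t f) {t | |t| ≤ 1} := by
  obtain ⟨N, C, hC, h⟩ := exists_lift_mult (g := g) (q := q) (p := p) (γ := γ) (σ := σ) (σ' := σ)
    (r := 0) (add_zero σ).symm
  obtain ⟨c, hc, hb⟩ := exists_bound_cosSymbol_upto (d := d) N
  have h1 : ∀ t : ℝ, ∃ L : WSpace g q σ p γ →L[ℂ] WSpace g q σ p γ, |t| ≤ 1 →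
      ‖L‖ ≤ C * c ∧ ∀ f, toDist (L f) = waveCos t (toDist f) := fun t => by
    by_cases ht : |t| ≤ 1
    · obtain ⟨L, hL⟩ := h (cosSymbol t) (hasTemperateGrowth_cosSymbol t) c hc
        (fun n hn ξ => by simpa using hb n hn t ht ξ)
      exact ⟨L, fun _ => hL⟩
    · exact ⟨0, fun h => absurd h ht⟩
  choose A hA using h1
  refine ⟨A, C * c, by positivity, hA, ?_⟩
  -- Uniform boundedness reduces strong continuity to the dense set of Schwartz functions.
  refine continuousOn_of_dense (M := C * c) (fun t ht => (hA t ht).1)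
    (denseRange_ofSchwartz (g := g) (q := q) (σ := σ) (p := p) (γ := γ)) ?_
  rintro _ ⟨φ, rfl⟩
  obtain ⟨C', hC', hs⟩ := exists_norm_mult_sinSymbol_le g q σ p γ
  have hP : (fun ξ : Euc d => -8 * (Real.pi : ℂ) ^ 2 * ((‖ξ‖ ^ 2 : ℝ) : ℂ)).HasTemperateGrowth := by
    fun_prop
  -- The unbounded factor |ξ|² of the difference of cosines is applied to φ and leaves a Schwartz
  -- function. The two sine multipliers are then bounded, one with norm O(|s - t|), so the orbit is
  -- Lipschitz in time.
  set Φ : 𝓢'(Euc d, ℂ) := mult (fun ξ : Euc d => -8 * (Real.pi : ℂ) ^ 2 * ((‖ξ‖ ^ 2 : ℝ) : ℂ)) φ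
    with hΦ
  have hΦfin : wNorm g q σ p γ Φ ≠ ∞ := by
    rw [hΦ, mult_coe hP]
    exact (memClosure_coe _).1.ne
  have hdiff : ∀ s, |s| ≤ 1 → ∀ t, |t| ≤ 1 → ‖A s (ofSchwartz φ) - A t (ofSchwartz φ)‖ ≤
      C' * C' * (wNorm g q σ p γ Φ).toReal * |s - t| := fun s hs1 t ht1 => by
    have hst : |(s + t) / 2| ≤ 1 := by rw [abs_le] at *; constructor <;> linarith
    have hst' : |(s - t) / 2| ≤ 1 := by rw [abs_le] at *; constructor <;> linarith
    have e1 : toDist (A s (ofSchwartz φ) - A t (ofSchwartz φ)) =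
        mult (sinSymbol ((s - t) / 2)) (mult (sinSymbol ((s + t) / 2)) Φ) := by
      rw [map_sub, (hA s hs1).2, (hA t ht1).2, hΦ,
        TemperedDistribution.fourierMultiplierCLM_fourierMultiplierCLM_apply hP
          (hasTemperateGrowth_sinSymbol _),
        TemperedDistribution.fourierMultiplierCLM_fourierMultiplierCLM_apply
          (hP.mul (hasTemperateGrowth_sinSymbol _)) (hasTemperateGrowth_sinSymbol _)]
      refine mult_sub_mult (hasTemperateGrowth_cosSymbol s) (hasTemperateGrowth_cosSymbol t)
        ((hP.mul (hasTemperateGrowth_sinSymbol _)).mul (hasTemperateGrowth_sinSymbol _))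
        (fun ξ => ?_) _
      rw [cosSymbol_sub]
      simp only [Pi.mul_apply]
      ring
    have h2 := hs _ hst' (mult (sinSymbol ((s + t) / 2)) Φ)
    have h3 := hs _ hst Φ
    rw [norm_def, e1]
    refine ENNReal.toReal_le_of_le_ofReal (by positivity) ?_
    calc _ ≤ ENNReal.ofReal (C' * |(s - t) / 2|) * (ENNReal.ofReal (C' * |(s + t) / 2|) *
          wNorm g q σ p γ Φ) := h2.trans (mul_le_mul_right h3 _)
      _ ≤ ENNReal.ofReal (C' * |s - t|) * (ENNReal.ofReal (C' * 1) * wNorm g q σ p γ Φ) := by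
          have h8 : |(s - t) / 2| ≤ |s - t| := by
            rw [abs_div, abs_two]; linarith [abs_nonneg (s - t)]
          exact mul_le_mul' (ENNReal.ofReal_le_ofReal (mul_le_mul_of_nonneg_left h8 hC'))
            (mul_le_mul_left (ENNReal.ofReal_le_ofReal (mul_le_mul_of_nonneg_left hst hC')) _)
      _ = _ := by
          rw [mul_one, ← ENNReal.ofReal_toReal hΦfin, ← ENNReal.ofReal_mul hC',
            ← ENNReal.ofReal_mul (by positivity), ENNReal.toReal_ofReal ENNReal.toReal_nonneg]
          congr 1; ring
  intro t ht
  rw [ContinuousWithinAt, tendsto_iff_norm_sub_tendsto_zero]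
  have h4 : Tendsto (fun s : ℝ => C' * C' * (wNorm g q σ p γ Φ).toReal * |s - t|)
      (𝓝[{t | |t| ≤ 1}] t) (𝓝 0) := by
    have : Continuous fun s : ℝ => C' * C' * (wNorm g q σ p γ Φ).toReal * |s - t| := by fun_prop
    simpa using (this.tendsto t).mono_left nhdsWithin_le_nhds
  refine squeeze_zero' (Eventually.of_forall fun _ => norm_nonneg _) ?_ h4
  filter_upwards [self_mem_nhdsWithin] with s hs1 using hdiff s hs1 t ht

/-- The propagator `sin (t √(-Δ)) / √(-Δ)` on the amalgam spaces gains one derivative. -/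
theorem exists_waveSin (g : 𝓢(Euc d, ℂ)) [hg : Fact (g ≠ 0)] (q : ℝ≥0∞) (σ : ℝ)
    (p : ℝ≥0∞) (γ : ℝ) [hq : Fact (1 ≤ q)] [hp : Fact (1 ≤ p)] :
    ∃ (B : ℝ → WSpace g q (σ - 1) p γ →L[ℂ] WSpace g q σ p γ) (M : ℝ), 0 ≤ M ∧
      (∀ t, |t| ≤ 1 → ‖B t‖ ≤ M ∧ ∀ f, toDist (B t f) = waveSin t (toDist f)) ∧
      ∀ f, ContinuousOn (fun t => B t f) {t | |t| ≤ 1} := by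
  obtain ⟨N, C, hC, h⟩ := exists_lift_mult (g := g) (q := q) (p := p) (γ := γ) (σ := σ - 1)
    (σ' := σ) (r := 1) (by ring)
  obtain ⟨c, hc, hb⟩ := exists_bound_sinSymbol_upto (d := d) N
  have h1 : ∀ t : ℝ, ∃ L : WSpace g q (σ - 1) p γ →L[ℂ] WSpace g q σ p γ, |t| ≤ 1 →
      ‖L‖ ≤ C * c ∧ ∀ f, toDist (L f) = waveSin t (toDist f) := fun t => by
    by_cases ht : |t| ≤ 1
    · obtain ⟨L, hL⟩ := h (sinSymbol t) (hasTemperateGrowth_sinSymbol t) c hc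
        (fun n hn ξ => (hb n hn t ht ξ).2)
      exact ⟨L, fun _ => hL⟩
    · exact ⟨0, fun h => absurd h ht⟩
  choose B hB using h1
  refine ⟨B, C * c, by positivity, hB, ?_⟩
  refine continuousOn_of_dense (M := C * c) (fun t ht => (hB t ht).1)
    (denseRange_ofSchwartz (g := g) (q := q) (σ := σ - 1) (p := p) (γ := γ)) ?_
  rintro _ ⟨φ, rfl⟩
  obtain ⟨C', hC', hs⟩ := exists_norm_mult_sinSymbol_le g q σ p γ
  obtain ⟨A, M, hM, hA, -⟩ := exists_waveCos g q σ p γ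
  set Φ : 𝓢'(Euc d, ℂ) := mult (fun ξ : Euc d => (2 : ℂ)) φ with hΦ
  have hΦS : Φ = ((2 : ℂ) • φ : 𝓢(Euc d, ℂ)) := by
    have h := DFunLike.congr_fun (TemperedDistribution.fourierMultiplierCLM_const (E := Euc d)
      (F := ℂ) (2 : ℂ)) (φ : 𝓢'(Euc d, ℂ))
    exact h.trans
      (map_smul (SchwartzMap.toTemperedDistributionCLM (Euc d) ℂ volume) (2 : ℂ) φ).symm
  have hP : (fun _ : Euc d => (2 : ℂ)).HasTemperateGrowth := by fun_prop
  have hΦfin : wNorm g q σ p γ Φ ≠ ∞ := by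
    rw [hΦS]
    exact (memClosure_coe _).1.ne
  have hdiff : ∀ s, |s| ≤ 1 → ∀ t, |t| ≤ 1 → ‖B s (ofSchwartz φ) - B t (ofSchwartz φ)‖ ≤
      C' * M * (wNorm g q σ p γ Φ).toReal * |s - t| := fun s hs1 t ht1 => by
    have hst : |(s + t) / 2| ≤ 1 := by rw [abs_le] at *; constructor <;> linarith
    have hst' : |(s - t) / 2| ≤ 1 := by rw [abs_le] at *; constructor <;> linarith
    -- The difference of sines factors into a bounded cosine multiplier and a sine multiplier of
    -- norm O(|s - t|), so no derivative falls on φ here.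
    have e1 : toDist (B s (ofSchwartz φ) - B t (ofSchwartz φ)) =
        mult (sinSymbol ((s - t) / 2)) (mult (cosSymbol ((s + t) / 2)) Φ) := by
      rw [map_sub, (hB s hs1).2, (hB t ht1).2, hΦ,
        TemperedDistribution.fourierMultiplierCLM_fourierMultiplierCLM_apply hP
          (hasTemperateGrowth_cosSymbol _),
        TemperedDistribution.fourierMultiplierCLM_fourierMultiplierCLM_apply
          (hP.mul (hasTemperateGrowth_cosSymbol _)) (hasTemperateGrowth_sinSymbol _)]
      refine mult_sub_mult (hasTemperateGrowth_sinSymbol s) (hasTemperateGrowth_sinSymbol t)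
        ((hP.mul (hasTemperateGrowth_cosSymbol _)).mul (hasTemperateGrowth_sinSymbol _))
        (fun ξ => ?_) _
      rw [sinSymbol_sub]
      simp only [Pi.mul_apply]
      ring
    have h2 := hs _ hst' (mult (cosSymbol ((s + t) / 2)) Φ)
    have h3 : wNorm g q σ p γ (mult (cosSymbol ((s + t) / 2)) Φ) ≤
        ENNReal.ofReal M * wNorm g q σ p γ Φ := by
      have h5 := (hA _ hst).2 (ofSchwartz ((2 : ℂ) • φ))
      rw [toDist_ofSchwartz, ← hΦS] at h5
      have h6 := (A ((s + t) / 2)).le_of_opNorm_le (hA _ hst).1 (ofSchwartz ((2 : ℂ) • φ))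
      have h7 := ENNReal.ofReal_le_ofReal h6
      rw [ENNReal.ofReal_mul hM, ofReal_norm_wspace, ofReal_norm_wspace, h5, toDist_ofSchwartz,
        ← hΦS] at h7
      exact h7
    rw [norm_def, e1]
    refine ENNReal.toReal_le_of_le_ofReal (by positivity) ?_
    calc _ ≤ ENNReal.ofReal (C' * |(s - t) / 2|) * (ENNReal.ofReal M *
          wNorm g q σ p γ Φ) := h2.trans (mul_le_mul_right h3 _)
      _ ≤ ENNReal.ofReal (C' * |s - t|) * (ENNReal.ofReal M * wNorm g q σ p γ Φ) := by
          have h8 : |(s - t) / 2| ≤ |s - t| := by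
            rw [abs_div, abs_two]; linarith [abs_nonneg (s - t)]
          exact mul_le_mul_left (ENNReal.ofReal_le_ofReal (mul_le_mul_of_nonneg_left h8 hC')) _
      _ = _ := by
          rw [← ENNReal.ofReal_toReal hΦfin, ← ENNReal.ofReal_mul hM,
            ← ENNReal.ofReal_mul (by positivity), ENNReal.toReal_ofReal ENNReal.toReal_nonneg]
          congr 1; ring
  intro t ht
  rw [ContinuousWithinAt, tendsto_iff_norm_sub_tendsto_zero]
  have h4 : Tendsto (fun s : ℝ => C' * M * (wNorm g q σ p γ Φ).toReal * |s - t|)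
      (𝓝[{t | |t| ≤ 1}] t) (𝓝 0) := by
    have : Continuous fun s : ℝ => C' * M * (wNorm g q σ p γ Φ).toReal * |s - t| := by fun_prop
    simpa using (this.tendsto t).mono_left nhdsWithin_le_nhds
  refine squeeze_zero' (Eventually.of_forall fun _ => norm_nonneg _) ?_ h4
  filter_upwards [self_mem_nhdsWithin] with s hs1 using hdiff s hs1 t ht

end

end

/-! ### Abstract local well-posedness for Duhamel's formula -/

section


section Duhamel

variable {X Y : Type*} [NormedAddCommGroup X] [NormedSpace ℂ X] [NormedAddCommGroup Y]
  [NormedSpace ℂ Y]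

/-- Lipschitz continuity on bounded sets. -/
def LipschitzOnBalls (N : X → Y) : Prop :=
  ∀ ρ : ℝ, ∃ L : ℝ, 0 ≤ L ∧ ∀ u v, ‖u‖ ≤ ρ → ‖v‖ ≤ ρ → ‖N u - N v‖ ≤ L * ‖u - v‖

lemma LipschitzOnBalls.continuous {N : X → Y} (hN : LipschitzOnBalls N) : Continuous N := by
  refine continuous_iff_continuousAt.2 fun u => ?_
  obtain ⟨L, hL, h⟩ := hN (‖u‖ + 1)
  rw [ContinuousAt, tendsto_iff_norm_sub_tendsto_zero]
  have h1 : Tendsto (fun v => L * ‖v - u‖) (𝓝 u) (𝓝 0) := by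
    have : Continuous fun v => L * ‖v - u‖ := by fun_prop
    simpa using this.tendsto u
  refine squeeze_zero' (Eventually.of_forall fun _ => norm_nonneg _) ?_ h1
  filter_upwards [Metric.ball_mem_nhds u one_pos] with v hv
  refine h v u ?_ (by linarith)
  rw [mem_ball_iff_norm] at hv
  have := norm_le_norm_add_norm_sub' v u
  linarith

lemma continuous_apply_of_bounded {B : ℝ → Y →L[ℂ] X} {M : ℝ} (hM : ∀ t, ‖B t‖ ≤ M)
    (hB : ∀ y, Continuous fun t => B t y) : Continuous fun a : ℝ × Y => B a.1 a.2 := by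
  refine continuous_iff_continuousAt.2 fun ⟨t, y⟩ => ?_
  rw [ContinuousAt, tendsto_iff_norm_sub_tendsto_zero]
  have h1 : Continuous fun a : ℝ × Y => M * ‖a.2 - y‖ + ‖B a.1 y - B t y‖ := by
    have := (hB y).comp (continuous_fst (X := ℝ) (Y := Y))
    have h2 : Continuous fun a : ℝ × Y => B a.1 y := this
    fun_prop
  have h2 : Tendsto (fun a : ℝ × Y => M * ‖a.2 - y‖ + ‖B a.1 y - B t y‖) (𝓝 (t, y)) (𝓝 0) := by
    simpa using h1.tendsto (t, y)
  refine squeeze_zero (fun _ => norm_nonneg _) (fun a => ?_) h2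
  calc ‖B a.1 a.2 - B t y‖ = ‖B a.1 (a.2 - y) + (B a.1 y - B t y)‖ := by
        rw [map_sub]; congr 1; abel
    _ ≤ ‖B a.1 (a.2 - y)‖ + ‖B a.1 y - B t y‖ := norm_add_le _ _
    _ ≤ _ := by
        gcongr
        exact (B a.1).le_of_opNorm_le (hM _) _

variable (A : ℝ → X →L[ℂ] X) (B : ℝ → Y →L[ℂ] X) (N : X → Y)

/-- The right-hand side of Duhamel's formula. -/
def duhamel (x : X) (y : Y) (u : ℝ → X) (t : ℝ) : X :=
  A t x + B t y + ∫ τ in (0 : ℝ)..t, B (t - τ) (N (u τ))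

variable {A B N} {M : ℝ} (hAM : ∀ t, ‖A t‖ ≤ M) (hBM : ∀ t, ‖B t‖ ≤ M)
  (hA : ∀ x, Continuous fun t => A t x) (hB : ∀ y, Continuous fun t => B t y)
  (hN : LipschitzOnBalls N)

include hBM hB hN

lemma continuous_duhamel_integrand {u : ℝ → X} (hu : Continuous u) :
    Continuous fun a : ℝ × ℝ => B (a.1 - a.2) (N (u a.2)) := by
  have h1 : Continuous fun a : ℝ × ℝ => (a.1 - a.2, N (u a.2)) := by
    have h2 := hN.continuous.comp (hu.comp (continuous_snd (X := ℝ) (Y := ℝ)))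
    have h3 : Continuous fun a : ℝ × ℝ => a.1 - a.2 := by fun_prop
    exact h3.prodMk h2
  exact (continuous_apply_of_bounded hBM hB).comp h1

/-- The bound keeps the time integral of the difference, so that it serves both the contraction
estimate and Gronwall's inequality. -/
lemma norm_duhamel_sub_le {x x' : X} {y y' : Y} {u v : ℝ → X} {t ρ L D : ℝ} (ht : 0 ≤ t)
    (hu : Continuous u) (hv : Continuous v)
    (hL : ∀ u v, ‖u‖ ≤ ρ → ‖v‖ ≤ ρ → ‖N u - N v‖ ≤ L * ‖u - v‖)
    (huρ : ∀ τ ∈ Set.Icc 0 t, ‖u τ‖ ≤ ρ) (hvρ : ∀ τ ∈ Set.Icc 0 t, ‖v τ‖ ≤ ρ)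
    (hAM : ∀ t, ‖A t‖ ≤ M) (hD : M * ‖x - x'‖ + M * ‖y - y'‖ ≤ D) :
    ‖duhamel A B N x y u t - duhamel A B N x' y' v t‖ ≤
      D + M * L * ∫ τ in (0 : ℝ)..t, ‖u τ - v τ‖ := by
  have hcu := continuous_duhamel_integrand hBM hB hN hu
  have hcv := continuous_duhamel_integrand hBM hB hN hv
  have h1 : ∀ {w : ℝ → X}, Continuous (fun a : ℝ × ℝ => B (a.1 - a.2) (N (w a.2))) →
      IntervalIntegrable (fun τ => B (t - τ) (N (w τ))) volume 0 t := fun h =>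
    (h.comp (continuous_const.prodMk continuous_id)).intervalIntegrable _ _
  have hM : 0 ≤ M := (norm_nonneg _).trans (hAM 0)
  have e1 : duhamel A B N x y u t - duhamel A B N x' y' v t = A t (x - x') + B t (y - y') +
      ∫ τ in (0 : ℝ)..t, (B (t - τ) (N (u τ)) - B (t - τ) (N (v τ))) := by
    rw [intervalIntegral.integral_sub (h1 hcu) (h1 hcv), duhamel, duhamel, map_sub, map_sub]
    abel
  have h2 : ‖∫ τ in (0 : ℝ)..t, (B (t - τ) (N (u τ)) - B (t - τ) (N (v τ)))‖ ≤
      ∫ τ in (0 : ℝ)..t, M * L * ‖u τ - v τ‖ := by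
    refine intervalIntegral.norm_integral_le_of_norm_le ht
      (Eventually.of_forall fun τ hτ => ?_) ((by fun_prop : Continuous fun τ =>
        M * L * ‖u τ - v τ‖).intervalIntegrable _ _)
    rw [← map_sub, mul_assoc]
    refine ((B _).le_of_opNorm_le (hBM _) _).trans (mul_le_mul_of_nonneg_left ?_ hM)
    exact hL _ _ (huρ τ ⟨hτ.1.le, hτ.2⟩) (hvρ τ ⟨hτ.1.le, hτ.2⟩)
  rw [e1]
  rw [intervalIntegral.integral_const_mul] at h2
  calc _ ≤ ‖A t (x - x')‖ + ‖B t (y - y')‖ + _ := norm_add₃_le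
    _ ≤ M * ‖x - x'‖ + M * ‖y - y'‖ + M * L * ∫ τ in (0 : ℝ)..t, ‖u τ - v τ‖ := by
        gcongr
        · exact (A t).le_of_opNorm_le (hAM t) _
        · exact (B t).le_of_opNorm_le (hBM t) _
    _ ≤ _ := by gcongr

-- Gronwall's inequality in integral form. It is applied to the primitive of w, which vanishes at 0
-- and whose derivative w is at most D plus K times the primitive.
omit hBM hB hN in
lemma le_of_le_integral {w : ℝ → ℝ} (hw : Continuous w) (hw0 : ∀ t, 0 ≤ w t) {D K T : ℝ}
    (hD : 0 ≤ D) (hK : 0 < K)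
    (h : ∀ t ∈ Set.Icc 0 T, w t ≤ D + K * ∫ τ in (0 : ℝ)..t, w τ) :
    ∀ t ∈ Set.Icc 0 T, w t ≤ D * Real.exp (K * t) := by
  set Φ : ℝ → ℝ := fun t => ∫ τ in (0 : ℝ)..t, w τ with hΦ
  have hd : ∀ t, HasDerivAt Φ (w t) t := fun t => hw.integral_hasStrictDerivAt 0 t |>.hasDerivAt
  have hΦ0 : ∀ t, 0 ≤ t → 0 ≤ Φ t := fun t ht =>
    intervalIntegral.integral_nonneg ht fun τ _ => hw0 τ
  have hg := norm_le_gronwallBound_of_norm_deriv_right_le (f := Φ) (f' := w) (δ := 0) (K := K)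
    (ε := D) (a := 0) (b := T) (fun t _ => (hd t).continuousAt.continuousWithinAt)
    (fun t _ => (hd t).hasDerivWithinAt) (by simp [hΦ]) (fun t ht => by
      rw [Real.norm_of_nonneg (hw0 t), Real.norm_of_nonneg (hΦ0 t ht.1), add_comm]
      exact h t ⟨ht.1, ht.2.le⟩)
  intro t ht
  have h1 := hg t ht
  rw [Real.norm_of_nonneg (hΦ0 t ht.1), gronwallBound_of_K_ne_0 hK.ne', sub_zero] at h1
  simp only [zero_mul, zero_add] at h1
  calc w t ≤ D + K * Φ t := h t ht
    _ ≤ D + K * (D / K * (Real.exp (K * t) - 1)) := by gcongr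
    _ = _ := by field_simp; ring

lemma duhamel_solution_dist_le {x x' : X} {y y' : Y} {u v : ℝ → X} {T ρ L : ℝ}
    (hu : Continuous u) (hv : Continuous v) (hL0 : 0 ≤ L)
    (hL : ∀ u v, ‖u‖ ≤ ρ → ‖v‖ ≤ ρ → ‖N u - N v‖ ≤ L * ‖u - v‖)
    (huρ : ∀ τ ∈ Set.Icc 0 T, ‖u τ‖ ≤ ρ) (hvρ : ∀ τ ∈ Set.Icc 0 T, ‖v τ‖ ≤ ρ)
    (hAM : ∀ t, ‖A t‖ ≤ M) (hus : ∀ t ∈ Set.Icc 0 T, u t = duhamel A B N x y u t)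
    (hvs : ∀ t ∈ Set.Icc 0 T, v t = duhamel A B N x' y' v t) :
    ∀ t ∈ Set.Icc 0 T, ‖u t - v t‖ ≤
      (M * ‖x - x'‖ + M * ‖y - y'‖) * Real.exp ((M * L + 1) * t) := by
  have hM : 0 ≤ M := (norm_nonneg _).trans (hAM 0)
  refine le_of_le_integral (w := fun t => ‖u t - v t‖) (by fun_prop) (fun t => norm_nonneg _)
    (by positivity) (by positivity) fun t ht => ?_
  have h1 := norm_duhamel_sub_le hBM hB hN (x := x) (x' := x') (y := y) (y' := y') ht.1 hu hv hL
    (fun τ hτ => huρ τ ⟨hτ.1, hτ.2.trans ht.2⟩) (fun τ hτ => hvρ τ ⟨hτ.1, hτ.2.trans ht.2⟩)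
    hAM le_rfl
  rw [← hus t ht, ← hvs t ht] at h1
  refine h1.trans ?_
  have h2 : 0 ≤ ∫ τ in (0 : ℝ)..t, ‖u τ - v τ‖ :=
    intervalIntegral.integral_nonneg ht.1 fun τ _ => norm_nonneg _
  have : M * L ≤ M * L + 1 := by linarith
  gcongr

include hAM hA

variable [CompleteSpace X]

lemma exists_duhamel_solution {R : ℝ} (hR : 0 ≤ R) : ∃ (T ρ : ℝ), 0 < T ∧ T ≤ 1 ∧
    ∀ x y, ‖x‖ ≤ R → ‖y‖ ≤ R → ∃ u : ℝ → X, Continuous u ∧ (∀ t, ‖u t‖ ≤ ρ) ∧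
      ∀ t ∈ Set.Icc 0 T, u t = duhamel A B N x y u t := by
  have hM : 0 ≤ M := (norm_nonneg _).trans (hAM 0)
  -- 2MR bounds the free evolution of the data, and the additional 1 is room for the Duhamel
  -- integral.
  set ρ : ℝ := 2 * (M * R) + 1 with hρ
  have hρ0 : 0 ≤ ρ := by positivity
  obtain ⟨L, hL0, hL⟩ := hN ρ
  -- T is chosen with TK = 1/2. The first summand of K keeps the ball of radius ρ invariant, the
  -- second makes the map a contraction with constant 1/2, and the third ensures T ≤ 1.
  set K : ℝ := M * (‖N 0‖ + L * ρ) + M * L + 1 with hK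
  have hK0 : 0 < K := by positivity
  set T : ℝ := 1 / (2 * K) with hT
  have hT0 : 0 < T := by positivity
  have hTK : T * K = 1 / 2 := by rw [hT]; field_simp
  have hK1 : 1 ≤ K := by
    have : 0 ≤ M * (‖N 0‖ + L * ρ) + M * L := by positivity
    linarith
  have hT1 : T ≤ 1 := by nlinarith
  refine ⟨T, ρ, hT0, hT1, fun x y hx hy => ?_⟩
  -- Clamping time to [0, T] lets the iteration run in the bounded continuous functions on the whole
  -- line.
  let c : ℝ → ℝ := fun t => max 0 (min t T)
  have hc : Continuous c := by fun_prop
  have hcI : ∀ t, c t ∈ Set.Icc 0 T := fun t =>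
    ⟨le_max_left _ _, max_le hT0.le (min_le_right _ _)⟩
  have hcid : ∀ t ∈ Set.Icc 0 T, c t = t := fun t ht => by
    simp only [c, min_eq_left ht.2, max_eq_right ht.1]
  have hcont : ∀ u : ℝ → X, Continuous u → Continuous fun t => duhamel A B N x y u (c t) :=
    fun u hu => by
    have h1 := continuous_duhamel_integrand hBM hB hN hu
    have h2 : Continuous fun t : ℝ => ∫ τ in (0 : ℝ)..t, B (t - τ) (N (u τ)) :=
      intervalIntegral.continuous_parametric_intervalIntegral_of_continuous
        (f := fun t τ => B (t - τ) (N (u τ))) h1 continuous_id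
    exact ((hA x).add (hB y)).add h2 |>.comp hc
  have hzero : ∀ t ∈ Set.Icc 0 T, ‖duhamel A B N x y (fun _ => 0) t‖ ≤
      2 * (M * R) + T * (M * ‖N 0‖) := fun t ht => by
    have h1 : ‖∫ τ in (0 : ℝ)..t, B (t - τ) (N 0)‖ ≤ M * ‖N 0‖ * |t - 0| :=
      intervalIntegral.norm_integral_le_of_norm_le_const fun τ _ =>
        (B _).le_of_opNorm_le (hBM _) _
    rw [sub_zero, abs_of_nonneg ht.1] at h1
    calc _ ≤ ‖A t x‖ + ‖B t y‖ + ‖∫ τ in (0 : ℝ)..t, B (t - τ) (N 0)‖ := norm_add₃_le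
      _ ≤ M * R + M * R + M * ‖N 0‖ * T := by
        gcongr
        · exact ((A t).le_of_opNorm_le (hAM t) _).trans (by gcongr)
        · exact ((B t).le_of_opNorm_le (hBM t) _).trans (by gcongr)
        · exact h1.trans (by gcongr; exact ht.2)
      _ = _ := by ring
  have hlip : ∀ u v : ℝ → X, Continuous u → Continuous v → (∀ t, ‖u t‖ ≤ ρ) → (∀ t, ‖v t‖ ≤ ρ) →
      ∀ δ : ℝ, (∀ t, ‖u t - v t‖ ≤ δ) → ∀ t ∈ Set.Icc 0 T,
      ‖duhamel A B N x y u t - duhamel A B N x y v t‖ ≤ M * L * (T * δ) :=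
    fun u v hu hv huρ hvρ δ hδ t ht => by
    have h1 := norm_duhamel_sub_le hBM hB hN (x := x) (x' := x) (y := y) (y' := y) (D := 0) ht.1
      hu hv hL (fun τ _ => huρ τ) (fun τ _ => hvρ τ) hAM (by simp)
    rw [zero_add] at h1
    refine h1.trans (mul_le_mul_of_nonneg_left ?_ (by positivity))
    have hδ0 : 0 ≤ δ := (norm_nonneg _).trans (hδ 0)
    have h2 := intervalIntegral.norm_integral_le_of_norm_le_const (a := 0) (b := t) (C := δ)
      (f := fun τ => ‖u τ - v τ‖) fun τ _ => by rw [norm_norm]; exact hδ τ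
    rw [sub_zero, abs_of_nonneg ht.1] at h2
    calc _ ≤ _ := Real.le_norm_self _
      _ ≤ δ * t := h2
      _ ≤ δ * T := by gcongr; exact ht.2
      _ = _ := mul_comm _ _
  have hbd : ∀ u : ℝ → X, Continuous u → (∀ t, ‖u t‖ ≤ ρ) → ∀ t ∈ Set.Icc 0 T,
      ‖duhamel A B N x y u t‖ ≤ ρ := fun u hu huρ t ht => by
    have h1 := hlip u (fun _ => 0) hu continuous_const huρ (fun _ => by simpa using hρ0) ρ
      (fun t => by simpa using huρ t) t ht
    have h2 := hzero t ht
    have h3 := norm_le_norm_add_norm_sub' (duhamel A B N x y u t) (duhamel A B N x y (fun _ => 0) t)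
    have h4 : T * (M * ‖N 0‖) + M * L * (T * ρ) ≤ T * K := by
      have : 0 ≤ T * (M * L + 1) := by positivity
      rw [hK]; linarith
    linarith
  have hne : (0 : ℝ) ≤ T := hT0.le
  let Ψ : BoundedContinuousFunction ℝ X → BoundedContinuousFunction ℝ X := fun u =>
    BoundedContinuousFunction.mkOfBound ⟨fun t => duhamel A B N x y u (c t), hcont u u.continuous⟩
      (Classical.choose ((isCompact_Icc (a := 0) (b := T)).exists_bound_of_continuousOn
        ((hcont u u.continuous).continuousOn)) * 2) (fun s t => by
        have hb := Classical.choose_spec ((isCompact_Icc (a := 0) (b := T)).exists_bound_of_continuousOn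
          ((hcont u u.continuous).continuousOn))
        have hcc : ∀ t, c (c t) = c t := fun t => hcid _ (hcI t)
        have hs := hb (c s) (hcI s)
        have ht := hb (c t) (hcI t)
        rw [hcc] at hs ht
        rw [dist_eq_norm]
        refine (norm_sub_le _ _).trans ?_
        calc _ ≤ _ + _ := add_le_add hs ht
          _ = _ := by ring)
  have hΨ : ∀ u t, Ψ u t = duhamel A B N x y u (c t) := fun u t => rfl
  let S : Set (BoundedContinuousFunction ℝ X) := Metric.closedBall 0 ρ
  have hSmem : ∀ u ∈ S, ∀ t, ‖u t‖ ≤ ρ := fun u hu t => by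
    rw [mem_closedBall_zero_iff] at hu
    exact (u.norm_coe_le_norm t).trans hu
  have hmaps : Set.MapsTo Ψ S S := fun u hu => by
    rw [mem_closedBall_zero_iff, BoundedContinuousFunction.norm_le hρ0]
    intro t
    rw [hΨ]
    exact hbd u u.continuous (hSmem u hu) _ (hcI t)
  have hcontr : ContractingWith (1 / 2) (hmaps.restrict Ψ S S) := by
    refine ⟨by norm_num, LipschitzWith.of_dist_le_mul fun u v => ?_⟩
    rw [Subtype.dist_eq, Subtype.dist_eq, Set.MapsTo.val_restrict_apply,
      Set.MapsTo.val_restrict_apply, BoundedContinuousFunction.dist_le (by positivity)]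
    intro t
    rw [hΨ, hΨ, dist_eq_norm]
    refine (hlip u.1 v.1 u.1.continuous v.1.continuous (hSmem _ u.2) (hSmem _ v.2)
      (dist u.1 v.1) (fun t => ?_) _ (hcI t)).trans ?_
    · rw [← dist_eq_norm]
      exact BoundedContinuousFunction.dist_coe_le_dist t
    · have h5 : M * L * T ≤ 1 / 2 := by
        rw [← hTK, hK]
        have : 0 ≤ T * (M * (‖N 0‖ + L * ρ) + 1) := by positivity
        linarith
      have h6 : (0 : ℝ) ≤ dist u.1 v.1 := dist_nonneg
      push_cast
      rw [← mul_assoc]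
      gcongr
  obtain ⟨u, huS, hu, -⟩ := hcontr.exists_fixedPoint' Metric.isClosed_closedBall.isComplete hmaps
    (x := 0) (Metric.mem_closedBall_self hρ0) (edist_ne_top _ _)
  refine ⟨u, u.continuous, hSmem u huS, fun t ht => ?_⟩
  have h1 : Ψ u t = u t := by rw [hu]
  rw [← h1, hΨ, hcid t ht]

/-- Local well-posedness for Duhamel's formula with a nonlinearity which is Lipschitz continuous
on bounded sets. -/
theorem duhamel_wellPosed {R : ℝ} (hR : 0 ≤ R) : ∃ T : ℝ, 0 < T ∧ T ≤ 1 ∧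
    (∀ x y, ‖x‖ ≤ R → ‖y‖ ≤ R → ∃ u : ℝ → X, Continuous u ∧
      ∀ t ∈ Set.Icc 0 T, u t = duhamel A B N x y u t) ∧
    (∀ x y u v, Continuous u → Continuous v → (∀ t ∈ Set.Icc 0 T, u t = duhamel A B N x y u t) →
      (∀ t ∈ Set.Icc 0 T, v t = duhamel A B N x y v t) → Set.EqOn u v (Set.Icc 0 T)) ∧
    ∃ L : ℝ, 0 ≤ L ∧ ∀ x y x' y' u v, ‖x‖ ≤ R → ‖y‖ ≤ R → ‖x'‖ ≤ R → ‖y'‖ ≤ R →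
      Continuous u → Continuous v → (∀ t ∈ Set.Icc 0 T, u t = duhamel A B N x y u t) →
      (∀ t ∈ Set.Icc 0 T, v t = duhamel A B N x' y' v t) →
      ∀ t ∈ Set.Icc 0 T, ‖u t - v t‖ ≤ L * (‖x - x'‖ + ‖y - y'‖) := by
  have hM : 0 ≤ M := (norm_nonneg _).trans (hAM 0)
  obtain ⟨T, ρ, hT0, hT1, hex⟩ := exists_duhamel_solution hAM hBM hA hB hN hR
  -- Uniqueness is not restricted to the ball of the fixed point argument. Two continuous solutions
  -- are bounded on the compact interval, hence lie in some ball, and Gronwall applies with its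
  -- Lipschitz constant.
  have huniq : ∀ x y u v, Continuous u → Continuous v →
      (∀ t ∈ Set.Icc 0 T, u t = duhamel A B N x y u t) →
      (∀ t ∈ Set.Icc 0 T, v t = duhamel A B N x y v t) → Set.EqOn u v (Set.Icc 0 T) := by
    intro x y u v hu hv hus hvs t ht
    obtain ⟨b, hb⟩ := (isCompact_Icc (a := (0 : ℝ)) (b := T)).exists_bound_of_continuousOn
      hu.continuousOn
    obtain ⟨b', hb'⟩ := (isCompact_Icc (a := (0 : ℝ)) (b := T)).exists_bound_of_continuousOn
      hv.continuousOn
    obtain ⟨L, hL0, hL⟩ := hN (max b b')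
    have h1 := duhamel_solution_dist_le hBM hB hN hu hv hL0 hL
      (fun τ hτ => (hb τ hτ).trans (le_max_left _ _))
      (fun τ hτ => (hb' τ hτ).trans (le_max_right _ _)) hAM hus hvs t ht
    simp only [sub_self, norm_zero, mul_zero, add_zero, zero_mul] at h1
    exact sub_eq_zero.1 (norm_le_zero_iff.1 h1)
  refine ⟨T, hT0, hT1, fun x y hx hy => ?_, huniq, ?_⟩
  · obtain ⟨u, hu, -, hus⟩ := hex x y hx hy
    exact ⟨u, hu, hus⟩
  · obtain ⟨L, hL0, hL⟩ := hN ρ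
    refine ⟨M * Real.exp (M * L + 1), by positivity, ?_⟩
    intro x y x' y' u v hx hy hx' hy' hu hv hus hvs t ht
    -- By uniqueness the given solutions coincide with the constructed ones, which stay in the ball
    -- of radius ρ. The Lipschitz constant of the data-to-solution map therefore depends on R only.
    obtain ⟨u₁, hu₁, huρ, hus₁⟩ := hex x y hx hy
    obtain ⟨v₁, hv₁, hvρ, hvs₁⟩ := hex x' y' hx' hy'
    rw [huniq x y u u₁ hu hu₁ hus hus₁ ht, huniq x' y' v v₁ hv hv₁ hvs hvs₁ ht]
    refine (duhamel_solution_dist_le hBM hB hN hu₁ hv₁ hL0 hL (fun τ _ => huρ τ) (fun τ _ => hvρ τ)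
      hAM hus₁ hvs₁ t ht).trans ?_
    have h1 : (M * L + 1) * t ≤ M * L + 1 := by
      have : 0 ≤ M * L + 1 := by positivity
      exact mul_le_of_le_one_right this (ht.2.trans hT1)
    calc _ ≤ (M * ‖x - x'‖ + M * ‖y - y'‖) * Real.exp (M * L + 1) := by gcongr
      _ = _ := by ring

end Duhamel

end

/-! ### Young's inequality with reciprocal exponents -/

section


variable {d : ℕ}

/-- The Lebesgue exponent with reciprocal `t`. -/
def ex (t : ℝ) : ℝ≥0∞ := (ENNReal.ofReal t)⁻¹

lemma ex_zero : ex 0 = ∞ := by simp [ex]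

lemma one_le_ex {t : ℝ} (h : t ≤ 1) : 1 ≤ ex t := by
  rw [ex, ENNReal.one_le_inv]; exact ENNReal.ofReal_le_one.2 h

lemma ex_ne_zero (t : ℝ) : ex t ≠ 0 := by simp [ex]

lemma ex_ne_top {t : ℝ} (h : 0 < t) : ex t ≠ ∞ := by simp [ex, h]

lemma ex_toReal {t : ℝ} (h : 0 < t) : (ex t).toReal = t⁻¹ := by
  rw [ex, ENNReal.toReal_inv, ENNReal.toReal_ofReal h.le]

lemma ex_toReal_inv {q : ℝ≥0∞} (hq : 1 ≤ q) : ex q⁻¹.toReal = q := by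
  have : q⁻¹ ≠ ∞ := by simpa using (zero_lt_one.trans_le hq).ne'
  rw [ex, ENNReal.ofReal_toReal this, inv_inv]

lemma holderTriple_ex {α β : ℝ} (hα : 0 ≤ α) (hβ : 0 ≤ β) :
    ENNReal.HolderTriple (ex α) (ex β) (ex (α + β)) :=
  ⟨by rw [ex, ex, ex, inv_inv, inv_inv, inv_inv, ENNReal.ofReal_add hα hβ]⟩

lemma eLpNorm_ex {α : ℝ} (hα : 0 < α) (A : Euc d → ℝ≥0∞) :
    eLpNorm A (ex α) volume = (∫⁻ x, A x ^ α⁻¹) ^ α := by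
  rw [eLpNorm_ennreal (ex_ne_zero α) (ex_ne_top hα), ex_toReal hα, one_div, inv_inv]

/-- The convolution of functions with values in `[0, ∞]`. -/
def cv (A B : Euc d → ℝ≥0∞) (y : Euc d) : ℝ≥0∞ := ∫⁻ η, A (y - η) * B η

lemma measurable_cv {A B : Euc d → ℝ≥0∞} (hA : Measurable A) (hB : Measurable B) :
    Measurable (cv A B) := by
  have h1 : Measurable fun z : Euc d × Euc d => A (z.1 - z.2) * B z.2 :=
    (hA.comp (measurable_fst.sub measurable_snd)).mul (hB.comp measurable_snd)
  exact h1.lintegral_prod_right'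

lemma cv_comm (A B : Euc d → ℝ≥0∞) (y : Euc d) : cv A B y = cv B A y := by
  rw [cv, cv, ← lintegral_sub_left_eq_self _ y]
  refine lintegral_congr fun η => ?_
  rw [sub_sub_cancel, mul_comm]

lemma eLpNorm_comp_sub_left {A : Euc d → ℝ≥0∞} (hA : Measurable A) (y : Euc d) (p : ℝ≥0∞) :
    eLpNorm (fun η => A (y - η)) p volume = eLpNorm A p volume := by
  have h := eLpNorm_comp_measurePreserving (p := p) hA.aestronglyMeasurable
    (Measure.measurePreserving_sub_left volume y)
  exact h

lemma cv_le_of_add_eq_one {A B : Euc d → ℝ≥0∞} (hA : Measurable A) (hB : Measurable B) {α β : ℝ}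
    (hα : 0 ≤ α) (hβ : 0 ≤ β) (h : α + β = 1) (y : Euc d) :
    cv A B y ≤ eLpNorm A (ex α) volume * eLpNorm B (ex β) volume := by
  have h1 := holderTriple_ex hα hβ
  have h2 : ex (α + β) = 1 := by simp [h, ex]
  rw [h2] at h1
  have hA' : Measurable fun η => A (y - η) := hA.comp (measurable_const.sub measurable_id)
  have h3 := lintegral_mul_le_ennreal (μ := volume) (p := ex α) (q := ex β) hA'.aemeasurable
    hB.aemeasurable
  rwa [eLpNorm_comp_sub_left hA] at h3

/-- Hölder with the three weights α + β - 1, 1 - β and 1 - α, which sum to 1. The integrand A(y -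
η)B(η) is split into powers of A^{1/α}B^{1/β}, A^{1/α} and B^{1/β}. -/
lemma cv_le_mul_rpow {A B : Euc d → ℝ≥0∞} (hA : Measurable A) (hB : Measurable B) {α β : ℝ}
    (hα : 0 < α) (hβ : 0 < β) (hα1 : α ≤ 1) (hβ1 : β ≤ 1) (h : 1 ≤ α + β) (y : Euc d) :
    cv A B y ≤ (∫⁻ x, A x ^ α⁻¹) ^ (1 - β) * (∫⁻ x, B x ^ β⁻¹) ^ (1 - α) *
      cv (fun x => A x ^ α⁻¹) (fun x => B x ^ β⁻¹) y ^ (α + β - 1) := by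
  have hA1 : Measurable fun x => A x ^ α⁻¹ := hA.pow_const _
  have hB1 : Measurable fun x => B x ^ β⁻¹ := hB.pow_const _
  have hA' : Measurable fun η => A (y - η) ^ α⁻¹ :=
    hA1.comp (measurable_const.sub measurable_id)
  let f : Fin 3 → Euc d → ℝ≥0∞ := ![fun η => A (y - η) ^ α⁻¹ * B η ^ β⁻¹,
    fun η => A (y - η) ^ α⁻¹, fun η => B η ^ β⁻¹]
  have hf : ∀ i ∈ Finset.univ, AEMeasurable (f i) volume := fun i _ => by
    fin_cases i
    · exact (hA'.mul hB1).aemeasurable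
    · exact hA'.aemeasurable
    · exact hB1.aemeasurable
  have hol := ENNReal.lintegral_prod_norm_pow_le (μ := volume) Finset.univ hf
    (p := ![α + β - 1, 1 - β, 1 - α]) (by simp [Fin.sum_univ_three])
    (fun i _ => by fin_cases i <;> simp <;> linarith)
  simp only [Fin.prod_univ_three, f, Matrix.cons_val_zero, Matrix.cons_val_one,
    Matrix.cons_val] at hol
  have h1 : ∫⁻ η, A (y - η) ^ α⁻¹ = ∫⁻ x, A x ^ α⁻¹ :=
    lintegral_sub_left_eq_self (fun x => A x ^ α⁻¹) y
  rw [h1] at hol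
  refine le_trans (le_of_eq (lintegral_congr fun η => ?_)) (hol.trans (le_of_eq ?_))
  · rw [ENNReal.mul_rpow_of_nonneg _ _ (by linarith), ← ENNReal.rpow_mul, ← ENNReal.rpow_mul,
      ← ENNReal.rpow_mul, ← ENNReal.rpow_mul]
    have e1 : A (y - η) = A (y - η) ^ (α⁻¹ * (α + β - 1)) * A (y - η) ^ (α⁻¹ * (1 - β)) := by
      rw [← ENNReal.rpow_add_of_nonneg _ _ (mul_nonneg (by positivity) (by linarith))
        (mul_nonneg (by positivity) (by linarith)), ← mul_add,
        show α + β - 1 + (1 - β) = α by ring, inv_mul_cancel₀ hα.ne', ENNReal.rpow_one]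
    have e2 : B η = B η ^ (β⁻¹ * (α + β - 1)) * B η ^ (β⁻¹ * (1 - α)) := by
      rw [← ENNReal.rpow_add_of_nonneg _ _ (mul_nonneg (by positivity) (by linarith))
        (mul_nonneg (by positivity) (by linarith)), ← mul_add,
        show α + β - 1 + (1 - α) = β by ring, inv_mul_cancel₀ hβ.ne', ENNReal.rpow_one]
    conv_lhs => rw [e1, e2]
    ring
  · rw [cv]; ring

/-- Young's convolution inequality, with the exponents given by their reciprocals. -/
theorem eLpNorm_cv_le {A B : Euc d → ℝ≥0∞} (hA : Measurable A) (hB : Measurable B) {α β : ℝ}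
    (hα : 0 ≤ α) (hβ : 0 ≤ β) (hα1 : α ≤ 1) (hβ1 : β ≤ 1) (h : 1 ≤ α + β) :
    eLpNorm (cv A B) (ex (α + β - 1)) volume ≤
      eLpNorm A (ex α) volume * eLpNorm B (ex β) volume := by
  rcases h.eq_or_lt with h0 | h0
  · rw [← h0, sub_self, ex_zero, eLpNorm_ennreal_top]
    exact essSup_le_of_ae_le _ (Eventually.of_forall fun y =>
      cv_le_of_add_eq_one hA hB hα hβ h0.symm y)
  have hα0 : 0 < α := by linarith
  have hβ0 : 0 < β := by linarith
  have hA1 : Measurable fun x => A x ^ α⁻¹ := hA.pow_const _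
  have hB1 : Measurable fun x => B x ^ β⁻¹ := hB.pow_const _
  have hJ : Measurable fun y => cv (fun x => A x ^ α⁻¹) (fun x => B x ^ β⁻¹) y ^ (α + β - 1) :=
    (measurable_cv hA1 hB1).pow_const _
  refine (eLpNorm_mono_ennreal fun y =>
    cv_le_mul_rpow hA hB hα0 hβ0 hα1 hβ1 h0.le y).trans ?_
  rw [eLpNorm_const_mul_ennreal (one_le_ex (by linarith)) _ hJ.aemeasurable,
    eLpNorm_ex (by linarith), eLpNorm_ex hα0, eLpNorm_ex hβ0]
  have hr : α + β - 1 ≠ 0 := by linarith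
  -- After the pointwise bound only the L¹ norm of a convolution is left, which Tonelli evaluates as
  -- a product.
  have hint : ∫⁻ y, (cv (fun x => A x ^ α⁻¹) (fun x => B x ^ β⁻¹) y ^ (α + β - 1)) ^
      (α + β - 1)⁻¹ = (∫⁻ x, A x ^ α⁻¹) * ∫⁻ x, B x ^ β⁻¹ := by
    simp only [← ENNReal.rpow_mul, mul_inv_cancel₀ hr, ENNReal.rpow_one, cv]
    rw [lintegral_lintegral_swap]
    · simp only [mul_comm (A _ ^ α⁻¹)]
      have : ∀ η : Euc d, ∫⁻ y, B η ^ β⁻¹ * A (y - η) ^ α⁻¹ =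
          B η ^ β⁻¹ * ∫⁻ x, A x ^ α⁻¹ := fun η => by
        have h5 : Measurable fun y => A (y - η) ^ α⁻¹ := hA1.comp (measurable_id.sub_const η)
        rw [lintegral_const_mul _ h5,
          lintegral_sub_right_eq_self (fun x => A x ^ α⁻¹) η]
      simp only [this]
      rw [lintegral_mul_const _ hB1, mul_comm]
    · exact ((hA1.comp (measurable_fst.sub measurable_snd)).mul
        (hB1.comp measurable_snd)).aemeasurable
  rw [hint, ENNReal.mul_rpow_of_nonneg _ _ (by linarith)]
  have e1 : (∫⁻ x, A x ^ α⁻¹) ^ α =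
      (∫⁻ x, A x ^ α⁻¹) ^ (1 - β) * (∫⁻ x, A x ^ α⁻¹) ^ (α + β - 1) := by
    rw [← ENNReal.rpow_add_of_nonneg _ _ (by linarith) (by linarith)]; congr 1; ring
  have e2 : (∫⁻ x, B x ^ β⁻¹) ^ β =
      (∫⁻ x, B x ^ β⁻¹) ^ (1 - α) * (∫⁻ x, B x ^ β⁻¹) ^ (α + β - 1) := by
    rw [← ENNReal.rpow_add_of_nonneg _ _ (by linarith) (by linarith)]; congr 1; ring
  rw [e1, e2]
  exact le_of_eq (by ring)

lemma bracket_add_le (y η : Euc d) : bracket (y + η) ≤ 4 * max (bracket y) (bracket η) := by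
  have h1 := bracket_le (y + η)
  have h2 := one_add_norm_le y
  have h3 := one_add_norm_le η
  have h4 := norm_add_le y η
  have h5 := le_max_left (bracket y) (bracket η)
  have h6 := le_max_right (bracket y) (bracket η)
  linarith

lemma wt_add_le {s : ℝ} (hs : 0 ≤ s) (y η : Euc d) :
    wt s (y + η) ≤ ENNReal.ofReal (4 ^ s) * (wt s y + wt s η) := by
  have hb := bracket_pos y
  have hb' := bracket_pos η
  rw [wt, wt, wt, ← ENNReal.ofReal_add (by positivity) (by positivity),
    ← ENNReal.ofReal_mul (by positivity)]
  refine ENNReal.ofReal_le_ofReal ?_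
  calc bracket (y + η) ^ s ≤ (4 * max (bracket y) (bracket η)) ^ s :=
        Real.rpow_le_rpow (bracket_pos _).le (bracket_add_le y η) hs
    _ = 4 ^ s * max (bracket y) (bracket η) ^ s :=
        Real.mul_rpow (by norm_num) (hb.le.trans (le_max_left _ _))
    _ ≤ _ := by
        refine mul_le_mul_of_nonneg_left ?_ (by positivity)
        rcases max_cases (bracket y) (bracket η) with h | h
        · rw [h.1]; exact le_add_of_nonneg_right (by positivity)
        · rw [h.1]; exact le_add_of_nonneg_left (by positivity)

/-- For s ≥ 0 one has ⟨y⟩^s ≲ ⟨y - η⟩^s + ⟨η⟩^s, so all the regularity falls on one factor at a time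
and the other is measured without weight. -/
lemma wt_mul_cv_le {s : ℝ} (hs : 0 ≤ s) {A B : Euc d → ℝ≥0∞} (hA : Measurable A)
    (hB : Measurable B) (y : Euc d) :
    wt s y * cv A B y ≤ ENNReal.ofReal (4 ^ s) *
      (cv (fun η => wt s η * A η) B y + cv A (fun η => wt s η * B η) y) := by
  have hm : Measurable fun η => A (y - η) * B η :=
    (hA.comp (measurable_const.sub measurable_id)).mul hB
  have hw : Measurable fun η => wt s η * B η := (measurable_wt s).mul hB
  have hm' : Measurable fun η => A (y - η) * (wt s η * B η) :=
    (hA.comp (measurable_const.sub measurable_id)).mul hw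
  rw [cv, cv, cv, ← lintegral_const_mul _ hm, ← lintegral_add_right _ hm',
    ← lintegral_const_mul' _ _ ENNReal.ofReal_ne_top]
  refine lintegral_mono fun η => ?_
  have h1 := wt_add_le hs (y - η) η
  rw [sub_add_cancel] at h1
  calc wt s y * (A (y - η) * B η)
      ≤ ENNReal.ofReal (4 ^ s) * (wt s (y - η) + wt s η) * (A (y - η) * B η) :=
        mul_le_mul' h1 le_rfl
    _ = _ := by ring

end

/-! ### Products in weighted Fourier–Lebesgue norms -/

section


variable {d : ℕ}

/-- The modulus of the Fourier transform of a Schwartz function. -/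
def af (h : 𝓢(Euc d, ℂ)) (y : Euc d) : ℝ≥0∞ := ‖𝓕 h y‖ₑ

lemma measurable_af (h : 𝓢(Euc d, ℂ)) : Measurable (af h) := (𝓕 h).continuous.measurable.enorm

lemma af_add_le (h h' : 𝓢(Euc d, ℂ)) (y : Euc d) : af (h + h') y ≤ af h y + af h' y := by
  have : 𝓕 (h + h') = 𝓕 h + 𝓕 h' := map_add (FourierTransform.fourierCLM ℂ 𝓢(Euc d, ℂ)) h h'
  rw [af, this, _root_.add_apply]
  exact enorm_add_le _ _

lemma af_zero (y : Euc d) : af (0 : 𝓢(Euc d, ℂ)) y = 0 := by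
  have : 𝓕 (0 : 𝓢(Euc d, ℂ)) = 0 := map_zero (FourierTransform.fourierCLM ℂ 𝓢(Euc d, ℂ))
  rw [af, this]; simp

lemma af_cj (h : 𝓢(Euc d, ℂ)) (y : Euc d) : af (cj h) y = af h (-y) := by
  have : 𝓕 (cj h) y = conj (𝓕 h (-y)) := by
    rw [fourier_apply_eq, fourier_apply_eq, ← integral_conj]
    refine integral_congr_ae (Eventually.of_forall fun z => ?_)
    simp only [cj_apply, map_mul]
    congr 1
    rw [chr_eq, chr_eq, inner_neg_right, neg_neg, ← Circle.coe_inv_eq_conj,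
      ← AddChar.map_neg_eq_inv]
  rw [af, this, af]; simp

lemma fourierInv_eq_fourier_neg (h : 𝓢(Euc d, ℂ)) (y : Euc d) : 𝓕⁻ h y = 𝓕 h (-y) := by
  rw [SchwartzMap.fourierInv_apply_eq]; rfl

lemma fourierInv_smul' (φ ψ : 𝓢(Euc d, ℂ)) (y : Euc d) :
    𝓕⁻ (smul' φ ψ) y = ∫ t, 𝓕⁻ φ t * 𝓕⁻ ψ (y - t) := by
  have h1 := SchwartzMap.fourier_convolution (ContinuousLinearMap.mul ℂ ℂ) (𝓕⁻ φ) (𝓕⁻ ψ)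
  have h2 : SchwartzMap.pairing (ContinuousLinearMap.mul ℂ ℂ) (𝓕 (𝓕⁻ φ)) (𝓕 (𝓕⁻ ψ)) =
      smul' φ ψ := by
    ext z
    rw [SchwartzMap.pairing_apply_apply, smul'_apply]
    simp
  rw [h2] at h1
  rw [← h1, fourierInv_fourier_eq, SchwartzMap.convolution_apply]
  rfl

lemma af_smul'_le (φ ψ : 𝓢(Euc d, ℂ)) (y : Euc d) : af (smul' φ ψ) y ≤ cv (af φ) (af ψ) y := by
  have h1 : 𝓕 (smul' φ ψ) y = 𝓕⁻ (smul' φ ψ) (-y) := by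
    rw [fourierInv_eq_fourier_neg, neg_neg]
  rw [af, h1, fourierInv_smul']
  refine (enorm_integral_le_lintegral_enorm _).trans (le_of_eq ?_)
  rw [← lintegral_neg_eq_self, cv_comm, cv]
  refine lintegral_congr fun η => ?_
  rw [enorm_mul, fourierInv_eq_fourier_neg, fourierInv_eq_fourier_neg, af, af, mul_comm, neg_neg,
    show -(-y - -η) = y - η by abel]

/-- The weighted Fourier-Lebesgue norm, with the exponent given by its reciprocal. -/
def fl (α σ : ℝ) (h : 𝓢(Euc d, ℂ)) : ℝ≥0∞ := innerNorm (ex α) σ (af h)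

lemma fl_zero (α σ : ℝ) : fl α σ (0 : 𝓢(Euc d, ℂ)) = 0 := by
  simp [fl, innerNorm, af_zero]

lemma fl_add_le {α : ℝ} (hα : α ≤ 1) (σ : ℝ) (h h' : 𝓢(Euc d, ℂ)) :
    fl α σ (h + h') ≤ fl α σ h + fl α σ h' :=
  (innerNorm_mono (af_add_le h h')).trans
    (innerNorm_add_le (one_le_ex hα) (measurable_af h) (measurable_af h'))

lemma fl_cj (α σ : ℝ) (h : 𝓢(Euc d, ℂ)) : fl α σ (cj h) = fl α σ h := by
  have hm : Measurable fun y => wt σ y * af h y := (measurable_wt σ).mul (measurable_af h)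
  have h1 := eLpNorm_comp_measurePreserving (p := ex α) hm.aestronglyMeasurable
    (Measure.measurePreserving_neg (volume : Measure (Euc d)))
  rw [fl, innerNorm, fl, innerNorm, ← h1]
  congr 1
  ext y
  simp [af_cj, wt_neg_arg]

lemma fl_smul'_zero_le {α β : ℝ} (hα : 0 ≤ α) (hβ : 0 ≤ β) (hα1 : α ≤ 1) (hβ1 : β ≤ 1)
    (h : 1 ≤ α + β) (φ ψ : 𝓢(Euc d, ℂ)) :
    fl (α + β - 1) 0 (smul' φ ψ) ≤ fl α 0 φ * fl β 0 ψ := by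
  simp only [fl, innerNorm, wt_zero, one_mul]
  exact (eLpNorm_mono_ennreal (af_smul'_le φ ψ)).trans
    (eLpNorm_cv_le (measurable_af φ) (measurable_af ψ) hα hβ hα1 hβ1 h)

/-- The weight falls on either factor. The two resulting terms may use different pairs of Young
exponents, provided both lead to the same ρ. -/
lemma fl_smul'_le {s : ℝ} (hs : 0 ≤ s) {α β α' β' ρ : ℝ} (hα : 0 ≤ α) (hβ : 0 ≤ β) (hα1 : α ≤ 1)
    (hβ1 : β ≤ 1) (hα' : 0 ≤ α') (hβ' : 0 ≤ β') (hα1' : α' ≤ 1) (hβ1' : β' ≤ 1)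
    (hρ : 0 ≤ ρ) (h : α + β = 1 + ρ) (h' : α' + β' = 1 + ρ) (φ ψ : 𝓢(Euc d, ℂ)) :
    fl ρ s (smul' φ ψ) ≤
      ENNReal.ofReal (4 ^ s) * (fl α s φ * fl β 0 ψ + fl α' 0 φ * fl β' s ψ) := by
  have m1 : Measurable fun η => wt s η * af φ η := (measurable_wt s).mul (measurable_af φ)
  have m2 : Measurable fun η => wt s η * af ψ η := (measurable_wt s).mul (measurable_af ψ)
  have c1 := measurable_cv m1 (measurable_af ψ)
  have c2 := measurable_cv (measurable_af φ) m2
  have hρ1 : 1 ≤ ex ρ := one_le_ex (by linarith)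
  have e1 := eLpNorm_cv_le m1 (measurable_af ψ) hα hβ hα1 hβ1 (by linarith)
  have e2 := eLpNorm_cv_le (measurable_af φ) m2 hα' hβ' hα1' hβ1' (by linarith)
  rw [h, add_sub_cancel_left] at e1
  rw [h', add_sub_cancel_left] at e2
  calc fl ρ s (smul' φ ψ) ≤ eLpNorm (fun y => ENNReal.ofReal (4 ^ s) *
        (cv (fun η => wt s η * af φ η) (af ψ) y + cv (af φ) (fun η => wt s η * af ψ η) y))
          (ex ρ) volume := eLpNorm_mono_ennreal fun y =>
        (mul_le_mul' le_rfl (af_smul'_le φ ψ y)).trans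
          (wt_mul_cv_le hs (measurable_af φ) (measurable_af ψ) y)
    _ = ENNReal.ofReal (4 ^ s) * eLpNorm (fun y => cv (fun η => wt s η * af φ η) (af ψ) y +
          cv (af φ) (fun η => wt s η * af ψ η) y) (ex ρ) volume :=
        eLpNorm_const_mul_ennreal hρ1 _ (c1.add c2).aemeasurable
    _ ≤ _ := by
        refine mul_le_mul' le_rfl ((eLpNorm_add_le c1.aestronglyMeasurable
          c2.aestronglyMeasurable hρ1).trans (add_le_add (e1.trans ?_) (e2.trans ?_)))
        · simp [fl, innerNorm, wt_zero]
        · simp [fl, innerNorm, wt_zero]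

/-- The `L^{1/δ}` norm of `⟨y⟩^{-τ}`. -/
def wtNorm (d : ℕ) (δ τ : ℝ) : ℝ≥0∞ := eLpNorm (wt (d := d) (-τ)) (ex δ) volume

lemma wtNorm_zero_lt_top {τ : ℝ} (hτ : 0 ≤ τ) : wtNorm d 0 τ < ∞ := by
  rw [wtNorm, ex_zero, eLpNorm_ennreal_top]
  refine lt_of_le_of_lt (essSup_le_of_ae_le 1 (Eventually.of_forall fun y => ?_)) ENNReal.one_lt_top
  have := wt_mono (show -τ ≤ 0 by linarith) y
  rwa [wt_zero] at this

lemma wtNorm_lt_top {δ τ : ℝ} (hδ : 0 < δ) (h : d * δ < τ) : wtNorm d δ τ < ∞ := by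
  rw [wtNorm, eLpNorm_ex hδ]
  refine ENNReal.rpow_lt_top_of_nonneg hδ.le (ne_of_lt ?_)
  have hτ : 0 < τ := lt_of_le_of_lt (by positivity) h
  have hi := (integrable_one_add_norm (E := Euc d) (μ := volume) (r := τ * δ⁻¹)
    (by rw [finrank_euclideanSpace_fin, ← div_eq_mul_inv, lt_div_iff₀ hδ]; exact h)).const_mul
      (2 ^ (τ * δ⁻¹))
  refine lt_of_le_of_lt (lintegral_mono fun y => ?_) hi.lintegral_lt_top
  have hb := bracket_pos y
  rw [wt, ENNReal.ofReal_rpow_of_pos (by positivity), ← Real.rpow_mul hb.le]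
  refine ENNReal.ofReal_le_ofReal ?_
  have h1 := one_add_norm_le y
  have h2 : (1 + ‖y‖) / 2 ≤ bracket y := by linarith
  have h3 : 0 < 1 + ‖y‖ := by positivity
  calc bracket y ^ (-τ * δ⁻¹) ≤ ((1 + ‖y‖) / 2) ^ (-τ * δ⁻¹) :=
        Real.rpow_le_rpow_of_nonpos (by positivity) h2 (by
          have : 0 ≤ τ * δ⁻¹ := by positivity
          linarith)
    _ = 2 ^ (τ * δ⁻¹) * (1 + ‖y‖) ^ (-(τ * δ⁻¹)) := by
        rw [neg_mul, Real.div_rpow h3.le (by norm_num), Real.rpow_neg (by norm_num : (0:ℝ) ≤ 2)]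
        field_simp

/-- Hölder against ⟨y⟩^{-τ}: raising the reciprocal exponent by δ costs τ derivatives, which is
possible if dδ < τ, and also if δ = 0 ≤ τ. -/
lemma fl_weight_le {α δ σ τ : ℝ} (hα : 0 ≤ α) (hδ : 0 ≤ δ) (h1 : α + δ ≤ 1)
    (h : 𝓢(Euc d, ℂ)) : fl (α + δ) σ h ≤ wtNorm d δ τ * fl α (σ + τ) h := by
  have := holderTriple_ex hδ hα
  rw [add_comm δ α] at this
  refine le_trans (le_of_eq ?_) (eLpNorm_mul_le_ennreal (one_le_ex h1) (p := ex δ) (q := ex α)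
    (measurable_wt (-τ)).aemeasurable
    ((measurable_wt (σ + τ)).mul (measurable_af h)).aemeasurable)
  rw [fl, innerNorm]
  congr 1
  ext y
  rw [← mul_assoc, ← wt_add]
  congr 2
  ring

end

/-! ### The power nonlinearity by repeated use of Young's inequality -/

section


variable {d : ℕ}

/-- The nonlinearity `|h|^{2k} h` of a Schwartz function `h`. -/
def pw : ℕ → 𝓢(Euc d, ℂ) → 𝓢(Euc d, ℂ)
  | 0, h => h
  | k + 1, h => smul' (smul' (pw k h) (cj h)) h

lemma pw_apply (k : ℕ) (h : 𝓢(Euc d, ℂ)) (z : Euc d) :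
    pw k h z = ((‖h z‖ ^ (2 * k) : ℝ) : ℂ) * h z := by
  induction k with
  | zero => simp [pw]
  | succ k ih =>
    rw [pw, smul'_apply, smul'_apply, ih, cj_apply, mul_assoc _ (h z) (conj (h z)),
      Complex.mul_conj, Complex.normSq_eq_norm_sq, mul_add, pow_add]
    push_cast
    ring

lemma pw_zero (k : ℕ) : pw k (0 : 𝓢(Euc d, ℂ)) = 0 := by
  ext z; rw [pw_apply]; simp

lemma cj_sub (φ ψ : 𝓢(Euc d, ℂ)) : cj (φ - ψ) = cj φ - cj ψ := by
  ext z; simp [cj_apply]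

lemma smul'_sub (φ ψ χ : 𝓢(Euc d, ℂ)) : smul' φ (ψ - χ) = smul' φ ψ - smul' φ χ := by
  ext z; simp [smul'_apply, mul_sub]

lemma sub_smul' (φ ψ χ : 𝓢(Euc d, ℂ)) : smul' (φ - ψ) χ = smul' φ χ - smul' ψ χ := by
  ext z; simp [smul'_apply, sub_mul]

/-- The sum of the two norms propagated by products of functions in a Fourier-Lebesgue space. -/
def pairNorm (s α θ b : ℝ) (h : 𝓢(Euc d, ℂ)) : ℝ≥0∞ := fl (b + α - 1 + θ) s h + fl b 0 h

lemma pairNorm_add_le {s α θ b : ℝ} (hα : α ≤ 1) (hθ : 0 ≤ θ) (hb : b ≤ 1 - θ)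
    (h h' : 𝓢(Euc d, ℂ)) :
    pairNorm s α θ b (h + h') ≤ pairNorm s α θ b h + pairNorm s α θ b h' := by
  refine (add_le_add (fl_add_le (by linarith) s h h') (fl_add_le (by linarith) 0 h h')).trans
    (le_of_eq ?_)
  rw [pairNorm, pairNorm]; ring

/-- The constant in the product estimate for `pairNorm`. -/
def prodConst (d : ℕ) (s α θ : ℝ) : ℝ≥0∞ :=
  (ENNReal.ofReal (4 ^ s) + 1) * (1 + wtNorm d (1 - θ - α) s)

lemma pairNorm_self_le {s α θ : ℝ} (hα : 0 ≤ α) (hθ : 0 ≤ θ) (hαθ : α + θ ≤ 1)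
    (f : 𝓢(Euc d, ℂ)) :
    pairNorm s α θ (1 - θ) f ≤ (1 + wtNorm d (1 - θ - α) s) * fl α s f := by
  have h1 := fl_weight_le (d := d) (α := α) (δ := 1 - θ - α) (σ := 0) (τ := s) hα (by linarith)
    (by linarith) f
  rw [show α + (1 - θ - α) = 1 - θ by ring, zero_add] at h1
  rw [pairNorm, show 1 - θ + α - 1 + θ = α by ring, add_mul, one_mul]
  exact add_le_add le_rfl h1

/-- The factor f is used both with parameters (α, s) and, after losing its weight, with (1 - θ, 0).
When the weight stays on h, Young pairs it with the second norm of f; otherwise the unweighted norm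
of h meets the first. In both cases, and in the unweighted part, b drops by exactly θ. -/
lemma pairNorm_smul'_le {s α θ b : ℝ} (hs : 0 ≤ s) (hα : 0 ≤ α) (hθ : 0 ≤ θ) (hαθ : α + θ ≤ 1)
    (hb : 1 - α ≤ b) (hb' : b ≤ 1 - θ) (h f : 𝓢(Euc d, ℂ)) :
    pairNorm s α θ (b - θ) (smul' h f) ≤
      prodConst d s α θ * (pairNorm s α θ b h * fl α s f) := by
  have e1 := fl_smul'_le hs (α := b + α - 1 + θ) (β := 1 - θ) (α' := b) (β' := α)
    (ρ := b + α - 1) (by linarith) (by linarith) (by linarith) (by linarith) (by linarith)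
    (by linarith) (by linarith) (by linarith) (by linarith) (by ring) (by ring) h f
  have e2 := fl_smul'_zero_le (α := b) (β := 1 - θ) (by linarith) (by linarith) (by linarith)
    (by linarith) (by linarith) h f
  rw [show b + (1 - θ) - 1 = b - θ by ring] at e2
  have e3 := pairNorm_self_le (s := s) hα hθ hαθ f
  set F := pairNorm s α θ (1 - θ) f with hF
  have e4 : fl α s f ≤ F := by
    rw [hF, pairNorm, show 1 - θ + α - 1 + θ = α by ring]; exact le_self_add
  have e5 : fl (1 - θ) 0 f ≤ F := le_add_self
  rw [pairNorm, show b - θ + α - 1 + θ = b + α - 1 by ring]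
  calc fl (b + α - 1) s (smul' h f) + fl (b - θ) 0 (smul' h f)
      ≤ ENNReal.ofReal (4 ^ s) * (fl (b + α - 1 + θ) s h * F + fl b 0 h * F) +
          (fl (b + α - 1 + θ) s h + fl b 0 h) * F := by
        refine add_le_add (e1.trans (mul_le_mul' le_rfl (add_le_add (mul_le_mul' le_rfl e5)
          (mul_le_mul' le_rfl e4)))) (e2.trans (mul_le_mul' le_add_self e5))
    _ = (ENNReal.ofReal (4 ^ s) + 1) * (pairNorm s α θ b h * F) := by rw [pairNorm]; ring
    _ ≤ (ENNReal.ofReal (4 ^ s) + 1) * (pairNorm s α θ b h *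
          ((1 + wtNorm d (1 - θ - α) s) * fl α s f)) :=
        mul_le_mul' le_rfl (mul_le_mul' le_rfl e3)
    _ = _ := by rw [prodConst]; ring

/-- The estimate for the nonlinearity `|h|^{2k} h` in Fourier-Lebesgue spaces, with a loss of one
derivative. -/
def FiberEstimate (d k : ℕ) (α s : ℝ) : Prop :=
  ∃ C : ℝ≥0∞, C ≠ ∞ ∧ ∀ h h' : 𝓢(Euc d, ℂ), fl α (s - 1) (pw k h - pw k h') ≤
    C * ((fl α s h + fl α s h') ^ (2 * k) * fl α s (h - h'))

/-- Raising k by one means two multiplications, hence a drop of 2θ. The condition 2kθ ≤ α keeps the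
reciprocal exponent α - 2kθ of the weighted part nonnegative. -/
lemma pairNorm_pw_sub_le {s α θ : ℝ} (hs : 0 ≤ s) (hα : 0 ≤ α) (hθ : 0 ≤ θ) (hαθ : α + θ ≤ 1)
    (hW : wtNorm d (1 - θ - α) s < ∞) (k : ℕ) (hk : 2 * k * θ ≤ α) :
    ∃ C : ℝ≥0∞, C ≠ ∞ ∧ ∀ h h' : 𝓢(Euc d, ℂ),
      pairNorm s α θ (1 - (2 * k + 1) * θ) (pw k h - pw k h') ≤
        C * ((fl α s h + fl α s h') ^ (2 * k) * fl α s (h - h')) := by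
  have hK : prodConst d s α θ ≠ ∞ := ENNReal.mul_ne_top
    (ENNReal.add_ne_top.2 ⟨ENNReal.ofReal_ne_top, ENNReal.one_ne_top⟩)
    (ENNReal.add_ne_top.2 ⟨ENNReal.one_ne_top, hW.ne⟩)
  induction k with
  | zero =>
    refine ⟨1 + wtNorm d (1 - θ - α) s,
      ENNReal.add_ne_top.2 ⟨ENNReal.one_ne_top, hW.ne⟩, fun h h' => ?_⟩
    simpa [pw] using pairNorm_self_le (s := s) hα hθ hαθ (h - h')
  | succ k ih =>
    push_cast at hk
    have hkθ : 0 ≤ (k : ℝ) * θ := by positivity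
    obtain ⟨C, hC, H⟩ := ih (by linarith)
    set K := prodConst d s α θ
    refine ⟨3 * (K ^ 2 * C), by finiteness, fun h h' => ?_⟩
    have mul2 : ∀ P f₁ f₂ : 𝓢(Euc d, ℂ),
        pairNorm s α θ (1 - (2 * ((k + 1 : ℕ) : ℝ) + 1) * θ) (smul' (smul' P f₁) f₂) ≤
          K ^ 2 * (pairNorm s α θ (1 - (2 * k + 1) * θ) P * fl α s f₁ * fl α s f₂) := by
      intro P f₁ f₂
      have a1 := pairNorm_smul'_le hs hα hθ hαθ (b := 1 - (2 * k + 1) * θ) (by linarith)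
        (by linarith) P f₁
      have a2 := pairNorm_smul'_le hs hα hθ hαθ (b := 1 - (2 * k + 1) * θ - θ) (by linarith)
        (by linarith) (smul' P f₁) f₂
      rw [show 1 - (2 * ((k + 1 : ℕ) : ℝ) + 1) * θ = 1 - (2 * k + 1) * θ - θ - θ by push_cast; ring]
      refine a2.trans ((mul_le_mul' le_rfl (mul_le_mul' a1 le_rfl)).trans (le_of_eq ?_))
      ring
    set S := fl α s h + fl α s h'
    set D := fl α s (h - h')
    have hS : fl α s h ≤ S := le_self_add
    have hS' : fl α s h' ≤ S := le_add_self
    have H' : pairNorm s α θ (1 - (2 * k + 1) * θ) (pw k h') ≤ C * (S ^ (2 * k) * S) := by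
      have := H h' 0
      rw [pw_zero, sub_zero, sub_zero, fl_zero, add_zero] at this
      exact this.trans (mul_le_mul' le_rfl (mul_le_mul' (pow_le_pow_left' hS' _) hS'))
    -- Telescoping over the three factors pw k h, conj h and h, so that each term contains exactly
    -- one difference.
    have e : pw (k + 1) h - pw (k + 1) h' =
        smul' (smul' (pw k h - pw k h') (cj h)) h + (smul' (smul' (pw k h') (cj (h - h'))) h +
          smul' (smul' (pw k h') (cj h')) (h - h')) := by
      simp only [pw, cj_sub, smul'_sub, sub_smul']; abel
    have hbd : 1 - (2 * ((k + 1 : ℕ) : ℝ) + 1) * θ ≤ 1 - θ := by push_cast; linarith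
    rw [e]
    refine (pairNorm_add_le (by linarith) hθ hbd _ _).trans
      ((add_le_add le_rfl (pairNorm_add_le (by linarith) hθ hbd _ _)).trans ?_)
    refine (add_le_add (mul2 _ _ _) (add_le_add (mul2 _ _ _) (mul2 _ _ _))).trans ?_
    rw [fl_cj, fl_cj, fl_cj]
    calc _ ≤ K ^ 2 * (C * (S ^ (2 * k) * D) * S * S) +
          (K ^ 2 * (C * (S ^ (2 * k) * S) * D * S) + K ^ 2 * (C * (S ^ (2 * k) * S) * S * D)) :=
        add_le_add (mul_le_mul' le_rfl (mul_le_mul' (mul_le_mul' (H h h') hS) hS))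
          (add_le_add (mul_le_mul' le_rfl (mul_le_mul' (mul_le_mul' H' le_rfl) hS))
            (mul_le_mul' le_rfl (mul_le_mul' (mul_le_mul' H' hS') le_rfl)))
      _ = _ := by rw [show 2 * (k + 1) = 2 * k + 2 by ring, pow_add]; ring

/-- The products end at reciprocal exponent α - 2kθ with the full weight s. One derivative brings it
back to α, which is the finiteness of `wtNorm d (2 * k * θ) 1`. -/
theorem fiberEstimate_of_young {s α θ : ℝ} (hs : 0 ≤ s) (hα : 0 ≤ α) (hθ : 0 ≤ θ)
    (hαθ : α + θ ≤ 1) (hW : wtNorm d (1 - θ - α) s < ∞) (k : ℕ) (hk : 2 * k * θ ≤ α)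
    (hW' : wtNorm d (2 * k * θ) 1 < ∞) : FiberEstimate d k α s := by
  obtain ⟨C, hC, H⟩ := pairNorm_pw_sub_le hs hα hθ hαθ hW k hk
  refine ⟨wtNorm d (2 * k * θ) 1 * C, ENNReal.mul_ne_top hW'.ne hC, fun h h' => ?_⟩
  have h1 := fl_weight_le (α := α - 2 * k * θ) (δ := 2 * k * θ) (σ := s - 1) (τ := 1) (by linarith)
    (by positivity) (by linarith) (pw k h - pw k h')
  rw [sub_add_cancel, sub_add_cancel] at h1
  rw [mul_assoc]
  refine h1.trans (mul_le_mul' le_rfl (le_trans ?_ (H h h')))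
  rw [pairNorm, show 1 - (2 * k + 1) * θ + α - 1 + θ = α - 2 * k * θ by ring]
  exact le_self_add

lemma fl_one_smul'_le {s : ℝ} (hs : 0 ≤ s) (φ ψ : 𝓢(Euc d, ℂ)) :
    fl 1 s (smul' φ ψ) ≤ 2 * ENNReal.ofReal (4 ^ s) * (fl 1 s φ * fl 1 s ψ) := by
  have h0 : ∀ χ : 𝓢(Euc d, ℂ), fl 1 0 χ ≤ fl 1 s χ := fun χ =>
    eLpNorm_mono_ennreal fun y => mul_le_mul' (wt_mono hs y) le_rfl
  refine (fl_smul'_le hs (α := 1) (β := 1) (α' := 1) (β' := 1) (ρ := 1) zero_le_one zero_le_one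
    le_rfl le_rfl zero_le_one zero_le_one le_rfl le_rfl zero_le_one rfl rfl φ ψ).trans ?_
  refine (mul_le_mul' le_rfl (add_le_add (mul_le_mul' le_rfl (h0 ψ))
    (mul_le_mul' (h0 φ) le_rfl))).trans (le_of_eq ?_)
  ring

end

/-! ### Plancherel bound and integrals over balls -/

section


variable {d : ℕ}

lemma norm_le_bracket (y : Euc d) : ‖y‖ ≤ bracket y := by
  rw [bracket]; exact Real.le_sqrt_of_sq_le (by linarith)

/-- Locally integrable functions that agree as distributions agree almost everywhere. -/
lemma ae_eq_of_integral_schwartz {f f' : Euc d → ℂ} (hf : LocallyIntegrable f volume)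
    (hf' : LocallyIntegrable f' volume)
    (h : ∀ φ : 𝓢(Euc d, ℂ), ∫ x, φ x * f x = ∫ x, φ x * f' x) : f =ᵐ[volume] f' := by
  refine ae_eq_of_integral_contDiff_smul_eq hf hf' fun g hg hs => ?_
  have hg' : ContDiff ℝ ((⊤ : ℕ∞) : WithTop ℕ∞) fun x => ((g x : ℝ) : ℂ) :=
    Complex.ofRealCLM.contDiff.comp hg
  have hs' : HasCompactSupport fun x => ((g x : ℝ) : ℂ) :=
    hs.comp_left (g := fun r : ℝ => (r : ℂ)) Complex.ofReal_zero
  have := h (hs'.toSchwartzMap hg')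
  simpa using this

/-- The Fourier transform of an integrable function is bounded in `L²` by the `L²` norm. -/
lemma lintegral_fourier_sq_le {G : Euc d → ℂ} (hG : Integrable G) (hG2 : MemLp G 2) :
    ∫⁻ y, ‖𝓕 G y‖ₑ ^ 2 ≤ ∫⁻ y, ‖G y‖ₑ ^ 2 := by
  set F : Lp ℂ 2 (volume : Measure (Euc d)) := hG2.toLp G
  have hc : Continuous (𝓕 G) := VectorFourier.fourierIntegral_continuous
    Real.continuous_fourierChar (L := innerₗ (Euc d)) continuous_inner hG
  have hK : LocallyIntegrable (𝓕 F : Lp ℂ 2 (volume : Measure (Euc d))) volume :=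
    (Lp.memLp (𝓕 F)).locallyIntegrable (by norm_num)
  -- The L² Fourier transform and the Fourier integral define the same tempered distribution, hence
  -- agree almost everywhere, and Plancherel applies to the latter.
  have hae : (𝓕 F : Lp ℂ 2 (volume : Measure (Euc d))) =ᵐ[volume] 𝓕 G := by
    refine ae_eq_of_integral_schwartz hK hc.locallyIntegrable fun φ => ?_
    have h1 := Lp.fourier_toTemperedDistribution_eq F
    have h2 : (𝓕 (F : 𝓢'(Euc d, ℂ))) φ = ∫ x, 𝓕 φ x * G x := by
      rw [TemperedDistribution.fourier_apply, Lp.toTemperedDistribution_apply]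
      refine integral_congr_ae ?_
      filter_upwards [hG2.coeFn_toLp] with x hx
      rw [hx, smul_eq_mul]
    have h3 := VectorFourier.integral_fourierIntegral_smul_eq_flip (L := innerₗ (Euc d))
      Real.continuous_fourierChar continuous_inner (φ.integrable (μ := volume)) hG
    rw [h1, Lp.toTemperedDistribution_apply] at h2
    simp only [smul_eq_mul] at h2
    rw [h2, flip_innerₗ] at *
    exact h3
  have h4 : eLpNorm (𝓕 G) 2 volume = eLpNorm G 2 volume := by
    rw [← eLpNorm_congr_ae hae, ← eLpNorm_congr_ae hG2.coeFn_toLp]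
    have h5 := Lp.norm_fourier_eq F
    rw [Lp.norm_def, Lp.norm_def] at h5
    exact (ENNReal.toReal_eq_toReal_iff' (Lp.memLp _).2.ne (Lp.memLp _).2.ne).1 h5
  have h6 : ∀ f : Euc d → ℂ, ∫⁻ y, ‖f y‖ₑ ^ 2 = eLpNorm f 2 volume ^ 2 := fun f => by
    rw [eLpNorm_eq_lintegral_rpow_enorm_toReal (by norm_num) (by norm_num)]
    rw [← ENNReal.rpow_natCast, ← ENNReal.rpow_mul]
    simp
  rw [h6, h6, h4]

/-- The bracket dominates the norm, and |y|^{-a} is integrable near 0 because a < d. Scaling the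
unit ball gives the power ρ^{d-a}. -/
lemma lintegral_bracket_ball_le (hd : 1 ≤ d) {a : ℝ} (ha : 0 ≤ a) (had : a < d) :
    ∃ K : ℝ, 0 ≤ K ∧ ∀ ρ : ℝ, 0 < ρ →
      ∫⁻ y in {y : Euc d | bracket y < ρ}, ENNReal.ofReal (bracket y ^ (-a)) ≤
        ENNReal.ofReal (K * ρ ^ (d - a)) := by
  have hfr : Module.finrank ℝ (Euc d) = d := finrank_euclideanSpace_fin
  have : Nontrivial (Euc d) := Module.nontrivial_of_finrank_pos (R := ℝ) (by rw [hfr]; exact hd)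
  have hm : Measurable fun y : Euc d => ‖y‖ ^ (-a) := by fun_prop
  have hint : ∀ ρ : ℝ, IntegrableOn (fun y : Euc d => ‖y‖ ^ (-a)) (Metric.ball 0 ρ) volume :=
    fun ρ => integrableOn_ball_of_norm_le_rpow (C := 1) (α := a) (by rw [hfr]; exact hd)
      (by rw [hfr]; exact had) (Eventually.of_forall fun y => by
        rw [one_mul, Real.norm_of_nonneg (by positivity)]) hm.aestronglyMeasurable
  refine ⟨∫ y in Metric.ball (0 : Euc d) 1, ‖y‖ ^ (-a), by positivity, fun ρ hρ => ?_⟩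
  have hsc : ∫ y in Metric.ball (0 : Euc d) ρ, ‖y‖ ^ (-a) =
      (∫ y in Metric.ball (0 : Euc d) 1, ‖y‖ ^ (-a)) * ρ ^ (d - a) := by
    have h1 := Measure.setIntegral_comp_smul_of_pos (volume : Measure (Euc d))
      (fun y => ‖y‖ ^ (-a)) (Metric.ball (0 : Euc d) 1) hρ
    rw [smul_unitBall_of_pos hρ, hfr] at h1
    have h2 : ∀ y : Euc d, ‖ρ • y‖ ^ (-a) = ρ ^ (-a) * ‖y‖ ^ (-a) := fun y => by
      rw [norm_smul, Real.norm_of_nonneg hρ.le, Real.mul_rpow hρ.le (norm_nonneg _)]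
    simp only [h2, smul_eq_mul] at h1
    rw [integral_const_mul, eq_inv_mul_iff_mul_eq₀ (by positivity)] at h1
    rw [← h1, sub_eq_add_neg, Real.rpow_add hρ, Real.rpow_natCast]
    ring
  rw [← hsc, ofReal_integral_eq_lintegral_ofReal (hint ρ)
    (Eventually.of_forall fun y => by positivity)]
  have hsub : {y : Euc d | bracket y < ρ} ⊆ Metric.ball 0 ρ := fun y hy =>
    mem_ball_zero_iff.2 ((norm_le_bracket y).trans_lt hy)
  refine (lintegral_mono_set hsub).trans (lintegral_mono_ae (ae_restrict_of_ae ?_))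
  have hne : ∀ᵐ y : Euc d, y ≠ 0 := by
    rw [ae_iff]; simp
  filter_upwards [hne] with y hy
  exact ENNReal.ofReal_le_ofReal (Real.rpow_le_rpow_of_nonpos (norm_pos_iff.2 hy)
    (norm_le_bracket y) (by linarith))

end

/-! ### A Paley-type inequality by level-dependent splitting -/

section


variable {d : ℕ}

/-- The weighted modulus `⟨y⟩^s |ψ(y)|`. -/
def wmod (s : ℝ) (ψ : 𝓢(Euc d, ℂ)) (y : Euc d) : ℝ := bracket y ^ s * ‖ψ y‖

lemma wmod_nonneg (s : ℝ) (ψ : 𝓢(Euc d, ℂ)) (y : Euc d) : 0 ≤ wmod s ψ y := by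
  have := bracket_pos y
  unfold wmod; positivity

lemma measurable_wmod (s : ℝ) (ψ : 𝓢(Euc d, ℂ)) : Measurable (wmod s ψ) :=
  ((continuous_bracket_rpow s).mul ψ.continuous.norm).measurable

/-- The set on which `ψ` is treated in `L²` at the level `l`. -/
def lvlSet (m s κ : ℝ) (ψ : 𝓢(Euc d, ℂ)) (l : ℝ) : Set (Euc d) :=
  {y | l ≤ bracket y ^ (d / m) ∧ l * bracket y ^ s * wmod s ψ y ^ κ ≤ 1}

lemma measurableSet_lvlSet_prod (m s κ c : ℝ) (ψ : 𝓢(Euc d, ℂ)) :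
    MeasurableSet {z : ℝ × Euc d | z.2 ∈ lvlSet m s κ ψ (z.1 / c)} := by
  have h1 : Measurable fun z : ℝ × Euc d => bracket z.2 ^ (d / m) :=
    (continuous_bracket_rpow (d / m)).measurable.comp measurable_snd
  have h2 : Measurable fun z : ℝ × Euc d => bracket z.2 ^ s :=
    (continuous_bracket_rpow s).measurable.comp measurable_snd
  have h3 : Measurable fun z : ℝ × Euc d => wmod s ψ z.2 ^ κ :=
    ((measurable_wmod s ψ).comp measurable_snd).pow_const κ
  have h4 : Measurable fun z : ℝ × Euc d => z.1 / c := measurable_fst.div_const c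
  exact (measurableSet_le h4 h1).inter (measurableSet_le ((h4.mul h2).mul h3) measurable_const)

lemma measurableSet_lvlSet (m s κ : ℝ) (ψ : 𝓢(Euc d, ℂ)) (l : ℝ) :
    MeasurableSet (lvlSet m s κ ψ l) := by
  have := (measurableSet_lvlSet_prod m s κ 1 ψ).preimage
    (measurable_prodMk_left (x := l) (β := Euc d))
  simpa using this

section LevelSets

variable {m Q s κ : ℝ}

/-- Here 1 + κ is the exponent conjugate to Q. The complement is covered by a ball and by a set of
large values. On the ball ⟨y⟩ < l^{m/d}, Hölder against ⟨y⟩^{-s} gives a multiple of l by the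
scaling relation between s, Q and m. On the other set |ψ| ≤ l · wmod^{1+κ} pointwise. -/
lemma lintegral_compl_lvlSet_le (hd : 1 ≤ d) (hQ : 2 ≤ Q) (hQm : Q ≤ m) (hκ : κ * (Q - 1) = 1)
    (hs : s * Q * m = d * (m - Q)) : ∃ C : ℝ, 0 < C ∧ ∀ ψ : 𝓢(Euc d, ℂ),
      ∫⁻ y, ENNReal.ofReal (wmod s ψ y ^ (1 + κ)) ≤ 1 → ∀ l : ℝ, 0 < l →
        ∫⁻ y in (lvlSet m s κ ψ l)ᶜ, ‖ψ y‖ₑ ≤ ENNReal.ofReal (C * l) := by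
  have hm : 0 < m := by linarith
  have hd0 : (0 : ℝ) < d := by exact_mod_cast hd
  have hκ0 : 0 < κ := by
    have h1 : 0 < Q - 1 := by linarith
    by_contra h
    nlinarith
  have hsQ : s * Q = d - d * Q / m := by field_simp; linarith
  have hsQ0 : 0 ≤ s * Q := by
    rw [show s * Q = d * (m - Q) / m by rw [eq_div_iff hm.ne']; exact hs]
    exact div_nonneg (mul_nonneg hd0.le (by linarith)) hm.le
  obtain ⟨K, hK, HK⟩ := lintegral_bracket_ball_le hd hsQ0 (by
    rw [hsQ]; have : 0 < d * Q / m := by positivity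
    linarith)
  refine ⟨K ^ (1 / Q) + 1, by positivity, fun ψ hψ l hl => ?_⟩
  set ρ := l ^ (m / d) with hρ
  have hρ0 : 0 < ρ := by positivity
  set B₁ : Set (Euc d) := {y | bracket y < ρ} with hB₁
  set B₂ : Set (Euc d) := {y | 1 < l * bracket y ^ s * wmod s ψ y ^ κ} with hB₂
  have hsub : (lvlSet m s κ ψ l)ᶜ ⊆ B₁ ∪ B₂ := by
    intro y hy
    by_contra hn
    rw [Set.mem_union, not_or] at hn
    refine hy ⟨?_, not_lt.1 hn.2⟩
    have h1 : ρ ≤ bracket y := not_lt.1 hn.1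
    calc l = ρ ^ (d / m) := by
          rw [hρ, ← Real.rpow_mul hl.le, show m / d * (d / m) = 1 by field_simp, Real.rpow_one]
      _ ≤ _ := Real.rpow_le_rpow hρ0.le h1 (by positivity)
  have e2 : ∫⁻ y in B₂, ‖ψ y‖ₑ ≤ ENNReal.ofReal l := by
    have hle : ∀ y ∈ B₂, ‖ψ y‖ₑ ≤ ENNReal.ofReal l * ENNReal.ofReal (wmod s ψ y ^ (1 + κ)) := by
      intro y hy
      rw [← ofReal_norm, ← ENNReal.ofReal_mul hl.le]
      refine ENNReal.ofReal_le_ofReal ?_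
      have h1 : 1 ≤ l * bracket y ^ s * wmod s ψ y ^ κ := le_of_lt hy
      calc ‖ψ y‖ ≤ ‖ψ y‖ * (l * bracket y ^ s * wmod s ψ y ^ κ) :=
            le_mul_of_one_le_right (norm_nonneg _) h1
        _ = l * (wmod s ψ y * wmod s ψ y ^ κ) := by simp only [wmod]; ring
        _ = _ := by
            rw [Real.rpow_add' (wmod_nonneg s ψ y) (by linarith), Real.rpow_one]
    have hB₂m : MeasurableSet B₂ := measurableSet_lt measurable_const
      ((measurable_const.mul (continuous_bracket_rpow s).measurable).mul
        ((measurable_wmod s ψ).pow_const κ))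
    calc ∫⁻ y in B₂, ‖ψ y‖ₑ
        ≤ ∫⁻ y in B₂, ENNReal.ofReal l * ENNReal.ofReal (wmod s ψ y ^ (1 + κ)) :=
          setLIntegral_mono' hB₂m hle
      _ ≤ ∫⁻ y, ENNReal.ofReal l * ENNReal.ofReal (wmod s ψ y ^ (1 + κ)) :=
          setLIntegral_le_lintegral _ _
      _ = ENNReal.ofReal l * ∫⁻ y, ENNReal.ofReal (wmod s ψ y ^ (1 + κ)) :=
          lintegral_const_mul' _ _ ENNReal.ofReal_ne_top
      _ ≤ ENNReal.ofReal l * 1 := mul_le_mul' le_rfl hψ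
      _ = _ := mul_one _
  have e1 : ∫⁻ y in B₁, ‖ψ y‖ₑ ≤ ENNReal.ofReal (K ^ (1 / Q) * l) := by
    have hconj : Q.HolderConjugate (1 + κ) := by
      rw [Real.holderConjugate_iff]
      refine ⟨by linarith, ?_⟩
      have h3 : Q ≠ 0 := by linarith
      rw [show 1 + κ = κ * Q by linarith]
      field_simp
      linarith
    have hol := ENNReal.lintegral_mul_le_Lp_mul_Lq (volume.restrict B₁) hconj
      (f := fun y => ENNReal.ofReal (bracket y ^ (-s))) (g := fun y => ENNReal.ofReal (wmod s ψ y))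
      (continuous_bracket_rpow (-s)).measurable.ennreal_ofReal.aemeasurable
      (measurable_wmod s ψ).ennreal_ofReal.aemeasurable
    simp only [Pi.mul_apply] at hol
    have h1 : ∀ y, ‖ψ y‖ₑ =
        ENNReal.ofReal (bracket y ^ (-s)) * ENNReal.ofReal (wmod s ψ y) := fun y => by
      have hb := bracket_pos y
      rw [← ENNReal.ofReal_mul (by positivity), wmod, ← mul_assoc,
        ← Real.rpow_add hb, neg_add_cancel, Real.rpow_zero, one_mul, ofReal_norm]
    have h2 : ∫⁻ y in B₁, ENNReal.ofReal (bracket y ^ (-s)) ^ Q ≤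
        ENNReal.ofReal (K * ρ ^ (d - s * Q)) := by
      refine le_trans (le_of_eq (lintegral_congr fun y => ?_)) (HK ρ hρ0)
      have hb := bracket_pos y
      rw [ENNReal.ofReal_rpow_of_pos (by positivity), ← Real.rpow_mul hb.le, neg_mul]
    have h3 : ∫⁻ y in B₁, ENNReal.ofReal (wmod s ψ y) ^ (1 + κ) ≤ 1 := by
      refine (setLIntegral_le_lintegral _ _).trans (le_trans (le_of_eq
        (lintegral_congr fun y => ?_)) hψ)
      rw [ENNReal.ofReal_rpow_of_nonneg (wmod_nonneg s ψ y) (by linarith)]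
    simp only [h1]
    refine hol.trans ?_
    calc _ ≤ ENNReal.ofReal (K * ρ ^ (d - s * Q)) ^ (1 / Q) * 1 ^ (1 / (1 + κ)) :=
          mul_le_mul' (ENNReal.rpow_le_rpow h2 (by positivity))
            (ENNReal.rpow_le_rpow h3 (by positivity))
      _ = _ := by
          rw [ENNReal.one_rpow, mul_one, ENNReal.ofReal_rpow_of_nonneg (by positivity)
            (by positivity), Real.mul_rpow hK (by positivity), ← Real.rpow_mul hρ0.le, hρ,
            ← Real.rpow_mul hl.le, hsQ]
          congr 2
          rw [show m / d * ((d - (d - d * Q / m)) * (1 / Q)) = 1 by field_simp; ring, Real.rpow_one]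
  calc ∫⁻ y in (lvlSet m s κ ψ l)ᶜ, ‖ψ y‖ₑ ≤ ∫⁻ y in B₁ ∪ B₂, ‖ψ y‖ₑ := lintegral_mono_set hsub
    _ ≤ (∫⁻ y in B₁, ‖ψ y‖ₑ) + ∫⁻ y in B₂, ‖ψ y‖ₑ := lintegral_union_le _ _ _
    _ ≤ ENNReal.ofReal (K ^ (1 / Q) * l) + ENNReal.ofReal l := add_le_add e1 e2
    _ = _ := by
        rw [← ENNReal.ofReal_add (by positivity) hl.le]; congr 1; ring

/-- The part of ψ off E has a transform bounded by its L¹ norm, at most t/2. The part on E must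
therefore exceed t/2, and Chebyshev with Plancherel estimates how often it does. -/
lemma volume_lt_norm_fourier_le {C : ℝ} (hC : 0 < C) (ψ : 𝓢(Euc d, ℂ)) {t : ℝ} (ht : 0 < t)
    {E : Set (Euc d)} (hE : MeasurableSet E)
    (h : ∫⁻ y in Eᶜ, ‖ψ y‖ₑ ≤ ENNReal.ofReal (C * (t / (2 * C)))) :
    volume {y : Euc d | t < ‖𝓕 ψ y‖} ≤ ENNReal.ofReal (4 / t ^ 2) * ∫⁻ y in E, ‖ψ y‖ₑ ^ 2 := by
  have i1 : Integrable (Eᶜ.indicator ψ) volume := ψ.integrable.indicator hE.compl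
  have i2 : Integrable (E.indicator ψ) volume := ψ.integrable.indicator hE
  have i3 : MemLp (E.indicator ψ) 2 volume := (ψ.memLp 2 volume).indicator hE
  have hsplit : ∀ y, 𝓕 ψ y = 𝓕 (Eᶜ.indicator ψ) y + 𝓕 (E.indicator ψ) y := fun y => by
    have hsum : (ψ : Euc d → ℂ) = Eᶜ.indicator ψ + E.indicator ψ :=
      (Set.indicator_compl_add_self E ψ).symm
    rw [SchwartzMap.fourier_coe, Real.fourier_eq, Real.fourier_eq, Real.fourier_eq,
      ← integral_add ((Real.fourierIntegral_convergent_iff y).2 i1)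
        ((Real.fourierIntegral_convergent_iff y).2 i2)]
    refine integral_congr_ae (Eventually.of_forall fun z => ?_)
    simp only
    rw [← smul_add, ← Pi.add_apply, ← hsum]
  have h1 : ∀ y, ‖𝓕 (Eᶜ.indicator ψ) y‖ ≤ t / 2 := fun y => by
    have hb : ‖𝓕 (Eᶜ.indicator ψ) y‖ₑ ≤ ENNReal.ofReal (C * (t / (2 * C))) := by
      rw [Real.fourier_eq]
      refine (enorm_integral_le_lintegral_enorm _).trans (le_trans (le_of_eq ?_) h)
      rw [← lintegral_indicator hE.compl]
      refine lintegral_congr fun z => ?_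
      rw [← enorm_indicator_eq_indicator_enorm, ← ofReal_norm, Circle.norm_smul, ofReal_norm]
    rw [← ofReal_norm, ENNReal.ofReal_le_ofReal_iff (by positivity)] at hb
    exact hb.trans (le_of_eq (by field_simp))
  have h2 := lintegral_fourier_sq_le i2 i3
  have h3 : {y : Euc d | t < ‖𝓕 ψ y‖} ⊆
      {y | ENNReal.ofReal (t / 2) ^ 2 ≤ ‖𝓕 (E.indicator ψ) y‖ₑ ^ 2} := fun y hy => by
    have h4 : t / 2 ≤ ‖𝓕 (E.indicator ψ) y‖ := by
      have h5 := h1 y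
      have h6 : t < ‖𝓕 ψ y‖ := hy
      rw [hsplit] at h6
      have := norm_add_le (𝓕 (Eᶜ.indicator ψ) y) (𝓕 (E.indicator ψ) y)
      linarith
    rw [Set.mem_ofPred_eq, ← ofReal_norm]
    exact pow_le_pow_left' (ENNReal.ofReal_le_ofReal h4) 2
  have hc : Continuous (𝓕 (E.indicator ψ)) := VectorFourier.fourierIntegral_continuous
    Real.continuous_fourierChar (L := innerₗ (Euc d)) continuous_inner i2
  have h7 := mul_meas_ge_le_lintegral (μ := volume) (hc.measurable.enorm.pow_const 2)
    (ENNReal.ofReal (t / 2) ^ 2)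
  have h8 : ∫⁻ y, ‖E.indicator ψ y‖ₑ ^ 2 = ∫⁻ y in E, ‖ψ y‖ₑ ^ 2 := by
    rw [← lintegral_indicator hE]
    refine lintegral_congr fun z => ?_
    by_cases hz : z ∈ E <;> simp [hz]
  have h9 : ENNReal.ofReal (4 / t ^ 2) * ENNReal.ofReal (t / 2) ^ 2 = 1 := by
    rw [← ENNReal.ofReal_pow (by positivity), ← ENNReal.ofReal_mul (by positivity),
      show 4 / t ^ 2 * (t / 2) ^ 2 = 1 by field_simp; norm_num, ENNReal.ofReal_one]
  calc volume {y : Euc d | t < ‖𝓕 ψ y‖}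
      ≤ volume {y | ENNReal.ofReal (t / 2) ^ 2 ≤ ‖𝓕 (E.indicator ψ) y‖ₑ ^ 2} := measure_mono h3
    _ = ENNReal.ofReal (4 / t ^ 2) * (ENNReal.ofReal (t / 2) ^ 2 *
          volume {y | ENNReal.ofReal (t / 2) ^ 2 ≤ ‖𝓕 (E.indicator ψ) y‖ₑ ^ 2}) := by
        rw [← mul_assoc, h9, one_mul]
    _ ≤ _ := mul_le_mul' le_rfl (h7.trans (h2.trans h8.le))

/-- Since 2 ≤ Q ≤ m, the power m - 2 of a minimum is at most the power m - Q of the first entry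
times the power Q - 2 of the second. The relations on κ and s make the exponents of X and r match
exactly. -/
lemma min_rpow_mul_sq_le (hQ : 2 ≤ Q) (hQm : Q ≤ m) (hm : 2 < m) (hκ : κ * (Q - 1) = 1)
    (hs : s * Q * m = d * (m - Q)) {X r : ℝ} (hX : 0 < X) (hr : 0 < r) :
    min (X ^ (d / m)) (X ^ (-s) * (X ^ s * r) ^ (-κ)) ^ (m - 2) * r ^ 2 ≤
      (X ^ s * r) ^ (1 + κ) := by
  set a := X ^ (d / m)
  set b := X ^ (-s) * (X ^ s * r) ^ (-κ)
  have ha : 0 < a := by positivity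
  have hb : 0 < b := by positivity
  have hmin : 0 < min a b := lt_min ha hb
  have hm0 : 0 < m := by linarith
  have h1 : min a b ^ (m - 2) ≤ a ^ (m - Q) * b ^ (Q - 2) := by
    rw [show m - 2 = (m - Q) + (Q - 2) by ring, Real.rpow_add hmin]
    exact mul_le_mul (Real.rpow_le_rpow hmin.le (min_le_left _ _) (by linarith))
      (Real.rpow_le_rpow hmin.le (min_le_right _ _) (by linarith)) (by positivity) (by positivity)
  have h2 : a ^ (m - Q) * b ^ (Q - 2) * r ^ 2 = (X ^ s * r) ^ (1 + κ) := by
    obtain ⟨x, rfl⟩ : ∃ x, Real.exp x = X := ⟨Real.log X, Real.exp_log hX⟩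
    obtain ⟨y, rfl⟩ : ∃ y, Real.exp y = r := ⟨Real.log r, Real.exp_log hr⟩
    simp only [a, b, ← Real.rpow_natCast, ← Real.exp_mul, ← Real.exp_add]
    congr 1
    have e1 : d / m * (m - Q) = s * Q := by field_simp; linarith
    have e2 : κ * Q = 1 + κ := by linarith
    push_cast
    linear_combination x * e1 - y * e2 - x * s * e2
  calc _ ≤ a ^ (m - Q) * b ^ (Q - 2) * r ^ 2 := mul_le_mul_of_nonneg_right h1 (by positivity)
    _ = _ := h2

lemma setLIntegral_rpow_Ioc (hm : 2 < m) {τ : ℝ} (hτ : 0 ≤ τ) :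
    ∫⁻ t in Set.Ioc 0 τ, ENNReal.ofReal (t ^ (m - 3)) = ENNReal.ofReal (τ ^ (m - 2) / (m - 2)) := by
  have h1 : IntervalIntegrable (fun t : ℝ => t ^ (m - 3)) volume 0 τ :=
    intervalIntegral.intervalIntegrable_rpow' (by linarith)
  rw [intervalIntegrable_iff_integrableOn_Ioc_of_le hτ] at h1
  rw [← ofReal_integral_eq_lintegral_ofReal h1, ← intervalIntegral.integral_of_le hτ,
    integral_rpow (Or.inl (by linarith))]
  · congr 1
    rw [show m - 3 + 1 = m - 2 by ring, Real.zero_rpow (by linarith), sub_zero]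
  · filter_upwards [ae_restrict_mem measurableSet_Ioc] with t ht
    exact Real.rpow_nonneg ht.1.le _

/-- For fixed y with ψ y ≠ 0 the levels t at which y belongs to the L² part lie below c times the
minimum of the previous lemma. The power t^{m-3} is integrable at 0 because m > 2. -/
lemma lintegral_lvlSet_le (hQ : 2 ≤ Q) (hQm : Q ≤ m) (hm : 2 < m) (hκ : κ * (Q - 1) = 1)
    (hs : s * Q * m = d * (m - Q)) {c : ℝ} (hc : 0 < c) (ψ : 𝓢(Euc d, ℂ)) (y : Euc d) :
    ‖ψ y‖ₑ ^ 2 * ∫⁻ t in Set.Ioi 0 ∩ {t | y ∈ lvlSet m s κ ψ (t / c)}, ENNReal.ofReal (t ^ (m - 3)) ≤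
      ENNReal.ofReal (c ^ (m - 2) / (m - 2)) * ENNReal.ofReal (wmod s ψ y ^ (1 + κ)) := by
  rcases eq_or_ne (ψ y) 0 with h0 | h0
  · simp [h0]
  have hr : 0 < ‖ψ y‖ := norm_pos_iff.2 h0
  have hX := bracket_pos y
  set X := bracket y
  set μ := min (X ^ (d / m)) (X ^ (-s) * (X ^ s * ‖ψ y‖) ^ (-κ)) with hμ
  have hμ0 : 0 ≤ μ := le_min (by positivity) (by positivity)
  have hsub : Set.Ioi 0 ∩ {t | y ∈ lvlSet m s κ ψ (t / c)} ⊆ Set.Ioc 0 (c * μ) := by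
    rintro t ⟨ht, h1, h2⟩
    refine ⟨ht, ?_⟩
    have h3 : t / c ≤ μ := by
      refine le_min h1 ?_
      have hw : 0 < X ^ s * ‖ψ y‖ := by positivity
      rw [Real.rpow_neg hX.le, Real.rpow_neg hw.le, ← mul_inv, ← one_div,
        le_div_iff₀ (by positivity), ← mul_assoc]
      exact h2
    rwa [div_le_iff₀' hc] at h3
  have hf := min_rpow_mul_sq_le (d := d) hQ hQm hm hκ hs hX hr
  calc _ ≤ ‖ψ y‖ₑ ^ 2 * ∫⁻ t in Set.Ioc 0 (c * μ), ENNReal.ofReal (t ^ (m - 3)) :=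
        mul_le_mul' le_rfl (lintegral_mono_set hsub)
    _ = ENNReal.ofReal (c ^ (m - 2) / (m - 2) * (μ ^ (m - 2) * ‖ψ y‖ ^ 2)) := by
        rw [setLIntegral_rpow_Ioc hm (by positivity), ← ofReal_norm,
          ← ENNReal.ofReal_pow (norm_nonneg _), ← ENNReal.ofReal_mul (by positivity),
          Real.mul_rpow hc.le hμ0]
        congr 1; ring
    _ ≤ _ := by
        have h5 : 0 ≤ c ^ (m - 2) / (m - 2) := div_nonneg (by positivity) (by linarith)
        rw [← ENNReal.ofReal_mul h5]
        exact ENNReal.ofReal_le_ofReal (mul_le_mul_of_nonneg_left hf h5)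

/-- Layer-cake formula with a splitting that depends on the level t. Tonelli then integrates over t
first, for each fixed y. -/
lemma lintegral_fourier_rpow_le (hd : 1 ≤ d) (hQ : 2 ≤ Q) (hQm : Q ≤ m) (hm : 2 < m)
    (hκ : κ * (Q - 1) = 1) (hs : s * Q * m = d * (m - Q)) : ∃ C : ℝ≥0∞, C ≠ ∞ ∧
      ∀ ψ : 𝓢(Euc d, ℂ), ∫⁻ y, ENNReal.ofReal (wmod s ψ y ^ (1 + κ)) ≤ 1 →
        ∫⁻ y, ENNReal.ofReal (‖𝓕 ψ y‖ ^ m) ≤ C := by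
  obtain ⟨C, hC, H⟩ := lintegral_compl_lvlSet_le hd hQ hQm hκ hs
  refine ⟨ENNReal.ofReal m * (4 * ENNReal.ofReal ((2 * C) ^ (m - 2) / (m - 2))), by finiteness,
    fun ψ hψ => ?_⟩
  have hcont : Continuous fun y => ‖𝓕 ψ y‖ := (𝓕 ψ).continuous.norm
  rw [lintegral_rpow_eq_lintegral_meas_lt_mul volume (Eventually.of_forall fun y => norm_nonneg _)
    hcont.measurable.aemeasurable (by linarith)]
  refine mul_le_mul' le_rfl ?_
  set S : Set (ℝ × Euc d) := {z | z.2 ∈ lvlSet m s κ ψ (z.1 / (2 * C))} with hS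
  have hSm : MeasurableSet S := measurableSet_lvlSet_prod m s κ (2 * C) ψ
  set F : ℝ → Euc d → ℝ≥0∞ := fun t y =>
    S.indicator (fun z => 4 * (‖ψ z.2‖ₑ ^ 2 * ENNReal.ofReal (z.1 ^ (m - 3)))) (t, y) with hF
  have hψm : Measurable fun z : ℝ × Euc d => ‖ψ z.2‖ₑ ^ 2 :=
    (ψ.continuous.measurable.comp measurable_snd).enorm.pow_const 2
  have htm : Measurable fun z : ℝ × Euc d => ENNReal.ofReal (z.1 ^ (m - 3)) :=
    (measurable_fst.pow_const (m - 3)).ennreal_ofReal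
  have hFm : Measurable (Function.uncurry F) :=
    ((measurable_const.mul (hψm.mul htm)).indicator hSm)
  have hstep : ∀ t ∈ Set.Ioi (0 : ℝ), volume {y : Euc d | t < ‖𝓕 ψ y‖} *
      ENNReal.ofReal (t ^ (m - 1)) ≤ ∫⁻ y, F t y := by
    intro t ht
    have ht0 : 0 < t := ht
    have h1 := volume_lt_norm_fourier_le hC ψ ht0 (measurableSet_lvlSet m s κ ψ (t / (2 * C)))
      (H ψ hψ _ (by positivity))
    refine (mul_le_mul' h1 le_rfl).trans (le_of_eq ?_)
    have h2 : ENNReal.ofReal (4 / t ^ 2) * ENNReal.ofReal (t ^ (m - 1)) =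
        4 * ENNReal.ofReal (t ^ (m - 3)) := by
      rw [← ENNReal.ofReal_mul (by positivity), show (4 : ℝ≥0∞) = ENNReal.ofReal 4 by simp,
        ← ENNReal.ofReal_mul (by norm_num), show m - 1 = (m - 3) + (2 : ℕ) by push_cast; ring,
        Real.rpow_add ht0, Real.rpow_natCast]
      congr 1; field_simp
    have hm2 : Measurable fun y => ‖ψ y‖ₑ ^ 2 := ψ.continuous.measurable.enorm.pow_const 2
    rw [mul_right_comm, h2, ← lintegral_const_mul _ hm2, ← lintegral_indicator
      (measurableSet_lvlSet m s κ ψ (t / (2 * C)))]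
    refine lintegral_congr fun y => ?_
    by_cases hy : y ∈ lvlSet m s κ ψ (t / (2 * C))
    · have hy' : (t, y) ∈ S := hy
      simp only [hF]
      rw [Set.indicator_of_mem hy, Set.indicator_of_mem hy']
      ring
    · have hy' : (t, y) ∉ S := hy
      simp only [hF]
      rw [Set.indicator_of_notMem hy, Set.indicator_of_notMem hy']
  calc ∫⁻ t in Set.Ioi 0, volume {y : Euc d | t < ‖𝓕 ψ y‖} * ENNReal.ofReal (t ^ (m - 1))
      ≤ ∫⁻ t in Set.Ioi 0, ∫⁻ y, F t y := setLIntegral_mono' measurableSet_Ioi hstep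
    _ = ∫⁻ y, ∫⁻ t in Set.Ioi 0, F t y := lintegral_lintegral_swap hFm.aemeasurable
    _ ≤ ∫⁻ y, 4 * (ENNReal.ofReal ((2 * C) ^ (m - 2) / (m - 2)) *
          ENNReal.ofReal (wmod s ψ y ^ (1 + κ))) := by
        refine lintegral_mono fun y => ?_
        have hSy : MeasurableSet {t : ℝ | y ∈ lvlSet m s κ ψ (t / (2 * C))} :=
          hSm.preimage measurable_prodMk_right
        refine le_trans (le_of_eq ?_) (mul_le_mul' (le_refl 4)
          (lintegral_lvlSet_le hQ hQm hm hκ hs (by positivity) ψ y))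
        have e : ∀ t, F t y = {t : ℝ | y ∈ lvlSet m s κ ψ (t / (2 * C))}.indicator
            (fun t => 4 * (‖ψ y‖ₑ ^ 2 * ENNReal.ofReal (t ^ (m - 3)))) t := fun t => rfl
        simp only [e]
        rw [lintegral_indicator hSy, Measure.restrict_restrict hSy, Set.inter_comm,
          lintegral_const_mul' _ _ (by finiteness), lintegral_const_mul' _ _ (by finiteness)]
    _ = 4 * ENNReal.ofReal ((2 * C) ^ (m - 2) / (m - 2)) *
          ∫⁻ y, ENNReal.ofReal (wmod s ψ y ^ (1 + κ)) := by
        simp only [← mul_assoc]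
        rw [lintegral_const_mul' _ _ (by finiteness)]
    _ ≤ _ := by
        refine (mul_le_mul' le_rfl hψ).trans (le_of_eq (mul_one _))

end LevelSets

end

/-! ### Sobolev embedding and the nonlinearity at low regularity -/

section


variable {d : ℕ}

lemma af_const_smul (c : ℂ) (h : 𝓢(Euc d, ℂ)) (y : Euc d) : af (c • h) y = ‖c‖ₑ * af h y := by
  have : 𝓕 (c • h) = c • 𝓕 h := map_smul (FourierTransform.fourierCLM ℂ 𝓢(Euc d, ℂ)) c h
  rw [af, this, _root_.smul_apply, smul_eq_mul, enorm_mul, af]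

lemma fl_const_smul {α : ℝ} (hα : α ≤ 1) (σ : ℝ) (c : ℂ) (h : 𝓢(Euc d, ℂ)) :
    fl α σ (c • h) = ‖c‖ₑ * fl α σ h := by
  rw [fl, fl, ← innerNorm_const_mul (one_le_ex hα) _ (measurable_af h)]
  congr 1
  ext y
  exact af_const_smul c h y

lemma eq_zero_of_fl_eq_zero {α σ : ℝ} {h : 𝓢(Euc d, ℂ)} (h0 : fl α σ h = 0) : h = 0 := by
  have hm : Measurable fun y => wt σ y * af h y := (measurable_wt σ).mul (measurable_af h)
  rw [fl, innerNorm, eLpNorm_eq_zero_iff hm.aestronglyMeasurable (ex_ne_zero α)] at h0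
  have h1 : ∀ᵐ y, 𝓕 h y = 0 := by
    filter_upwards [h0] with y hy
    rcases mul_eq_zero.1 hy with h2 | h2
    · exact absurd h2 (wt_ne_zero σ y)
    · simpa [af] using h2
  ext z
  have h2 : h z = 𝓕⁻ (𝓕 h) z := by rw [fourierInv_fourier_eq]
  rw [h2, fourierInv_apply_eq]
  refine (integral_eq_zero_of_ae ?_).trans rfl
  filter_upwards [h1] with y hy
  simp [hy]

lemma lintegral_wmod_fourierInv {s κ Q : ℝ} (hQ : 2 ≤ Q) (hκ : κ * (Q - 1) = 1)
    (h : 𝓢(Euc d, ℂ)) : ∫⁻ y, ENNReal.ofReal (wmod s (𝓕⁻ h) y ^ (1 + κ)) =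
      fl (1 - 1 / Q) s h ^ (1 + κ) := by
  have hQ0 : Q ≠ 0 := by linarith
  have hα : 0 < 1 - 1 / Q := by
    have : 1 / Q < 1 := by rw [div_lt_one (by linarith)]; linarith
    linarith
  have hκ' : (1 - 1 / Q)⁻¹ = 1 + κ := by
    refine inv_eq_of_mul_eq_one_right ?_
    have e : (1 - 1 / Q) * (1 + κ) = (Q - 1) * (1 + κ) / Q := by field_simp
    rw [e, div_eq_one_iff_eq hQ0]
    linarith
  have hκ0 : 0 < 1 + κ := by rw [← hκ']; positivity
  rw [fl, innerNorm, eLpNorm_ex hα, ← ENNReal.rpow_mul, ← hκ', mul_inv_cancel₀ hα.ne',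
    ENNReal.rpow_one, hκ', ← lintegral_neg_eq_self]
  refine lintegral_congr fun y => ?_
  rw [← ENNReal.ofReal_rpow_of_nonneg (wmod_nonneg _ _ _) hκ0.le, wmod,
    fourierInv_eq_fourier_neg, neg_neg, ENNReal.ofReal_mul (Real.rpow_nonneg (bracket_pos _).le _),
    ofReal_norm, ← wt_neg_arg s y]
  rfl

/-- The Sobolev embedding of weighted Fourier-Lebesgue spaces into Lebesgue spaces. -/
theorem eLpNorm_le_fl (hd : 1 ≤ d) {m Q s : ℝ} (hQ : 2 ≤ Q) (hQm : Q ≤ m) (hm : 2 < m)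
    (hs : d * (m - Q) ≤ s * Q * m) : ∃ C : ℝ≥0∞, C ≠ ∞ ∧ ∀ h : 𝓢(Euc d, ℂ),
      eLpNorm h (ENNReal.ofReal m) volume ≤ C * fl (1 - 1 / Q) s h := by
  have hQ0 : 0 < Q := by linarith
  have hm0 : 0 < m := by linarith
  -- The critical regularity, for which the scaling relation is an equality. Larger s only increases
  -- the norm on the right.
  set s₀ := d * (m - Q) / (Q * m) with hs₀
  have hs₀' : s₀ * Q * m = d * (m - Q) := by rw [hs₀]; field_simp
  have hs₀s : s₀ ≤ s := by rw [hs₀, div_le_iff₀ (by positivity)]; linarith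
  set κ := (Q - 1)⁻¹ with hκ
  have hκ1 : κ * (Q - 1) = 1 := inv_mul_cancel₀ (by linarith)
  have hκ0 : 0 < κ := inv_pos.2 (by linarith)
  obtain ⟨C, hC, H⟩ := lintegral_fourier_rpow_le hd hQ hQm hm hκ1 hs₀'
  refine ⟨C ^ (1 / m) + 1, by finiteness, fun h => ?_⟩
  have hα : 1 - 1 / Q ≤ 1 := by
    have : 0 ≤ 1 / Q := by positivity
    linarith
  have hmono : fl (1 - 1 / Q) s₀ h ≤ fl (1 - 1 / Q) s h :=
    eLpNorm_mono_ennreal fun y => mul_le_mul' (wt_mono hs₀s y) le_rfl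
  refine le_trans ?_ (mul_le_mul' le_rfl hmono)
  set Λ := fl (1 - 1 / Q) s₀ h with hΛ
  rcases eq_or_ne Λ 0 with h0 | h0
  · rw [eq_zero_of_fl_eq_zero h0]
    have e : ((0 : 𝓢(Euc d, ℂ)) : Euc d → ℂ) = 0 := rfl
    rw [e, eLpNorm_zero]
    exact zero_le
  rcases eq_or_ne Λ ∞ with ht | ht
  · rw [ht, ENNReal.mul_top (by simp)]; exact le_top
  -- The Paley-type inequality is available for unit norm, so h is normalised; homogeneity restores
  -- the general case.
  set c : ℂ := (((Λ.toReal)⁻¹ : ℝ) : ℂ) with hc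
  have hΛ0 : 0 < Λ.toReal := ENNReal.toReal_pos h0 ht
  have hcn : ‖c‖ₑ = Λ⁻¹ := by
    rw [hc, ← ofReal_norm, Complex.norm_real, Real.norm_of_nonneg (by positivity),
      ENNReal.ofReal_inv_of_pos hΛ0, ENNReal.ofReal_toReal ht]
  have h1 := H (𝓕⁻ (c • h)) (by
    rw [lintegral_wmod_fourierInv hQ hκ1, fl_const_smul hα, hcn, ← hΛ,
      ENNReal.inv_mul_cancel h0 ht, ENNReal.one_rpow])
  rw [fourier_fourierInv_eq] at h1
  have h2 : eLpNorm (c • h : 𝓢(Euc d, ℂ)) (ENNReal.ofReal m) volume ≤ C ^ (1 / m) := by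
    rw [eLpNorm_eq_lintegral_rpow_enorm_toReal (by simpa using hm0) ENNReal.ofReal_ne_top,
      ENNReal.toReal_ofReal hm0.le]
    refine ENNReal.rpow_le_rpow (le_trans (le_of_eq (lintegral_congr fun y => ?_)) h1)
      (by positivity)
    rw [← ofReal_norm, ENNReal.ofReal_rpow_of_nonneg (norm_nonneg _) hm0.le]
  have h3 : eLpNorm (c • h : 𝓢(Euc d, ℂ)) (ENNReal.ofReal m) volume =
      Λ⁻¹ * eLpNorm h (ENNReal.ofReal m) volume := by
    rw [← hcn, ← eLpNorm_const_smul]; rfl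
  rw [h3] at h2
  calc eLpNorm h (ENNReal.ofReal m) volume
      = Λ * (Λ⁻¹ * eLpNorm h (ENNReal.ofReal m) volume) := by
        rw [← mul_assoc, ENNReal.mul_inv_cancel h0 ht, one_mul]
    _ ≤ Λ * C ^ (1 / m) := mul_le_mul' le_rfl h2
    _ ≤ _ := by rw [mul_comm]; exact mul_le_mul' le_self_add le_rfl

lemma lintegral_pow_mul_le {β : Type*} [MeasurableSpace β] {μ : Measure β} (k : ℕ)
    {S D : β → ℝ≥0∞} (hS : AEMeasurable S μ) (hD : AEMeasurable D μ) :
    ∫⁻ x, S x ^ (2 * k) * D x ∂μ ≤ eLpNorm S (2 * k + 1 : ℕ) μ ^ (2 * k) *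
      eLpNorm D (2 * k + 1 : ℕ) μ := by
  set n : ℝ := ((2 * k + 1 : ℕ) : ℝ) with hn
  have hn0 : 0 < n := by positivity
  have hf : ∀ i ∈ Finset.univ, AEMeasurable ((![fun x => S x ^ n, fun x => D x ^ n] :
      Fin 2 → β → ℝ≥0∞) i) μ := fun i _ => by
    fin_cases i
    · exact hS.pow_const n
    · exact hD.pow_const n
  have hol := ENNReal.lintegral_prod_norm_pow_le (μ := μ) Finset.univ hf
    (p := ![2 * k / n, 1 / n]) (by
      simp only [Fin.sum_univ_two, Matrix.cons_val_zero, Matrix.cons_val_one]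
      rw [← add_div, div_eq_one_iff_eq hn0.ne', hn]; push_cast; rfl)
    (fun i _ => by fin_cases i <;> simp <;> positivity)
  simp only [Fin.prod_univ_two, Matrix.cons_val_zero, Matrix.cons_val_one,
    ← ENNReal.rpow_mul] at hol
  rw [mul_div_cancel₀ _ hn0.ne', mul_one_div_cancel hn0.ne'] at hol
  have hk : ∀ a : ℝ≥0∞, a ^ (2 * (k : ℝ)) = a ^ (2 * k) := fun a => by
    rw [← ENNReal.rpow_natCast]; push_cast; rfl
  simp only [ENNReal.rpow_one, hk] at hol
  refine hol.trans (le_of_eq ?_)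
  have hne : ((2 * k + 1 : ℕ) : ℝ≥0∞) ≠ 0 := Nat.cast_ne_zero.2 (Nat.succ_ne_zero _)
  rw [eLpNorm_ennreal hne (ENNReal.natCast_ne_top _), eLpNorm_ennreal hne (ENNReal.natCast_ne_top _),
    ENNReal.toReal_natCast, ← hn, ← hk, ← ENNReal.rpow_mul]
  congr 3
  ring

/-- Induction on k through |a|² = a · conj a, with the difference telescoped over the three factors.
Every step adds two terms, whence the constant 2k + 1. -/
lemma enorm_pow_mul_sub_le (k : ℕ) (a b : ℂ) :
    ‖((‖a‖ ^ (2 * k) : ℝ) : ℂ) * a - ((‖b‖ ^ (2 * k) : ℝ) : ℂ) * b‖ₑ ≤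
      (2 * k + 1 : ℕ) * ((‖a‖ₑ + ‖b‖ₑ) ^ (2 * k) * ‖a - b‖ₑ) := by
  have hr : ∀ k : ℕ, ‖((‖a‖ ^ (2 * k) : ℝ) : ℂ) * a - ((‖b‖ ^ (2 * k) : ℝ) : ℂ) * b‖ ≤
      (2 * k + 1) * ((‖a‖ + ‖b‖) ^ (2 * k) * ‖a - b‖) := by
    intro k
    induction k with
    | zero => simp
    | succ k ih =>
      have hsq : ∀ z : ℂ, ((‖z‖ ^ (2 * (k + 1)) : ℝ) : ℂ) = ((‖z‖ ^ (2 * k) : ℝ) : ℂ) * (z * conj z) :=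
        fun z => by
          rw [Complex.mul_conj, Complex.normSq_eq_norm_sq, mul_add, pow_add]; push_cast; ring
      set P := ((‖a‖ ^ (2 * k) : ℝ) : ℂ) * a
      set P' := ((‖b‖ ^ (2 * k) : ℝ) : ℂ) * b with hP'
      set S := ‖a‖ + ‖b‖
      have hS0 : 0 ≤ S := by positivity
      have ha : ‖a‖ ≤ S := le_add_of_nonneg_right (norm_nonneg _)
      have hb : ‖b‖ ≤ S := le_add_of_nonneg_left (norm_nonneg _)
      have hP'S : ‖P'‖ ≤ S ^ (2 * k) * S := by
        rw [hP', norm_mul, Complex.norm_real, Real.norm_of_nonneg (by positivity)]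
        exact mul_le_mul (pow_le_pow_left₀ (norm_nonneg _) hb _) hb (norm_nonneg _) (by positivity)
      have e : ((‖a‖ ^ (2 * (k + 1)) : ℝ) : ℂ) * a - ((‖b‖ ^ (2 * (k + 1)) : ℝ) : ℂ) * b =
          (P - P') * conj a * a + (P' * conj (a - b) * a + P' * conj b * (a - b)) := by
        rw [hsq, hsq, map_sub]; ring
      rw [e]
      refine (norm_add_le _ _).trans ((add_le_add le_rfl (norm_add_le _ _)).trans ?_)
      simp only [norm_mul, RCLike.norm_conj]
      have t1 : ‖P - P'‖ * ‖a‖ * ‖a‖ ≤ (2 * k + 1) * (S ^ (2 * k) * ‖a - b‖) * S * S := by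
        gcongr
      have t2 : ‖P'‖ * ‖a - b‖ * ‖a‖ ≤ S ^ (2 * k) * S * ‖a - b‖ * S := by gcongr
      have t3 : ‖P'‖ * ‖b‖ * ‖a - b‖ ≤ S ^ (2 * k) * S * S * ‖a - b‖ := by gcongr
      calc _ ≤ _ := add_le_add t1 (add_le_add t2 t3)
        _ = _ := by rw [show 2 * (k + 1) = 2 * k + 2 by ring, pow_add]; push_cast; ring
  rw [← ofReal_norm, ← ofReal_norm, ← ofReal_norm, ← ofReal_norm,
    ← ENNReal.ofReal_add (norm_nonneg _) (norm_nonneg _), ← ENNReal.ofReal_pow (by positivity),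
    ← ENNReal.ofReal_mul (by positivity), ← ENNReal.ofReal_natCast,
    ← ENNReal.ofReal_mul (by positivity)]
  refine ENNReal.ofReal_le_ofReal ((hr k).trans (le_of_eq ?_))
  push_cast; rfl

lemma lintegral_pow_mul_sub_le {β : Type*} [MeasurableSpace β] {μ : Measure β} (k : ℕ)
    {a b : β → ℂ} (ha : AEStronglyMeasurable a μ) (hb : AEStronglyMeasurable b μ) :
    ∫⁻ x, ‖((‖a x‖ ^ (2 * k) : ℝ) : ℂ) * a x - ((‖b x‖ ^ (2 * k) : ℝ) : ℂ) * b x‖ₑ ∂μ ≤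
      (2 * k + 1 : ℕ) * ((eLpNorm a (2 * k + 1 : ℕ) μ + eLpNorm b (2 * k + 1 : ℕ) μ) ^ (2 * k) *
        eLpNorm (a - b) (2 * k + 1 : ℕ) μ) := by
  refine (lintegral_mono fun x => enorm_pow_mul_sub_le k (a x) (b x)).trans ?_
  rw [lintegral_const_mul' _ _ (ENNReal.natCast_ne_top _)]
  refine mul_le_mul' le_rfl ((lintegral_pow_mul_le k (ha.enorm.add hb.enorm)
    (ha.sub hb).enorm).trans (mul_le_mul' (pow_le_pow_left' ?_ _) (le_of_eq ?_)))
  · refine (eLpNorm_add_le ha.enorm.aestronglyMeasurable hb.enorm.aestronglyMeasurable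
      (by exact_mod_cast Nat.succ_le_succ (Nat.zero_le _))).trans (le_of_eq ?_)
    rw [eLpNorm_enorm, eLpNorm_enorm]
  · exact eLpNorm_enorm _

/-- The Fourier transform of the difference of powers is bounded by its L¹ norm, hence by L^{2k+1}
norms of h and h'. What is left is ⟨y⟩^{s-1} in L^{1/α}, finite because dα < 1 - s. -/
theorem fiberEstimate_of_local {s α : ℝ} (hα : 0 < α) (hα1 : α ≤ 1) {k : ℕ} {C : ℝ≥0∞} (hC : C ≠ ∞)
    (H : ∀ h : 𝓢(Euc d, ℂ), eLpNorm h (2 * k + 1 : ℕ) volume ≤ C * fl α s h)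
    (hs : d * α < 1 - s) : FiberEstimate d k α s := by
  have hW := wtNorm_lt_top hα hs
  refine ⟨wtNorm d α (1 - s) * ((2 * k + 1 : ℕ) * (C ^ (2 * k) * C)), ?_, fun h h' => ?_⟩
  · exact ENNReal.mul_ne_top hW.ne (ENNReal.mul_ne_top (ENNReal.natCast_ne_top _)
      (ENNReal.mul_ne_top (ENNReal.pow_ne_top hC) hC))
  set P := pw k h - pw k h' with hP
  have h1 : ∀ y, af P y ≤ ∫⁻ z, ‖P z‖ₑ := fun y => by
    rw [af, fourier_apply_eq]
    refine (enorm_integral_le_lintegral_enorm _).trans (le_of_eq (lintegral_congr fun z => ?_))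
    rw [enorm_mul, ← ofReal_norm, norm_chr, ENNReal.ofReal_one, one_mul]
  have h2 : ∫⁻ z, ‖P z‖ₑ ≤ (2 * k + 1 : ℕ) * (C ^ (2 * k) * C) *
      ((fl α s h + fl α s h') ^ (2 * k) * fl α s (h - h')) := by
    have h3 := lintegral_pow_mul_sub_le (μ := volume) k (a := h) (b := h')
      h.continuous.aestronglyMeasurable h'.continuous.aestronglyMeasurable
    have h4 : ∀ z, P z = ((‖h z‖ ^ (2 * k) : ℝ) : ℂ) * h z - ((‖h' z‖ ^ (2 * k) : ℝ) : ℂ) * h' z :=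
      fun z => by rw [hP, _root_.sub_apply, pw_apply, pw_apply]
    simp only [h4]
    have h5 : eLpNorm (h - h' : Euc d → ℂ) (2 * k + 1 : ℕ) volume ≤ C * fl α s (h - h') :=
      H (h - h')
    refine (h3.trans (mul_le_mul' le_rfl (mul_le_mul' (pow_le_pow_left'
      (add_le_add (H h) (H h')) _) h5))).trans (le_of_eq ?_)
    rw [← mul_add, mul_pow]; ring
  calc fl α (s - 1) P ≤ eLpNorm (fun y => (∫⁻ z, ‖P z‖ₑ) * wt (s - 1) y) (ex α) volume :=
        eLpNorm_mono_ennreal fun y => by rw [mul_comm]; exact mul_le_mul' (h1 y) le_rfl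
    _ = (∫⁻ z, ‖P z‖ₑ) * wtNorm d α (1 - s) := by
        rw [eLpNorm_const_mul_ennreal (one_le_ex hα1) _ (measurable_wt _).aemeasurable, wtNorm,
          neg_sub]
    _ ≤ _ := (mul_le_mul' h2 le_rfl).trans (le_of_eq (by ring))

end

/-! ### Choice of exponents and nonlinear estimates in the amalgam norm -/

section


variable {d : ℕ}

section Exponents

variable {k : ℕ} {Q s : ℝ}

/-- The local Lebesgue integrability gained by a function in the weighted Fourier-Lebesgue space. -/
lemma exists_eLpNorm_le_fl (hd : 1 ≤ d) (hk : 1 ≤ k) (hs : 0 ≤ s) (hQ : 2 * k * d < Q)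
    (hQs : 1 / Q ≤ s + 1 / (2 * k + 1)) : ∃ C : ℝ≥0∞, C ≠ ∞ ∧ ∀ h : 𝓢(Euc d, ℂ),
      eLpNorm h (ENNReal.ofReal (max (2 * k + 1) Q)) volume ≤ C * fl (1 - 1 / Q) s h := by
  have hd' : (1 : ℝ) ≤ d := by exact_mod_cast hd
  have hk' : (1 : ℝ) ≤ k := by exact_mod_cast hk
  have hkd : 2 ≤ 2 * (k : ℝ) * d := by nlinarith
  refine eLpNorm_le_fl hd (by linarith) (le_max_right _ _)
    (lt_max_of_lt_left (by linarith)) ?_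
  rcases le_total (2 * (k : ℝ) + 1) Q with h | h
  · rw [max_eq_right h, sub_self, mul_zero]
    have : 0 ≤ Q := by linarith
    positivity
  · rw [max_eq_left h]
    -- For k ≥ 1 the inequalities 2kd < Q ≤ 2k + 1 exclude d ≥ 2.
    have hd1 : d = 1 := by
      by_contra hne
      have h2 : (2 : ℝ) ≤ d := by exact_mod_cast (by lia : 2 ≤ d)
      nlinarith
    have hQ0 : 0 < Q := by linarith
    have hn : (0 : ℝ) < 2 * k + 1 := by linarith
    have h3 : 1 / Q * (Q * (2 * k + 1)) ≤ (s + 1 / (2 * k + 1)) * (Q * (2 * k + 1)) :=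
      mul_le_mul_of_nonneg_right hQs (by positivity)
    have e1 : 1 / Q * (Q * (2 * k + 1)) = 2 * k + 1 := by field_simp
    have e2 : (s + 1 / (2 * k + 1)) * (Q * (2 * k + 1)) = s * Q * (2 * k + 1) + Q := by
      field_simp
    rw [e1, e2] at h3
    rw [hd1]; push_cast; linarith

/-- Young's scheme with loss θ per product needs ℱL^q_s inside the unweighted space of reciprocal
exponent 1 - θ, the bound 2kθ ≤ 1 - 1/Q, and 2kdθ < 1. For Q ≥ 2k+1 the value θ = 1/Q fulfils all
three even if s = 0. For Q ≤ 2k+1 one has d = 1, and the case is split at s = 1/Q. -/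
theorem fiberEstimate (hd : 1 ≤ d) (hk : 1 ≤ k) (hs : 0 ≤ s) (hQ : 2 * k * d < Q)
    (hQs : 1 / Q ≤ s + 1 / (2 * k + 1)) : FiberEstimate d k (1 - 1 / Q) s := by
  have hd' : (1 : ℝ) ≤ d := by exact_mod_cast hd
  have hk' : (1 : ℝ) ≤ k := by exact_mod_cast hk
  have hkd : 2 ≤ 2 * (k : ℝ) * d := by nlinarith
  have hQ0 : 0 < Q := by linarith
  have hQ1 : 1 / Q ≤ 1 / 2 := one_div_le_one_div_of_le (by norm_num) (by linarith)
  have hQ2 : 0 < 1 / Q := by positivity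
  rcases le_total (2 * (k : ℝ) + 1) Q with h | h
  · refine fiberEstimate_of_young (θ := 1 / Q) hs (by linarith) hQ2.le (by linarith) ?_ k ?_ ?_
    · rw [show 1 - 1 / Q - (1 - 1 / Q) = 0 by ring]
      exact wtNorm_zero_lt_top hs
    · have : (2 * k + 1) * (1 / Q) ≤ 1 := by rw [mul_one_div, div_le_one hQ0]; exact h
      linarith
    · refine wtNorm_lt_top (by positivity) ?_
      rw [show (d : ℝ) * (2 * k * (1 / Q)) = 2 * k * d / Q by ring, div_lt_one hQ0]
      exact hQ
  · have hd1 : d = 1 := by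
      by_contra hne
      have h2 : (2 : ℝ) ≤ d := by exact_mod_cast (by lia : 2 ≤ d)
      nlinarith
    -- Below 1/Q one has 1 - 1/Q < 1 - s, which is the integrability of ⟨y⟩^{s-1} required by the L¹
    -- argument. From 1/Q on, any positive θ gives 1/Q - θ < s, so the embedding needed for Young's
    -- scheme holds.
    rcases lt_or_ge s (1 / Q) with hsQ | hsQ
    · obtain ⟨C, hC, H⟩ := exists_eLpNorm_le_fl hd hk hs hQ hQs
      refine fiberEstimate_of_local (C := C) (by linarith) (by linarith) hC (fun f => ?_) ?_
      · have := H f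
        rw [max_eq_left h] at this
        refine le_trans (le_of_eq ?_) this
        congr 1
        rw [← ENNReal.ofReal_natCast]; push_cast; rfl
      · rw [hd1]; push_cast; linarith
    · set θ := min (1 / Q) ((1 - 1 / Q) / (2 * k)) / 2 with hθ
      have hα : 0 < (1 - 1 / Q) / (2 * k) := div_pos (by linarith) (by linarith)
      have hmin : 0 < min (1 / Q) ((1 - 1 / Q) / (2 * k)) := lt_min hQ2 hα
      have hθ0 : 0 < θ := by positivity
      have h1 : θ ≤ 1 / Q / 2 := div_le_div_of_nonneg_right (min_le_left _ _) (by norm_num)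
      have h2 : θ ≤ (1 - 1 / Q) / (2 * k) :=
        (half_le_self hmin.le).trans (min_le_right _ _)
      have h3 : 2 * k * θ ≤ 1 - 1 / Q := by rwa [le_div_iff₀' (by linarith)] at h2
      refine fiberEstimate_of_young (θ := θ) hs (by linarith) hθ0.le (by linarith) ?_ k h3 ?_
      · refine wtNorm_lt_top (by linarith) ?_
        rw [hd1]; push_cast; linarith
      · refine wtNorm_lt_top (by positivity) ?_
        rw [hd1]; push_cast; linarith

end Exponents

section Global

variable {p q : ℝ≥0∞} {s γ : ℝ} {g : 𝓢(Euc d, ℂ)}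

lemma innerNorm_amp_coe (hq : 1 ≤ q) (σ : ℝ) (h ψ : 𝓢(Euc d, ℂ)) (x : Euc d) :
    innerNorm q σ (amp h (ψ : 𝓢'(Euc d, ℂ)) x) = fl q⁻¹.toReal σ (smul' (tr x h) ψ) := by
  rw [fl, ex_toReal_inv hq]
  congr 1
  ext y
  rw [amp, localFourier_coe_eq_fourier, af]

lemma pw_ne_zero (hg : g ≠ 0) (k : ℕ) : pw k g ≠ 0 := by
  obtain ⟨z, hz⟩ := DFunLike.ne_iff.1 hg
  have hz' : g z ≠ 0 := hz
  refine DFunLike.ne_iff.2 ⟨z, ?_⟩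
  rw [pw_apply]
  have : ((‖g z‖ ^ (2 * k) : ℝ) : ℂ) ≠ 0 := by
    exact_mod_cast pow_ne_zero _ (norm_ne_zero_iff.2 hz')
  exact mul_ne_zero this hz'

/-- Localising the power with the power of the window is the power of the localised function. This
reduces the amalgam estimate to one for each fixed x. -/
lemma smul'_tr_pw (k : ℕ) (g u : 𝓢(Euc d, ℂ)) (x : Euc d) :
    smul' (tr x (pw k g)) (pw k u) = pw k (smul' (tr x g) u) := by
  ext z
  have e : ∀ h : 𝓢(Euc d, ℂ), tr x h z = h (z - x) := fun h => rfl
  rw [smul'_apply, pw_apply, pw_apply, smul'_apply, e, e, pw_apply, norm_mul, mul_pow]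
  push_cast
  ring

/-- The nonlinearity `|u|^{2k} u` is Lipschitz on bounded sets of Schwartz functions for the Wiener
amalgam norms. -/
theorem wNorm_pw_sub_le (hg : g ≠ 0) (hq : 1 ≤ q) (hp : 1 ≤ p) (hγ : 0 ≤ γ) {k : ℕ}
    (hF : FiberEstimate d k q⁻¹.toReal s) : ∃ C : ℝ≥0∞, C ≠ ∞ ∧ ∀ u v : 𝓢(Euc d, ℂ),
      wNorm g q (s - 1) p γ (pw k u - pw k v : 𝓢(Euc d, ℂ)) ≤
        C * ((wNorm g q s p γ u + wNorm g q s p γ v) ^ (2 * k) *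
          wNorm g q s p γ (u - v : 𝓢(Euc d, ℂ))) := by
  obtain ⟨C₁, hC₁, H₁⟩ := hF
  obtain ⟨C₂, -, H₂⟩ := wNorm_window_le (pw_ne_zero hg k) hq hp (s - 1) γ g
  obtain ⟨C₃, -, H₃⟩ := innerNorm_amp_le hg hq hp s hγ
  refine ⟨ENNReal.ofReal C₂ * (C₁ * ENNReal.ofReal C₃ ^ (2 * k)), by finiteness, fun u v => ?_⟩
  set D : 𝓢(Euc d, ℂ) := u - v with hD
  have hA : Measurable fun x => innerNorm q s (amp g (D : 𝓢'(Euc d, ℂ)) x) :=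
    measurable_innerNorm (measurable_amp g _)
  -- Of the 2k + 1 factors, 2k are bounded uniformly in x by amalgam norms. The difference alone
  -- keeps its dependence on x, so its L^p_γ norm can be taken afterwards.
  have hx : ∀ x, innerNorm q (s - 1) (amp (pw k g) ((pw k u - pw k v : 𝓢(Euc d, ℂ)) :
      𝓢'(Euc d, ℂ)) x) ≤ C₁ * ENNReal.ofReal C₃ ^ (2 * k) *
        (wNorm g q s p γ u + wNorm g q s p γ v) ^ (2 * k) *
          innerNorm q s (amp g (D : 𝓢'(Euc d, ℂ)) x) := by
    intro x
    rw [innerNorm_amp_coe hq, innerNorm_amp_coe hq, smul'_sub, smul'_tr_pw, smul'_tr_pw]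
    have h1 := H₁ (smul' (tr x g) u) (smul' (tr x g) v)
    rw [← smul'_sub, ← hD, ← innerNorm_amp_coe hq, ← innerNorm_amp_coe hq] at h1
    refine h1.trans ?_
    have h2 := add_le_add (H₃ (u : 𝓢'(Euc d, ℂ)) x) (H₃ (v : 𝓢'(Euc d, ℂ)) x)
    rw [← mul_add] at h2
    rw [mul_assoc, mul_assoc]
    refine mul_le_mul' le_rfl ?_
    rw [← mul_assoc, ← mul_pow]
    exact mul_le_mul' (pow_le_pow_left' h2 _) le_rfl
  calc wNorm g q (s - 1) p γ (pw k u - pw k v : 𝓢(Euc d, ℂ))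
      ≤ ENNReal.ofReal C₂ * wNorm (pw k g) q (s - 1) p γ (pw k u - pw k v : 𝓢(Euc d, ℂ)) := H₂ _
    _ ≤ ENNReal.ofReal C₂ * (C₁ * ENNReal.ofReal C₃ ^ (2 * k) *
        (wNorm g q s p γ u + wNorm g q s p γ v) ^ (2 * k) * wNorm g q s p γ D) := by
        refine mul_le_mul' le_rfl ?_
        rw [wNorm_eq, wNorm_eq g q s p γ D, mixNorm, mixNorm, ← innerNorm_const_mul hp _ hA]
        exact innerNorm_mono hx
    _ = _ := by ring

/-- For `q = 1` the Wiener amalgam space is an algebra under pointwise multiplication. -/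
theorem wNorm_smul'_le (hg : g ≠ 0) (hp : 1 ≤ p) (hs : 0 ≤ s) (hγ : 0 ≤ γ) :
    ∃ C : ℝ≥0∞, C ≠ ∞ ∧ ∀ u v : 𝓢(Euc d, ℂ), wNorm g 1 s p γ (smul' u v : 𝓢(Euc d, ℂ)) ≤
      C * (wNorm g 1 s p γ u * wNorm g 1 s p γ v) := by
  -- The product u v is measured with the window g², which splits into one factor g for u and one
  -- for v.
  have hgg : smul' g g ≠ 0 := by
    obtain ⟨z, hz⟩ := DFunLike.ne_iff.1 hg
    have hz' : g z ≠ 0 := hz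
    refine DFunLike.ne_iff.2 ⟨z, ?_⟩
    rw [smul'_apply]
    exact mul_ne_zero hz' hz'
  obtain ⟨C₂, -, H₂⟩ := wNorm_window_le hgg le_rfl hp s γ g
  obtain ⟨C₃, -, H₃⟩ := innerNorm_amp_le hg le_rfl hp s hγ
  refine ⟨ENNReal.ofReal C₂ * (2 * ENNReal.ofReal (4 ^ s) * ENNReal.ofReal C₃), by finiteness,
    fun u v => ?_⟩
  have hA : Measurable fun x => innerNorm 1 s (amp g (v : 𝓢'(Euc d, ℂ)) x) :=
    measurable_innerNorm (measurable_amp g _)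
  have hx : ∀ x, innerNorm 1 s (amp (smul' g g) ((smul' u v : 𝓢(Euc d, ℂ)) : 𝓢'(Euc d, ℂ)) x) ≤
      2 * ENNReal.ofReal (4 ^ s) * (ENNReal.ofReal C₃ * wNorm g 1 s p γ u) *
        innerNorm 1 s (amp g (v : 𝓢'(Euc d, ℂ)) x) := by
    intro x
    have e : smul' (tr x (smul' g g)) (smul' u v) = smul' (smul' (tr x g) u) (smul' (tr x g) v) := by
      ext z
      have e : ∀ h : 𝓢(Euc d, ℂ), tr x h z = h (z - x) := fun h => rfl
      simp only [smul'_apply, e]; ring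
    have h1 := fl_one_smul'_le hs (smul' (tr x g) u) (smul' (tr x g) v)
    have e1 : (1 : ℝ≥0∞)⁻¹.toReal = 1 := by simp
    have h2 : fl 1 s (smul' (tr x g) u) ≤ ENNReal.ofReal C₃ * wNorm g 1 s p γ u := by
      have := H₃ (u : 𝓢'(Euc d, ℂ)) x
      rwa [innerNorm_amp_coe le_rfl, e1] at this
    rw [innerNorm_amp_coe le_rfl, innerNorm_amp_coe le_rfl, e, e1]
    refine h1.trans ?_
    rw [mul_assoc (2 * ENNReal.ofReal (4 ^ s)) (_ * _)]
    exact mul_le_mul' le_rfl (mul_le_mul' h2 le_rfl)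
  calc wNorm g 1 s p γ (smul' u v : 𝓢(Euc d, ℂ))
      ≤ ENNReal.ofReal C₂ * wNorm (smul' g g) 1 s p γ (smul' u v : 𝓢(Euc d, ℂ)) := H₂ _
    _ ≤ ENNReal.ofReal C₂ * (2 * ENNReal.ofReal (4 ^ s) *
          (ENNReal.ofReal C₃ * wNorm g 1 s p γ u) * wNorm g 1 s p γ v) := by
        refine mul_le_mul' le_rfl ?_
        rw [wNorm_eq, wNorm_eq g 1 s p γ v, mixNorm, mixNorm, ← innerNorm_const_mul hp _ hA]
        exact innerNorm_mono hx
    _ = _ := by ring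

lemma cj_ne_zero (hg : g ≠ 0) : cj g ≠ 0 := by
  obtain ⟨z, hz⟩ := DFunLike.ne_iff.1 hg
  have hz' : g z ≠ 0 := hz
  refine DFunLike.ne_iff.2 ⟨z, ?_⟩
  rw [cj_apply]
  exact (map_ne_zero (starRingEnd ℂ)).2 hz'

/-- The Wiener amalgam norm is invariant under complex conjugation, up to a constant. -/
theorem wNorm_cj_le (hg : g ≠ 0) (hq : 1 ≤ q) (hp : 1 ≤ p) (σ γ : ℝ) :
    ∃ C : ℝ≥0∞, C ≠ ∞ ∧ ∀ u : 𝓢(Euc d, ℂ),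
      wNorm g q σ p γ (cj u : 𝓢(Euc d, ℂ)) ≤ C * wNorm g q σ p γ u := by
  obtain ⟨C, -, H⟩ := wNorm_window_le (cj_ne_zero hg) hq hp σ γ g
  refine ⟨ENNReal.ofReal C, ENNReal.ofReal_ne_top, fun u => (H _).trans
    (mul_le_mul' le_rfl (le_of_eq ?_))⟩
  rw [wNorm_eq, wNorm_eq, mixNorm, mixNorm]
  congr 1
  ext x
  have e : smul' (tr x (cj g)) (cj u) = cj (smul' (tr x g) u) := by
    ext z
    have e : ∀ h : 𝓢(Euc d, ℂ), tr x h z = h (z - x) := fun h => rfl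
    simp only [smul'_apply, e, cj_apply, map_mul]
  rw [innerNorm_amp_coe hq, innerNorm_amp_coe hq, e, fl_cj]

end Global

end

/-! ### Extension by density and well-definedness of F(u) -/

section


variable {d : ℕ}

/-- A map that is Lipschitz on bounded parts of a dense set extends to the whole space. -/
lemma exists_lipschitzOnBalls_extension {S X Y : Type*} [NormedAddCommGroup X]
    [NormedAddCommGroup Y] [CompleteSpace Y] {i : S → X} (hi : DenseRange i) {f : S → Y}
    (H : ∀ ρ : ℝ, ∃ L : ℝ, 0 ≤ L ∧ ∀ a b, ‖i a‖ ≤ ρ → ‖i b‖ ≤ ρ →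
      ‖f a - f b‖ ≤ L * ‖i a - i b‖) :
    ∃ N : X → Y, LipschitzOnBalls N ∧ ∀ a, N (i a) = f a := by
  have hne : ∀ x, (comap i (𝓝 x)).NeBot := fun x => comap_neBot fun t ht => by
    obtain ⟨_, h, a, rfl⟩ := mem_closure_iff_nhds.1 (hi x) t ht
    exact ⟨a, h⟩
  have ht : ∀ x, Tendsto i (comap i (𝓝 x)) (𝓝 x) := fun x => tendsto_comap
  have hb : ∀ x, ∀ᶠ a in comap i (𝓝 x), ‖i a‖ ≤ ‖x‖ + 1 := fun x => by
    have := ((ht x).norm).eventually (ge_mem_nhds (show ‖x‖ < ‖x‖ + 1 by linarith))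
    exact this
  have hlim : ∀ x, ∃ y, Tendsto f (comap i (𝓝 x)) (𝓝 y) := fun x => by
    have := hne x
    refine cauchy_map_iff_exists_tendsto.1 ?_
    rw [Metric.cauchy_iff]
    refine ⟨inferInstance, fun ε hε => ?_⟩
    obtain ⟨L, hL, hf⟩ := H (‖x‖ + 1)
    have h1 := (ht x).eventually (Metric.ball_mem_nhds x (show 0 < ε / (2 * (L + 1)) by positivity))
    refine ⟨_, image_mem_map (h1.and (hb x)), ?_⟩
    rintro _ ⟨a, ⟨ha, ha'⟩, rfl⟩ _ ⟨b, ⟨hb, hb'⟩, rfl⟩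
    have h2 : dist (i a) (i b) < ε / (L + 1) := by
      have := dist_triangle_right (i a) (i b) x
      have e : ε / (2 * (L + 1)) + ε / (2 * (L + 1)) = ε / (L + 1) := by field_simp; norm_num
      linarith
    rw [lt_div_iff₀ (by positivity)] at h2
    rw [dist_eq_norm] at h2 ⊢
    have h3 := hf a b ha' hb'
    nlinarith [norm_nonneg (i a - i b)]
  choose N hN using hlim
  refine ⟨N, fun ρ => ?_, fun a => ?_⟩
  · obtain ⟨L, hL, hf⟩ := H (ρ + 1)
    refine ⟨L, hL, fun x y hx hy => ?_⟩
    have := hne x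
    have := hne y
    have t1 : Tendsto (fun z : S × S => ‖f z.1 - f z.2‖) (comap i (𝓝 x) ×ˢ comap i (𝓝 y))
        (𝓝 ‖N x - N y‖) :=
      (((hN x).comp tendsto_fst).sub ((hN y).comp tendsto_snd)).norm
    have t2 : Tendsto (fun z : S × S => L * ‖i z.1 - i z.2‖) (comap i (𝓝 x) ×ˢ comap i (𝓝 y))
        (𝓝 (L * ‖x - y‖)) :=
      ((((ht x).comp tendsto_fst).sub ((ht y).comp tendsto_snd)).norm).const_mul L
    refine le_of_tendsto_of_tendsto t1 t2 ?_
    filter_upwards [tendsto_fst.eventually (hb x), tendsto_snd.eventually (hb y)] with z h1 h2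
    exact hf _ _ (h1.trans (by linarith)) (h2.trans (by linarith))
  · have := hne (i a)
    refine tendsto_nhds_unique (hN (i a)) ?_
    rw [tendsto_iff_norm_sub_tendsto_zero]
    obtain ⟨L, hL, hf⟩ := H (‖i a‖ + 1)
    have h1 : Tendsto (fun b => L * ‖i b - i a‖) (comap i (𝓝 (i a))) (𝓝 0) := by
      have := (((ht (i a)).sub_const (i a)).norm).const_mul L
      simpa using this
    refine squeeze_zero' (Eventually.of_forall fun _ => norm_nonneg _) ?_ h1
    filter_upwards [hb (i a)] with b hb
    exact hf b a hb (by linarith)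

/-- Integrability against a bump function equal to 1 on a ball gives integrability of f on that
ball. -/
lemma IsGivenBy.locallyIntegrable {u : 𝓢'(Euc d, ℂ)} {f : Euc d → ℂ} (h : IsGivenBy u f) :
    LocallyIntegrable f volume := by
  intro x
  let b : ContDiffBump x := ⟨1, 2, one_pos, one_lt_two⟩
  have hb : ContDiff ℝ ((⊤ : ℕ∞) : WithTop ℕ∞) fun z => ((b z : ℝ) : ℂ) :=
    Complex.ofRealCLM.contDiff.comp b.contDiff
  have hs : HasCompactSupport fun z => ((b z : ℝ) : ℂ) :=
    b.hasCompactSupport.comp_left (g := fun r : ℝ => (r : ℂ)) Complex.ofReal_zero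
  refine ⟨Metric.ball x 1, Metric.ball_mem_nhds x one_pos, ?_⟩
  refine ((h (hs.toSchwartzMap hb)).1.integrableOn (s := Metric.ball x 1)).congr_fun (fun z hz => ?_)
    measurableSet_ball
  have : b z = 1 := b.one_of_mem_closedBall (Metric.ball_subset_closedBall hz)
  simp [this]

lemma IsGivenBy.ae_eq {u : 𝓢'(Euc d, ℂ)} {f f' : Euc d → ℂ} (h : IsGivenBy u f)
    (h' : IsGivenBy u f') : f =ᵐ[volume] f' :=
  ae_eq_of_integral_schwartz h.locallyIntegrable h'.locallyIntegrable fun φ =>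
    (h φ).2.symm.trans (h' φ).2

/-- The function representing u is determined almost everywhere, so F ∘ f does not depend on its
choice; in the linear clause a u is represented by a f = F ∘ f. -/
lemma IsGivenBy.unique {F : ℂ → ℂ} {u v w : 𝓢'(Euc d, ℂ)} {f : Euc d → ℂ} (hu : IsGivenBy u f)
    (hw : IsGivenBy w fun x => F (f x)) (hv : IsNonlinearImage F u v) : v = w := by
  refine DFunLike.ext _ _ fun φ => ?_
  rw [(hw φ).2]
  rcases hv with ⟨f', hu', hv'⟩ | ⟨a, ha, rfl⟩
  · rw [(hv' φ).2]
    refine integral_congr_ae ?_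
    filter_upwards [hu'.ae_eq hu] with x hx
    rw [hx]
  · have : (a • u) φ = a * u φ := rfl
    rw [this, (hu φ).2, ← integral_const_mul]
    refine integral_congr_ae (Eventually.of_forall fun x => ?_)
    simp only [ha]; ring

section

variable (g : 𝓢(Euc d, ℂ)) [hg : Fact (g ≠ 0)] (q : ℝ≥0∞) (s : ℝ) (p : ℝ≥0∞) (γ : ℝ)
  [hq : Fact (1 ≤ q)] [hp : Fact (1 ≤ p)]

/-- The superposition operator of `F` acts between amalgam spaces, with the loss of one derivative,
and is Lipschitz on bounded sets. -/
def ActsOn (F : ℂ → ℂ) : Prop :=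
  ∃ N : WSpace g q s p γ → WSpace g q (s - 1) p γ, LipschitzOnBalls N ∧
    ∀ u v, IsNonlinearImage F (toDist u) v ↔ v = toDist (N u)

variable {g q s p γ}

lemma actsOn_of_isGivenBy {F : ℂ → ℂ} {N : WSpace g q s p γ → WSpace g q (s - 1) p γ}
    (hN : LipschitzOnBalls N)
    (h : ∀ u, ∃ f, IsGivenBy (toDist u) f ∧ IsGivenBy (toDist (N u)) fun x => F (f x)) :
    ActsOn g q s p γ F := by
  refine ⟨N, hN, fun u v => ⟨fun hv => ?_, fun hv => ?_⟩⟩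
  · obtain ⟨f, h1, h2⟩ := h u
    exact h1.unique h2 hv
  · obtain ⟨f, h1, h2⟩ := h u
    exact Or.inl ⟨f, h1, hv ▸ h2⟩

lemma exists_inclusion : ∃ ι : WSpace g q s p γ →L[ℂ] WSpace g q (s - 1) p γ,
    ∀ u, toDist (ι u) = toDist u := by
  obtain ⟨ι, -, h⟩ := exists_lift (g := g) (q := q) (p := p) (γ := γ) (σ := s) (σ' := s - 1)
    (ContinuousLinearMap.id ℂ _) zero_le_one (fun f => by
      rw [ENNReal.ofReal_one, one_mul, ContinuousLinearMap.id_apply, wNorm_eq, wNorm_eq]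
      exact innerNorm_mono fun x => eLpNorm_mono_ennreal fun y =>
        mul_le_mul' (wt_mono (by linarith) y) le_rfl)
    (fun φ => ⟨φ, rfl⟩)
  exact ⟨ι, h⟩

/-- The case k = 0. Elements of the space need not be functions, so existence of the image uses the
linear clause of `IsNonlinearImage`; uniqueness must treat both clauses, and a is recovered from the
value at 1. -/
lemma actsOn_linear (a : ℂ) : ActsOn g q s p γ fun z => a * z := by
  obtain ⟨ι, hι⟩ := exists_inclusion (g := g) (q := q) (p := p) (γ := γ) (s := s)
  refine ⟨fun u => a • ι u, fun ρ => ⟨‖a‖ * ‖ι‖, by positivity, fun u v _ _ => ?_⟩,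
    fun u v => ⟨fun hv => ?_, fun hv => Or.inr ⟨a, fun _ => rfl, ?_⟩⟩⟩
  · rw [← smul_sub, ← map_sub, norm_smul, mul_assoc]
    exact mul_le_mul_of_nonneg_left (ι.le_opNorm _) (norm_nonneg _)
  · rw [map_smul, hι]
    rcases hv with ⟨f, hu, hv⟩ | ⟨b, hb, rfl⟩
    · refine DFunLike.ext _ _ fun φ => ?_
      have : (a • toDist u) φ = a * toDist u φ := rfl
      rw [(hv φ).2, this, (hu φ).2, ← integral_const_mul]
      refine integral_congr_ae (Eventually.of_forall fun x => ?_)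
      simp only; ring
    · have : a = b := by simpa using hb 1
      rw [this]
  · rw [hv, map_smul, hι]

end

/-- The finite measure with density `(1 + ‖z‖)^{-M}`. -/
def krnMeasure (d M : ℕ) : Measure (Euc d) :=
  volume.withDensity fun z => ENNReal.ofReal (krn M z)

lemma lintegral_krnMeasure (M : ℕ) (f : Euc d → ℝ≥0∞) :
    ∫⁻ z, f z ∂krnMeasure d M = ∫⁻ z, ENNReal.ofReal (krn M z) * f z := by
  have hm : Measurable fun z : Euc d => ENNReal.ofReal (krn M z) := (measurable_krn M).ennreal_ofReal
  rw [krnMeasure, lintegral_withDensity_eq_lintegral_mul_non_measurable _ hm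
    (Eventually.of_forall fun _ => ENNReal.ofReal_lt_top)]
  rfl

lemma absolutelyContinuous_krnMeasure (M : ℕ) : volume ≪ krnMeasure d M :=
  withDensity_absolutelyContinuous' (measurable_krn M).ennreal_ofReal.aemeasurable
    (Eventually.of_forall fun z => by simpa using krn_pos M z)

instance : IsFiniteMeasure (krnMeasure d (d + 1)) := by
  refine isFiniteMeasure_withDensity_ofReal ?_
  exact (integrable_krn (lt_add_one d)).2

/-- Schwartz functions are dominated by the density of `krnMeasure`. Hence integrable functions for
that measure define tempered distributions, continuously in L¹. -/
lemma exists_enorm_le_krn (M : ℕ) (φ : 𝓢(Euc d, ℂ)) : ∃ C : ℝ, 0 ≤ C ∧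
    ∀ z, ‖φ z‖ₑ ≤ ENNReal.ofReal C * ENNReal.ofReal (krn M z) := by
  have h := SchwartzMap.one_add_le_sup_seminorm_apply (𝕜 := ℂ) (m := (M, 0)) (k := M) (n := 0)
    le_rfl le_rfl φ
  refine ⟨2 ^ M * ((Finset.Iic (M, 0)).sup fun m => SchwartzMap.seminorm ℂ m.1 m.2) φ,
    by positivity, fun z => ?_⟩
  rw [← ofReal_norm, ← ENNReal.ofReal_mul (by positivity)]
  refine ENNReal.ofReal_le_ofReal ?_
  have h1 := h z
  rw [norm_iteratedFDeriv_zero] at h1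
  rw [krn, ← div_eq_mul_inv, le_div_iff₀ (by positivity), mul_comm]
  exact h1

lemma integrable_mul_of_krnMeasure {M : ℕ} {f : Euc d → ℂ} (hf : Integrable f (krnMeasure d M))
    (φ : 𝓢(Euc d, ℂ)) : Integrable (fun z => φ z * f z) volume := by
  obtain ⟨C, hC, h⟩ := exists_enorm_le_krn M φ
  refine ⟨φ.continuous.aestronglyMeasurable.mul
    (hf.1.mono_ac (absolutelyContinuous_krnMeasure M)), ?_⟩
  have h1 : ∫⁻ z, ‖f z‖ₑ ∂krnMeasure d M < ∞ := hf.2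
  rw [lintegral_krnMeasure] at h1
  calc ∫⁻ z, ‖φ z * f z‖ₑ ≤ ∫⁻ z, ENNReal.ofReal C * (ENNReal.ofReal (krn M z) * ‖f z‖ₑ) := by
        refine lintegral_mono fun z => ?_
        rw [enorm_mul, ← mul_assoc]
        exact mul_le_mul' (h z) le_rfl
    _ = ENNReal.ofReal C * ∫⁻ z, ENNReal.ofReal (krn M z) * ‖f z‖ₑ :=
        lintegral_const_mul' _ _ ENNReal.ofReal_ne_top
    _ < ∞ := ENNReal.mul_lt_top ENNReal.ofReal_lt_top h1

lemma exists_enorm_integral_sub_le (M : ℕ) (φ : 𝓢(Euc d, ℂ)) : ∃ C : ℝ, 0 ≤ C ∧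
    ∀ f f' : Euc d → ℂ, Integrable f (krnMeasure d M) → Integrable f' (krnMeasure d M) →
      ‖(∫ z, φ z * f z) - ∫ z, φ z * f' z‖ₑ ≤
        ENNReal.ofReal C * ∫⁻ z, ‖f z - f' z‖ₑ ∂krnMeasure d M := by
  obtain ⟨C, hC, h⟩ := exists_enorm_le_krn M φ
  refine ⟨C, hC, fun f f' hf hf' => ?_⟩
  rw [← integral_sub (integrable_mul_of_krnMeasure hf φ) (integrable_mul_of_krnMeasure hf' φ),
    lintegral_krnMeasure, ← lintegral_const_mul' _ _ ENNReal.ofReal_ne_top]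
  refine (enorm_integral_le_lintegral_enorm _).trans (lintegral_mono fun z => ?_)
  rw [← mul_sub, enorm_mul, ← mul_assoc]
  exact mul_le_mul' (h z) le_rfl

end

/-! ### The power nonlinearity acts on the amalgam spaces -/

section


variable {d : ℕ}

lemma krn_mul_krn_sub_le (M : ℕ) (x z : Euc d) : krn M z * krn M (z - x) ≤ krn M x := by
  rw [krn, krn, krn, ← mul_inv, ← mul_pow]
  refine inv_anti₀ (by positivity) (pow_le_pow_left₀ (by positivity) ?_ M)
  have h1 : ‖x‖ ≤ ‖z‖ + ‖z - x‖ := by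
    have := norm_sub_le z (z - x)
    rwa [sub_sub_cancel] at this
  nlinarith [norm_nonneg z, norm_nonneg (z - x), mul_nonneg (norm_nonneg z) (norm_nonneg (z - x))]

lemma lipschitzOnBalls_of_enorm_sub_le {S X Y : Type*} [NormedAddCommGroup X]
    [NormedAddCommGroup Y] {i : S → X} {G : S → Y} {C : ℝ≥0∞} (hC : C ≠ ∞) {j : ℕ}
    (h : ∀ f f', ‖G f - G f'‖ₑ ≤ C * ((‖i f‖ₑ + ‖i f'‖ₑ) ^ j * ‖i f - i f'‖ₑ)) (ρ : ℝ) :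
    ∃ L : ℝ, 0 ≤ L ∧ ∀ a b, ‖i a‖ ≤ ρ → ‖i b‖ ≤ ρ → ‖G a - G b‖ ≤ L * ‖i a - i b‖ := by
  refine ⟨(C * (2 * ENNReal.ofReal ρ) ^ j).toReal, ENNReal.toReal_nonneg, fun a b ha hb => ?_⟩
  have h1 : ‖i a‖ₑ + ‖i b‖ₑ ≤ 2 * ENNReal.ofReal ρ := by
    rw [two_mul, ← ofReal_norm, ← ofReal_norm]
    exact add_le_add (ENNReal.ofReal_le_ofReal ha) (ENNReal.ofReal_le_ofReal hb)
  have h2 : ‖G a - G b‖ₑ ≤ C * (2 * ENNReal.ofReal ρ) ^ j * ‖i a - i b‖ₑ := by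
    rw [mul_assoc]
    exact (h a b).trans (mul_le_mul' le_rfl (mul_le_mul' (pow_le_pow_left' h1 _) le_rfl))
  have ht : C * (2 * ENNReal.ofReal ρ) ^ j ≠ ∞ := by finiteness
  have h3 := ENNReal.toReal_mono (by finiteness) h2
  rwa [ENNReal.toReal_mul, toReal_enorm, toReal_enorm] at h3

lemma exists_extension_of_norm {S X F : Type*} [AddCommGroup S] [Module ℂ S]
    [NormedAddCommGroup X] [NormedSpace ℂ X]
    [NormedAddCommGroup F] [NormedSpace ℂ F] [CompleteSpace F] {i : S →ₗ[ℂ] X} (hi : DenseRange i)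
    (T : S →ₗ[ℂ] F) {C : ℝ} (hb : ∀ φ, ‖T φ‖ ≤ C * ‖i φ‖) :
    ∃ J : X →L[ℂ] F, ∀ φ, J (i φ) = T φ :=
  ⟨T.extendOfNorm i, fun φ => LinearMap.extendOfNorm_eq hi ⟨C, hb⟩ φ⟩

/-- The map `φ ↦ φ.toLp` as a linear map. -/
def toLpLinear (n : ℝ≥0∞) [Fact (1 ≤ n)] (μ : Measure (Euc d)) [IsFiniteMeasure μ] :
    𝓢(Euc d, ℂ) →ₗ[ℂ] Lp ℂ n μ where
  toFun φ := φ.toLp n μ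
  map_add' φ ψ := (SchwartzMap.toLpCLM ℂ ℂ n μ).map_add φ ψ
  map_smul' c φ := (SchwartzMap.toLpCLM ℂ ℂ n μ).map_smul c φ

lemma norm_toLpLinear {n : ℝ≥0∞} [Fact (1 ≤ n)] (μ : Measure (Euc d)) [IsFiniteMeasure μ]
    (φ : 𝓢(Euc d, ℂ)) : ‖toLpLinear n μ φ‖ = (eLpNorm φ n μ).toReal :=
  SchwartzMap.norm_toLp (f := φ) (p := n) (μ := μ)

section

variable {g : 𝓢(Euc d, ℂ)} {q : ℝ≥0∞} {s : ℝ} {p : ℝ≥0∞} {γ : ℝ}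

/-- The embedding bounds g(· - x)φ in L^m uniformly in x. Averaging over x against the integrable
kernel κ recovers φ, because cκ(z) ≤ ∫ κ(x)|g(z - x)|^m dx with c = ∫ κ|g|^m > 0; this follows from
κ(z)κ(z - x) ≤ κ(x). -/
lemma exists_eLpNorm_krnMeasure_le (hg : g ≠ 0) (hq : 1 ≤ q) (hp : 1 ≤ p) (hγ : 0 ≤ γ) {m : ℝ}
    (hm : 1 ≤ m) {C : ℝ≥0∞} (hC : C ≠ ∞)
    (H : ∀ h : 𝓢(Euc d, ℂ), eLpNorm h (ENNReal.ofReal m) volume ≤ C * fl q⁻¹.toReal s h) :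
    ∃ C' : ℝ≥0∞, C' ≠ ∞ ∧ ∀ φ : 𝓢(Euc d, ℂ),
      eLpNorm φ (ENNReal.ofReal m) (krnMeasure d (d + 1)) ≤ C' * wNorm g q s p γ φ := by
  obtain ⟨C₃, -, H₃⟩ := innerNorm_amp_le hg hq hp s hγ
  have hm0 : 0 < m := by linarith
  have hmr : (ENNReal.ofReal m).toReal = m := ENNReal.toReal_ofReal hm0.le
  have hm0' : ENNReal.ofReal m ≠ 0 := by simpa using hm0
  have hLp : ∀ (μ : Measure (Euc d)) (f : Euc d → ℂ),
      eLpNorm f (ENNReal.ofReal m) μ = (∫⁻ z, ‖f z‖ₑ ^ m ∂μ) ^ (1 / m) := fun μ f => by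
    rw [eLpNorm_eq_lintegral_rpow_enorm_toReal hm0' ENNReal.ofReal_ne_top, hmr]
  set κ : Euc d → ℝ≥0∞ := fun z => ENNReal.ofReal (krn (d + 1) z) with hκ
  have hκm : Measurable κ := (measurable_krn (d + 1)).ennreal_ofReal
  set K : ℝ≥0∞ := ∫⁻ x : Euc d, κ x with hK
  have hKt : K ≠ ∞ := by
    have := (integrable_krn (d := d) (lt_add_one d)).lintegral_lt_top
    exact this.ne
  set c : ℝ≥0∞ := ∫⁻ w, κ w * ‖g w‖ₑ ^ m with hc
  have hgm : Measurable fun w => ‖g w‖ₑ ^ m := g.continuous.measurable.enorm.pow_const m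
  have hc0 : c ≠ 0 := by
    intro h0
    have hkg : Measurable fun w => κ w * ‖g w‖ₑ ^ m := hκm.mul hgm
    rw [hc, lintegral_eq_zero_iff hkg] at h0
    refine hg (DFunLike.coe_injective ?_)
    refine (Continuous.ae_eq_iff_eq volume g.continuous continuous_zero).1 ?_
    filter_upwards [h0] with w hw
    have hw' : κ w * ‖g w‖ₑ ^ m = 0 := hw
    rcases mul_eq_zero.1 hw' with h1 | h1
    · have := krn_pos (d + 1) w
      simp only [hκ, ENNReal.ofReal_eq_zero] at h1
      linarith
    · simpa [hm0.not_gt, hm0] using h1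
  have hct : c ≠ ∞ := by
    have h1 : ∫⁻ w, ‖g w‖ₑ ^ m < ∞ := by
      have := (g.memLp (ENNReal.ofReal m) volume).2
      rw [hLp] at this
      exact (ENNReal.rpow_lt_top_iff_of_pos (by positivity)).1 this
    refine ne_of_lt (lt_of_le_of_lt (lintegral_mono fun w => ?_) h1)
    refine (mul_le_mul' (?_ : κ w ≤ 1) le_rfl).trans (one_mul _).le
    refine ENNReal.ofReal_le_one.2 (inv_le_one_of_one_le₀ (one_le_pow₀ ?_))
    have := norm_nonneg w
    linarith
  refine ⟨(c⁻¹ * K) ^ (1 / m) * (C * ENNReal.ofReal C₃), by finiteness, fun φ => ?_⟩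
  set W := wNorm g q s p γ (φ : 𝓢'(Euc d, ℂ)) with hW
  have hφm : Measurable fun z => ‖φ z‖ₑ ^ m := φ.continuous.measurable.enorm.pow_const m
  have hx : ∀ x, ∫⁻ z, ‖g (z - x) * φ z‖ₑ ^ m ≤ (C * ENNReal.ofReal C₃ * W) ^ m := fun x => by
    have h1 := H (smul' (tr x g) φ)
    rw [← innerNorm_amp_coe hq] at h1
    have h2 := h1.trans (mul_le_mul' le_rfl (H₃ (φ : 𝓢'(Euc d, ℂ)) x))
    rw [hLp, ← mul_assoc, one_div, ENNReal.rpow_inv_le_iff hm0] at h2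
    refine le_trans (le_of_eq (lintegral_congr fun z => ?_)) h2
    have e : tr x g z = g (z - x) := rfl
    rw [smul'_apply, e]
  have hF : Measurable (Function.uncurry fun z x : Euc d => κ x * ‖g (z - x) * φ z‖ₑ ^ m) := by
    have h1 : Measurable fun a : Euc d × Euc d => g (a.1 - a.2) * φ a.1 :=
      ((g.continuous.comp (continuous_fst.sub continuous_snd)).mul
        (φ.continuous.comp continuous_fst)).measurable
    exact (hκm.comp measurable_snd).mul (h1.enorm.pow_const m)
  have hmain : c * ∫⁻ z, κ z * ‖φ z‖ₑ ^ m ≤ K * (C * ENNReal.ofReal C₃ * W) ^ m := by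
    calc c * ∫⁻ z, κ z * ‖φ z‖ₑ ^ m = ∫⁻ z, c * (κ z * ‖φ z‖ₑ ^ m) :=
          (lintegral_const_mul' _ _ hct).symm
      _ ≤ ∫⁻ z, ∫⁻ x, κ x * ‖g (z - x) * φ z‖ₑ ^ m := by
          refine lintegral_mono fun z => ?_
          have h1 : c = ∫⁻ x, κ (z - x) * ‖g (z - x)‖ₑ ^ m :=
            (lintegral_sub_left_eq_self (fun w => κ w * ‖g w‖ₑ ^ m) z).symm
          have h2 : Measurable fun x => κ (z - x) * ‖g (z - x)‖ₑ ^ m :=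
            (hκm.mul hgm).comp (measurable_const.sub measurable_id)
          rw [h1, ← lintegral_mul_const _ h2]
          refine lintegral_mono fun x => ?_
          simp only
          rw [enorm_mul, ENNReal.mul_rpow_of_nonneg _ _ hm0.le]
          have h3 : κ z * κ (z - x) ≤ κ x := by
            simp only [hκ]
            rw [← ENNReal.ofReal_mul (krn_pos _ _).le]
            exact ENNReal.ofReal_le_ofReal (krn_mul_krn_sub_le _ _ _)
          calc κ (z - x) * ‖g (z - x)‖ₑ ^ m * (κ z * ‖φ z‖ₑ ^ m)
              = κ z * κ (z - x) * (‖g (z - x)‖ₑ ^ m * ‖φ z‖ₑ ^ m) := by ring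
            _ ≤ _ := mul_le_mul' h3 le_rfl
      _ = ∫⁻ x, ∫⁻ z, κ x * ‖g (z - x) * φ z‖ₑ ^ m := lintegral_lintegral_swap hF.aemeasurable
      _ ≤ ∫⁻ x, κ x * (C * ENNReal.ofReal C₃ * W) ^ m := by
          refine lintegral_mono fun x => ?_
          simp only
          rw [lintegral_const_mul' _ _ ENNReal.ofReal_ne_top]
          exact mul_le_mul' le_rfl (hx x)
      _ = _ := lintegral_mul_const _ hκm
  have hdiv : ∫⁻ z, κ z * ‖φ z‖ₑ ^ m ≤ c⁻¹ * K * (C * ENNReal.ofReal C₃ * W) ^ m := by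
    calc ∫⁻ z, κ z * ‖φ z‖ₑ ^ m = c⁻¹ * (c * ∫⁻ z, κ z * ‖φ z‖ₑ ^ m) := by
          rw [← mul_assoc, ENNReal.inv_mul_cancel hc0 hct, one_mul]
      _ ≤ _ := by rw [mul_assoc]; exact mul_le_mul' le_rfl hmain
  rw [hLp, lintegral_krnMeasure]
  refine (ENNReal.rpow_le_rpow hdiv (by positivity)).trans (le_of_eq ?_)
  rw [ENNReal.mul_rpow_of_nonneg _ _ (by positivity), ← ENNReal.rpow_mul, mul_one_div_cancel hm0.ne',
    ENNReal.rpow_one]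
  ring

variable [hg : Fact (g ≠ 0)] [hq : Fact (1 ≤ q)] [hp : Fact (1 ≤ p)]

lemma exists_toLp {n : ℝ≥0∞} [hn : Fact (1 ≤ n)] {C : ℝ≥0∞} (hC : C ≠ ∞)
    (H : ∀ φ : 𝓢(Euc d, ℂ), eLpNorm φ n (krnMeasure d (d + 1)) ≤ C * wNorm g q s p γ φ) :
    ∃ J : WSpace g q s p γ →L[ℂ] Lp ℂ n (krnMeasure d (d + 1)),
      ∀ φ, J (ofSchwartz φ) = φ.toLp n (krnMeasure d (d + 1)) :=
  exists_extension_of_norm denseRange_ofSchwartz (toLpLinear n (krnMeasure d (d + 1)))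
    (C := C.toReal) fun φ => by
      have h2 := ENNReal.toReal_mono (ENNReal.mul_ne_top hC
        (memClosure_toDist (ofSchwartz φ : WSpace g q s p γ)).1.ne) (H φ)
      rw [ENNReal.toReal_mul] at h2
      rw [norm_toLpLinear]
      exact h2

/-- Both sides are continuous in u and agree on Schwartz functions. Finiteness of the measure makes
the integral against φ continuous on L^n. -/
lemma isGivenBy_of_toLp {n : ℝ≥0∞} [hn : Fact (1 ≤ n)]
    {J : WSpace g q s p γ →L[ℂ] Lp ℂ n (krnMeasure d (d + 1))}
    (hJ : ∀ φ, J (ofSchwartz φ) = φ.toLp n (krnMeasure d (d + 1))) (u : WSpace g q s p γ) :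
    IsGivenBy (toDist u) (J u) := by
  have hint : ∀ f : Lp ℂ n (krnMeasure d (d + 1)), Integrable f (krnMeasure d (d + 1)) :=
    fun f => (Lp.memLp f).integrable hn.out
  refine fun φ => ⟨integrable_mul_of_krnMeasure (hint _) φ, ?_⟩
  obtain ⟨C, hC, h⟩ := exists_enorm_integral_sub_le (d + 1) φ
  have hcont : Continuous fun f : Lp ℂ n (krnMeasure d (d + 1)) => ∫ z, φ z * f z := by
    set c : ℝ≥0∞ := krnMeasure d (d + 1) Set.univ ^ (1 / (1 : ℝ≥0∞).toReal - 1 / n.toReal) with hc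
    have hct : c ≠ ∞ := by
      refine ENNReal.rpow_ne_top_of_nonneg ?_ (measure_ne_top _ _)
      rw [sub_nonneg, ENNReal.toReal_one, div_one]
      rcases eq_or_ne n ∞ with rfl | hnt
      · simp
      · have h2 : 1 ≤ n.toReal := by
          have := ENNReal.toReal_mono hnt hn.out
          simpa using this
        exact (div_le_one (by linarith)).2 h2
    refine LipschitzOnBalls.continuous fun ρ => lipschitzOnBalls_of_enorm_sub_le (i := id) (j := 0)
      (G := fun f : Lp ℂ n (krnMeasure d (d + 1)) => ∫ z, φ z * f z)
      (C := ENNReal.ofReal C * c) (by finiteness) (fun f f' => (h f f' (hint f) (hint f')).trans ?_) ρ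
    rw [pow_zero, one_mul, mul_assoc]
    refine mul_le_mul' le_rfl ?_
    have h2 := eLpNorm_le_eLpNorm_mul_rpow_measure_univ (μ := krnMeasure d (d + 1)) hn.out
      ((Lp.memLp f).1.sub (Lp.memLp f').1)
    rw [eLpNorm_one_eq_lintegral_enorm, ← hc, mul_comm] at h2
    refine h2.trans (le_of_eq ?_)
    rw [id, id, Lp.enorm_def, eLpNorm_congr_ae (Lp.coeFn_sub f f')]
  have key : ∀ u : WSpace g q s p γ, evalAt φ u = ∫ z, φ z * J u z := fun u => by
    refine denseRange_ofSchwartz.induction_on (p := fun u : WSpace g q s p γ =>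
      evalAt φ u = ∫ z, φ z * J u z) u
      (isClosed_eq (evalAt φ).continuous (hcont.comp J.continuous)) fun ψ => ?_
    rw [evalAt_apply, toDist_ofSchwartz, hJ]
    refine (SchwartzMap.toTemperedDistributionCLM_apply_apply volume ψ φ).trans
      (integral_congr_ae ?_)
    filter_upwards [(absolutelyContinuous_krnMeasure (d + 1)).ae_le
      (ψ.coeFn_toLp n (krnMeasure d (d + 1)))] with z hz
    rw [hz, smul_eq_mul]
  exact key u

/-- The density argument for the nonlinear map: f ↦ |f|^{2k} f is Lipschitz on balls from L^{2k+1}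
to L¹, so the extension of the power by density is the pointwise power. -/
lemma isGivenBy_pow_of_toLp {k : ℕ} [hn : Fact ((1 : ℝ≥0∞) ≤ (2 * k + 1 : ℕ))] {lam : ℂ}
    {J : WSpace g q s p γ →L[ℂ] Lp ℂ (2 * k + 1 : ℕ) (krnMeasure d (d + 1))}
    (hJ : ∀ φ, J (ofSchwartz φ) = φ.toLp (2 * k + 1 : ℕ) (krnMeasure d (d + 1)))
    {N : WSpace g q s p γ → WSpace g q (s - 1) p γ} (hN : Continuous N)
    (hN' : ∀ φ, N (ofSchwartz φ) = lam • ofSchwartz (pw k φ)) (u : WSpace g q s p γ) :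
    IsGivenBy (toDist (N u)) fun z => lam * ((‖J u z‖ ^ (2 * k) : ℝ) : ℂ) * J u z := by
  let P : (Euc d → ℂ) → Euc d → ℂ := fun f z => ((‖f z‖ ^ (2 * k) : ℝ) : ℂ) * f z
  have hPm : ∀ f : Lp ℂ (2 * k + 1 : ℕ) (krnMeasure d (d + 1)), AEStronglyMeasurable (P f) (krnMeasure d (d + 1)) := fun f => by
    have hf := (Lp.memLp f).1
    exact (Complex.continuous_ofReal.comp_aestronglyMeasurable (hf.norm.pow (2 * k))).mul hf
  have hPint : ∀ f : Lp ℂ (2 * k + 1 : ℕ) (krnMeasure d (d + 1)), Integrable (P f) (krnMeasure d (d + 1)) := fun f => by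
    refine ⟨hPm f, ?_⟩
    have h1 := lintegral_pow_mul_sub_le (μ := krnMeasure d (d + 1)) k (a := f) (b := 0) (Lp.memLp f).1
      aestronglyMeasurable_zero
    simp only [Pi.zero_apply, mul_zero, sub_zero, eLpNorm_zero, add_zero] at h1
    refine lt_of_le_of_lt h1 ?_
    have h2 := (Lp.memLp f).2.ne
    exact (by finiteness : _ ≠ ∞).lt_top
  have e : ∀ z, lam * ((‖J u z‖ ^ (2 * k) : ℝ) : ℂ) * J u z = lam * P (J u) z := fun z => by
    simp only [P]; ring
  simp only [e]
  intro φ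
  have i1 := integrable_mul_of_krnMeasure (hPint (J u)) φ
  have e2 : ∀ z, φ z * (lam * P (J u) z) = lam * (φ z * P (J u) z) := fun z => by ring
  simp only [e2]
  refine ⟨i1.const_mul lam, ?_⟩
  rw [integral_const_mul]
  obtain ⟨C, hC, h⟩ := exists_enorm_integral_sub_le (d + 1) φ
  have hcont : Continuous fun f : Lp ℂ (2 * k + 1 : ℕ) (krnMeasure d (d + 1)) => ∫ z, φ z * P f z := by
    refine LipschitzOnBalls.continuous fun ρ => lipschitzOnBalls_of_enorm_sub_le (i := id)
      (G := fun f : Lp ℂ (2 * k + 1 : ℕ) (krnMeasure d (d + 1)) => ∫ z, φ z * P f z) (j := 2 * k) (C := ENNReal.ofReal C * (2 * k + 1 : ℕ)) (by finiteness)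
      (fun f f' => (h _ _ (hPint f) (hPint f')).trans ?_) ρ
    rw [mul_assoc]
    refine mul_le_mul' le_rfl ((lintegral_pow_mul_sub_le k (Lp.memLp f).1
      (Lp.memLp f').1).trans (le_of_eq ?_))
    rw [id, id, Lp.enorm_def, Lp.enorm_def, Lp.enorm_def, eLpNorm_congr_ae (Lp.coeFn_sub f f')]
  have key : ∀ u : WSpace g q s p γ, evalAt φ (N u) = lam * ∫ z, φ z * P (J u) z := fun u => by
    refine denseRange_ofSchwartz.induction_on (p := fun u : WSpace g q s p γ =>
      evalAt φ (N u) = lam * ∫ z, φ z * P (J u) z) u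
      (isClosed_eq ((evalAt φ).continuous.comp hN)
        (continuous_const.mul (hcont.comp J.continuous))) fun ψ => ?_
    rw [hN', map_smul, evalAt_apply, toDist_ofSchwartz, hJ, smul_eq_mul]
    congr 1
    refine (SchwartzMap.toTemperedDistributionCLM_apply_apply volume (pw k ψ) φ).trans
      (integral_congr_ae ?_)
    filter_upwards [(absolutelyContinuous_krnMeasure (d + 1)).ae_le
      (ψ.coeFn_toLp (2 * k + 1 : ℕ) (krnMeasure d (d + 1)))] with z hz
    simp only [P, hz, pw_apply, smul_eq_mul]
  exact key u

/-- The power nonlinearity acts on the amalgam spaces for finite conjugate exponents. -/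
theorem actsOn_pow (hd : 1 ≤ d) {k : ℕ} (hk : 1 ≤ k) {Q : ℝ} (hs : 0 ≤ s) (hγ : 0 ≤ γ)
    (hqQ : q⁻¹.toReal = 1 - 1 / Q) (hQ : 2 * k * d < Q) (hQs : 1 / Q ≤ s + 1 / (2 * k + 1))
    (lam : ℂ) : ActsOn g q s p γ fun z => lam * ((‖z‖ ^ (2 * k) : ℝ) : ℂ) * z := by
  obtain ⟨C₁, hC₁, H₁⟩ := wNorm_pw_sub_le (s := s) hg.out hq.out hp.out hγ
    (hqQ ▸ fiberEstimate hd hk hs hQ hQs)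
  obtain ⟨C₂, hC₂, H₂⟩ := exists_eLpNorm_le_fl hd hk hs hQ hQs
  rw [← hqQ] at H₂
  set m := max (2 * (k : ℝ) + 1) Q with hm
  have hm1 : 2 * (k : ℝ) + 1 ≤ m := le_max_left _ _
  have hk0 : (0 : ℝ) ≤ k := Nat.cast_nonneg k
  obtain ⟨C₃, hC₃, H₃⟩ := exists_eLpNorm_krnMeasure_le hg.out hq.out hp.out hγ
    (by linarith : 1 ≤ m) hC₂ H₂
  have hn : Fact ((1 : ℝ≥0∞) ≤ (2 * k + 1 : ℕ)) :=
    ⟨by exact_mod_cast Nat.succ_le_succ (Nat.zero_le _)⟩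
  -- The embedding is into L^m with m = max(2k+1, Q). The measure is finite, so it may be lowered to
  -- the exponent 2k + 1 that the power requires.
  have hnm : ((2 * k + 1 : ℕ) : ℝ≥0∞) ≤ ENNReal.ofReal m := by
    rw [← ENNReal.ofReal_natCast]
    refine ENNReal.ofReal_le_ofReal (le_trans (le_of_eq ?_) hm1)
    push_cast; rfl
  set c : ℝ≥0∞ := krnMeasure d (d + 1) Set.univ ^
    (1 / ((2 * k + 1 : ℕ) : ℝ≥0∞).toReal - 1 / (ENNReal.ofReal m).toReal) with hc
  have hct : c ≠ ∞ := by
    refine ENNReal.rpow_ne_top_of_nonneg ?_ (measure_ne_top _ _)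
    rw [sub_nonneg, ENNReal.toReal_ofReal (by linarith), ENNReal.toReal_natCast]
    refine one_div_le_one_div_of_le (by positivity) ?_
    push_cast; exact hm1
  obtain ⟨J, hJ⟩ := exists_toLp (g := g) (q := q) (s := s) (p := p) (γ := γ)
    (n := (2 * k + 1 : ℕ)) (C := c * C₃) (by finiteness) (fun φ => by
      refine (eLpNorm_le_eLpNorm_mul_rpow_measure_univ hnm
        φ.continuous.aestronglyMeasurable).trans ?_
      rw [← hc, mul_comm, mul_assoc]
      exact mul_le_mul' le_rfl (H₃ φ))
  obtain ⟨N, hN, hN'⟩ := exists_lipschitzOnBalls_extension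
    (denseRange_ofSchwartz (g := g) (q := q) (σ := s) (p := p) (γ := γ))
    (f := fun φ => (lam • ofSchwartz (pw k φ) : WSpace g q (s - 1) p γ))
    (lipschitzOnBalls_of_enorm_sub_le (C := ‖lam‖ₑ * C₁) (j := 2 * k) (by finiteness)
      fun φ ψ => by
        rw [← smul_sub, ← map_sub, ← map_sub, enorm_smul, mul_assoc, enorm_wspace, enorm_wspace,
          enorm_wspace, enorm_wspace]
        exact mul_le_mul' le_rfl (H₁ φ ψ))
  exact actsOn_of_isGivenBy hN fun u => ⟨J u, isGivenBy_of_toLp hJ u,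
    isGivenBy_pow_of_toLp hJ hN.continuous hN' u⟩

end

end

/-! ### Entire nonlinearities for q = 1 -/

section


variable {d : ℕ}

/-- At a real point z = r ≥ 0 there is no distinction between z and its conjugate, and convergence
of the unconditional sum there is absolute. -/
lemma summable_norm_mul_pow {F : ℂ → ℂ} {c : ℕ × ℕ → ℂ}
    (hc : ∀ z : ℂ, HasSum (fun n : ℕ × ℕ => c n * z ^ n.1 * conj z ^ n.2) (F z)) {r : ℝ}
    (hr : 0 ≤ r) : Summable fun n : ℕ × ℕ => ‖c n‖ * r ^ (n.1 + n.2) := by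
  refine (hc (r : ℂ)).summable.norm.congr fun n => ?_
  rw [Complex.conj_ofReal, norm_mul, norm_mul, norm_pow, norm_pow, Complex.norm_real,
    Real.norm_of_nonneg hr, mul_assoc, ← pow_add]

lemma IsEntireRealAnalytic.continuous {F : ℂ → ℂ} (hF : IsEntireRealAnalytic F) :
    Continuous F := by
  obtain ⟨c, hc⟩ := hF
  have e : F = fun z => ∑' n : ℕ × ℕ, c n * z ^ n.1 * conj z ^ n.2 :=
    funext fun z => (hc z).tsum_eq.symm
  refine continuous_iff_continuousAt.2 fun z₀ => ?_
  have hz : 0 ≤ ‖z₀‖ + 1 := by positivity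
  have h1 : ContinuousOn (fun z => ∑' n : ℕ × ℕ, c n * z ^ n.1 * conj z ^ n.2)
      (Metric.closedBall 0 (‖z₀‖ + 1)) := by
    refine continuousOn_tsum (fun n => Continuous.continuousOn ?_) (summable_norm_mul_pow hc hz)
      fun n z h => ?_
    · exact (continuous_const.mul (continuous_id.pow n.1)).mul (Complex.continuous_conj.pow n.2)
    · rw [mem_closedBall_zero_iff] at h
      rw [norm_mul, norm_mul, norm_pow, norm_pow, RCLike.norm_conj, mul_assoc, ← pow_add]
      exact mul_le_mul_of_nonneg_left (pow_le_pow_left₀ (norm_nonneg _) h _) (norm_nonneg _)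
  rw [e]
  refine h1.continuousAt ?_
  refine Filter.mem_of_superset (Metric.closedBall_mem_nhds z₀ one_pos) fun z h => ?_
  rw [mem_closedBall_iff_norm] at h
  rw [mem_closedBall_zero_iff]
  have := norm_le_norm_add_norm_sub' z z₀
  linarith

lemma enorm_apply_le_fl (h : 𝓢(Euc d, ℂ)) (z : Euc d) : ‖h z‖ₑ ≤ fl 1 0 h := by
  have e1 : h z = ∫ y, (Real.fourierChar (inner ℝ y z) : ℂ) • 𝓕 h y := by
    have : h z = 𝓕⁻ (𝓕 h) z := by rw [FourierTransform.fourierInv_fourier_eq]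
    rw [this, SchwartzMap.fourierInv_coe, Real.fourierInv_eq]
    rfl
  have e2 : fl 1 0 h = ∫⁻ y, ‖𝓕 h y‖ₑ := by
    rw [fl, innerNorm, show ex 1 = 1 by simp [ex], eLpNorm_one_eq_lintegral_enorm]
    refine lintegral_congr fun y => ?_
    simp [wt, af]
  rw [e1, e2]
  refine (enorm_integral_le_lintegral_enorm _).trans (le_of_eq (lintegral_congr fun y => ?_))
  have h1 : ‖(Real.fourierChar (inner ℝ y z) : ℂ)‖ₑ = 1 := by
    rw [← ofReal_norm, Circle.norm_coe, ENNReal.ofReal_one]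
  rw [enorm_smul, h1, one_mul]

section

variable {g : 𝓢(Euc d, ℂ)} {s : ℝ} {p : ℝ≥0∞} {γ : ℝ}

/-- Fourier inversion bounds the localised function by its ℱL¹ norm. The window is centred at z -
z₀, where g(z₀) ≠ 0, so its value at z is bounded away from 0 uniformly in z. -/
lemma exists_enorm_apply_le_wNorm (hg : g ≠ 0) (hp : 1 ≤ p) (hs : 0 ≤ s) (hγ : 0 ≤ γ) :
    ∃ C : ℝ≥0∞, C ≠ ∞ ∧ ∀ (φ : 𝓢(Euc d, ℂ)) (z : Euc d), ‖φ z‖ₑ ≤ C * wNorm g 1 s p γ φ := by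
  obtain ⟨z₀, hz₀⟩ := DFunLike.ne_iff.1 hg
  have hz₀' : ‖g z₀‖ₑ ≠ 0 := by simpa using hz₀
  obtain ⟨C, -, H⟩ := innerNorm_amp_le hg le_rfl hp s hγ
  refine ⟨‖g z₀‖ₑ⁻¹ * ENNReal.ofReal C, by finiteness, fun φ z => ?_⟩
  have h1 : ‖g z₀‖ₑ * ‖φ z‖ₑ ≤ ENNReal.ofReal C * wNorm g 1 s p γ φ := by
    have h2 := enorm_apply_le_fl (smul' (tr (z - z₀) g) φ) z
    have e : tr (z - z₀) g z = g z₀ := by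
      have : tr (z - z₀) g z = g (z - (z - z₀)) := rfl
      rw [this, sub_sub_cancel]
    rw [smul'_apply, e, enorm_mul] at h2
    refine h2.trans (le_trans ?_ (H (φ : 𝓢'(Euc d, ℂ)) (z - z₀)))
    rw [innerNorm_amp_coe le_rfl, inv_one, ENNReal.toReal_one]
    exact eLpNorm_mono_ennreal fun y => mul_le_mul' (wt_mono hs y) le_rfl
  calc ‖φ z‖ₑ = ‖g z₀‖ₑ⁻¹ * (‖g z₀‖ₑ * ‖φ z‖ₑ) := by
        rw [← mul_assoc, ENNReal.inv_mul_cancel hz₀' enorm_ne_top, one_mul]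
    _ ≤ _ := by rw [mul_assoc]; exact mul_le_mul' le_rfl h1

variable [hg : Fact (g ≠ 0)] [hq : Fact ((1 : ℝ≥0∞) ≤ 1)] [hp : Fact (1 ≤ p)]

lemma exists_boundedContinuous (hs : 0 ≤ s) (hγ : 0 ≤ γ) :
    ∃ J : WSpace g 1 s p γ →L[ℂ] BoundedContinuousFunction (Euc d) ℂ,
      ∀ φ z, J (ofSchwartz φ) z = φ z := by
  obtain ⟨C, hC, H⟩ := exists_enorm_apply_le_wNorm hg.out hp.out hs hγ
  obtain ⟨J, hJ⟩ := exists_extension_of_norm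
    (denseRange_ofSchwartz (g := g) (q := 1) (σ := s) (p := p) (γ := γ))
    (SchwartzMap.toBoundedContinuousFunctionCLM ℂ (Euc d) ℂ).toLinearMap (C := C.toReal)
    fun φ => by
      refine (BoundedContinuousFunction.norm_le (by positivity)).2 fun z => ?_
      have h1 := ENNReal.toReal_mono (ENNReal.mul_ne_top hC
        (memClosure_toDist (ofSchwartz φ : WSpace g 1 s p γ)).1.ne) (H φ z)
      rw [ENNReal.toReal_mul, toReal_enorm] at h1
      exact h1
  exact ⟨J, fun φ z => by rw [hJ]; rfl⟩

lemma isGivenBy_of_boundedContinuous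
    {J : WSpace g 1 s p γ →L[ℂ] BoundedContinuousFunction (Euc d) ℂ}
    (hJ : ∀ φ z, J (ofSchwartz φ) z = φ z) (u : WSpace g 1 s p γ) :
    IsGivenBy (toDist u) (J u) := by
  intro φ
  have hint : ∀ f : BoundedContinuousFunction (Euc d) ℂ, Integrable fun z => φ z * f z :=
    fun f => by
      refine φ.integrable.mul_bdd (c := ‖f‖) f.continuous.aestronglyMeasurable ?_
      exact Eventually.of_forall fun z => f.norm_coe_le_norm z
  refine ⟨hint _, ?_⟩
  have hcont : Continuous fun f : BoundedContinuousFunction (Euc d) ℂ => ∫ z, φ z * f z := by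
    refine LipschitzOnBalls.continuous fun ρ => ⟨∫ z, ‖φ z‖, by positivity, fun f f' _ _ => ?_⟩
    rw [← integral_sub (hint f) (hint f'), ← integral_mul_const]
    refine norm_integral_le_of_norm_le (φ.integrable.norm.mul_const _)
      (Eventually.of_forall fun z => ?_)
    rw [← mul_sub, norm_mul]
    exact mul_le_mul_of_nonneg_left ((f - f').norm_coe_le_norm z) (norm_nonneg _)
  have key : ∀ u : WSpace g 1 s p γ, evalAt φ u = ∫ z, φ z * J u z := fun u => by
    refine denseRange_ofSchwartz.induction_on (p := fun u : WSpace g 1 s p γ =>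
      evalAt φ u = ∫ z, φ z * J u z) u
      (isClosed_eq (evalAt φ).continuous (hcont.comp J.continuous)) fun ψ => ?_
    rw [evalAt_apply, toDist_ofSchwartz]
    refine (SchwartzMap.toTemperedDistributionCLM_apply_apply volume ψ φ).trans
      (integral_congr_ae (Eventually.of_forall fun z => ?_))
    simp only [hJ, smul_eq_mul]
  exact key u

/-- The monomials `φ^j conj(φ)^k` are bounded and Lipschitz on balls, with constants growing at most
geometrically. -/
lemma exists_monomial (hs : 0 ≤ s) (hγ : 0 ≤ γ) : ∃ D : ℝ, 0 ≤ D ∧ ∀ n : ℕ × ℕ,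
    ∃ τ : 𝓢(Euc d, ℂ) → 𝓢(Euc d, ℂ),
      (n ≠ 0 → ∀ φ z, τ φ z = φ z ^ n.1 * conj (φ z) ^ n.2) ∧
      ∀ (ρ : ℝ), ∀ φ ψ, ‖(ofSchwartz φ : WSpace g 1 s p γ)‖ ≤ ρ →
        ‖(ofSchwartz ψ : WSpace g 1 s p γ)‖ ≤ ρ →
        ‖(ofSchwartz (τ φ) : WSpace g 1 s p γ)‖ ≤ (D * (ρ + 1)) ^ (n.1 + n.2) ∧
        ‖(ofSchwartz (τ φ - τ ψ) : WSpace g 1 s p γ)‖ ≤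
          (D * (ρ + 1)) ^ (n.1 + n.2) * ‖(ofSchwartz (φ - ψ) : WSpace g 1 s p γ)‖ := by
  obtain ⟨K₀, hK₀, HK⟩ := wNorm_smul'_le hg.out hp.out hs hγ
  obtain ⟨E₀, hE₀, HE⟩ := wNorm_cj_le hg.out hq.out hp.out s γ
  let nm : 𝓢(Euc d, ℂ) → ℝ := fun φ => ‖(ofSchwartz φ : WSpace g 1 s p γ)‖
  have nm0 : ∀ φ, 0 ≤ nm φ := fun φ => norm_nonneg _
  have nadd : ∀ φ ψ, nm (φ + ψ) ≤ nm φ + nm ψ := fun φ ψ => by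
    simp only [nm, map_add]; exact norm_add_le _ _
  -- Constants at least 1 make the base KE(ρ + 1) at least 1, so one geometric bound covers values
  -- and Lipschitz constants.
  set K := max 1 K₀.toReal with hK
  set E := max 1 E₀.toReal with hE
  have hK1 : 1 ≤ K := le_max_left _ _
  have hE1 : 1 ≤ E := le_max_left _ _
  have nmul : ∀ φ ψ, nm (smul' φ ψ) ≤ K * (nm φ * nm ψ) := fun φ ψ => by
    have := ENNReal.toReal_mono (ENNReal.mul_ne_top hK₀ (ENNReal.mul_ne_top
      (memClosure_toDist (ofSchwartz φ : WSpace g 1 s p γ)).1.ne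
      (memClosure_toDist (ofSchwartz ψ : WSpace g 1 s p γ)).1.ne)) (HK φ ψ)
    rw [ENNReal.toReal_mul, ENNReal.toReal_mul] at this
    exact le_trans this (mul_le_mul_of_nonneg_right (le_max_right _ _)
      (mul_nonneg (nm0 φ) (nm0 ψ)))
  have ncj : ∀ φ, nm (cj φ) ≤ E * nm φ := fun φ => by
    have := ENNReal.toReal_mono (ENNReal.mul_ne_top hE₀
      (memClosure_toDist (ofSchwartz φ : WSpace g 1 s p γ)).1.ne) (HE φ)
    rw [ENNReal.toReal_mul] at this
    exact le_trans this (mul_le_mul_of_nonneg_right (le_max_right _ _) (nm0 φ))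
  let Mono : ℕ → ℕ → Prop := fun j k => ∃ τ : 𝓢(Euc d, ℂ) → 𝓢(Euc d, ℂ),
    (∀ φ z, τ φ z = φ z ^ j * conj (φ z) ^ k) ∧ ∀ (ρ : ℝ), ∀ φ ψ, nm φ ≤ ρ → nm ψ ≤ ρ →
      nm (τ φ) ≤ (K * E * (ρ + 1)) ^ (j + k) ∧
      nm (τ φ - τ ψ) ≤ (K * E * (ρ + 1)) ^ (j + k) * nm (φ - ψ)
  have base : ∀ w : 𝓢(Euc d, ℂ) → 𝓢(Euc d, ℂ), (∀ φ ψ, w (φ - ψ) = w φ - w ψ) →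
      (∀ φ, nm (w φ) ≤ E * nm φ) → ∀ (ρ : ℝ), ∀ φ ψ, nm φ ≤ ρ → nm ψ ≤ ρ →
      nm (w φ) ≤ (K * E * (ρ + 1)) ^ 1 ∧
      nm (w φ - w ψ) ≤ (K * E * (ρ + 1)) ^ 1 * nm (φ - ψ) := by
    intro w hw hwE ρ φ ψ hφ hψ
    have hρ : 0 ≤ ρ := (nm0 φ).trans hφ
    have hEK : E ≤ K * E := le_mul_of_one_le_left (by linarith) hK1
    rw [pow_one]
    constructor
    · exact (hwE φ).trans (mul_le_mul hEK (by linarith) (nm0 φ) (by linarith))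
    · rw [← hw]
      refine (hwE _).trans (mul_le_mul_of_nonneg_right ?_ (nm0 _))
      refine hEK.trans (le_mul_of_one_le_right (by linarith) (by linarith))
  have step : ∀ w : 𝓢(Euc d, ℂ) → 𝓢(Euc d, ℂ), (∀ φ ψ, w (φ - ψ) = w φ - w ψ) →
      (∀ φ, nm (w φ) ≤ E * nm φ) → ∀ (τ : 𝓢(Euc d, ℂ) → 𝓢(Euc d, ℂ)) (m : ℕ),
      (∀ (ρ : ℝ), ∀ φ ψ, nm φ ≤ ρ → nm ψ ≤ ρ → nm (τ φ) ≤ (K * E * (ρ + 1)) ^ m ∧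
        nm (τ φ - τ ψ) ≤ (K * E * (ρ + 1)) ^ m * nm (φ - ψ)) →
      ∀ (ρ : ℝ), ∀ φ ψ, nm φ ≤ ρ → nm ψ ≤ ρ →
        nm (smul' (w φ) (τ φ)) ≤ (K * E * (ρ + 1)) ^ (m + 1) ∧
        nm (smul' (w φ) (τ φ) - smul' (w ψ) (τ ψ)) ≤
          (K * E * (ρ + 1)) ^ (m + 1) * nm (φ - ψ) := by
    intro w hw hwE τ m hτ ρ φ ψ hφ hψ
    have hρ : 0 ≤ ρ := (nm0 φ).trans hφ
    obtain ⟨h1, h2⟩ := hτ ρ φ ψ hφ hψ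
    have hKE : 0 < K * E := by positivity
    set P := (K * E * (ρ + 1)) ^ m with hP
    have hP0 : 0 ≤ P := by positivity
    have hwφ : ∀ χ, nm χ ≤ ρ → nm (w χ) ≤ E * ρ := fun χ hχ =>
      (hwE χ).trans (mul_le_mul_of_nonneg_left hχ (by linarith))
    constructor
    · calc nm (smul' (w φ) (τ φ)) ≤ K * (nm (w φ) * nm (τ φ)) := nmul _ _
        _ ≤ K * (E * (ρ + 1) * P) := by
            refine mul_le_mul_of_nonneg_left (mul_le_mul ?_ h1 (nm0 _) (by positivity))
              (by linarith)
            exact (hwφ φ hφ).trans (mul_le_mul_of_nonneg_left (by linarith) (by linarith))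
        _ = _ := by rw [pow_succ]; ring
    -- The product rule contributes KEP and KEρP, whose sum is KE(ρ + 1)P. This is why the base
    -- contains ρ + 1.
    · have e : smul' (w φ) (τ φ) - smul' (w ψ) (τ ψ) =
          smul' (w (φ - ψ)) (τ φ) + smul' (w ψ) (τ φ - τ ψ) := by
        rw [hw, sub_smul', smul'_sub]; abel
      calc nm (smul' (w φ) (τ φ) - smul' (w ψ) (τ ψ))
          ≤ K * (nm (w (φ - ψ)) * nm (τ φ)) + K * (nm (w ψ) * nm (τ φ - τ ψ)) := by
            rw [e]; exact (nadd _ _).trans (add_le_add (nmul _ _) (nmul _ _))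
        _ ≤ K * (E * nm (φ - ψ) * P) + K * (E * ρ * (P * nm (φ - ψ))) := by
            refine add_le_add (mul_le_mul_of_nonneg_left (mul_le_mul (hwE _) h1 (nm0 _) ?_)
              (by linarith)) (mul_le_mul_of_nonneg_left (mul_le_mul (hwφ ψ hψ) h2 (nm0 _) ?_)
              (by linarith))
            · exact mul_nonneg (by linarith) (nm0 _)
            · positivity
        _ = _ := by rw [pow_succ]; ring
  have hid : ∀ φ, nm (id φ) ≤ E * nm φ := fun φ => le_mul_of_one_le_left (nm0 φ) hE1
  have m01 : Mono 0 1 := ⟨cj, fun φ z => by simp [cj_apply], base cj cj_sub ncj⟩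
  have m10 : Mono 1 0 := ⟨id, fun φ z => by simp, base id (fun _ _ => rfl) hid⟩
  have s1 : ∀ j k, Mono j k → Mono (j + 1) k := by
    rintro j k ⟨τ, h1, h2⟩
    refine ⟨fun φ => smul' (id φ) (τ φ), fun φ z => ?_, ?_⟩
    · rw [smul'_apply, h1, id, pow_succ]; ring
    · rw [show j + 1 + k = j + k + 1 by ring]
      exact step id (fun _ _ => rfl) hid τ _ h2
  have s2 : ∀ j k, Mono j k → Mono j (k + 1) := by
    rintro j k ⟨τ, h1, h2⟩
    refine ⟨fun φ => smul' (cj φ) (τ φ), fun φ z => ?_, ?_⟩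
    · rw [smul'_apply, h1, cj_apply, pow_succ]; ring
    · exact step cj cj_sub ncj τ _ h2
  have h0 : ∀ k, Mono 0 (k + 1) := fun k => by
    induction k with
    | zero => exact m01
    | succ k ih => exact s2 _ _ ih
  have h1 : ∀ j, Mono (j + 1) 0 := fun j => by
    induction j with
    | zero => exact m10
    | succ j ih => exact s1 _ _ ih
  have h2 : ∀ j k, Mono (j + 1) k := fun j k => by
    induction k with
    | zero => exact h1 j
    | succ k ih => exact s2 _ _ ih
  refine ⟨K * E, by positivity, ?_⟩
  rintro ⟨j, k⟩
  rcases j with _ | j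
  · rcases k with _ | k
    · refine ⟨fun _ => 0, fun h => absurd rfl h, fun ρ φ ψ _ _ => ?_⟩
      simp
    · obtain ⟨τ, h3, h4⟩ := h0 k
      exact ⟨τ, fun _ => h3, h4⟩
  · obtain ⟨τ, h3, h4⟩ := h2 j k
    exact ⟨τ, fun _ => h3, h4⟩

/-- Entire real-analytic functions vanishing at the origin act on `W(ℱL¹_s, L^p_γ)`. -/
theorem actsOn_entire (hs : 0 ≤ s) (hγ : 0 ≤ γ) {F : ℂ → ℂ} (hF : IsEntireRealAnalytic F)
    (hF0 : F 0 = 0) : ActsOn g 1 s p γ F := by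
  have hFc := hF.continuous
  obtain ⟨c, hc⟩ := hF
  have hc0 : c 0 = 0 := by
    have h1 := hc 0
    have h2 : HasSum (fun n : ℕ × ℕ => c n * (0 : ℂ) ^ n.1 * conj (0 : ℂ) ^ n.2) (c 0) := by
      convert hasSum_single (f := fun n : ℕ × ℕ => c n * (0 : ℂ) ^ n.1 * conj (0 : ℂ) ^ n.2)
        (0 : ℕ × ℕ) ?_ using 1
      · simp
      · rintro ⟨j, k⟩ hn
        rcases j with _ | j
        · rcases k with _ | k
          · exact absurd rfl hn
          · simp
        · simp
    rw [h2.unique h1, hF0]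
  obtain ⟨D, hD, H⟩ := exists_monomial (g := g) (s := s) (p := p) (γ := γ) hs hγ
  choose τ hτ hb using H
  obtain ⟨J, hJ⟩ := exists_boundedContinuous (g := g) (s := s) (p := p) (γ := γ) hs hγ
  let T : ℕ × ℕ → 𝓢(Euc d, ℂ) → WSpace g 1 s p γ := fun n φ => c n • ofSchwartz (τ n φ)
  have hsum : ∀ φ, Summable fun n => T n φ := fun φ => by
    set ρ := ‖(ofSchwartz φ : WSpace g 1 s p γ)‖ with hρ
    refine Summable.of_norm_bounded
      (summable_norm_mul_pow hc (r := D * (ρ + 1)) (by positivity)) fun n => ?_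
    simp only [T]
    rw [norm_smul]
    exact mul_le_mul_of_nonneg_left (hb n ρ φ φ le_rfl le_rfl).1 (norm_nonneg _)
  obtain ⟨N, hN, hN'⟩ := exists_lipschitzOnBalls_extension
    (denseRange_ofSchwartz (g := g) (q := 1) (σ := s) (p := p) (γ := γ))
    (f := fun φ => ∑' n, T n φ) (fun ρ => by
      rcases lt_or_ge ρ 0 with hρ | hρ
      · exact ⟨0, le_rfl, fun a _ ha => absurd ((norm_nonneg _).trans ha) (not_le.2 hρ)⟩
      have hS := summable_norm_mul_pow hc (r := D * (ρ + 1)) (by positivity)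
      refine ⟨∑' n : ℕ × ℕ, ‖c n‖ * (D * (ρ + 1)) ^ (n.1 + n.2),
        tsum_nonneg fun n => by positivity, fun φ ψ hφ hψ => ?_⟩
      rw [← (hsum φ).tsum_sub (hsum ψ), ← tsum_mul_right]
      refine tsum_of_norm_bounded (hS.mul_right _).hasSum fun n => ?_
      simp only [T]
      rw [← smul_sub, ← map_sub, ← map_sub, norm_smul, mul_assoc]
      exact mul_le_mul_of_nonneg_left (hb n ρ φ ψ hφ hψ).2 (norm_nonneg _))
  -- Evaluation at z is continuous on the space, so the identity need only be checked on Schwartz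
  -- functions, where it is the power series of F evaluated term by term.
  have hval : ∀ (u : WSpace g 1 s p γ) z, J (N u) z = F (J u z) := fun u z => by
    have hev : Continuous fun f : BoundedContinuousFunction (Euc d) ℂ => f z :=
      (BoundedContinuousFunction.evalCLM ℂ z).continuous
    refine denseRange_ofSchwartz.induction_on (p := fun u : WSpace g 1 s p γ =>
      J (N u) z = F (J u z)) u (isClosed_eq (hev.comp (J.continuous.comp hN.continuous))
        (hFc.comp (hev.comp J.continuous))) fun φ => ?_
    rw [hN', hJ]
    have h1 : HasSum (fun n => J (T n φ) z) (J (∑' n, T n φ) z) :=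
      ((BoundedContinuousFunction.evalCLM ℂ z).comp J).hasSum (hsum φ).hasSum
    refine h1.unique ((hc (φ z)).congr_fun ?_)
    intro n
    simp only [T]
    rw [map_smul, BoundedContinuousFunction.smul_apply, hJ, smul_eq_mul]
    rcases eq_or_ne n 0 with rfl | hn
    · rw [hc0]; simp
    · rw [hτ n hn, mul_assoc]
  obtain ⟨ι, hι⟩ := exists_inclusion (g := g) (q := 1) (p := p) (γ := γ) (s := s)
  refine actsOn_of_isGivenBy (N := fun u => ι (N u)) (fun ρ => ?_) fun u =>
    ⟨J u, isGivenBy_of_boundedContinuous hJ u, ?_⟩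
  · obtain ⟨L, hL, h⟩ := hN ρ
    refine ⟨‖ι‖ * L, by positivity, fun u v hu hv => ?_⟩
    rw [← map_sub, mul_assoc]
    exact (ι.le_opNorm _).trans (mul_le_mul_of_nonneg_left (h u v hu hv) (norm_nonneg _))
  · rw [hι]
    have h1 : (fun x => F (J u x)) = J (N u) := funext fun x => (hval u x).symm
    rw [h1]
    exact isGivenBy_of_boundedContinuous hJ (N u)

end

lemma isEntireRealAnalytic_pow (k : ℕ) (lam : ℂ) :
    IsEntireRealAnalytic fun z => lam * ((‖z‖ ^ (2 * k) : ℝ) : ℂ) * z := by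
  refine ⟨fun n => if n = (k + 1, k) then lam else 0, fun z => ?_⟩
  convert hasSum_single (f := fun n : ℕ × ℕ =>
    (if n = (k + 1, k) then lam else 0) * z ^ n.1 * conj z ^ n.2) (k + 1, k) ?_ using 1
  · simp only [if_true]
    rw [pow_mul, ← Complex.normSq_eq_norm_sq, Complex.ofReal_pow,
      ← Complex.mul_conj, mul_pow, pow_succ]
    ring
  · intro n hn
    rw [if_neg hn]; ring

end

/-! ### From Duhamel's formula to distributional solutions -/

section


variable {d : ℕ}

/-- The retraction of the line onto `[-1, 1]`. -/
def clampUnit (t : ℝ) : ℝ := max (-1) (min 1 t)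

lemma abs_clampUnit_le (t : ℝ) : |clampUnit t| ≤ 1 :=
  abs_le.2 ⟨le_max_left _ _, max_le (by norm_num) (min_le_left _ _)⟩

lemma clampUnit_eq {t : ℝ} (ht : |t| ≤ 1) : clampUnit t = t := by
  rw [clampUnit, min_eq_right (abs_le.1 ht).2, max_eq_right (abs_le.1 ht).1]

lemma continuous_clampUnit : Continuous clampUnit :=
  continuous_const.max (continuous_const.min continuous_id)

section

variable {g : 𝓢(Euc d, ℂ)} {q : ℝ≥0∞} {s : ℝ} {p : ℝ≥0∞} {γ : ℝ}
variable [hg : Fact (g ≠ 0)] [hq : Fact (1 ≤ q)] [hp : Fact (1 ≤ p)]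

variable (g q s p γ) in
lemma exists_waveCos_all : ∃ (A : ℝ → WSpace g q s p γ →L[ℂ] WSpace g q s p γ) (M : ℝ),
    (∀ t, ‖A t‖ ≤ M) ∧ (∀ f, Continuous fun t => A t f) ∧
      ∀ t, |t| ≤ 1 → ∀ f, toDist (A t f) = waveCos t (toDist f) := by
  obtain ⟨A, M, -, h, hc⟩ := exists_waveCos g q s p γ
  refine ⟨fun t => A (clampUnit t), M, fun t => (h _ (abs_clampUnit_le t)).1, fun f =>
    (hc f).comp_continuous continuous_clampUnit abs_clampUnit_le, fun t ht f => ?_⟩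
  simp only [clampUnit_eq ht]
  exact (h t ht).2 f

variable (g q s p γ) in
lemma exists_waveSin_all : ∃ (B : ℝ → WSpace g q (s - 1) p γ →L[ℂ] WSpace g q s p γ) (M : ℝ),
    (∀ t, ‖B t‖ ≤ M) ∧ (∀ f, Continuous fun t => B t f) ∧
      ∀ t, |t| ≤ 1 → ∀ f, toDist (B t f) = waveSin t (toDist f) := by
  obtain ⟨B, M, -, h, hc⟩ := exists_waveSin g q s p γ
  refine ⟨fun t => B (clampUnit t), M, fun t => (h _ (abs_clampUnit_le t)).1, fun f =>
    (hc f).comp_continuous continuous_clampUnit abs_clampUnit_le, fun t ht f => ?_⟩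
  simp only [clampUnit_eq ht]
  exact (h t ht).2 f

omit hg in
lemma norm_ofDist_le {R : ℝ} (hR : 0 ≤ R) {f : 𝓢'(Euc d, ℂ)} (hf : MemClosure g q s p γ f)
    (h : wNorm g q s p γ f ≤ ENNReal.ofReal R) : ‖ofDist f hf‖ ≤ R :=
  ENNReal.toReal_le_of_le_ofReal hR h

lemma isContinuousCurve_toDist {u : ℝ → WSpace g q s p γ} (hu : Continuous u) (T : ℝ) :
    IsContinuousCurve g q s p γ T fun t => toDist (u t) := by
  refine fun t _ => ⟨(memW_iff_memClosure _).2 (memClosure_toDist _), ?_⟩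
  have h1 : Continuous fun τ => ‖u τ - u t‖ₑ := by fun_prop
  have h2 : Tendsto (fun τ => ‖u τ - u t‖ₑ) (𝓝[Set.Icc 0 T] t) (𝓝 0) := by
    simpa using (h1.tendsto t).mono_left nhdsWithin_le_nhds
  refine h2.congr fun τ => ?_
  rw [enorm_wspace, map_sub]

/-- Outside [0, T] the curve is frozen at its endpoint values, so the abstract argument for curves
on the line applies to an arbitrary solution. -/
lemma IsContinuousCurve.exists_lift {T : ℝ} (hT : 0 ≤ T) {U : ℝ → 𝓢'(Euc d, ℂ)}
    (hU : IsContinuousCurve g q s p γ T U) :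
    ∃ u : ℝ → WSpace g q s p γ, Continuous u ∧ ∀ t ∈ Set.Icc 0 T, toDist (u t) = U t := by
  let v : Set.Icc (0 : ℝ) T → WSpace g q s p γ := fun t =>
    ofDist (U t) ((memW_iff_memClosure _).1 (hU t t.2).1)
  have hv : Continuous v := by
    refine continuous_iff_continuousAt.2 fun t => ?_
    rw [ContinuousAt, tendsto_iff_norm_sub_tendsto_zero]
    have h1 := (hU t t.2).2
    have h2 : Tendsto (fun τ : Set.Icc (0 : ℝ) T => (τ : ℝ)) (𝓝 t) (𝓝[Set.Icc 0 T] (t : ℝ)) :=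
      tendsto_nhdsWithin_iff.2 ⟨continuous_subtype_val.tendsto t, Eventually.of_forall fun τ => τ.2⟩
    have h3 := (ENNReal.tendsto_toReal ENNReal.zero_ne_top).comp (h1.comp h2)
    exact h3
  refine ⟨fun t => v (Set.projIcc 0 T hT t), hv.comp continuous_projIcc, fun t ht => ?_⟩
  simp only [Set.projIcc_of_mem hT ht]
  rfl

variable {A : ℝ → WSpace g q s p γ →L[ℂ] WSpace g q s p γ}
  {B : ℝ → WSpace g q (s - 1) p γ →L[ℂ] WSpace g q s p γ}
  {N : WSpace g q s p γ → WSpace g q (s - 1) p γ} {M : ℝ}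

/-- Evaluation at φ is a bounded functional and commutes with the Bochner integral, so Duhamel's
formula in the amalgam space becomes the distributional equation. Since T ≤ 1, only times at which A
and B are the true propagators occur. -/
lemma toDist_duhamel_apply (hBM : ∀ t, ‖B t‖ ≤ M) (hB : ∀ f, Continuous fun t => B t f)
    (hN : LipschitzOnBalls N)
    (hA' : ∀ t, |t| ≤ 1 → ∀ f, toDist (A t f) = waveCos t (toDist f))
    (hB' : ∀ t, |t| ≤ 1 → ∀ f, toDist (B t f) = waveSin t (toDist f))
    (x : WSpace g q s p γ) (y : WSpace g q (s - 1) p γ) {u : ℝ → WSpace g q s p γ}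
    (hu : Continuous u) {w : ℝ → 𝓢'(Euc d, ℂ)} {T : ℝ} (hT : T ≤ 1)
    (hw : ∀ τ ∈ Set.Icc 0 T, w τ = toDist (N (u τ))) {t : ℝ} (ht : t ∈ Set.Icc 0 T)
    (φ : 𝓢(Euc d, ℂ)) :
    IntervalIntegrable (fun τ => waveSin (t - τ) (w τ) φ) volume 0 t ∧
      toDist (duhamel A B N x y u t) φ = waveCos t (toDist x) φ + waveSin t (toDist y) φ +
        ∫ τ in (0 : ℝ)..t, waveSin (t - τ) (w τ) φ := by
  have hc : Continuous fun τ => B (t - τ) (N (u τ)) :=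
    (continuous_duhamel_integrand hBM hB hN hu).comp (continuous_const.prodMk continuous_id)
  have habs : |t| ≤ 1 := abs_le.2 ⟨by linarith [ht.1], by linarith [ht.2]⟩
  have e : ∀ τ ∈ Set.Icc 0 t, evalAt φ (B (t - τ) (N (u τ))) = waveSin (t - τ) (w τ) φ :=
    fun τ hτ => by
      have h1 : |t - τ| ≤ 1 := abs_le.2 ⟨by linarith [hτ.2], by linarith [hτ.1, ht.2]⟩
      rw [evalAt_apply, hB' _ h1, hw τ ⟨hτ.1, hτ.2.trans ht.2⟩]
  have e' : Set.EqOn (fun τ => evalAt φ (B (t - τ) (N (u τ))))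
      (fun τ => waveSin (t - τ) (w τ) φ) (Set.uIcc 0 t) := by
    rw [Set.uIcc_of_le ht.1]; exact e
  refine ⟨(((evalAt φ).continuous.comp hc).intervalIntegrable 0 t).congr
    (e'.mono Set.uIoc_subset_uIcc), ?_⟩
  rw [← evalAt_apply, duhamel, map_add, map_add, evalAt_apply, evalAt_apply, hA' t habs,
    hB' t habs, ← ContinuousLinearMap.intervalIntegral_comp_comm _ (hc.intervalIntegrable 0 t),
    intervalIntegral.integral_congr e']

/-- Local well-posedness for nonlinearities that act on the amalgam spaces. -/
theorem ActsOn.locallyWellPosed {F : ℂ → ℂ} (hF : ActsOn g q s p γ F) :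
    LocallyWellPosed g q s p γ F := by
  obtain ⟨N, hN, hact⟩ := hF
  obtain ⟨A, MA, hAM, hA, hA'⟩ := exists_waveCos_all g q s p γ
  obtain ⟨B, MB, hBM, hB, hB'⟩ := exists_waveSin_all g q s p γ
  have hAM' : ∀ t, ‖A t‖ ≤ max MA MB := fun t => (hAM t).trans (le_max_left _ _)
  have hBM' : ∀ t, ‖B t‖ ≤ max MA MB := fun t => (hBM t).trans (le_max_right _ _)
  intro R hR
  obtain ⟨T, hT0, hT1, hex, huniq, L, hL, hlip⟩ :=
    duhamel_wellPosed hAM' hBM' hA hB hN hR.le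
  -- Every solution in the sense of the theorem is one of the abstract equation: `ActsOn` leaves no
  -- choice for the distribution F(u(τ)), and distributions separate elements of the space.
  have lift : ∀ {u₀ u₁ U} (h₀ : MemClosure g q s p γ u₀) (h₁ : MemClosure g q (s - 1) p γ u₁),
      IsSolution g q s p γ F T u₀ u₁ U → ∃ u : ℝ → WSpace g q s p γ, Continuous u ∧
        (∀ t ∈ Set.Icc 0 T, toDist (u t) = U t) ∧
        ∀ t ∈ Set.Icc 0 T, u t = duhamel A B N (ofDist u₀ h₀) (ofDist u₁ h₁) u t := by
    intro u₀ u₁ U h₀ h₁ hU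
    obtain ⟨u, hu, huU⟩ := hU.1.exists_lift hT0.le
    obtain ⟨w, hw, hsol⟩ := hU.2
    refine ⟨u, hu, huU, fun t ht => toDist_injective (DFunLike.ext _ _ fun φ => ?_)⟩
    have hw' : ∀ τ ∈ Set.Icc 0 T, w τ = toDist (N (u τ)) := fun τ hτ =>
      (hact _ _).1 (by rw [huU τ hτ]; exact hw τ hτ)
    rw [(toDist_duhamel_apply hBM' hB hN hA' hB' _ _ hu hT1 hw' ht φ).2, huU t ht,
      (hsol t ht φ).2]
    rfl
  refine ⟨T, hT0, fun u₀ u₁ hball => ?_, L, hL, ?_⟩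
  · obtain ⟨h₀, h₁, b₀, b₁⟩ := hball
    rw [memW_iff_memClosure] at h₀ h₁
    obtain ⟨u, hu, hsol⟩ := hex (ofDist u₀ h₀) (ofDist u₁ h₁) (norm_ofDist_le hR.le h₀ b₀)
      (norm_ofDist_le hR.le h₁ b₁)
    refine ⟨fun t => toDist (u t), ⟨isContinuousCurve_toDist hu T, fun τ => toDist (N (u τ)),
      fun τ _ => (hact _ _).2 rfl, fun t ht φ => ?_⟩, fun V hV t ht => ?_⟩
    · obtain ⟨h1, h2⟩ := toDist_duhamel_apply hBM' hB hN hA' hB' (ofDist u₀ h₀) (ofDist u₁ h₁)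
        hu hT1 (fun _ _ => rfl) ht φ
      rw [← hsol t ht] at h2
      exact ⟨h1, h2⟩
    · obtain ⟨v, hv, hvV, hvs⟩ := lift h₀ h₁ hV
      rw [← hvV t ht, huniq _ _ v u hv hu hvs hsol ht]
  · intro u₀ u₁ v₀ v₁ U V hu hv hU hV t ht
    obtain ⟨h₀, h₁, b₀, b₁⟩ := hu
    obtain ⟨h₀', h₁', b₀', b₁'⟩ := hv
    rw [memW_iff_memClosure] at h₀ h₁ h₀' h₁'
    obtain ⟨u, hu, huU, hus⟩ := lift h₀ h₁ hU
    obtain ⟨v, hv, hvV, hvs⟩ := lift h₀' h₁' hV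
    have h1 := hlip _ _ _ _ u v (norm_ofDist_le hR.le h₀ b₀) (norm_ofDist_le hR.le h₁ b₁)
      (norm_ofDist_le hR.le h₀' b₀') (norm_ofDist_le hR.le h₁' b₁') hu hv hus hvs t ht
    have h2 := ENNReal.ofReal_le_ofReal h1
    rw [ENNReal.ofReal_mul hL, ENNReal.ofReal_add (norm_nonneg _) (norm_nonneg _),
      ofReal_norm_wspace, ofReal_norm_wspace, ofReal_norm_wspace, map_sub, map_sub, map_sub,
      huU t ht, hvV t ht] at h2
    exact h2

end

end

end NLW

end

/-! ### The theorem -/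

theorem theorem3 (d : ℕ) (hd : 1 ≤ d) (p q q' : ℝ≥0∞) (hp : 1 ≤ p) (hq : 1 ≤ q)
    (hqq' : ENNReal.HolderConjugate q q') (s γ : ℝ) (hs : 0 ≤ s) (hγ : 0 ≤ γ)
    (g : 𝓢(EuclideanSpace ℝ (Fin d), ℂ)) (hg : HasCompactSupport g) (hg0 : g ≠ 0) :
    (∀ (k : ℕ) (lam : ℂ), ((2 * k * d : ℕ) : ℝ≥0∞) < q' →
      q'⁻¹ ≤ ENNReal.ofReal (s + 1 / (2 * (k : ℝ) + 1)) →
      NLW.LocallyWellPosed g q s p γ (fun z : ℂ => lam * ((‖z‖ ^ (2 * k) : ℝ) : ℂ) * z)) ∧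
    (q = 1 → ∀ F : ℂ → ℂ, NLW.IsEntireRealAnalytic F → F 0 = 0 →
      NLW.LocallyWellPosed g q s p γ F) := by
  have := Fact.mk hg0
  have := Fact.mk hq
  have := Fact.mk hp
  have part_b : q = 1 → ∀ F : ℂ → ℂ, NLW.IsEntireRealAnalytic F → F 0 = 0 →
      NLW.LocallyWellPosed g q s p γ F := by
    rintro rfl F hF hF0
    exact (NLW.actsOn_entire hs hγ hF hF0).locallyWellPosed
  refine ⟨fun k lam h1 h2 => ?_, part_b⟩
  rcases Nat.eq_zero_or_pos k with rfl | hk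
  · have e : (fun z : ℂ => lam * ((‖z‖ ^ (2 * 0) : ℝ) : ℂ) * z) = fun z => lam * z := by
      funext z; simp
    rw [e]
    exact (NLW.actsOn_linear lam).locallyWellPosed
  have hinv : q⁻¹ + q'⁻¹ = 1 := hqq'.inv_add_inv_eq_one
  -- If q' = ∞ then q = 1 and the power is an entire real-analytic function, so part (b) covers it;
  -- otherwise the exponent Q is the real number q'.
  rcases eq_or_ne q' ⊤ with rfl | hq'
  · have hq1 : q = 1 := by simpa using hinv
    exact part_b hq1 _ (NLW.isEntireRealAnalytic_pow k lam) (by simp)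
  have hq0 : q'⁻¹ ≠ ⊤ := fun h => by simp [h] at hinv
  have hqi : q⁻¹ ≠ ⊤ := fun h => by simp [h] at hinv
  refine (NLW.actsOn_pow (Q := q'.toReal) hd hk hs hγ ?_ ?_ ?_ lam).locallyWellPosed
  · have h3 := congrArg ENNReal.toReal hinv
    rw [ENNReal.toReal_add hqi hq0, ENNReal.toReal_inv q', ENNReal.toReal_one] at h3
    rw [one_div]
    linarith
  · have h3 := (ENNReal.toReal_lt_toReal (ENNReal.natCast_ne_top _) hq').2 h1
    rw [ENNReal.toReal_natCast] at h3
    exact_mod_cast h3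
  · have h3 := ENNReal.toReal_mono ENNReal.ofReal_ne_top h2
    rwa [ENNReal.toReal_inv, ENNReal.toReal_ofReal (by positivity), ← one_div] at h3
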